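/- Let $p\in[1,2)$ and $\delta\in(0,1)$. For a matrix $A\in\mathbb R^{n\times d}$ with $d\ge 1$ and full column rank, given as the list of its nonzero rows with their nonzero entries, and $\varepsilon\in(0,1)$, consider the following randomized algorithm, in which $c_1,c_2,c_3,c_4>0$ and $k_0\in\mathbb N$ are constants. "Sampling with respect to $AR^{-1}$ and size $s$" means: draw a Gaussian $d\times\lceil c_2(1+\log n)\rceil$ matrix $G$, compute the $p$-th powers $\lambda_i$ of the Euclidean norms of the rows of $AR^{-1}G$, keep row $i$ of $A$ independently with probability $q_i=\min(1,s\lambda_i/\sum_j\lambda_j)$, and give a kept row the weight $q_i^{-1/p}$; the sampling matrix has one row, with a single nonzero entry, for each kept row. 1. Compute $M=SDA$, where $S$ has $\lceil c_1d^5(1+\log d)^5\rceil+1$ rows, each column of $S$ is an independent uniformly random standard basis vector, and $D$ is diagonal with independent entries from the standard $p$-stable distribution (characteristic function $e^{-|t|^p}$). 2. Compute $\tilde R$ by a QR decomposition of $M$. 3. Compute a sampling matrix $\tilde S$ by sampling with respect to $A\tilde R^{-1}$ and size $c_3d^{k_0}$. 4. Compute $R$ from $\tilde SA$ by ellipsoidal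 rounding of $\{x:\|\tilde SAx\|_p\le1\}$ (started from the QR decomposition of $\tilde SA$, with at most $\lceil 4d\log m\rceil+1$ cuts, where $m$ is the number of rows of $\tilde S$). 5. Output the sampling matrix $S$ obtained by sampling with respect to $AR^{-1}$ and size $c_4d^{3+p/2}(1+\log(1/\varepsilon))/\varepsilon^2$. A time step is one elementary operation on real numbers (arithmetic, comparison, power, logarithm, ceiling), one draw of a random number, one array access, or one loop pass. Then the constants $c_1,\dots,c_4,k_0$ and further constants $C,K>0$, $k\in\mathbb N$ can be chosen, depending only on $p$ and $\delta$, such that for all $n$, $d\ge1$, all $A\in\mathbb R^{n\times d}$ of full column rank and all $\varepsilon\in(0,1)$, with probability at least $1-\delta$ the following hold together: - $(1-\varepsilon)\|Ax\|_p\le\|SAx\|_p\le(1+\varepsilon)\|Ax\|_p$ for all $x\in\mathbb R^d$; - $S$ has at most $C\,d^{3+p/2}\,(1+\log(1/\varepsilon))/\varepsilon^2$ rows; - if the number $\mathrm{nnz}(A)$ of nonzero entries of $A$ is at least $K d^{k}$, then the algorithm takes at most $C\cdot\mathrm{nnz}(A)\cdot\log n$ time steps. -/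

import Mathlib

/-! ## The standard `p`-stable distribution -/

namespace StableLaw

open MeasureTheory Filter Topology Set

theorem stableKernel_cont (p t : ℝ) : ContinuousOn (fun w : ℝ => 1 - Real.cos (t * w ^ (-(1 / p)))) (Ioi 0) := by
  apply ContinuousOn.sub continuousOn_const
  apply Real.continuous_cos.comp_continuousOn
  apply ContinuousOn.mul continuousOn_const
  intro w hw
  exact (Real.continuousAt_rpow_const w _ (Or.inl (ne_of_gt hw))).continuousWithinAt

theorem stableKernel_int {p : ℝ} (hp : 0 < p) (hp2 : p < 2) (t : ℝ) :
    IntegrableOn (fun w : ℝ => 1 - Real.cos (t * w ^ (-(1 / p)))) (Ioi 0) := by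
  have hm : AEStronglyMeasurable (fun w : ℝ => 1 - Real.cos (t * w ^ (-(1 / p))))
      (volume.restrict (Ioi 0)) := (stableKernel_cont p t).aestronglyMeasurable measurableSet_Ioi
  rw [← Ioc_union_Ioi_eq_Ioi (zero_le_one (α := ℝ))]
  refine IntegrableOn.union ?_ ?_
  · refine Integrable.mono' (g := fun _ => (2 : ℝ)) (integrable_const _) ?_ ?_
    · exact hm.mono_measure (Measure.restrict_mono Ioc_subset_Ioi_self le_rfl)
    · refine ae_of_all _ fun w => ?_
      rw [Real.norm_eq_abs, abs_le]
      constructor <;> linarith [Real.cos_le_one (t * w ^ (-(1 / p))), Real.neg_one_le_cos (t * w ^ (-(1 / p)))]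
  · have h2 : IntegrableOn (fun w : ℝ => t ^ 2 * w ^ (-(2 / p))) (Ioi 1) := by
      apply Integrable.const_mul
      apply integrableOn_Ioi_rpow_of_lt _ one_pos
      rw [neg_lt_neg_iff, lt_div_iff₀ hp]; linarith
    refine Integrable.mono' h2 ?_ ?_
    · exact hm.mono_measure (Measure.restrict_mono (Ioi_subset_Ioi zero_le_one) le_rfl)
    · refine ae_restrict_of_forall_mem measurableSet_Ioi fun w hw => ?_
      have hw0 : (0 : ℝ) < w := lt_trans one_pos hw
      have h3 := Real.one_sub_sq_div_two_le_cos (x := t * w ^ (-(1 / p)))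
      have h4 : (t * w ^ (-(1 / p))) ^ 2 = t ^ 2 * w ^ (-(2 / p)) := by
        rw [mul_pow, ← Real.rpow_natCast (w ^ _), ← Real.rpow_mul hw0.le]
        congr 2; push_cast; ring
      have h5 : 0 ≤ t ^ 2 * w ^ (-(2 / p)) := by positivity
      rw [Real.norm_eq_abs, abs_le]
      constructor <;> linarith [Real.cos_le_one (t * w ^ (-(1 / p)))]

theorem stableKernel_scale {p : ℝ} (hp : 0 < p) (t : ℝ) :
    ∫ w in Ioi (0:ℝ), (1 - Real.cos (t * w ^ (-(1 / p)))) =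
      |t| ^ p * ∫ w in Ioi (0:ℝ), (1 - Real.cos (w ^ (-(1 / p)))) := by
  rcases eq_or_ne t 0 with rfl | ht
  · simp [Real.zero_rpow hp.ne']
  have hb : 0 < |t| ^ p := Real.rpow_pos_of_pos (abs_pos.2 ht) _
  have h := integral_comp_mul_left_Ioi (fun w : ℝ => 1 - Real.cos (t * w ^ (-(1 / p)))) 0 hb
  rw [mul_zero, smul_eq_mul] at h
  have h' : ∫ x in Ioi (0:ℝ), (1 - Real.cos (t * (|t| ^ p * x) ^ (-(1 / p))))
      = ∫ w in Ioi (0:ℝ), (1 - Real.cos (w ^ (-(1 / p)))) := by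
    refine setIntegral_congr_fun measurableSet_Ioi fun x hx => ?_
    have hx0 : (0:ℝ) < x := hx
    rw [Real.mul_rpow hb.le hx0.le, ← Real.rpow_mul (abs_nonneg t)]
    have : p * -(1 / p) = -1 := by field_simp
    rw [this, Real.rpow_neg_one, ← Real.cos_abs (t * _), abs_mul, abs_mul, abs_inv, abs_abs,
      ← mul_assoc, mul_inv_cancel₀ (abs_ne_zero.2 ht), one_mul,
      abs_of_pos (Real.rpow_pos_of_pos hx0 _)]
  rw [h'] at h
  rw [h, ← mul_assoc, mul_inv_cancel₀ hb.ne', one_mul]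

theorem stableKernel_pos {p : ℝ} (hp : 0 < p) (hp2 : p < 2) :
    0 < ∫ w in Ioi (0:ℝ), (1 - Real.cos (w ^ (-(1 / p)))) := by
  have hi := stableKernel_int hp hp2 1
  simp only [one_mul] at hi
  rw [setIntegral_pos_iff_support_of_nonneg_ae
    (ae_of_all _ fun w => sub_nonneg.2 (Real.cos_le_one _)) hi]
  refine lt_of_lt_of_le (b := volume (Ioo (1:ℝ) 2)) (by simp) (measure_mono ?_)
  intro w hw
  have hw0 : (0:ℝ) < w := lt_trans one_pos hw.1
  refine ⟨?_, hw0⟩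
  rw [Function.mem_support]
  have h1 : w ^ (-(1 / p)) < 1 := Real.rpow_lt_one_of_one_lt_of_neg hw.1 (by simp [hp])
  have h0 : 0 < w ^ (-(1 / p)) := Real.rpow_pos_of_pos hw0 _
  have : Real.cos (w ^ (-(1 / p))) < 1 := by
    have h2 := Real.cos_lt_cos_of_nonneg_of_le_pi_div_two le_rfl
      (by linarith [Real.pi_gt_three]) h0
    rwa [Real.cos_zero] at h2
  intro h; linarith

/-- The law of `(N U) ^ (-1/p)` with `U` uniform on `(0, 1]`: a one-sided power-tail law used only to
construct the symmetric stable law as a limit of sums. -/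
noncomputable def rho (p : ℝ) (N : ℕ) : Measure ℝ :=
  (volume.restrict (Ioc (0:ℝ) 1)).map (fun v => ((N : ℝ) * v) ^ (-(1 / p)))

theorem meas_aux (p : ℝ) (N : ℕ) : Measurable (fun v : ℝ => ((N : ℝ) * v) ^ (-(1 / p))) := by
  fun_prop

instance (p : ℝ) (N : ℕ) : IsProbabilityMeasure (rho p N) := by
  have : IsProbabilityMeasure (volume.restrict (Ioc (0:ℝ) 1)) := ⟨by simp⟩
  exact Measure.isProbabilityMeasure_map (meas_aux p N).aemeasurable

theorem rho_re (p : ℝ) (N : ℕ) (hN : 0 < N) (t : ℝ) :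
    (N : ℝ) * (1 - (charFun (rho p N) t).re) = ∫ w in (0:ℝ)..N, (1 - Real.cos (t * w ^ (-(1 / p)))) := by
  have hN' : (N : ℝ) ≠ 0 := by positivity
  have : IsProbabilityMeasure (volume.restrict (Ioc (0:ℝ) 1)) := ⟨by simp⟩
  have h1 : (charFun (rho p N) t).re = ∫ v in Ioc (0:ℝ) 1, Real.cos (t * (N * v) ^ (-(1 / p))) := by
    rw [charFun_apply_real, rho, integral_map (meas_aux p N).aemeasurable (by fun_prop)]
    rw [← RCLike.re_eq_complex_re, ← integral_re]
    · refine integral_congr_ae (ae_of_all _ fun v => ?_)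
      simp only [RCLike.re_eq_complex_re]
      rw [← Complex.ofReal_mul, Complex.exp_ofReal_mul_I_re]
    · refine Integrable.mono' (g := fun _ => (1:ℝ)) (integrable_const _)
        (Measurable.aestronglyMeasurable (by fun_prop)) ?_
      refine ae_of_all _ fun v => ?_
      rw [← Complex.ofReal_mul, Complex.norm_exp_ofReal_mul_I]
  have h2 : (1 : ℝ) - (charFun (rho p N) t).re
      = ∫ v in (0:ℝ)..1, (1 - Real.cos (t * (N * v) ^ (-(1 / p)))) := by
    rw [h1, intervalIntegral.integral_of_le zero_le_one, integral_sub (integrable_const _)]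
    · simp
    · refine Integrable.mono' (g := fun _ => (1:ℝ)) (integrable_const _)
        (Measurable.aestronglyMeasurable (by fun_prop)) ?_
      exact ae_of_all _ fun v => Real.abs_cos_le_one _
  rw [h2, intervalIntegral.integral_comp_mul_left (fun w => 1 - Real.cos (t * w ^ (-(1 / p)))) hN']
  simp [hN']

/-- The symmetrization of `rho p N`. -/
noncomputable def symRho (p : ℝ) (N : ℕ) : Measure ℝ :=
  (2⁻¹ : ENNReal) • (rho p N + (rho p N).map (fun x => -1 * x))

instance (p : ℝ) (N : ℕ) : IsProbabilityMeasure ((rho p N).map (fun x => -1 * x)) :=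
  Measure.isProbabilityMeasure_map (by fun_prop)

instance (p : ℝ) (N : ℕ) : IsProbabilityMeasure (symRho p N) := by
  constructor
  simp only [symRho, Measure.smul_apply, Measure.add_apply, measure_univ, smul_eq_mul]
  rw [one_add_one_eq_two]
  exact ENNReal.inv_mul_cancel (by simp) (by simp)

theorem symRho_charFun (p : ℝ) (N : ℕ) (t : ℝ) :
    charFun (symRho p N) t = ((charFun (rho p N) t).re : ℂ) := by
  have hi : ∀ (μ : Measure ℝ) [IsProbabilityMeasure μ],
      Integrable (fun x : ℝ => Complex.exp (t * x * Complex.I)) μ := by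
    intro μ _
    refine Integrable.mono' (g := fun _ => (1:ℝ)) (integrable_const _) (by fun_prop) ?_
    refine ae_of_all _ fun v => ?_
    rw [← Complex.ofReal_mul, Complex.norm_exp_ofReal_mul_I]
  have h : charFun (symRho p N) t = (2⁻¹ : ℝ) •
      (charFun (rho p N) t + charFun ((rho p N).map (fun x => -1 * x)) t) := by
    simp only [charFun_apply_real]
    rw [symRho, integral_smul_measure, integral_add_measure (hi _) (hi _)]
    simp
  rw [h, charFun_map_mul, neg_one_mul, charFun_neg, Complex.add_conj]
  simp

/-- Existence of the standard symmetric `p`-stable law: there is a probability measure on `ℝ` with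
characteristic function `t ↦ exp (-|t| ^ p)`. -/
theorem exists_standardStable {p : ℝ} (hp : 0 < p) (hp2 : p < 2) :
    ∃ D : Measure ℝ, IsProbabilityMeasure D ∧
      ∀ t : ℝ, charFun D t = ((Real.exp (-(|t| ^ p)) : ℝ) : ℂ) := by
  set c : ℝ := ∫ w in Ioi (0:ℝ), (1 - Real.cos (w ^ (-(1 / p)))) with hc
  have hcpos : 0 < c := stableKernel_pos hp hp2
  let ν : ℕ → Measure ℝ := fun N =>
    (Measure.pi (fun _ : Fin N => symRho p N)).map (fun x => ∑ i, x i)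
  have hν : ∀ N, IsProbabilityMeasure (ν N) := fun N =>
    Measure.isProbabilityMeasure_map (by fun_prop)
  have hcf : ∀ N t, charFun (ν N) t = (((1 + ((charFun (rho p N) t).re - 1)) ^ N : ℝ) : ℂ) := by
    intro N t
    simp only [ν]
    rw [ProbabilityTheory.charFun_map_sum_pi_eq_prod]
    simp [symRho_charFun]
  let f : ℝ → ℂ := fun t => ((Real.exp (-(|t| ^ p * c)) : ℝ) : ℂ)
  have hlim : ∀ t, Tendsto (fun N => charFun (ν N) t) atTop (𝓝 (f t)) := by
    intro t
    simp_rw [hcf]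
    refine (Complex.continuous_ofReal.tendsto _).comp ?_
    apply Real.tendsto_one_add_pow_exp_of_tendsto
    have h1 : Tendsto (fun N : ℕ => ∫ w in (0:ℝ)..N, (1 - Real.cos (t * w ^ (-(1 / p))))) atTop
        (𝓝 (|t| ^ p * c)) := by
      rw [hc, ← stableKernel_scale hp]
      exact intervalIntegral_tendsto_integral_Ioi 0 (stableKernel_int hp hp2 t) tendsto_natCast_atTop_atTop
    refine h1.neg.congr' ?_
    filter_upwards [eventually_gt_atTop 0] with N hN
    rw [← rho_re p N hN t]; ring
  have hf : ContinuousAt f 0 := by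
    apply Continuous.continuousAt
    have : Continuous fun t : ℝ => |t| ^ p := continuous_abs.rpow_const fun _ => Or.inr hp.le
    fun_prop
  have htight := isTightMeasureSet_of_tendsto_charFun hf hlim
  let μ : ℕ → ProbabilityMeasure ℝ := fun N => ⟨ν N, hν N⟩
  have hcomp : IsCompact (closure {x | ∃ n, μ n = x}) :=
    isCompact_closure_of_isTightMeasureSet (by
      convert htight using 1
      ext m
      constructor
      · rintro ⟨_, ⟨n, rfl⟩, rfl⟩
        exact ⟨n, rfl⟩
      · rintro ⟨n, rfl⟩
        exact ⟨μ n, ⟨n, rfl⟩, rfl⟩)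
  obtain ⟨U, hU⟩ := Ultrafilter.exists_le (atTop : Filter ℕ)
  obtain ⟨μ', -, hμ' : Tendsto _ _ _⟩ := hcomp.ultrafilter_le_nhds (U.map μ)
    (.trans (by simp) (monotone_principal subset_closure))
  have hμf : ∀ t, charFun (μ' : Measure ℝ) t = f t := by
    intro t
    refine tendsto_nhds_unique ?_ ((hlim t).mono_left hU)
    have := (ProbabilityMeasure.tendsto_iff_forall_integral_rclike_tendsto ℂ).1 hμ'
      (BoundedContinuousFunction.innerProbChar t)
    simp_rw [charFun_eq_integral_innerProbChar]
    exact this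
  refine ⟨(μ' : Measure ℝ).map (c ^ (-(1 / p)) * ·), Measure.isProbabilityMeasure_map (by fun_prop), ?_⟩
  intro t
  rw [charFun_map_mul, hμf]
  simp only [f]
  congr 3
  rw [abs_mul, Real.mul_rpow (abs_nonneg _) (abs_nonneg _),
    abs_of_pos (Real.rpow_pos_of_pos hcpos _), ← Real.rpow_mul hcpos.le]
  have : -(1 / p) * p = -1 := by field_simp
  rw [this, Real.rpow_neg_one]
  field_simp

/-- The standard `p`-stable distribution on `ℝ`: the probability measure with characteristic function
`t ↦ exp (-|t| ^ p)` (it is unique, as a finite measure is determined by its characteristic function).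
For `p = 1` this is the standard Cauchy distribution. Outside `0 < p < 2` the value is irrelevant. -/
noncomputable def stableLaw (p : ℝ) : Measure ℝ :=
  open Classical in
  if h : 0 < p ∧ p < 2 then (exists_standardStable h.1 h.2).choose else Measure.dirac 0

instance (p : ℝ) : IsProbabilityMeasure (stableLaw p) := by
  unfold stableLaw
  split_ifs with h
  · exact (exists_standardStable h.1 h.2).choose_spec.1
  · infer_instance

theorem charFun_stableLaw {p : ℝ} (hp : 0 < p) (hp2 : p < 2) (t : ℝ) :
    charFun (stableLaw p) t = ((Real.exp (-(|t| ^ p)) : ℝ) : ℂ) := by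
  have h : 0 < p ∧ p < 2 := ⟨hp, hp2⟩
  rw [stableLaw, dif_pos h]
  exact (exists_standardStable h.1 h.2).choose_spec.2 t

end StableLaw

/-! ## A real random access machine with a step count

A computation of type `Timed α` consists of its result and of the number of time steps that it takes.
One time step is one arithmetic operation or comparison on real numbers, one evaluation of a power,
logarithm or integer ceiling, one reading of a random number, one writing into an array, or one
pass of the control through a loop. The algorithms below handle real numbers only through the
primitives of this section. -/

/-- A result together with the number of time steps spent on it. -/
structure Timed (α : Type) where
  val : α
  cost : ℕ

namespace Timed

/-- Handing over a value takes no time; the times of consecutive computations add up. -/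
instance : Monad Timed where
  pure a := ⟨a, 0⟩
  bind x f := ⟨(f x.val).val, x.cost + (f x.val).cost⟩

/-- One elementary operation with result `a`; used only to define the primitives below. -/
def op {α : Type} (a : α) : Timed α := ⟨a, 1⟩

/-- Spend `k` time steps. -/
def charge (k : ℕ) : Timed Unit := ⟨(), k⟩

noncomputable section

def add (x y : ℝ) : Timed ℝ := op (x + y)
def sub (x y : ℝ) : Timed ℝ := op (x - y)
def mul (x y : ℝ) : Timed ℝ := op (x * y)
def div (x y : ℝ) : Timed ℝ := op (x / y)
def sqrt (x : ℝ) : Timed ℝ := op (Real.sqrt x)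
def pow (x y : ℝ) : Timed ℝ := op (x ^ y)
def abs (x : ℝ) : Timed ℝ := op |x|
def sign (x : ℝ) : Timed ℝ := op (Real.sign x)
def min (x y : ℝ) : Timed ℝ := op (x ⊓ y)
def log (x : ℝ) : Timed ℝ := op (Real.log x)
def ceil (x : ℝ) : Timed ℕ := op ⌈x⌉₊
def lt (x y : ℝ) : Timed Bool := op (decide (x < y))

/-- Read one random number. -/
def draw {α : Type} (x : α) : Timed α := op x

/-- Write `x` into position `i` of the array `v`. -/
def store {α : Type} {m : ℕ} (v : Fin m → α) (i : Fin m) (x : α) : Timed (Fin m → α) :=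
  op (Function.update v i x)

/-- Write `x` into position `(i, j)` of the two-dimensional array `M`. -/
def store₂ {α : Type} {m d : ℕ} (M : Fin m → Fin d → α) (i : Fin m) (j : Fin d) (x : α) :
    Timed (Fin m → Fin d → α) :=
  op (Function.update M i (Function.update (M i) j x))

/-- Put a new element in front of a list. -/
def push {α : Type} (a : α) (l : List α) : Timed (List α) := op (a :: l)

/-- Compute an array entry by entry. -/
def tabulate {α : Type} {m : ℕ} (f : Fin m → Timed α) : Timed (Fin m → α) :=
  ⟨fun i => (f i).val, ∑ i, ((f i).cost + 1)⟩

/-- Compute the terms of a sum and add them up. -/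
def sum {m : ℕ} (f : Fin m → Timed ℝ) : Timed ℝ :=
  ⟨∑ i, (f i).val, ∑ i, ((f i).cost + 1)⟩

/-- Apply a computation to all elements of a list. -/
def mapList {α β : Type} (l : List α) (f : α → Timed β) : Timed (List β) :=
  ⟨l.map fun a => (f a).val, (l.map fun a => (f a).cost + 1).sum⟩

/-- Compute the terms of a sum indexed by a list and add them up. -/
def sumList {α : Type} (l : List α) (f : α → Timed ℝ) : Timed ℝ :=
  ⟨(l.map fun a => (f a).val).sum, (l.map fun a => (f a).cost + 1).sum⟩

/-- Loop through a list, starting from the state `s`. -/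
def forList {α σ : Type} : List α → (α → σ → Timed σ) → σ → Timed σ
  | [], _, s => pure s
  | a :: l, f, s => do
    charge 1
    let t ← f a s
    forList l f t

/-- Loop through `0, …, m - 1`, starting from the state `s`. -/
def forFin {σ : Type} (m : ℕ) (f : Fin m → σ → Timed σ) (s : σ) : Timed σ :=
  forList (List.finRange m) f s

/-- Perform the computation `f` on the state `k` times. -/
def repeatTimes {σ : Type} : ℕ → (σ → Timed σ) → σ → Timed σ
  | 0, _, s => pure s
  | k + 1, f, s => do
    charge 1
    let t ← f s
    repeatTimes k f t

end

end Timed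

/-! ## Sparse matrices, norms and embeddings -/

namespace LpEmbedding

open MeasureTheory Matrix Timed

/-- The number of nonzero entries of `A`. -/
noncomputable def nnz {n d : ℕ} (A : Matrix (Fin n) (Fin d) ℝ) : ℕ :=
  {ij : Fin n × Fin d | A ij.1 ij.2 ≠ 0}.ncard

/-- A row of a sparse `n × d` matrix: its index and the list of its nonzero entries, each with its
column. -/
abbrev SparseRow (n d : ℕ) : Type := Fin n × List (Fin d × ℝ)

/-- The sparse format in which the algorithm receives `A`: the list of the rows that are not zero,
each given by its nonzero entries. -/
noncomputable def sparseRows {n d : ℕ} (A : Matrix (Fin n) (Fin d) ℝ) : List (SparseRow n d) :=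
  ((List.finRange n).map fun i =>
    (i, ((List.finRange d).filter fun j => decide (A i j ≠ 0)).map fun j => (j, A i j))).filter
    fun row => !row.2.isEmpty

/-- The norm `‖v‖_p = (∑ᵢ |vᵢ| ^ p) ^ (1/p)`. -/
noncomputable def lpNorm (p : ℝ) {m : ℕ} (v : Fin m → ℝ) : ℝ := (∑ i, |v i| ^ p) ^ (1 / p)

/-- `S` embeds the column space of `A`, with the norm `‖·‖_p`, with distortion `1 ± ε`. -/
def IsLpEmbedding (p ε : ℝ) {s n d : ℕ} (S : Matrix (Fin s) (Fin n) ℝ)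
    (A : Matrix (Fin n) (Fin d) ℝ) : Prop :=
  ∀ x : Fin d → ℝ,
    (1 - ε) * lpNorm p (A *ᵥ x) ≤ lpNorm p (S *ᵥ (A *ᵥ x)) ∧
      lpNorm p (S *ᵥ (A *ᵥ x)) ≤ (1 + ε) * lpNorm p (A *ᵥ x)

/-- The sampling matrix described by a list of pairs (row of `A`, weight): every row of it has a single
nonzero entry. -/
def samplingMatrix {n : ℕ} (S : List (Fin n × ℝ)) : Matrix (Fin S.length) (Fin n) ℝ :=
  Matrix.of fun k i => if i = (S.get k).1 then (S.get k).2 else 0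

/-! ## The subroutines -/

noncomputable section

/-- Product of two dense matrices. -/
def matMul {a b c : ℕ} (P : Fin a → Fin b → ℝ) (Q : Fin b → Fin c → ℝ) :
    Timed (Fin a → Fin c → ℝ) :=
  tabulate fun i => tabulate fun k => sum fun j => mul (P i j) (Q j k)

/-- Product of a dense matrix and a vector. -/
def matVec {a b : ℕ} (P : Fin a → Fin b → ℝ) (u : Fin b → ℝ) : Timed (Fin a → ℝ) :=
  tabulate fun i => sum fun j => mul (P i j) (u j)

/-- Product of a row vector and a dense matrix. -/
def vecMat {a b : ℕ} (u : Fin a → ℝ) (P : Fin a → Fin b → ℝ) : Timed (Fin b → ℝ) :=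
  tabulate fun j => sum fun i => mul (u i) (P i j)

/-- Inner product. -/
def dot {a : ℕ} (u v : Fin a → ℝ) : Timed ℝ := sum fun i => mul (u i) (v i)

/-- The array of zeros. -/
def zeros (a b : ℕ) : Timed (Fin a → Fin b → ℝ) := tabulate fun _ => tabulate fun _ => pure 0

/-- The sparse embedding `Π A = S D A`: row `i` of `A` is multiplied by the random number `X i` and added
to row `h i` of the result. -/
def sparseEmbed {n d s : ℕ} (rows : List (SparseRow n d)) (h : Fin n → Fin s) (X : Fin n → ℝ) :
    Timed (Fin s → Fin d → ℝ) := do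
  let M₀ ← zeros s d
  forList rows (fun row M => do
    let k ← draw (h row.1)
    let x ← draw (X row.1)
    forList row.2 (fun e M => do
      let y ← mul x e.2
      let z ← add (M k e.1) y
      store₂ M k e.1 z) M) M₀

/-- `R⁻¹`, where `M = Q R` is the QR decomposition of `M`, by the modified Gram-Schmidt process: column
operations that make the columns of `M` orthonormal are applied to the identity matrix as well.
`QT.1 i` and `QT.2 i` are the `i`-th columns of `Q` and of `R⁻¹`. -/
def qrInverse {m d : ℕ} (M : Fin m → Fin d → ℝ) : Timed (Fin d → Fin d → ℝ) := do
  let Q₀ ← zeros d m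
  let T₀ ← zeros d d
  let QT ← forFin d (fun j QT => do
    let v₀ ← tabulate fun k => pure (M k j)
    let t₀ ← tabulate fun l => pure (if l = j then 1 else 0)
    let vt ← forFin d (fun i vt =>
      if i < j then do
        let r ← dot (QT.1 i) vt.1
        let v ← tabulate fun k => do
          let y ← mul r (QT.1 i k)
          sub (vt.1 k) y
        let t ← tabulate fun l => do
          let y ← mul r (QT.2 i l)
          sub (vt.2 l) y
        pure (v, t)
      else pure vt) (v₀, t₀)
    let a ← dot vt.1 vt.1
    let c ← sqrt a
    let q ← tabulate fun k => div (vt.1 k) c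
    let t ← tabulate fun l => div (vt.2 l) c
    let Q ← store QT.1 j q
    let T ← store QT.2 j t
    pure (Q, T)) (Q₀, T₀)
  tabulate fun k => tabulate fun j => pure (QT.2 j k)

/-- Subspace-preserving sampling of the rows of `A` with respect to `A T`, where `T = R⁻¹`. The Euclidean
norms of the rows of `A T` are estimated by those of the rows of `A T G` (up to a common factor), for
a Gaussian matrix `G` with few columns; row `i` is kept, independently of the others, with
probability `qᵢ = min (1, s λᵢ / ∑ⱼ λⱼ)`, where `λᵢ` is the `p`-th power of the estimate, and gets the
weight `qᵢ ^ (-1/p)`. The random numbers `U i` are uniform on `[0, 1]`. -/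
def sampleRows {n d r : ℕ} (p s : ℝ) (rows : List (SparseRow n d)) (T : Fin d → Fin d → ℝ)
    (G : Fin d → Fin r → ℝ) (U : Fin n → ℝ) : Timed (List (SparseRow n d × ℝ)) := do
  let G₀ ← tabulate fun j => tabulate fun k => draw (G j k)
  let W ← matMul T G₀
  let half ← div p 2
  let scored ← mapList rows (fun row => do
    let v ← tabulate fun k => sumList row.2 (fun e => mul e.2 (W e.1 k))
    let a ← dot v v
    let score ← pow a half
    pure (row, score))
  let total ← sumList scored (fun x => pure x.2)
  let e ← div (-1) p
  forList scored (fun x acc => do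
    let a ← mul s x.2
    let b ← div a total
    let q ← min 1 b
    let u ← draw (U x.1.1)
    let keep ← lt u q
    if keep then do
      let w ← pow q e
      push (x.1, w) acc
    else pure acc) []

/-- The dense matrix `S A` for the sampling matrix `S` given by the list `L` of kept rows and weights. -/
def denseRows {n d : ℕ} (L : List (SparseRow n d × ℝ)) : Timed (Fin L.length → Fin d → ℝ) :=
  tabulate fun k => do
    let z₀ ← tabulate fun _ => pure 0
    forList (L.get k).1.2 (fun e z => do
      let y ← mul (L.get k).2 e.2
      store z e.1 y) z₀

/-- One step of the ellipsoidal rounding of the convex body `{x | ‖M x‖_p ≤ 1}`, which is contained in the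
ellipsoid `{B y | ‖y‖₂ ≤ 1}`. If one of the axis points `B e_l / (2 √d)` lies outside of the body, then
the body lies in a slab that does not contain this point, and the ellipsoid is replaced by the smallest
one around the part of it in such a slab; otherwise nothing happens. -/
def roundingStep {m d : ℕ} (p : ℝ) (M : Fin m → Fin d → ℝ) (B : Fin d → Fin d → ℝ) :
    Timed (Fin d → Fin d → ℝ) := do
  let c₀ ← sqrt (d : ℝ)
  let c ← mul 2 c₀
  let found ← forFin d (fun l acc => do
    let u ← tabulate fun j => div (B j l) c
    let z ← matVec M u
    let a ← sum fun k => do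
      let y ← abs (z k)
      pow y p
    let outside ← lt 1 a
    pure (if outside then some z else acc)) none
  match found with
  | none => pure B
  | some z => do
    let p₁ ← sub p 1
    let y ← tabulate fun k => do
      let a ← abs (z k)
      let b ← pow a p₁
      let t ← sign (z k)
      mul t b
    -- the normal vector of the slab, in the original and in the ellipsoid's coordinates
    let g ← vecMat y M
    let a₀ ← vecMat g B
    let b ← dot a₀ a₀
    let b₁ ← sqrt b
    let a ← tabulate fun l => div (a₀ l) b₁
    -- factors `1/2` along `a`, and `σ` orthogonally to `a`
    let t₁ ← sub (d : ℝ) (1 / 4)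
    let t₂ ← sub (d : ℝ) 1
    let t₃ ← div t₁ t₂
    let σ ← sqrt t₃
    let τ ← sub (1 / 2) σ
    let Ba ← matVec B a
    tabulate fun j => tabulate fun l => do
      let x ← mul σ (B j l)
      let y₁ ← mul (Ba j) (a l)
      let y₂ ← mul τ y₁
      add x y₂

/-- Fast conditioning by ellipsoidal rounding, started from the QR decomposition of `M`: computes
`B = R⁻¹` such that the `ℓ_p` condition number of `M R⁻¹` is at most `2 d`, if `M` has full column rank. -/
def rounding {m d : ℕ} (p : ℝ) (M : Fin m → Fin d → ℝ) : Timed (Fin d → Fin d → ℝ) := do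
  let B₀ ← qrInverse M
  let a ← log (m : ℝ)
  let b ← mul 4 (d : ℝ)
  let c ← mul b a
  let N ← ceil c
  repeatTimes (N + 1) (roundingStep p M) B₀

/-! ## The algorithm -/

/-- The constants hidden in the sizes that the algorithm uses. -/
structure Constants where
  /-- factor in the dimension of the sparse embedding -/
  embed : ℝ
  /-- factor in the number of Gaussian vectors for estimating row norms -/
  gauss : ℝ
  /-- factor in the size of the coarse sample -/
  coarse : ℝ
  /-- exponent of `d` in the size of the coarse sample -/
  coarseExp : ℕ
  /-- factor in the size of the final sample -/
  final : ℝ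

/-- Dimension of the sparse embedding, of order `d ^ 5 log ^ 5 d`. -/
def embedDim (c : Constants) (d : ℕ) : ℕ :=
  ⌈c.embed * (d : ℝ) ^ 5 * (1 + Real.log d) ^ 5⌉₊ + 1

instance (c : Constants) (d : ℕ) : NeZero (embedDim c d) := ⟨Nat.succ_ne_zero _⟩

/-- Number of Gaussian vectors for estimating row norms, of order `log n`. -/
def gaussDim (c : Constants) (n : ℕ) : ℕ := ⌈c.gauss * (1 + Real.log n)⌉₊

/-- Sampling parameter of the coarse sampling, a polynomial in `d`. -/
def coarseSize (c : Constants) (d : ℕ) : ℝ := c.coarse * (d : ℝ) ^ c.coarseExp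

/-- Sampling parameter of the final sampling. -/
def finalSize (c : Constants) (p ε : ℝ) (d : ℕ) : ℝ :=
  c.final * (d : ℝ) ^ (3 + p / 2) * (1 + Real.log (1 / ε)) / ε ^ 2

/-- All random numbers that the algorithm may read: positions in the sparse embedding, multipliers in the
sparse embedding, and, for each of the two samplings, a Gaussian matrix and uniform numbers. -/
abbrev Randomness (n d s r : ℕ) : Type :=
  (Fin n → Fin s) × (Fin n → ℝ) × (Fin d → Fin r → ℝ) × (Fin n → ℝ) ×
    (Fin d → Fin r → ℝ) × (Fin n → ℝ)

/-- The law of a `d × r` matrix with independent standard Gaussian entries. -/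
def gaussianMatrixLaw (d r : ℕ) : Measure (Fin d → Fin r → ℝ) :=
  Measure.pi fun _ => Measure.pi fun _ => ProbabilityTheory.gaussianReal 0 1

/-- The law of `n` independent uniform numbers in `[0, 1]`. -/
def uniformLaw (n : ℕ) : Measure (Fin n → ℝ) :=
  Measure.pi fun _ => volume.restrict (Set.Icc (0 : ℝ) 1)

/-- All random numbers are independent: the positions are uniform on `Fin s`, the multipliers have the
standard `p`-stable distribution. -/
def randomnessLaw (p : ℝ) (n d s r : ℕ) : Measure (Randomness n d s r) :=
  (Measure.pi fun _ => ProbabilityTheory.uniformOn (Set.univ : Set (Fin s))).prod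
    ((Measure.pi fun _ => StableLaw.stableLaw p).prod
      ((gaussianMatrixLaw d r).prod ((uniformLaw n).prod
        ((gaussianMatrixLaw d r).prod (uniformLaw n)))))

instance (p : ℝ) (n d s r : ℕ) [NeZero s] : IsProbabilityMeasure (randomnessLaw p n d s r) := by
  have : IsProbabilityMeasure (volume.restrict (Set.Icc (0 : ℝ) 1)) := ⟨by simp⟩
  have : IsProbabilityMeasure (ProbabilityTheory.uniformOn (Set.univ : Set (Fin s))) :=
    ProbabilityTheory.isProbabilityMeasure_uniformOn Set.finite_univ Set.univ_nonempty
  unfold randomnessLaw gaussianMatrixLaw uniformLaw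
  infer_instance

/-- The algorithm: (1) a low-distortion sparse embedding `M = Π̃ A`; (2) `T = R̃⁻¹` from the QR
decomposition of `M`; (3) a coarse sample `S̃` of the rows of `A` with respect to `A R̃⁻¹`; (4) `B = R⁻¹`
by ellipsoidal rounding of `S̃ A`; (5) the final sample of the rows of `A` with respect to `A R⁻¹`.
The output lists the sampled row indices of `A` and their weights. The charged steps at the beginning pay
for evaluating the four sizes `embedDim`, `gaussDim`, `coarseSize` and `finalSize`. -/
def improvedEmbedding (c : Constants) (p ε : ℝ) {n d : ℕ} (rows : List (SparseRow n d))
    (ω : Randomness n d (embedDim c d) (gaussDim c n)) : Timed (List (Fin n × ℝ)) := do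
  charge 30
  let M ← sparseEmbed rows ω.1 ω.2.1
  let T ← qrInverse M
  let L ← sampleRows p (coarseSize c d) rows T ω.2.2.1 ω.2.2.2.1
  let N ← denseRows L
  let B ← rounding p N
  let S ← sampleRows p (finalSize c p ε d) rows B ω.2.2.2.2.1 ω.2.2.2.2.2
  mapList S fun x => pure (x.1.1, x.2)

end

end LpEmbedding

/-! The heart of the proof is a statement about sampling. Write `U = A T` for an invertible `T` and
call it conditioned (`IsConditioned`) if `‖y‖₂ ^ p ≤ κ₁ ‖U y‖_p ^ p` for all `y` and `∑ ‖U i‖₂ ^ p ≤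
κ₂`. Then row `i` contributes at most the fraction `κ₁ ‖U i‖₂ ^ p` to `‖U y‖_p ^ p`. If rows are
kept with probabilities proportional to estimates of `‖U i‖₂ ^ p`, a Chernoff bound
(`sampleSum_tail`) makes the sampled norm of one vector `(1 ± ε)`-accurate up to probability `exp
(-c ε² s / (κ₁ κ₂))`, and a net with `(C d κ₁ κ₂ / ε) ^ d` points extends this to all vectors,
because both norms are seminorms (`seminorm_close`). So a size `s` of order `κ₁ κ₂ d log (d κ₁ κ₂ /
ε) / ε²` suffices (`exists_sampling_event`). About `log n` Gaussian columns are enough for the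
estimates, since only two things are needed of them: no row is underestimated by more than a
constant, and the sum of all estimates is not much too large.

It remains to find good bases. Two are used, one after the other.

The sparse embedding `S D A` distorts norms only by a polynomial in `d` (`sketch_distortion`), so
that the QR decomposition of it gives `κ₁ κ₂` polynomial in `d`; a polynomial sample then preserves
norms up to a factor `2`. For the distortion, a basis of maximal volume is combined with a set `H`
of heavy rows (`exists_isHeavyBasis`): after the rows of `H` are scaled down by a tiny factor `γ`,
the basis is conditioned, and all rows outside of `H` have small norm, while `H` has about `d² log
(1 / γ)` elements. With enough buckets no two heavy rows collide and few light pairs do. A unit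
vector either has a good part of its mass on light rows, and then this mass is spread over at least
`2 d` buckets, whose independent stable sums are all tiny with a probability small enough for a
union bound over a net; or it has a huge entry on a heavy row, which dominates the noise in its
bucket (`bucketSum_bounds`).

Ellipsoidal rounding of the coarse sample (`rounding_contains`) gives `κ₁ κ₂` of order `d ^ (1 + p /
2)`. Every cut removes a constant fraction of the volume of an ellipsoid that always contains the
unit ball of the `ℓ_p` norm, so the cuts end after about `d log m` rounds with all axis points
inside. The second sampling, with this basis, then needs the size in the theorem.

The samplings are applied to bases that are themselves random. Therefore the bad events are
constructed as measurable sets of triples (basis, Gaussian matrix, uniform numbers), the bases are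
shown to be measurable functions of the earlier randomness, and the sections are integrated. The
running time is bounded by following the structure of the program: the passes through the sparse
rows cost `nnz A` times `log n`, and everything else is polynomial in `d`, hence dominated by `nnz
A` when `A` has enough nonzero entries. -/

namespace Timed

/-! ### Values and costs of timed loops -/

@[simp] theorem bind_val {α β : Type} (x : Timed α) (f : α → Timed β) :
    (x >>= f).val = (f x.val).val := rfl

@[simp] theorem bind_cost {α β : Type} (x : Timed α) (f : α → Timed β) :
    (x >>= f).cost = x.cost + (f x.val).cost := rfl

@[simp] theorem pure_val {α : Type} (a : α) : (pure a : Timed α).val = a := rfl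

@[simp] theorem pure_cost {α : Type} (a : α) : (pure a : Timed α).cost = 0 := rfl

@[simp] theorem charge_cost (k : ℕ) : (charge k).cost = k := rfl

theorem forList_val {α σ : Type} (l : List α) (f : α → σ → Timed σ) (s : σ) :
    (forList l f s).val = l.foldl (fun t a => (f a t).val) s := by
  induction l generalizing s with
  | nil => rfl
  | cons a l ih => simp [forList, ih]

theorem forFin_val {σ : Type} (m : ℕ) (f : Fin m → σ → Timed σ) (s : σ) :
    (forFin m f s).val = (List.finRange m).foldl (fun t a => (f a t).val) s :=
  forList_val _ _ _

/-- The form in which loop invariants are used: `P j` describes the state before pass `j`. -/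
theorem foldl_finRange_induction {σ : Type*} {m : ℕ} (f : σ → Fin m → σ) (s : σ)
    (P : ℕ → σ → Prop) (h0 : P 0 s) (hs : ∀ (j : Fin m) t, P j t → P (j + 1) (f t j)) :
    P m ((List.finRange m).foldl f s) := by
  induction m with
  | zero => simpa using h0
  | succ m ih =>
    rw [List.finRange_succ_last, List.foldl_append, List.foldl_map]
    have := ih (fun t i => f t i.castSucc) (fun j t h => hs j.castSucc t h)
    exact hs (Fin.last m) _ this

theorem forFin_induction {σ : Type} {m : ℕ} (f : Fin m → σ → Timed σ) (s : σ)
    (P : ℕ → σ → Prop) (h0 : P 0 s) (hs : ∀ (j : Fin m) t, P j t → P (j + 1) (f j t).val) :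
    P m (forFin m f s).val := by
  rw [forFin_val]
  exact foldl_finRange_induction _ _ P h0 hs

theorem forList_cost_le {α σ : Type} (l : List α) (f : α → σ → Timed σ) (s : σ) (c : α → ℕ)
    (h : ∀ a ∈ l, ∀ t, (f a t).cost ≤ c a) :
    (forList l f s).cost ≤ (l.map fun a => c a + 1).sum := by
  induction l generalizing s with
  | nil => simp [forList]
  | cons a l ih =>
    have h1 := h a (by simp) s
    have h2 := ih (f a s).val (fun b hb t => h b (by simp [hb]) t)
    simp only [forList, bind_cost, charge_cost, List.map_cons, List.sum_cons]
    omega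

theorem forFin_cost_le {σ : Type} {m : ℕ} (f : Fin m → σ → Timed σ) (s : σ) (c : ℕ)
    (h : ∀ a t, (f a t).cost ≤ c) : (forFin m f s).cost ≤ m * (c + 1) := by
  have := forList_cost_le (List.finRange m) f s (fun _ => c) (fun a _ t => h a t)
  simpa [forFin] using this

theorem repeatTimes_cost_le {σ : Type} (k : ℕ) (f : σ → Timed σ) (s : σ) (c : ℕ)
    (h : ∀ t, (f t).cost ≤ c) : (repeatTimes k f s).cost ≤ k * (c + 1) := by
  induction k generalizing s with
  | zero => simp [repeatTimes]
  | succ k ih =>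
    have h1 := ih (f s).val
    have h2 := h s
    simp only [repeatTimes, bind_cost, charge_cost]
    rw [add_mul]
    omega

theorem repeatTimes_val {σ : Type} (k : ℕ) (f : σ → Timed σ) (s : σ) :
    (repeatTimes k f s).val = (fun t => (f t).val)^[k] s := by
  induction k generalizing s with
  | zero => rfl
  | succ k ih => simp [repeatTimes, ih]

theorem tabulate_cost_le {α : Type} {m : ℕ} (f : Fin m → Timed α) (c : ℕ)
    (h : ∀ i, (f i).cost ≤ c) : (tabulate f).cost ≤ m * (c + 1) := by
  simp only [tabulate]
  calc ∑ i, ((f i).cost + 1) ≤ ∑ _i : Fin m, (c + 1) :=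
        Finset.sum_le_sum fun i _ => Nat.succ_le_succ (h i)
    _ = m * (c + 1) := by simp

theorem sum_cost_le {m : ℕ} (f : Fin m → Timed ℝ) (c : ℕ)
    (h : ∀ i, (f i).cost ≤ c) : (sum f).cost ≤ m * (c + 1) := by
  simp only [sum]
  calc ∑ i, ((f i).cost + 1) ≤ ∑ _i : Fin m, (c + 1) :=
        Finset.sum_le_sum fun i _ => Nat.succ_le_succ (h i)
    _ = m * (c + 1) := by simp

end Timed

/-! ### Correctness of the QR decomposition -/

namespace LpEmbedding

open MeasureTheory Matrix Timed

/-- The state of the Gram-Schmidt process before column `j` is treated: the first `j` columns of `Q`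
are orthonormal and equal `M` times those of the upper triangular matrix `T`. -/
structure GramSchmidtState {m d : ℕ} (M : Fin m → Fin d → ℝ) (j : ℕ)
    (QT : (Fin d → Fin m → ℝ) × (Fin d → Fin d → ℝ)) : Prop where
  eq_mul : ∀ i : Fin d, i.1 < j → QT.1 i = Matrix.of M *ᵥ QT.2 i
  orthonormal : ∀ i i' : Fin d, i.1 < j → i'.1 < j →
    QT.1 i ⬝ᵥ QT.1 i' = if i = i' then 1 else 0
  triangular : ∀ i l : Fin d, i.1 < j → i < l → QT.2 i l = 0

/-- The state of the orthogonalization of column `j` against the first `i` columns. -/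
structure OrthogonalizationState {m d : ℕ} (M : Fin m → Fin d → ℝ) (j : Fin d)
    (Q : Fin d → Fin m → ℝ) (i : ℕ) (vt : (Fin m → ℝ) × (Fin d → ℝ)) : Prop where
  eq_mul : vt.1 = Matrix.of M *ᵥ vt.2
  orthogonal : ∀ i' : Fin d, i'.1 < i → i' < j → Q i' ⬝ᵥ vt.1 = 0
  self : vt.2 j = 1
  triangular : ∀ l : Fin d, j < l → vt.2 l = 0

/-- Orthogonalization of a column against column `i`. -/
theorem OrthogonalizationState.step {m d : ℕ} {M : Fin m → Fin d → ℝ} {j : Fin d}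
    {QT : (Fin d → Fin m → ℝ) × (Fin d → Fin d → ℝ)} (hQ : GramSchmidtState M j QT) (i : Fin d)
    {vt : (Fin m → ℝ) × (Fin d → ℝ)} (h : OrthogonalizationState M j QT.1 i vt) (hij : i < j) :
    OrthogonalizationState M j QT.1 (i + 1)
      (vt.1 - (QT.1 i ⬝ᵥ vt.1) • QT.1 i, vt.2 - (QT.1 i ⬝ᵥ vt.1) • QT.2 i) where
  eq_mul := by
    simp only [Matrix.mulVec_sub, Matrix.mulVec_smul]
    rw [← h.eq_mul, ← hQ.eq_mul i hij]
  orthogonal := by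
    intro i' h1 h2
    simp only [dotProduct_sub, dotProduct_smul, smul_eq_mul]
    rw [hQ.orthonormal i' i h2 hij]
    split_ifs with h3
    · subst h3; ring
    · have : i'.1 < i.1 := by
        have : i'.1 ≠ i.1 := fun h => h3 (Fin.ext h)
        omega
      rw [h.orthogonal i' this h2]; ring
  self := by simp [hQ.triangular i j hij hij, h.self]
  triangular := by
    intro l hl
    simp [hQ.triangular i l hij (hij.trans hl), h.triangular l hl]

/-- Normalization is possible because what is left of column `j` is `M` applied to a coefficient
vector with entry `1` at `j`; this vector is nonzero and `M` is injective. -/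
theorem GramSchmidtState.step {m d : ℕ} {M : Fin m → Fin d → ℝ}
    (hM : ∀ x, Matrix.of M *ᵥ x = 0 → x = 0) (j : Fin d)
    {QT : (Fin d → Fin m → ℝ) × (Fin d → Fin d → ℝ)} (hQ : GramSchmidtState M j QT)
    {vt : (Fin m → ℝ) × (Fin d → ℝ)} (h : OrthogonalizationState M j QT.1 d vt) :
    GramSchmidtState M (j + 1)
      (Function.update QT.1 j (fun k => vt.1 k / √(vt.1 ⬝ᵥ vt.1)),
        Function.update QT.2 j (fun k => vt.2 k / √(vt.1 ⬝ᵥ vt.1))) := by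
  set c := √(vt.1 ⬝ᵥ vt.1) with hc
  have hv : vt.1 ≠ 0 := by
    intro h0
    have := hM vt.2 (by rw [← h.eq_mul, h0])
    have h1 := h.self
    rw [this] at h1
    simp at h1
  have hvv : 0 < vt.1 ⬝ᵥ vt.1 :=
    lt_of_le_of_ne (Finset.sum_nonneg fun i _ => mul_self_nonneg _)
      (fun h => hv (dotProduct_self_eq_zero.1 h.symm))
  have hc0 : 0 < c := Real.sqrt_pos.2 hvv
  have hcc : c * c = vt.1 ⬝ᵥ vt.1 := Real.mul_self_sqrt hvv.le
  have e1 : (fun k => vt.1 k / c) = c⁻¹ • vt.1 := by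
    ext k; simp [div_eq_inv_mul]
  have e2 : (fun k => vt.2 k / c) = c⁻¹ • vt.2 := by
    ext k; simp [div_eq_inv_mul]
  rw [e1, e2]
  have hlt : ∀ i : Fin d, i.1 < j + 1 → i ≠ j → i.1 < j.1 := by
    intro i hi hne
    have : i.1 ≠ j.1 := fun h => hne (Fin.ext h)
    omega
  refine ⟨?_, ?_, ?_⟩
  · intro i hi
    by_cases hij : i = j
    · subst hij
      simp only [Function.update_self, Matrix.mulVec_smul, ← h.eq_mul]
    · simp only [Function.update_of_ne hij]
      exact hQ.eq_mul i (hlt i hi hij)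
  · intro i i' hi hi'
    by_cases hij : i = j <;> by_cases hij' : i' = j
    · subst hij; subst hij'
      simp only [Function.update_self, dotProduct_smul, smul_dotProduct, smul_eq_mul, ← hcc]
      field_simp
      simp
    · subst hij
      have : QT.1 i' ⬝ᵥ vt.1 = 0 := h.orthogonal i' i'.2 (hlt i' hi' hij')
      simp only [Function.update_self, Function.update_of_ne hij', smul_dotProduct,
        dotProduct_comm vt.1, this]
      simp [Ne.symm hij']
    · subst hij'
      have : QT.1 i ⬝ᵥ vt.1 = 0 := h.orthogonal i i.2 (hlt i hi hij)
      simp only [Function.update_self, Function.update_of_ne hij, dotProduct_smul, this]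
      simp [hij]
    · simp only [Function.update_of_ne hij, Function.update_of_ne hij']
      exact hQ.orthonormal i i' (hlt i hi hij) (hlt i' hi' hij')
  · intro i l hi hl
    by_cases hij : i = j
    · subst hij
      simp [h.triangular l hl]
    · simp only [Function.update_of_ne hij]
      exact hQ.triangular i l (hlt i hi hij) hl

/-- The columns of `M R⁻¹` computed by the QR decomposition are orthonormal. -/
theorem qrInverse_orthonormal {m d : ℕ} (M : Fin m → Fin d → ℝ)
    (hM : ∀ x, Matrix.of M *ᵥ x = 0 → x = 0) :
    (Matrix.of M * Matrix.of (qrInverse M).val)ᵀ * (Matrix.of M * Matrix.of (qrInverse M).val)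
      = 1 := by
  have key : ∃ QT, GramSchmidtState M d QT ∧ (qrInverse M).val = fun k j => QT.2 j k := by
    refine ⟨_, ?_, rfl⟩
    refine forFin_induction _ _ (GramSchmidtState M) ?_ ?_
    · exact ⟨fun i hi => absurd hi (Nat.not_lt_zero _), fun i _ hi => absurd hi (Nat.not_lt_zero _),
        fun i _ hi => absurd hi (Nat.not_lt_zero _)⟩
    · intro j QT hQ
      -- The inner loop runs through all `d` columns and skips those with `i ≥ j`, for which the
      -- invariant has nothing to add.
      refine GramSchmidtState.step hM j hQ ?_
      refine forFin_induction _ _ (OrthogonalizationState M j QT.1) ?_ ?_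
      · refine ⟨?_, fun i hi => absurd hi (Nat.not_lt_zero _), ?_, ?_⟩
        · ext k
          simp [tabulate, Matrix.mulVec, dotProduct]
        · simp [tabulate]
        · intro l hl
          simp [tabulate, hl.ne']
      · intro i vt h
        split_ifs with hij
        · exact h.step hQ i hij
        · refine ⟨h.eq_mul, ?_, h.self, h.triangular⟩
          intro i' h1 h2
          refine h.orthogonal i' ?_ h2
          have := lt_of_lt_of_le h2 (not_lt.1 hij)
          exact this
  obtain ⟨QT, h, hT⟩ := key
  have hcol : ∀ j k, (Matrix.of M * Matrix.of (qrInverse M).val) k j = QT.1 j k := by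
    intro j k
    rw [h.eq_mul j j.2, hT]
    simp [Matrix.mul_apply, Matrix.mulVec, dotProduct]
  ext i j
  rw [Matrix.mul_apply, Matrix.one_apply, ← h.orthonormal i j i.2 j.2]
  simp [hcol, dotProduct]

/-! ### Ellipsoidal rounding -/

/-- A linear map of the Euclidean unit ball into itself has determinant at most one. -/
theorem abs_det_le_one_of_contraction {d : ℕ} (C : Matrix (Fin d) (Fin d) ℝ)
    (hC : ∀ y : Fin d → ℝ, y ⬝ᵥ y ≤ 1 → (C *ᵥ y) ⬝ᵥ (C *ᵥ y) ≤ 1) : |C.det| ≤ 1 := by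
  let S : Set (Fin d → ℝ) := {y | y ⬝ᵥ y ≤ 1}
  have hcont : Continuous fun y : Fin d → ℝ => y ⬝ᵥ y := by
    unfold dotProduct; fun_prop
  have hsub : C.toLin' '' S ⊆ S := by
    rintro _ ⟨y, hy, rfl⟩
    simpa [S] using hC y hy
  have hpos : 0 < volume S := by
    have hopen : IsOpen {y : Fin d → ℝ | y ⬝ᵥ y < 1} := isOpen_lt hcont continuous_const
    refine lt_of_lt_of_le (hopen.measure_pos volume ⟨0, by simp⟩) (measure_mono ?_)
    intro y hy
    exact (Set.mem_ofPred.1 hy).le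
  have hfin : volume S < ⊤ := by
    refine lt_of_le_of_lt (measure_mono ?_) (measure_closedBall_lt_top (x := (0 : Fin d → ℝ)) (r := 1))
    intro y hy
    rw [mem_closedBall_zero_iff, pi_norm_le_iff_of_nonneg zero_le_one]
    intro i
    have h1 : y i * y i ≤ y ⬝ᵥ y :=
      Finset.single_le_sum (f := fun i => y i * y i) (fun j _ => mul_self_nonneg _) (Finset.mem_univ i)
    have h2 : y ⬝ᵥ y ≤ 1 := hy
    rw [Real.norm_eq_abs, abs_le]
    constructor <;> nlinarith
  -- The image of the ball has `|det C|` times its volume, which is positive and finite.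
  have h := measure_mono (μ := volume) hsub
  rw [Measure.addHaar_image_linearMap, LinearMap.det_toLin'] at h
  have h2 : ENNReal.ofReal |C.det| ≤ 1 := by
    by_contra hcon
    have := ENNReal.mul_lt_mul_left hpos.ne' hfin.ne (not_le.1 hcon)
    rw [one_mul] at this
    exact absurd h (not_le.2 this)
  rw [ENNReal.ofReal_le_one] at h2
  exact h2

/-- The value of `|z| ^ (p - 1) sign z`, the derivative of `|z| ^ p / p`. -/
noncomputable def signedPow (p z : ℝ) : ℝ := Real.sign z * |z| ^ (p - 1)

theorem signedPow_mul_self {p z : ℝ} (hp : 1 ≤ p) : signedPow p z * z = |z| ^ p := by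
  unfold signedPow
  rcases eq_or_ne z 0 with rfl | hz
  · simp [Real.zero_rpow (by linarith : p ≠ 0)]
  · have h1 : Real.sign z * z = |z| := by
      rcases lt_or_gt_of_ne hz with h | h
      · rw [Real.sign_of_neg h, abs_of_neg h]; ring
      · rw [Real.sign_of_pos h, abs_of_pos h]; ring
    have h2 : |z| ^ p = |z| ^ (p - 1) * |z| := by
      rw [← Real.rpow_add_one (abs_ne_zero.2 hz)]; congr 1; ring
    rw [h2, ← h1]; ring

/-- Young's inequality, as a weighted mean inequality so that `p = 1` needs no separate treatment.
Summed over coordinates, it bounds on the unit ball of the `ℓ_p` norm the linear functional that is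
the derivative of `‖·‖_p ^ p / p` at `z`. -/
theorem signedPow_mul_le {p : ℝ} (hp : 1 ≤ p) (z v : ℝ) :
    signedPow p z * v ≤ (p - 1) / p * |z| ^ p + 1 / p * |v| ^ p := by
  have hp0 : 0 < p := by linarith
  have h0 : signedPow p z * v ≤ |z| ^ (p - 1) * |v| := by
    unfold signedPow
    have h1 : |Real.sign z| ≤ 1 := by
      rcases Real.sign_apply_eq z with h | h | h <;> simp [h]
    calc Real.sign z * |z| ^ (p - 1) * v ≤ |Real.sign z * |z| ^ (p - 1) * v| := le_abs_self _
      _ = |Real.sign z| * (|z| ^ (p - 1) * |v|) := by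
        rw [abs_mul, abs_mul, abs_of_nonneg (Real.rpow_nonneg (abs_nonneg z) _)]; ring
      _ ≤ 1 * (|z| ^ (p - 1) * |v|) := by gcongr
      _ = _ := one_mul _
  refine h0.trans ?_
  have h := Real.geom_mean_le_arith_mean2_weighted (w₁ := (p - 1) / p) (w₂ := 1 / p)
    (p₁ := |z| ^ p) (p₂ := |v| ^ p) (div_nonneg (by linarith) hp0.le) (by positivity)
    (by positivity) (by positivity) (by field_simp; ring)
  rw [← Real.rpow_mul (abs_nonneg z), ← Real.rpow_mul (abs_nonneg v)] at h
  have e1 : p * ((p - 1) / p) = p - 1 := by field_simp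
  have e2 : p * (1 / p) = 1 := by field_simp
  rwa [e1, e2, Real.rpow_one] at h

/-- The matrix that halves the direction of the unit vector `a` and multiplies the orthogonal
complement by `σ`. -/
noncomputable def squeeze {d : ℕ} (σ : ℝ) (a : Fin d → ℝ) : Matrix (Fin d) (Fin d) ℝ :=
  σ • (1 : Matrix (Fin d) (Fin d) ℝ) + (1 / 2 - σ) • vecMulVec a a

theorem squeeze_mulVec {d : ℕ} (σ : ℝ) (a w : Fin d → ℝ) :
    squeeze σ a *ᵥ w = σ • w + ((1 / 2 - σ) * (a ⬝ᵥ w)) • a := by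
  ext i
  simp [squeeze, Matrix.add_mulVec, Matrix.smul_mulVec, Matrix.vecMulVec_mulVec]
  ring

/-- The factor by which a cut stretches the directions parallel to the slab. -/
noncomputable def stretch (d : ℕ) : ℝ := √(((d : ℝ) - 1 / 4) / ((d : ℝ) - 1))

/-- The matrix determinant lemma for a rank-one update of `σ • 1`. Dimension one is separate because
`stretch 1` is `0`, being the root of a quotient by zero. -/
theorem det_squeeze {d : ℕ} (hd : 0 < d) (a : Fin d → ℝ) (ha : a ⬝ᵥ a = 1) (σ : ℝ)
    (hσ : d ≠ 1 → σ ≠ 0) : (squeeze σ a).det = σ ^ (d - 1) / 2 := by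
  by_cases h1 : d = 1
  · subst h1
    have ha' : a 0 * a 0 = 1 := by simpa [dotProduct] using ha
    simp only [squeeze, Matrix.det_unique, Matrix.add_apply, Matrix.smul_apply,
      Matrix.one_apply, vecMulVec_apply, Fin.default_eq_zero, smul_eq_mul]
    simp [ha']
  · have hs := hσ h1
    have e : squeeze σ a = σ • (1 + replicateCol Unit (((1 / 2 - σ) / σ) • a) * replicateRow Unit a) := by
      unfold squeeze
      rw [smul_add]
      congr 1
      ext i j
      simp [Matrix.mul_apply, vecMulVec_apply]
      field_simp
    rw [e, Matrix.det_smul, Matrix.det_one_add_replicateCol_mul_replicateRow]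
    simp only [dotProduct_smul, ha, Fintype.card_fin, smul_eq_mul, mul_one]
    obtain ⟨k, rfl⟩ : ∃ k, d = k + 1 := ⟨d - 1, by omega⟩
    simp only [add_tsub_cancel_right, pow_succ]
    field_simp
    ring

theorem stretch_pos {d : ℕ} (hd : 2 ≤ d) : 0 < stretch d := by
  have : (2 : ℝ) ≤ d := by exact_mod_cast hd
  exact Real.sqrt_pos.2 (div_pos (by linarith) (by linarith))

/-- The square of `stretch d` is `1 + (3 / 4) / (d - 1) ≤ exp ((3 / 4) / (d - 1))`, so the `(d -
1)`-st power of `stretch d` is at most `exp (3 / 8)`; the rest is `exp (5 / 8) ≤ 2`, used in the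
form `exp (5 / 4) ≤ 4`. -/
theorem stretch_pow_le {d : ℕ} (hd : 0 < d) : stretch d ^ (d - 1) / 2 ≤ Real.exp (-(1 / 4)) := by
  have h5 : Real.exp (5 / 4) ≤ 4 := by
    have h := Real.exp_one_lt_d9
    have e : Real.exp (5 / 4) ^ 4 = Real.exp 1 ^ 5 := by
      rw [← Real.exp_nat_mul, ← Real.exp_nat_mul]; norm_num
    have : Real.exp 1 ^ 5 ≤ 2.72 ^ 5 := by gcongr; linarith
    by_contra hc
    have h4 : (4 : ℝ) ^ 4 < Real.exp (5 / 4) ^ 4 := by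
      have := not_le.1 hc
      gcongr
    rw [e] at h4
    norm_num at this h4
    linarith
  have hsq : (stretch d ^ (d - 1)) ^ 2 ≤ Real.exp (3 / 4) := by
    by_cases h1 : d = 1
    · subst h1; simp; norm_num
    have h2 : (2 : ℝ) ≤ d := by exact_mod_cast (by omega : 2 ≤ d)
    have h3 : ((d - 1 : ℕ) : ℝ) = (d : ℝ) - 1 := by
      rw [Nat.cast_sub (by omega)]; simp
    rw [← pow_mul, mul_comm, pow_mul, stretch,
      Real.sq_sqrt (div_nonneg (by linarith) (by linarith))]
    have h4 : ((d : ℝ) - 1 / 4) / (d - 1) ≤ Real.exp (3 / 4 / (d - 1)) := by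
      refine le_trans (le_of_eq ?_) (Real.add_one_le_exp _)
      have : (d : ℝ) - 1 ≠ 0 := by linarith
      field_simp
      ring
    calc _ ≤ Real.exp (3 / 4 / (d - 1)) ^ (d - 1) := by
          gcongr
          exact div_nonneg (by linarith) (by linarith)
      _ = Real.exp (3 / 4) := by
          rw [← Real.exp_nat_mul, h3]
          congr 1
          have : (d : ℝ) - 1 ≠ 0 := by linarith
          field_simp
  have hs0 : 0 ≤ stretch d := Real.sqrt_nonneg _
  refine (sq_le_sq₀ (by positivity)
    (Real.exp_pos _).le).1 ?_
  rw [div_pow, ← Real.exp_nat_mul]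
  have e : Real.exp (3 / 4) = Real.exp (((2 : ℕ) : ℝ) * -(1 / 4)) * Real.exp (5 / 4) := by
    rw [← Real.exp_add]; norm_num
  rw [e] at hsq
  have := Real.exp_pos (((2 : ℕ) : ℝ) * -(1 / 4))
  nlinarith

/-- A slab of half-width `1 / (2 √d)` meets the unit ball inside of the squeezed ball. -/
theorem exists_squeeze_eq {d : ℕ} (hd : 0 < d) (a y : Fin d → ℝ) (ha : a ⬝ᵥ a = 1)
    (hy : y ⬝ᵥ y ≤ 1) (hay : (a ⬝ᵥ y) ^ 2 ≤ 1 / (4 * d)) :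
    ∃ w, w ⬝ᵥ w ≤ 1 ∧ y = squeeze (stretch d) a *ᵥ w := by
  by_cases h1 : d = 1
  · subst h1
    refine ⟨(2 : ℝ) • y, ?_, ?_⟩
    · simp [dotProduct] at ha hy hay ⊢
      nlinarith
    · rw [squeeze_mulVec]
      have ha' : a 0 * a 0 = 1 := by simpa [dotProduct] using ha
      ext i
      have hi : i = 0 := Subsingleton.elim _ _
      subst hi
      simp [stretch, dotProduct]
      linear_combination -(y 0) * ha'
  · have h2 : (2 : ℝ) ≤ d := by exact_mod_cast (by omega : 2 ≤ d)
    set σ := stretch d with hσ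
    have hσ0 : 0 < σ := stretch_pos (by omega)
    have hσ2 : σ ^ 2 * (d - 1) = d - 1 / 4 := by
      rw [hσ, stretch, Real.sq_sqrt (div_nonneg (by linarith) (by linarith))]
      have : (d : ℝ) - 1 ≠ 0 := by linarith
      field_simp
    set b := a ⬝ᵥ y with hb
    have haw : ∀ c e : ℝ, a ⬝ᵥ (c • y + e • a) = c * b + e := by
      intro c e
      simp only [dotProduct_add, dotProduct_smul, ha, ← hb, smul_eq_mul]; ring
    -- This is the inverse of the squeeze: the component of `y` along `a` is doubled and the
    -- orthogonal one divided by `σ`.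
    refine ⟨(1 / σ) • y + ((2 - 1 / σ) * b) • a, ?_, ?_⟩
    · have : ((1 / σ) • y + ((2 - 1 / σ) * b) • a) ⬝ᵥ ((1 / σ) • y + ((2 - 1 / σ) * b) • a)
          = (y ⬝ᵥ y - b ^ 2) / σ ^ 2 + 4 * b ^ 2 := by
        simp only [dotProduct_add, add_dotProduct, dotProduct_smul, smul_dotProduct, ha,
          smul_eq_mul, dotProduct_comm y a, ← hb]
        field_simp
        ring
      rw [this]
      have h4 : 4 * d * b ^ 2 ≤ 1 := by
        rw [le_div_iff₀ (by positivity)] at hay; linarith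
      rw [← le_sub_iff_add_le, div_le_iff₀ (by positivity)]
      -- The squared norm of the witness is `4 b² + (‖y‖² - b²) / σ²`. The value of `stretch` is the
      -- one for which this is exactly `1` when `‖y‖ = 1` and `b² = 1 / (4 d)`.
      have h5 : (d - 1 : ℝ) * ((1 - 4 * b ^ 2) * σ ^ 2) ≥ (d - 1) * (1 - b ^ 2) := by
        have : (d - 1 : ℝ) * ((1 - 4 * b ^ 2) * σ ^ 2) = (1 - 4 * b ^ 2) * (d - 1 / 4) := by
          rw [← hσ2]; ring
        rw [this]
        nlinarith
      have h6 : (1 - b ^ 2) ≤ (1 - 4 * b ^ 2) * σ ^ 2 :=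
        le_of_mul_le_mul_left h5 (by linarith)
      linarith
    · rw [squeeze_mulVec, haw]
      ext i
      simp only [Pi.add_apply, Pi.smul_apply, smul_eq_mul]
      field_simp
      ring

/-- The ellipsoid `{B y | ‖y‖₂ ≤ 1}` contains the convex body `{x | ‖M x‖_p ≤ 1}`. -/
def ContainsBody (p : ℝ) {m d : ℕ} (M : Fin m → Fin d → ℝ) (B : Matrix (Fin d) (Fin d) ℝ) : Prop :=
  ∀ x : Fin d → ℝ, ∑ k, |(Matrix.of M *ᵥ x) k| ^ p ≤ 1 → ∃ y, y ⬝ᵥ y ≤ 1 ∧ x = B *ᵥ y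

/-- The axis points `B e_l / (2 √d)`. -/
noncomputable def axisPoint {d : ℕ} (B : Fin d → Fin d → ℝ) (l : Fin d) : Fin d → ℝ :=
  fun j => B j l / (2 * √(d : ℝ))

/-- All axis points of the ellipsoid lie in the convex body. -/
def AxisInside (p : ℝ) {m d : ℕ} (M : Fin m → Fin d → ℝ) (B : Fin d → Fin d → ℝ) : Prop :=
  ∀ l, ∑ k, |(Matrix.of M *ᵥ axisPoint B l) k| ^ p ≤ 1

/-- The normal vector of the slab that cuts off the point `u`, in the coordinates of the ellipsoid. -/
noncomputable def slabNormal (p : ℝ) {m d : ℕ} (M : Fin m → Fin d → ℝ) (B : Fin d → Fin d → ℝ)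
    (z : Fin m → ℝ) : Fin d → ℝ :=
  ((fun k => signedPow p (z k)) ᵥ* Matrix.of M) ᵥ* Matrix.of B

/-- The ellipsoid after a cut. -/
noncomputable def cut (p : ℝ) {m d : ℕ} (M : Fin m → Fin d → ℝ) (B : Fin d → Fin d → ℝ)
    (z : Fin m → ℝ) : Fin d → Fin d → ℝ :=
  Matrix.of B * squeeze (stretch d)
    (fun l => slabNormal p M B z l / √(slabNormal p M B z ⬝ᵥ slabNormal p M B z))

/-- The axis point that is found to be outside, if there is one. -/
noncomputable def findOutside (p : ℝ) {m d : ℕ} (M : Fin m → Fin d → ℝ) (B : Fin d → Fin d → ℝ) :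
    Option (Fin m → ℝ) :=
  (List.finRange d).foldl (fun acc l =>
    if 1 < ∑ k, |(Matrix.of M *ᵥ axisPoint B l) k| ^ p then some (Matrix.of M *ᵥ axisPoint B l)
    else acc) none

theorem roundingStep_val (p : ℝ) {m d : ℕ} (M : Fin m → Fin d → ℝ) (B : Fin d → Fin d → ℝ) :
    (roundingStep p M B).val = match findOutside p M B with
      | none => B
      | some z => cut p M B z := by
  have h : ∀ found : Option (Fin m → ℝ), (match found with
    | none => (pure B : Timed (Fin d → Fin d → ℝ))
    | some z => do
      let p₁ ← sub p 1
      let y ← tabulate fun k => do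
        let a ← abs (z k)
        let b ← pow a p₁
        let t ← sign (z k)
        mul t b
      let g ← vecMat y M
      let a₀ ← vecMat g B
      let b ← dot a₀ a₀
      let b₁ ← sqrt b
      let a ← tabulate fun l => div (a₀ l) b₁
      let t₁ ← sub (d : ℝ) (1 / 4)
      let t₂ ← sub (d : ℝ) 1
      let t₃ ← div t₁ t₂
      let σ ← sqrt t₃
      let τ ← sub (1 / 2) σ
      let Ba ← matVec B a
      tabulate fun j => tabulate fun l => do
        let x ← mul σ (B j l)
        let y₁ ← mul (Ba j) (a l)
        let y₂ ← mul τ y₁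
        add x y₂).val = match found with
      | none => B
      | some z => cut p M B z := by
    rintro (_ | z)
    · rfl
    · simp only [bind_val]
      ext j l
      simp only [cut, squeeze, Matrix.mul_add, Matrix.mul_smul, Matrix.mul_one, Matrix.mul_vecMulVec]
      simp only [Matrix.add_apply, Matrix.smul_apply, vecMulVec_apply, smul_eq_mul, Matrix.of_apply]
      rfl
  rw [← h]
  unfold findOutside
  unfold roundingStep
  rw [bind_val, bind_val, bind_val, forFin_val]
  congr 2
  simp only [bind_val, pure_val]
  simp [Timed.lt, op, Timed.sum, matVec, tabulate, Timed.div, Timed.abs, Timed.pow, Timed.mul, Timed.sqrt, axisPoint, Matrix.mulVec, dotProduct]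
  rfl

theorem findOutside_spec (p : ℝ) {m d : ℕ} (M : Fin m → Fin d → ℝ) (B : Fin d → Fin d → ℝ) :
    (findOutside p M B = none → AxisInside p M B) ∧
      ∀ z, findOutside p M B = some z →
        ∃ l, z = Matrix.of M *ᵥ axisPoint B l ∧ 1 < ∑ k, |z k| ^ p := by
  have := foldl_finRange_induction (m := d) (fun acc l =>
    if 1 < ∑ k, |(Matrix.of M *ᵥ axisPoint B l) k| ^ p then some (Matrix.of M *ᵥ axisPoint B l)
    else acc) none (fun j acc => (acc = none →
      ∀ l : Fin d, l.1 < j → ∑ k, |(Matrix.of M *ᵥ axisPoint B l) k| ^ p ≤ 1) ∧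
      ∀ z, acc = some z → ∃ l, z = Matrix.of M *ᵥ axisPoint B l ∧ 1 < ∑ k, |z k| ^ p)
    ⟨by simp, by simp⟩ (by
      rintro j acc ⟨h1, h2⟩
      split_ifs with h
      · refine ⟨by simp, ?_⟩
        intro z hz
        simp only [Option.some.injEq] at hz
        exact ⟨j, hz.symm, by rw [← hz]; exact h⟩
      · refine ⟨?_, h2⟩
        intro h0 l hl
        rcases Nat.lt_succ_iff_lt_or_eq.1 hl with h3 | h3
        · exact h1 h0 l h3
        · rw [Fin.ext h3]; exact not_lt.1 h)
  exact ⟨fun h l => this.1 h l l.2, this.2⟩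

/-- A cut keeps the convex body inside of the ellipsoid and shrinks the volume. -/
theorem cut_spec {p : ℝ} (hp : 1 ≤ p) {m d : ℕ} (hd : 0 < d) (M : Fin m → Fin d → ℝ)
    (B : Fin d → Fin d → ℝ) (hB : ContainsBody p M (Matrix.of B)) (l : Fin d)
    (hl : 1 < ∑ k, |(Matrix.of M *ᵥ axisPoint B l) k| ^ p) :
    ContainsBody p M (Matrix.of (cut p M B (Matrix.of M *ᵥ axisPoint B l))) ∧
      (Matrix.of (cut p M B (Matrix.of M *ᵥ axisPoint B l))).det
        = (Matrix.of B).det * (stretch d ^ (d - 1) / 2) := by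
  set z := Matrix.of M *ᵥ axisPoint B l with hz
  set Z := ∑ k, |z k| ^ p with hZ
  set a₀ := slabNormal p M B z with ha₀
  have hd0 : (0 : ℝ) < d := by exact_mod_cast hd
  have hs : 0 < 2 * √(d : ℝ) := by positivity
  have hdot : ∀ y, a₀ ⬝ᵥ y = ∑ k, signedPow p (z k) * (Matrix.of M *ᵥ (Matrix.of B *ᵥ y)) k := by
    intro y
    rw [ha₀, slabNormal, ← Matrix.dotProduct_mulVec, ← Matrix.dotProduct_mulVec]
    rfl
  -- Since `z` is the image of the `l`-th axis point, pairing the normal with `e_l` gives the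
  -- derivative at `z` in direction `z`, which is `∑ |z k| ^ p`, up to the scaling of the axis
  -- point.
  have haxis : a₀ l = 2 * √(d : ℝ) * Z := by
    have e : Matrix.of B *ᵥ Pi.single l 1 = (2 * √(d : ℝ)) • axisPoint B l := by
      ext j
      simp [axisPoint]
      field_simp
    have := hdot (Pi.single l 1)
    rw [dotProduct_single, mul_one, e, Matrix.mulVec_smul, ← hz] at this
    rw [this, hZ, Finset.mul_sum]
    refine Finset.sum_congr rfl fun k _ => ?_
    rw [Pi.smul_apply, smul_eq_mul, ← signedPow_mul_self hp]; ring
  have hpos : 0 < a₀ l := by rw [haxis]; positivity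
  have hsq : a₀ l * a₀ l ≤ a₀ ⬝ᵥ a₀ :=
    Finset.single_le_sum (f := fun i => a₀ i * a₀ i) (fun j _ => mul_self_nonneg _) (Finset.mem_univ l)
  have hN : 0 < a₀ ⬝ᵥ a₀ := lt_of_lt_of_le (mul_pos hpos hpos) hsq
  set c := √(a₀ ⬝ᵥ a₀) with hc
  have hc0 : 0 < c := Real.sqrt_pos.2 hN
  have hcc : c * c = a₀ ⬝ᵥ a₀ := Real.mul_self_sqrt hN.le
  set a : Fin d → ℝ := fun l => a₀ l / c with ha
  have hac : a = c⁻¹ • a₀ := by ext i; simp [ha, div_eq_inv_mul]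
  have haa : a ⬝ᵥ a = 1 := by
    rw [hac, dotProduct_smul, smul_dotProduct, ← hcc]
    simp only [smul_eq_mul]
    field_simp
  have hcut : Matrix.of (cut p M B z) = Matrix.of B * squeeze (stretch d) a := rfl
  -- The supporting functional is at most `Z` on the body, while its norm is at least `a₀ l = 2 √d
  -- Z`. So the slab has half-width at most `1 / (2 √d)` in the coordinates of the ellipsoid.
  have hle : ∀ y, ∑ k, |(Matrix.of M *ᵥ (Matrix.of B *ᵥ y)) k| ^ p ≤ 1 → a₀ ⬝ᵥ y ≤ Z := by
    intro y hy
    rw [hdot]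
    have hp0 : 0 < p := by linarith
    calc _ ≤ ∑ k, ((p - 1) / p * |z k| ^ p
            + 1 / p * |(Matrix.of M *ᵥ (Matrix.of B *ᵥ y)) k| ^ p) :=
          Finset.sum_le_sum fun k _ => signedPow_mul_le hp _ _
      _ = (p - 1) / p * Z + 1 / p * ∑ k, |(Matrix.of M *ᵥ (Matrix.of B *ᵥ y)) k| ^ p := by
          rw [Finset.sum_add_distrib, ← Finset.mul_sum, ← Finset.mul_sum]
      _ ≤ (p - 1) / p * Z + 1 / p * Z := by
          gcongr
          exact hy.trans hl.le
      _ = Z := by field_simp; ring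
  refine ⟨?_, ?_⟩
  · intro x hx
    obtain ⟨y, hy, rfl⟩ := hB x hx
    have h1 := hle y hx
    have h2 := hle (-y) (by simpa [Matrix.mulVec_neg] using hx)
    rw [dotProduct_neg] at h2
    have hay : (a ⬝ᵥ y) ^ 2 ≤ 1 / (4 * d) := by
      have e : a ⬝ᵥ y = (a₀ ⬝ᵥ y) / c := by
        rw [hac, smul_dotProduct, smul_eq_mul]; field_simp
      have h3 : (a₀ ⬝ᵥ y) ^ 2 ≤ Z ^ 2 := sq_le_sq.2 (by
        rw [abs_of_pos (lt_trans one_pos hl)]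
        exact abs_le.2 ⟨by linarith, h1⟩)
      have h4 : 4 * d * Z ^ 2 ≤ c ^ 2 := by
        rw [sq c, hcc]
        refine le_trans (le_of_eq ?_) hsq
        rw [haxis]
        have := Real.mul_self_sqrt hd0.le
        linear_combination (-4 * Z ^ 2) * this
      rw [e, div_pow, div_le_div_iff₀ (by positivity) (by positivity)]
      nlinarith
    obtain ⟨w, hw, hyw⟩ := exists_squeeze_eq hd a y haa hy hay
    refine ⟨w, hw, ?_⟩
    rw [hcut, ← Matrix.mulVec_mulVec, ← hyw]
  · rw [hcut, Matrix.det_mul, det_squeeze hd a haa]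
    intro h1
    exact (stretch_pos (by omega)).ne'

theorem det_ne_zero_of_orthonormal {m d : ℕ} {M : Matrix (Fin m) (Fin d) ℝ}
    {B : Matrix (Fin d) (Fin d) ℝ} (h : (M * B)ᵀ * (M * B) = 1) : B.det ≠ 0 := by
  have : ((M * B)ᵀ * M) * B = 1 := by rw [Matrix.mul_assoc]; exact h
  have h2 := congrArg Matrix.det this
  rw [Matrix.det_mul, Matrix.det_one] at h2
  exact right_ne_zero_of_mul (h2.symm ▸ one_ne_zero)

theorem dotProduct_mulVec_self_of_orthonormal {m d : ℕ} {V : Matrix (Fin m) (Fin d) ℝ}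
    (h : Vᵀ * V = 1) (y : Fin d → ℝ) : (V *ᵥ y) ⬝ᵥ (V *ᵥ y) = y ⬝ᵥ y := by
  rw [Matrix.dotProduct_mulVec, ← Matrix.mulVec_transpose, Matrix.mulVec_mulVec, h, Matrix.one_mulVec]

/-- The `ℓ₂` norm of a vector is at most its `ℓ_p` norm, for unit vectors. -/
theorem dotProduct_self_le_one {p : ℝ} (hp₁ : 1 ≤ p) (hp₂ : p ≤ 2) {m : ℕ} (v : Fin m → ℝ)
    (h : ∑ k, |v k| ^ p ≤ 1) : v ⬝ᵥ v ≤ 1 := by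
  refine le_trans (Finset.sum_le_sum fun k _ => ?_) h
  have h1 : |v k| ≤ 1 := by
    have : |v k| ^ p ≤ 1 := le_trans
      (Finset.single_le_sum (f := fun k => |v k| ^ p) (fun j _ => by positivity) (Finset.mem_univ k)) h
    by_contra hc
    exact absurd this (not_le.2 (Real.one_lt_rpow (not_le.1 hc) (by linarith)))
  rcases eq_or_ne (v k) 0 with h0 | h0
  · rw [h0]; simp; positivity
  · calc v k * v k = |v k| ^ (2 : ℝ) := by rw [Real.rpow_two, sq_abs, sq]
      _ ≤ |v k| ^ p := Real.rpow_le_rpow_of_exponent_ge (abs_pos.2 h0) h1 hp₂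

/-- All entries are at most `1`, so `|v k| ^ p ≤ |v k|`, and the `ℓ₁` norm is bounded by
Cauchy-Schwarz. -/
theorem sum_abs_rpow_le_one {p : ℝ} (hp₁ : 1 ≤ p) {m : ℕ} (v : Fin m → ℝ)
    (h : m * (v ⬝ᵥ v) ≤ 1) : ∑ k, |v k| ^ p ≤ 1 := by
  have hk : ∀ k, |v k| ≤ 1 := by
    intro k
    have hm : (1 : ℝ) ≤ m := by
      have : 0 < m := lt_of_le_of_lt (Nat.zero_le _) k.2
      exact_mod_cast this
    have h1 : v k * v k ≤ v ⬝ᵥ v :=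
      Finset.single_le_sum (f := fun i => v i * v i) (fun j _ => mul_self_nonneg _) (Finset.mem_univ k)
    have h2 : 0 ≤ v ⬝ᵥ v := le_trans (mul_self_nonneg _) h1
    rw [abs_le]
    constructor <;> nlinarith
  have h1 : ∑ k, |v k| ^ p ≤ ∑ k, |v k| := by
    refine Finset.sum_le_sum fun k _ => ?_
    rcases eq_or_ne (v k) 0 with h0 | h0
    · rw [h0]; simp [Real.zero_rpow (by linarith : p ≠ 0)]
    · calc |v k| ^ p ≤ |v k| ^ (1 : ℝ) :=
          Real.rpow_le_rpow_of_exponent_ge (abs_pos.2 h0) (hk k) hp₁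
        _ = |v k| := Real.rpow_one _
  refine h1.trans ?_
  have h2 := sq_sum_le_card_mul_sum_sq (s := Finset.univ) (f := fun k => |v k|)
  have h3 : ∑ k, |v k| ^ 2 = v ⬝ᵥ v := by simp [dotProduct, sq]
  simp only [Finset.card_univ, Fintype.card_fin] at h2
  rw [h3] at h2
  nlinarith [Finset.sum_nonneg fun k (_ : k ∈ Finset.univ) => abs_nonneg (v k)]

/-- Ellipsoidal rounding: the ellipsoid `{B y | ‖y‖₂ ≤ 1}` computed by `rounding` contains the body
`{x | ‖M x‖_p ≤ 1}`, which in turn contains the axis points `B e_l / (2 √d)`. -/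
theorem rounding_contains {p : ℝ} (hp₁ : 1 ≤ p) (hp₂ : p ≤ 2) {m d : ℕ} (hd : 0 < d)
    (M : Fin m → Fin d → ℝ) (hM : ∀ x, Matrix.of M *ᵥ x = 0 → x = 0) :
    ContainsBody p M (Matrix.of (rounding p M).val) ∧ (Matrix.of (rounding p M).val).det ≠ 0 ∧
      AxisInside p M (rounding p M).val := by
  set B₀ := (qrInverse M).val with hB₀
  have horth := qrInverse_orthonormal M hM
  rw [← hB₀] at horth
  have hdet₀ : (Matrix.of B₀).det ≠ 0 := det_ne_zero_of_orthonormal horth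
  have hnorm : ∀ y, (Matrix.of M *ᵥ (Matrix.of B₀ *ᵥ y)) ⬝ᵥ (Matrix.of M *ᵥ (Matrix.of B₀ *ᵥ y))
      = y ⬝ᵥ y := by
    intro y
    rw [Matrix.mulVec_mulVec]
    exact dotProduct_mulVec_self_of_orthonormal horth y
  have hm : 0 < m := by
    rcases Nat.eq_zero_or_pos m with h | h
    · subst h
      have := hM (Pi.single ⟨0, hd⟩ 1) (Subsingleton.elim _ _)
      have := congrFun this ⟨0, hd⟩
      simp at this
    · exact h
  have hm' : (1 : ℝ) ≤ m := by exact_mod_cast hm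
  have hsurj : ∀ B : Matrix (Fin d) (Fin d) ℝ, B.det ≠ 0 → ∀ x, B *ᵥ (B⁻¹ *ᵥ x) = x := by
    intro B hB x
    rw [Matrix.mulVec_mulVec, Matrix.mul_nonsing_inv _ (isUnit_iff_ne_zero.2 hB), Matrix.one_mulVec]
  -- After `k` rounds, either no axis point is outside and nothing changes any more, or all `k`
  -- rounds were cuts, each of which multiplied the volume by at most `exp (-1 / 4)`.
  let J : ℕ → (Fin d → Fin d → ℝ) → Prop := fun k B =>
    ContainsBody p M (Matrix.of B) ∧ (Matrix.of B).det ≠ 0 ∧ (AxisInside p M B ∨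
      |(Matrix.of B).det| ≤ Real.exp (-(k / 4)) * |(Matrix.of B₀).det|)
  have hJ0 : J 0 B₀ := by
    refine ⟨?_, hdet₀, Or.inr (by simp)⟩
    intro x hx
    refine ⟨(Matrix.of B₀)⁻¹ *ᵥ x, ?_, (hsurj _ hdet₀ x).symm⟩
    rw [← hnorm, hsurj _ hdet₀]
    exact dotProduct_self_le_one hp₁ hp₂ _ hx
  have hfac : 0 < stretch d ^ (d - 1) / 2 := by
    rcases eq_or_ne d 1 with h | h
    · subst h; simp
    · have := stretch_pos (d := d) (by omega); positivity
  have hstep : ∀ k B, J k B → J (k + 1) (roundingStep p M B).val := by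
    rintro k B ⟨h1, h2, h3⟩
    have hspec := findOutside_spec p M B
    rw [roundingStep_val]
    cases hf : findOutside p M B with
    | none => exact ⟨h1, h2, Or.inl (hspec.1 hf)⟩
    | some z =>
      obtain ⟨l, rfl, hl⟩ := hspec.2 z hf
      obtain ⟨h4, h5⟩ := cut_spec hp₁ hd M B h1 l hl
      refine ⟨h4, ?_, Or.inr ?_⟩
      · simp only
        rw [h5]; exact mul_ne_zero h2 hfac.ne'
      · rcases h3 with h3 | h3
        · exact absurd hl (not_lt.2 (h3 l))
        · simp only
          rw [h5, abs_mul, abs_of_pos hfac]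
          calc _ ≤ Real.exp (-(k / 4)) * |(Matrix.of B₀).det| * Real.exp (-(1 / 4)) := by
                gcongr
                exact stretch_pow_le hd
            _ = _ := by
                rw [mul_right_comm, ← Real.exp_add]
                push_cast
                ring_nf
  have hJ : ∀ k, J k ((fun t => (roundingStep p M t).val)^[k] B₀) := by
    intro k
    induction k with
    | zero => exact hJ0
    | succ k ih =>
      rw [Function.iterate_succ_apply']
      exact hstep k _ ih
  set N := ⌈4 * (d : ℝ) * Real.log m⌉₊ with hN
  have hval : (rounding p M).val = (fun t => (roundingStep p M t).val)^[N + 1] B₀ := by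
    simp only [rounding, bind_val, repeatTimes_val]
    rfl
  have hfin := hJ (N + 1)
  rw [← hval] at hfin
  obtain ⟨h1, h2, h3⟩ := hfin
  refine ⟨h1, h2, h3.resolve_right ?_⟩
  intro h4
  set B := Matrix.of (rounding p M).val with hB
  set ρ : ℝ := (√(m : ℝ))⁻¹ with hρ
  have hs0 : 0 < √(m : ℝ) := Real.sqrt_pos.2 (by linarith)
  -- The image under `B₀` of the ball of radius `1 / √m` lies in the body, hence in the current
  -- ellipsoid. This bounds the volume of the ellipsoid from below and limits the number of cuts.
  have hcontr := abs_det_le_one_of_contraction (ρ • (B⁻¹ * Matrix.of B₀)) (by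
    intro y hy
    have hx : ∑ k, |(Matrix.of M *ᵥ (Matrix.of B₀ *ᵥ (ρ • y))) k| ^ p ≤ 1 := by
      apply sum_abs_rpow_le_one hp₁
      rw [hnorm, dotProduct_smul, smul_dotProduct, smul_eq_mul, smul_eq_mul]
      have : m * (ρ * ρ) = 1 := by
        have := Real.mul_self_sqrt (by linarith : (0 : ℝ) ≤ m)
        rw [hρ]
        field_simp
        linarith
      nlinarith
    obtain ⟨w, hw, hyw⟩ := h1 _ hx
    have : (ρ • (B⁻¹ * Matrix.of B₀)) *ᵥ y = w := by
      rw [Matrix.smul_mulVec, ← Matrix.mulVec_smul, ← Matrix.mulVec_mulVec, hyw, Matrix.mulVec_mulVec,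
        Matrix.nonsing_inv_mul _ (isUnit_iff_ne_zero.2 h2), Matrix.one_mulVec]
    rw [this]; exact hw)
  rw [Matrix.det_smul, Matrix.det_mul, Matrix.det_nonsing_inv, Ring.inverse_eq_inv', abs_mul, abs_mul,
    Fintype.card_fin, abs_pow, abs_of_pos (inv_pos.2 hs0), abs_inv] at hcontr
  have hb : 0 < |B.det| := abs_pos.2 h2
  have hb0 : 0 < |(Matrix.of B₀).det| := abs_pos.2 hdet₀
  have h5 : |(Matrix.of B₀).det| ≤ √(m : ℝ) ^ d * |B.det| := by
    rw [inv_pow, ← mul_assoc, ← mul_inv, inv_mul_le_iff₀ (by positivity), mul_one] at hcontr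
    exact hcontr
  have h6 : √(m : ℝ) ^ d ≤ Real.exp (d * Real.log m) := by
    rw [Real.exp_nat_mul, Real.exp_log (by linarith)]
    gcongr
    rw [Real.sqrt_le_left (by linarith)]
    nlinarith
  have h7 : |(Matrix.of B₀).det| ≤ Real.exp (d * Real.log m) *
      (Real.exp (-(((N + 1 : ℕ) : ℝ) / 4)) * |(Matrix.of B₀).det|) := by
    refine h5.trans ?_
    gcongr
  rw [← mul_assoc, ← Real.exp_add] at h7
  -- Here the additional round beyond `⌈4 d log m⌉` makes the inequality strict.
  have h8 : Real.exp (d * Real.log m + -(((N + 1 : ℕ) : ℝ) / 4)) < 1 := by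
    rw [Real.exp_lt_one_iff]
    have := Nat.le_ceil (4 * (d : ℝ) * Real.log m)
    push_cast
    rw [← hN] at this
    linarith
  nlinarith

/-- The well-conditioned basis computed by ellipsoidal rounding: lower bound. -/
theorem rounding_lower {p : ℝ} (hp₁ : 1 ≤ p) (hp₂ : p ≤ 2) {m d : ℕ} (hd : 0 < d)
    (M : Fin m → Fin d → ℝ) (hM : ∀ x, Matrix.of M *ᵥ x = 0 → x = 0) (y : Fin d → ℝ) :
    (y ⬝ᵥ y) ^ (p / 2) ≤ ∑ k, |(Matrix.of M *ᵥ (Matrix.of (rounding p M).val *ᵥ y)) k| ^ p := by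
  obtain ⟨h1, h2, -⟩ := rounding_contains hp₁ hp₂ hd M hM
  set B := Matrix.of (rounding p M).val with hB
  set Z := ∑ k, |(Matrix.of M *ᵥ (B *ᵥ y)) k| ^ p with hZ
  have hp0 : 0 < p := by linarith
  have hinj : ∀ u v, B *ᵥ u = B *ᵥ v → u = v := by
    intro u v huv
    have := congrArg (fun x => B⁻¹ *ᵥ x) huv
    simpa [Matrix.mulVec_mulVec, Matrix.nonsing_inv_mul _ (isUnit_iff_ne_zero.2 h2)] using this
  have hZ0 : 0 ≤ Z := Finset.sum_nonneg fun k _ => by positivity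
  rcases hZ0.eq_or_lt with h0 | h0
  · have h3 : Matrix.of M *ᵥ (B *ᵥ y) = 0 := by
      ext k
      have := (Finset.sum_eq_zero_iff_of_nonneg (fun k _ => by positivity)).1 h0.symm k (Finset.mem_univ k)
      rw [Real.rpow_eq_zero (abs_nonneg _) hp0.ne'] at this
      simpa using this
    have h4 : y = 0 := hinj y 0 (by rw [hM _ h3, Matrix.mulVec_zero])
    rw [← h0, h4]
    simp [Real.zero_rpow (by linarith : p / 2 ≠ 0)]
  -- Scaling by `Z ^ (-1 / p)` moves the vector to the boundary of the body; the general inequality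
  -- follows by homogeneity.
  · set c := Z ^ (-(1 / p)) with hc
    have hc0 : 0 < c := Real.rpow_pos_of_pos h0 _
    have hcp : c ^ p = Z⁻¹ := by
      rw [hc, ← Real.rpow_mul hZ0, ← Real.rpow_neg_one]; congr 1; field_simp
    obtain ⟨w, hw, hyw⟩ := h1 (B *ᵥ (c • y)) (by
      simp only [Matrix.mulVec_smul, Pi.smul_apply, smul_eq_mul, abs_mul,
        Real.mul_rpow (abs_nonneg _) (abs_nonneg _)]
      rw [← Finset.mul_sum, ← hZ, abs_of_pos hc0, hcp, inv_mul_cancel₀ h0.ne'])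
    rw [← hinj _ _ hyw, dotProduct_smul, smul_dotProduct, smul_eq_mul, smul_eq_mul] at hw
    have hy : 0 ≤ y ⬝ᵥ y := Finset.sum_nonneg fun i _ => mul_self_nonneg _
    have h5 : (c * (c * (y ⬝ᵥ y))) ^ (p / 2) ≤ 1 :=
      Real.rpow_le_one (by positivity) hw (by positivity)
    rw [← mul_assoc, Real.mul_rpow (by positivity) hy, ← sq, ← Real.rpow_natCast,
      ← Real.rpow_mul hc0.le] at h5
    have e : ((2 : ℕ) : ℝ) * (p / 2) = p := by push_cast; ring
    rw [e, hcp] at h5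
    rwa [inv_mul_le_iff₀ h0, mul_one] at h5

/-- The well-conditioned basis computed by ellipsoidal rounding: upper bound. -/
theorem rounding_upper {p : ℝ} (hp₁ : 1 ≤ p) (hp₂ : p ≤ 2) {m d : ℕ} (hd : 0 < d)
    (M : Fin m → Fin d → ℝ) (hM : ∀ x, Matrix.of M *ᵥ x = 0 → x = 0) (l : Fin d) :
    ∑ k, |(Matrix.of M * Matrix.of (rounding p M).val) k l| ^ p ≤ (2 * √(d : ℝ)) ^ p := by
  obtain ⟨-, -, h⟩ := rounding_contains hp₁ hp₂ hd M hM
  have hd0 : (0 : ℝ) < d := by exact_mod_cast hd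
  have hs : 0 < 2 * √(d : ℝ) := by positivity
  have e : ∀ k, (Matrix.of M * Matrix.of (rounding p M).val) k l =
      2 * √(d : ℝ) * (Matrix.of M *ᵥ axisPoint (rounding p M).val l) k := by
    intro k
    simp only [Matrix.mul_apply, Matrix.mulVec, dotProduct, axisPoint, Finset.mul_sum, Matrix.of_apply]
    refine Finset.sum_congr rfl fun j _ => ?_
    field_simp
  have e' : ∀ k, |(Matrix.of M * Matrix.of (rounding p M).val) k l| ^ p =
      (2 * √(d : ℝ)) ^ p * |(Matrix.of M *ᵥ axisPoint (rounding p M).val l) k| ^ p := by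
    intro k
    rw [e, abs_mul, abs_of_pos hs, Real.mul_rpow hs.le (abs_nonneg _)]
  simp only [e', ← Finset.mul_sum]
  exact mul_le_of_le_one_right (by positivity) (h l)

end LpEmbedding

/-! ### Linear combinations, anti-concentration and tails of stable variables -/

namespace StableLaw

open MeasureTheory ProbabilityTheory Filter Topology Set

/-- `D` has the characteristic function `t ↦ exp (-c |t| ^ p)`. -/
def HasStableCharFun (p c : ℝ) (D : Measure ℝ) : Prop :=
  ∀ t : ℝ, charFun D t = ((Real.exp (-(c * |t| ^ p)) : ℝ) : ℂ)

theorem hasStableCharFun_stableLaw {p : ℝ} (hp : 0 < p) (hp2 : p < 2) :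
    HasStableCharFun p 1 (stableLaw p) := by
  intro t
  rw [charFun_stableLaw hp hp2, one_mul]

/-- The Gaussian law is the case `p = 2`, so that the products with Gaussian matrices are covered by
the same lemmas as the stable multipliers. -/
theorem hasStableCharFun_gaussian : HasStableCharFun 2 (1 / 2) (gaussianReal 0 1) := by
  intro t
  rw [charFun_gaussianReal]
  push_cast
  congr 1
  rw [Real.rpow_two, sq_abs]
  push_cast
  simp
  ring

section

variable {Ω ι κ : Type*} {mΩ : MeasurableSpace Ω} {P : Measure Ω}
  [Fintype ι] [Fintype κ] {X : ι → Ω → ℝ} {p c : ℝ} {D : Measure ℝ}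

theorem charFun_map_linear (hX : ∀ i, Measurable (X i)) (hind : iIndepFun X P)
    (hlaw : ∀ i, P.map (X i) = D) (hD : HasStableCharFun p c D) (b : ι → ℝ) (s : ℝ) :
    charFun (P.map fun ω => ∑ i, b i * X i ω) s
      = ((Real.exp (-(c * (∑ i, |b i| ^ p) * |s| ^ p)) : ℝ) : ℂ) := by
  have h1 : iIndepFun (fun i ω => b i * X i ω) P :=
    hind.comp (fun i x => b i * x) (fun i => measurable_const_mul (b i))
  rw [h1.charFun_map_fun_sum_eq_prod (fun i => ((hX i).const_mul (b i)).aemeasurable),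
    Finset.prod_apply]
  have h2 : ∀ i, charFun (P.map fun ω => b i * X i ω) s
      = ((Real.exp (-(c * |b i| ^ p * |s| ^ p)) : ℝ) : ℂ) := by
    intro i
    have : (P.map fun ω => b i * X i ω) = D.map (b i * ·) := by
      rw [← hlaw i, Measure.map_map (measurable_const_mul (b i)) (hX i)]; rfl
    rw [this, charFun_map_mul, hD, abs_mul, Real.mul_rpow (abs_nonneg _) (abs_nonneg _), mul_assoc]
  simp only [h2]
  rw [← Complex.ofReal_prod, ← Real.exp_sum, Finset.sum_neg_distrib, Finset.mul_sum, Finset.sum_mul]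

/-- A linear combination of independent copies of a stable random variable is distributed like a
multiple of it. -/
theorem map_linear [IsProbabilityMeasure P] (hp : 0 < p) (hX : ∀ i, Measurable (X i)) (hind : iIndepFun X P)
    (hlaw : ∀ i, P.map (X i) = D) (hD : HasStableCharFun p c D) [IsProbabilityMeasure D] (b : ι → ℝ) :
    (P.map fun ω => ∑ i, b i * X i ω) = D.map ((∑ i, |b i| ^ p) ^ (1 / p) * ·) := by
  have hm : Measurable fun ω => ∑ i, b i * X i ω :=
    Finset.measurable_sum _ fun i _ => (hX i).const_mul (b i)
  have := Measure.isProbabilityMeasure_map (μ := P) hm.aemeasurable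
  have := Measure.isProbabilityMeasure_map (μ := D)
    (measurable_const_mul ((∑ i, |b i| ^ p) ^ (1 / p))).aemeasurable
  refine Measure.ext_of_charFun ?_
  ext s
  have hS : 0 ≤ ∑ i, |b i| ^ p := Finset.sum_nonneg fun i _ => by positivity
  rw [charFun_map_linear hX hind hlaw hD, charFun_map_mul, hD, abs_mul,
    Real.mul_rpow (abs_nonneg _) (abs_nonneg _), abs_of_nonneg (Real.rpow_nonneg hS _),
    ← Real.rpow_mul hS, one_div_mul_cancel hp.ne', Real.rpow_one, mul_assoc]

/-- Linear combinations with disjoint supports of independent copies of a stable random variable are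
independent. -/
theorem iIndepFun_linear [IsProbabilityMeasure P] (hp : 0 < p) (hX : ∀ i, Measurable (X i)) (hind : iIndepFun X P)
    (hlaw : ∀ i, P.map (X i) = D) (hD : HasStableCharFun p c D) (a : κ → ι → ℝ)
    (ha : ∀ i k k', k ≠ k' → a k i = 0 ∨ a k' i = 0) :
    iIndepFun (fun k ω => ∑ i, a k i * X i ω) P := by
  have hm : ∀ k, Measurable fun ω => ∑ i, a k i * X i ω := fun k =>
    Finset.measurable_sum _ fun i _ => (hX i).const_mul (a k i)
  rw [iIndepFun_iff_charFun_pi fun k => (hm k).aemeasurable]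
  intro t
  -- The joint characteristic function at `t` is that of a single linear combination of the `X i` at
  -- `1`, so independence can be read off from a product formula.
  have h1 : charFun (P.map fun ω => WithLp.toLp 2 fun k => ∑ i, a k i * X i ω) t
      = charFun (P.map fun ω => ∑ i, (∑ k, t k * a k i) * X i ω) 1 := by
    have hm1 : Measurable fun ω => WithLp.toLp 2 fun k => ∑ i, a k i * X i ω := by fun_prop
    have hm2 : Measurable fun ω => ∑ i, (∑ k, t k * a k i) * X i ω := by fun_prop
    rw [charFun_apply, charFun_apply_real, integral_map hm1.aemeasurable (by fun_prop),
      integral_map hm2.aemeasurable (by fun_prop)]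
    refine integral_congr_ae (ae_of_all _ fun ω => ?_)
    simp only [PiLp.inner_apply, RCLike.inner_apply, conj_trivial, Complex.ofReal_one, one_mul]
    congr 3
    simp only [Finset.sum_mul, Finset.mul_sum]
    rw [Finset.sum_comm]
    refine Finset.sum_congr rfl fun i _ => Finset.sum_congr rfl fun k _ => by ring
  rw [h1, charFun_map_linear hX hind hlaw hD]
  simp only [charFun_map_linear hX hind hlaw hD]
  rw [← Complex.ofReal_prod, ← Real.exp_sum, Finset.sum_neg_distrib]
  congr 3
  -- By disjointness of the supports at most one term of the inner sum is nonzero, so the `p`-th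
  -- power is additive here.
  have h2 : ∀ i, |∑ k, t k * a k i| ^ p = ∑ k, |t k| ^ p * |a k i| ^ p := by
    intro i
    by_cases h : ∃ k, a k i ≠ 0
    · obtain ⟨k, hk⟩ := h
      have h0 : ∀ k', k' ≠ k → a k' i = 0 := fun k' hk' => (ha i k' k hk').resolve_right hk
      rw [Finset.sum_eq_single k (fun k' _ hk' => by rw [h0 k' hk', mul_zero]) (by simp),
        Finset.sum_eq_single k (fun k' _ hk' => by
          rw [h0 k' hk', abs_zero, Real.zero_rpow hp.ne', mul_zero]) (by simp),
        abs_mul, Real.mul_rpow (abs_nonneg _) (abs_nonneg _)]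
    · push Not at h
      simp [h, Real.zero_rpow hp.ne']
  simp only [h2, abs_one, Real.one_rpow, mul_one]
  rw [Finset.sum_comm, Finset.mul_sum]
  refine Finset.sum_congr rfl fun k _ => ?_
  rw [Finset.mul_sum, Finset.mul_sum, Finset.sum_mul]
  refine Finset.sum_congr rfl fun i _ => by ring

end

/-- A law with characteristic function `exp (-|t| ^ p)` has small mass near zero. -/
theorem exists_measure_abs_le {p : ℝ} (hp : 1 ≤ p) {D : Measure ℝ} [IsProbabilityMeasure D]
    (hD : HasStableCharFun p 1 D) : ∀ θ : ℝ, 0 < θ → D.real {x | |x| ≤ θ} ≤ 20 * θ := by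
  intro θ hθ
  -- With variance `θ⁻²`, the characteristic function `exp (-x² / (2 θ²))` is at least `1 / 2` on
  -- `[-θ, θ]`, and the Gaussian density is of order `θ` at most.
  set v : NNReal := ⟨(θ ^ 2)⁻¹, by positivity⟩ with hv
  have hvv : (v : ℝ) = (θ ^ 2)⁻¹ := rfl
  have hv0 : v ≠ 0 := by
    intro h
    have := congrArg NNReal.toReal h
    rw [hvv] at this
    simp at this
    exact hθ.ne' this
  have hcf : ∀ x : ℝ, charFun (gaussianReal 0 v) x = ((Real.exp (-(x ^ 2 / (2 * θ ^ 2))) : ℝ) : ℂ) := by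
    intro x
    rw [charFun_gaussianReal, hvv]
    push_cast
    congr 1
    field_simp
    simp
    ring
  -- A Parseval identity: the integral of a Gaussian against `D` becomes an integral of the
  -- characteristic function of `D`, which is integrable.
  have hswap : ∫ x, charFun (gaussianReal 0 v) x ∂D = ∫ t, charFun D t ∂(gaussianReal 0 v) := by
    simp only [charFun_apply_real]
    rw [integral_integral_swap]
    · refine integral_congr_ae (ae_of_all _ fun t => integral_congr_ae (ae_of_all _ fun x => ?_))
      simp only
      congr 2
      ring
    · refine Integrable.mono' (g := fun _ => (1:ℝ)) (integrable_const _)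
        (Measurable.aestronglyMeasurable (by fun_prop)) ?_
      refine ae_of_all _ fun z => ?_
      simp only [Function.uncurry]
      rw [← Complex.ofReal_mul, Complex.norm_exp_ofReal_mul_I]
  have hreal : ∫ x, Real.exp (-(x ^ 2 / (2 * θ ^ 2))) ∂D
      = ∫ t, Real.exp (-(1 * |t| ^ p)) ∂(gaussianReal 0 v) := by
    have : ((∫ x, Real.exp (-(x ^ 2 / (2 * θ ^ 2))) ∂D : ℝ) : ℂ)
        = ((∫ t, Real.exp (-(1 * |t| ^ p)) ∂(gaussianReal 0 v) : ℝ) : ℂ) := by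
      rw [← integral_complex_ofReal, ← integral_complex_ofReal]
      simp only [← hcf]
      rw [hswap]
      exact integral_congr_ae (ae_of_all _ fun t => hD t)
    exact_mod_cast this
  have hbound : ∀ t : ℝ, Real.exp (-(1 * |t| ^ p)) ≤ 2 * Real.exp 1 * (1 + t ^ 2)⁻¹ := by
    intro t
    have h1 : |t| - 1 ≤ |t| ^ p := by
      rcases le_total |t| 1 with h | h
      · have : 0 ≤ |t| ^ p := by positivity
        linarith
      · have := Real.rpow_le_rpow_of_exponent_le h hp
        rw [Real.rpow_one] at this
        linarith
    have h2 := Real.quadratic_le_exp_of_nonneg (abs_nonneg t)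
    rw [sq_abs] at h2
    have h3 : 0 ≤ |t| := abs_nonneg t
    rw [← div_eq_mul_inv, le_div_iff₀ (by positivity)]
    calc Real.exp (-(1 * |t| ^ p)) * (1 + t ^ 2) ≤ Real.exp (1 - |t|) * (2 * Real.exp |t|) := by
          gcongr
          · linarith
          · nlinarith
      _ = 2 * Real.exp 1 := by
          rw [Real.exp_sub]
          field_simp
  have hgint : ∫ t, Real.exp (-(1 * |t| ^ p)) ∂(gaussianReal 0 v) ≤ 9 * θ := by
    have hpdf : ∀ t, gaussianPDFReal 0 v t ≤ θ / 2 := by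
      intro t
      rw [gaussianPDFReal, hvv]
      have h1 : Real.exp (-(t - 0) ^ 2 / (2 * (θ ^ 2)⁻¹)) ≤ 1 := by
        rw [Real.exp_le_one_iff, neg_div]
        exact neg_nonpos.2 (by positivity)
      have h2 : (√(2 * Real.pi * (θ ^ 2)⁻¹))⁻¹ ≤ θ / 2 := by
        rw [inv_le_comm₀ (by positivity) (by positivity)]
        apply Real.le_sqrt_of_sq_le
        have := Real.pi_gt_three
        field_simp
        linarith
      calc _ ≤ (θ / 2) * 1 := by gcongr
        _ = _ := mul_one _
    rw [integral_gaussianReal_eq_integral_smul hv0]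
    calc _ ≤ ∫ t : ℝ, (θ / 2) * (2 * Real.exp 1) * (1 + t ^ 2)⁻¹ := by
          refine integral_mono_of_nonneg (ae_of_all _ fun t => ?_) ?_ (ae_of_all _ fun t => ?_)
          · exact smul_nonneg (gaussianPDFReal_nonneg _ _ _) (Real.exp_pos _).le
          · exact integrable_inv_one_add_sq.const_mul _
          · simp only [smul_eq_mul]
            calc _ ≤ (θ / 2) * (2 * Real.exp 1 * (1 + t ^ 2)⁻¹) := by
                  gcongr
                  · exact hpdf t
                  · exact hbound t
              _ = _ := by ring
      _ = θ * Real.exp 1 * Real.pi := by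
          rw [integral_const_mul, integral_univ_inv_one_add_sq]; ring
      _ ≤ 9 * θ := by
          have h1 := Real.exp_one_lt_d9
          have h2 := Real.pi_lt_d2
          have : Real.exp 1 * Real.pi ≤ 2.72 * 3.15 := by
            have := Real.pi_pos
            gcongr; linarith
          nlinarith
  have hmark : D.real {x | |x| ≤ θ} ≤ 2 * ∫ x, Real.exp (-(x ^ 2 / (2 * θ ^ 2))) ∂D := by
    have hint : Integrable (fun x : ℝ => Real.exp (-(x ^ 2 / (2 * θ ^ 2)))) D := by
      refine Integrable.mono' (g := fun _ => (1:ℝ)) (integrable_const _)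
        (Measurable.aestronglyMeasurable (by fun_prop)) (ae_of_all _ fun x => ?_)
      rw [Real.norm_eq_abs, abs_of_pos (Real.exp_pos _), Real.exp_le_one_iff]
      exact neg_nonpos.2 (by positivity)
    have h := mul_meas_ge_le_integral_of_nonneg (μ := D)
      (ae_of_all _ fun x : ℝ => (Real.exp_pos (-(x ^ 2 / (2 * θ ^ 2)))).le) hint (1 / 2)
    have hsub : D.real {x | |x| ≤ θ} ≤ D.real {x | 1 / 2 ≤ Real.exp (-(x ^ 2 / (2 * θ ^ 2)))} := by
      refine measureReal_mono ?_
      intro x hx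
      have hx' : |x| ≤ θ := hx
      have h1 : x ^ 2 ≤ θ ^ 2 := by rw [← sq_abs]; gcongr
      have h2 := Real.add_one_le_exp (-(x ^ 2 / (2 * θ ^ 2)))
      have h3 : x ^ 2 / (2 * θ ^ 2) ≤ 1 / 2 := by
        rw [div_le_div_iff₀ (by positivity) (by positivity)]; linarith
      exact mem_ofPred.2 (by linarith)
    linarith
  rw [hreal] at hmark
  linarith

/-- The tail of a law with characteristic function `exp (-|t| ^ p)`. -/
theorem measure_abs_gt_le {p : ℝ} (hp : 1 ≤ p) {D : Measure ℝ} [IsProbabilityMeasure D]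
    (hD : HasStableCharFun p 1 D) {r : ℝ} (hr : 2 ≤ r) : D.real {x | r < |x|} ≤ 4 / r := by
  have hr0 : 0 < r := by linarith
  refine (measureReal_abs_gt_le_integral_charFun hr0).trans ?_
  -- On this interval `|t| ≤ 2 / r ≤ 1`, so `1 - exp (-|t| ^ p) ≤ |t| ^ p ≤ |t| ≤ 2 / r`.
  have h : ‖∫ t in (-2 * r⁻¹)..(2 * r⁻¹), 1 - charFun D t‖ ≤ (2 * r⁻¹) * |2 * r⁻¹ - (-2 * r⁻¹)| := by
    refine intervalIntegral.norm_integral_le_of_norm_le_const fun t ht => ?_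
    have hle : (-2 : ℝ) * r⁻¹ ≤ 2 * r⁻¹ := by
      have : 0 < r⁻¹ := by positivity
      linarith
    rw [uIoc_of_le hle] at ht
    have habs : |t| ≤ 2 * r⁻¹ := abs_le.2 ⟨by linarith [ht.1], ht.2⟩
    have h1 : |t| ≤ 1 := habs.trans (by rw [← div_eq_mul_inv, div_le_one hr0]; exact hr)
    have h2 : |t| ^ p ≤ |t| := by
      rcases eq_or_ne t 0 with h0 | h0
      · rw [h0]; simp [Real.zero_rpow (by linarith : p ≠ 0)]
      · calc |t| ^ p ≤ |t| ^ (1:ℝ) := Real.rpow_le_rpow_of_exponent_ge (abs_pos.2 h0) h1 hp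
          _ = |t| := Real.rpow_one _
    have h3 := Real.add_one_le_exp (-(1 * |t| ^ p))
    have h4 : Real.exp (-(1 * |t| ^ p)) ≤ 1 := by
      rw [Real.exp_le_one_iff]; exact neg_nonpos.2 (by positivity)
    rw [hD, ← Complex.ofReal_one, ← Complex.ofReal_sub, Complex.norm_real, Real.norm_eq_abs,
      abs_of_nonneg (by linarith)]
    linarith
  have e : |2 * r⁻¹ - (-2 * r⁻¹)| = 4 * r⁻¹ := by
    have : 0 < r⁻¹ := by positivity
    rw [abs_of_nonneg (by linarith)]
    ring
  rw [e] at h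
  calc _ ≤ 2⁻¹ * r * (2 * r⁻¹ * (4 * r⁻¹)) := by gcongr
    _ = 4 / r := by field_simp

end StableLaw

namespace LpEmbedding

open MeasureTheory ProbabilityTheory Matrix Timed

/-! ### Independent Bernoulli sampling -/

/-- The estimate of `∑ i, v i` from a sample in which `i` is kept, if `x i < q i`, with probability
`q i`. -/
noncomputable def sampleSum {n : ℕ} (q v x : Fin n → ℝ) : ℝ :=
  ∑ i, (if x i < q i then (q i)⁻¹ else 0) * v i

instance (n : ℕ) : IsProbabilityMeasure (uniformLaw n) := by
  have : IsProbabilityMeasure (volume.restrict (Set.Icc (0 : ℝ) 1)) := ⟨by simp⟩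
  unfold uniformLaw
  infer_instance

theorem integral_uniform_ite {q : ℝ} (hq₀ : 0 ≤ q) (hq₁ : q ≤ 1) (a b : ℝ) :
    ∫ x in Set.Icc (0 : ℝ) 1, (if x < q then a else b) = q * a + (1 - q) * b := by
  have h : (fun x : ℝ => if x < q then a else b) = fun x => b + (Set.Iio q).indicator (fun _ => a - b) x := by
    ext x
    by_cases hx : x < q <;> simp [Set.indicator, hx]
  have hv : volume (Set.Iio q ∩ Set.Icc (0:ℝ) 1) = ENNReal.ofReal q := by
    have : Set.Iio q ∩ Set.Icc (0:ℝ) 1 = Set.Ico 0 q := by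
      ext x
      simp only [Set.mem_inter_iff, Set.mem_Iio, Set.mem_Icc, Set.mem_Ico]
      constructor
      · rintro ⟨h1, h2, -⟩; exact ⟨h2, h1⟩
      · rintro ⟨h1, h2⟩; exact ⟨h2, h1, by linarith⟩
    rw [this, Real.volume_Ico, sub_zero]
  have hfin : IsFiniteMeasure (volume.restrict (Set.Icc (0 : ℝ) 1)) := by infer_instance
  have hv' : (volume.restrict (Set.Icc (0 : ℝ) 1)).real (Set.Iio q) = q := by
    rw [Measure.real, Measure.restrict_apply measurableSet_Iio, hv, ENNReal.toReal_ofReal hq₀]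
  rw [h, integral_add (integrable_const _) ((integrable_const _).indicator measurableSet_Iio),
    integral_indicator measurableSet_Iio, setIntegral_const (s := Set.Iio q), hv']
  simp
  ring

/-- For exponents of modulus at most `1` use `exp x ≤ 1 + x + x²`: the linear terms cancel, since
the estimate is unbiased, and the variance is `(1 - q) v² / q ≤ ρ v`. For `q = 1` the estimate is
exact, so that `v ≤ ρ q` is only needed for `q < 1`. -/
theorem bernoulli_mgf_le {q v ρ t : ℝ} (hq₀ : 0 < q) (hq₁ : q ≤ 1) (hv : 0 ≤ v)
    (hvq : q < 1 → v ≤ ρ * q) (hρ : 0 ≤ ρ) (ht : |t| * ρ ≤ 1) :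
    q * Real.exp (t * (q⁻¹ * v - v)) + (1 - q) * Real.exp (t * (0 * v - v))
      ≤ Real.exp (t ^ 2 * ρ * v) := by
  rcases hq₁.eq_or_lt with rfl | hq
  · simp
    positivity
  have hvρ := hvq hq
  have hA : |t * (q⁻¹ * v - v)| ≤ 1 := by
    have h1 : |q⁻¹ * v - v| ≤ ρ := by
      have h2 : q⁻¹ * v ≤ ρ := by rw [inv_mul_le_iff₀ hq₀]; linarith
      have h3 : v ≤ q⁻¹ * v := le_mul_of_one_le_left hv ((one_le_inv₀ hq₀).2 hq.le)
      rw [abs_of_nonneg (by linarith)]; linarith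
    rw [abs_mul]
    exact le_trans (mul_le_mul_of_nonneg_left h1 (abs_nonneg t)) ht
  have hB : |t * (0 * v - v)| ≤ 1 := by
    have h1 : |0 * v - v| ≤ ρ := by
      rw [zero_mul, zero_sub, abs_neg, abs_of_nonneg hv]
      nlinarith
    rw [abs_mul]
    exact le_trans (mul_le_mul_of_nonneg_left h1 (abs_nonneg t)) ht
  have eA := (abs_le.1 (Real.abs_exp_sub_one_sub_id_le hA)).2
  have eB := (abs_le.1 (Real.abs_exp_sub_one_sub_id_le hB)).2
  have h1 : q * Real.exp (t * (q⁻¹ * v - v)) + (1 - q) * Real.exp (t * (0 * v - v))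
      ≤ q * (1 + t * (q⁻¹ * v - v) + (t * (q⁻¹ * v - v)) ^ 2)
        + (1 - q) * (1 + t * (0 * v - v) + (t * (0 * v - v)) ^ 2) := by
    have : 0 ≤ 1 - q := by linarith
    gcongr <;> linarith
  have h2 : q * (1 + t * (q⁻¹ * v - v) + (t * (q⁻¹ * v - v)) ^ 2)
        + (1 - q) * (1 + t * (0 * v - v) + (t * (0 * v - v)) ^ 2)
      = 1 + t ^ 2 * ((1 - q) * (v * (q⁻¹ * v))) := by
    field_simp
    ring
  have h3 : (1 - q) * (v * (q⁻¹ * v)) ≤ ρ * v := by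
    have h4 : q⁻¹ * v ≤ ρ := by rw [inv_mul_le_iff₀ hq₀]; linarith
    have h5 : 0 ≤ q⁻¹ * v := by positivity
    calc (1 - q) * (v * (q⁻¹ * v)) ≤ 1 * (v * ρ) := by gcongr; linarith
      _ = ρ * v := by ring
  have h6 := Real.add_one_le_exp (t ^ 2 * ρ * v)
  nlinarith [sq_nonneg t]

theorem integrable_uniform_ite (q a b : ℝ) :
    Integrable (fun x : ℝ => if x < q then a else b) (volume.restrict (Set.Icc (0 : ℝ) 1)) := by
  have h : (fun x : ℝ => if x < q then a else b) = fun x => b + (Set.Iio q).indicator (fun _ => a - b) x := by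
    ext x
    by_cases hx : x < q <;> simp [Set.indicator, hx]
  rw [h]
  exact (integrable_const _).add ((integrable_const _).indicator measurableSet_Iio)

theorem sampleSum_mgf_le {n : ℕ} {q v : Fin n → ℝ} {ρ t : ℝ} (hq₀ : ∀ i, 0 < q i)
    (hq₁ : ∀ i, q i ≤ 1) (hv : ∀ i, 0 ≤ v i) (hvq : ∀ i, q i < 1 → v i ≤ ρ * q i) (hρ : 0 ≤ ρ)
    (ht : |t| * ρ ≤ 1) :
    Integrable (fun x => Real.exp (t * (sampleSum q v x - ∑ i, v i))) (uniformLaw n) ∧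
      ∫ x, Real.exp (t * (sampleSum q v x - ∑ i, v i)) ∂(uniformLaw n)
        ≤ Real.exp (t ^ 2 * ρ * ∑ i, v i) := by
  have e : ∀ x : Fin n → ℝ, Real.exp (t * (sampleSum q v x - ∑ i, v i))
      = ∏ i, (if x i < q i then Real.exp (t * ((q i)⁻¹ * v i - v i))
          else Real.exp (t * (0 * v i - v i))) := by
    intro x
    rw [sampleSum, ← Finset.sum_sub_distrib, Finset.mul_sum, Real.exp_sum]
    refine Finset.prod_congr rfl fun i _ => ?_
    split_ifs <;> rfl
  simp only [e]
  refine ⟨?_, ?_⟩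
  · exact Integrable.fintype_prod (f := fun i (y : ℝ) => if y < q i then
      Real.exp (t * ((q i)⁻¹ * v i - v i)) else Real.exp (t * (0 * v i - v i)))
      fun i => integrable_uniform_ite _ _ _
  · unfold uniformLaw
    rw [integral_fintype_prod_eq_prod (f := fun i (y : ℝ) => if y < q i then
      Real.exp (t * ((q i)⁻¹ * v i - v i)) else Real.exp (t * (0 * v i - v i))), Finset.mul_sum,
      Real.exp_sum]
    refine Finset.prod_le_prod (fun i _ => integral_nonneg fun y => ?_) fun i _ => ?_
    · simp only [Pi.zero_apply]
      split_ifs <;> positivity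
    · rw [integral_uniform_ite (hq₀ i).le (hq₁ i)]
      exact bernoulli_mgf_le (hq₀ i) (hq₁ i) (hv i) (hvq i) hρ ht

/-- Chernoff bound for Bernoulli sampling: if all terms that may be lost contribute at most
a fraction `ρ` of the sum, in units of their weight, then the estimate is `(1 ± ε)`-accurate. -/
theorem sampleSum_tail {n : ℕ} {q v : Fin n → ℝ} {ρ ε : ℝ} (hq₀ : ∀ i, 0 < q i)
    (hq₁ : ∀ i, q i ≤ 1) (hv : ∀ i, 0 ≤ v i) (hρ : 0 < ρ) (hε₀ : 0 < ε) (hε₁ : ε ≤ 1)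
    (hvq : ∀ i, q i < 1 → v i ≤ ρ * (∑ j, v j) * q i) :
    (uniformLaw n).real {x | ε * ∑ i, v i < |sampleSum q v x - ∑ i, v i|}
      ≤ 2 * Real.exp (-(ε ^ 2 / (4 * ρ))) := by
  set V := ∑ i, v i with hV
  have hV0 : 0 ≤ V := Finset.sum_nonneg fun i _ => hv i
  rcases hV0.eq_or_lt with h0 | h0
  · have hz : ∀ i, v i = 0 := fun i =>
      (Finset.sum_eq_zero_iff_of_nonneg fun i _ => hv i).1 h0.symm i (Finset.mem_univ i)
    have : {x : Fin n → ℝ | ε * V < |sampleSum q v x - V|} = ∅ := by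
      ext x
      simp [sampleSum, hz, ← h0]
    rw [this]
    simp
    positivity
  have key : ∀ s : ℝ, |s| = 1 → (uniformLaw n).real {x | ε * V ≤ s * (sampleSum q v x - V)}
      ≤ Real.exp (-(ε ^ 2 / (4 * ρ))) := by
    intro s hs
    have hs2 : s ^ 2 = 1 := by rw [← sq_abs, hs]; norm_num
    -- The modulus of `t` minimizes `t² ρ V² - |t| ε V`; the minimum is `-ε² / (4 ρ)`.
    set t := s * (ε / (2 * ρ * V)) with ht
    have hb : 0 < ε / (2 * ρ * V) := by positivity
    obtain ⟨hint, hle⟩ := sampleSum_mgf_le (q := q) (v := v) (ρ := ρ * V) (t := t) hq₀ hq₁ hv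
      hvq (by positivity) (by
        rw [ht, abs_mul, hs, one_mul, abs_of_pos hb]
        field_simp
        linarith)
    rw [← hV] at hint hle
    have hm := mul_meas_ge_le_integral_of_nonneg (μ := uniformLaw n)
      (Filter.Eventually.of_forall fun x => (Real.exp_pos (t * (sampleSum q v x - V))).le) hint
      (Real.exp (ε / (2 * ρ * V) * (ε * V)))
    have hsub : (uniformLaw n).real {x | ε * V ≤ s * (sampleSum q v x - V)} ≤ (uniformLaw n).real
        {x | Real.exp (ε / (2 * ρ * V) * (ε * V)) ≤ Real.exp (t * (sampleSum q v x - V))} := by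
      refine measureReal_mono ?_
      intro x hx
      have hx' : ε * V ≤ s * (sampleSum q v x - V) := hx
      refine Set.mem_ofPred.2 (Real.exp_le_exp.2 ?_)
      calc _ ≤ ε / (2 * ρ * V) * (s * (sampleSum q v x - V)) := by gcongr
        _ = _ := by rw [ht]; ring
    have h1 : Real.exp (ε / (2 * ρ * V) * (ε * V)) * (uniformLaw n).real
        {x | ε * V ≤ s * (sampleSum q v x - V)} ≤ Real.exp (t ^ 2 * (ρ * V) * V) :=
      le_trans (by gcongr) (hm.trans hle)
    have h2 : t ^ 2 * (ρ * V) * V = -(ε ^ 2 / (4 * ρ)) + ε / (2 * ρ * V) * (ε * V) := by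
      rw [ht, mul_pow, hs2]
      field_simp
      ring
    rw [h2, Real.exp_add, mul_comm] at h1
    exact le_of_mul_le_mul_right h1 (Real.exp_pos _)
  have hsub : {x : Fin n → ℝ | ε * V < |sampleSum q v x - V|} ⊆
      {x | ε * V ≤ 1 * (sampleSum q v x - V)} ∪ {x | ε * V ≤ (-1) * (sampleSum q v x - V)} := by
    intro x hx
    have hx' : ε * V < |sampleSum q v x - V| := hx
    rcases lt_abs.1 hx' with h | h
    · exact Or.inl (Set.mem_ofPred.2 (by linarith))
    · exact Or.inr (Set.mem_ofPred.2 (by linarith))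
  calc _ ≤ _ := measureReal_mono hsub
    _ ≤ _ := measureReal_union_le _ _
    _ ≤ Real.exp (-(ε ^ 2 / (4 * ρ))) + Real.exp (-(ε ^ 2 / (4 * ρ))) :=
        add_le_add (key 1 (by simp)) (key (-1) (by simp))
    _ = _ := by ring

/-- The number of sampled elements. -/
theorem sample_card_tail {n : ℕ} {q : Fin n → ℝ} (hq₀ : ∀ i, 0 ≤ q i) (hq₁ : ∀ i, q i ≤ 1)
    {a : ℝ} (ha : 0 < a) :
    (uniformLaw n).real {x | a ≤ ∑ i, if x i < q i then (1 : ℝ) else 0} ≤ (∑ i, q i) / a := by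
  have hev : ∀ i, MeasurePreserving (fun x : Fin n → ℝ => x i) (uniformLaw n)
      (volume.restrict (Set.Icc (0 : ℝ) 1)) := by
    have : IsProbabilityMeasure (volume.restrict (Set.Icc (0 : ℝ) 1)) := ⟨by simp⟩
    intro i
    exact measurePreserving_eval (fun _ : Fin n => volume.restrict (Set.Icc (0 : ℝ) 1)) i
  have hint : ∀ i, Integrable (fun x : Fin n → ℝ => if x i < q i then (1 : ℝ) else 0) (uniformLaw n) :=
    fun i => ((hev i).integrable_comp (integrable_uniform_ite (q i) 1 0).aestronglyMeasurable).2
      (integrable_uniform_ite (q i) 1 0)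
  have hm := mul_meas_ge_le_integral_of_nonneg (μ := uniformLaw n)
      (f := fun x => ∑ i, if x i < q i then (1 : ℝ) else 0)
      (Filter.Eventually.of_forall fun x => Finset.sum_nonneg fun i _ => by split_ifs <;> norm_num)
      (integrable_finsetSum _ fun i _ => hint i) a
  rw [integral_finsetSum _ fun i _ => hint i] at hm
  have h2 : ∀ i, ∫ x, (if x i < q i then (1 : ℝ) else 0) ∂(uniformLaw n) = q i := by
    intro i
    have h3 := (hev i).map_eq
    have h4 := integral_map (μ := uniformLaw n) (hev i).measurable.aemeasurable
      (f := fun y : ℝ => if y < q i then (1 : ℝ) else 0)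
      (by rw [h3]; exact (integrable_uniform_ite (q i) 1 0).aestronglyMeasurable)
    rw [← h4, h3, integral_uniform_ite (hq₀ i) (hq₁ i)]
    ring
  simp only [h2] at hm
  rw [le_div_iff₀ ha]
  linarith

/-! ### Gaussian estimates of row norms -/

instance (d r : ℕ) : IsProbabilityMeasure (gaussianMatrixLaw d r) := by
  unfold gaussianMatrixLaw
  infer_instance

theorem gaussianMatrix_iIndepFun (d r : ℕ) :
    iIndepFun (fun (jk : Fin d × Fin r) (G : Fin d → Fin r → ℝ) => G jk.1 jk.2)
      (gaussianMatrixLaw d r) := by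
  have := iIndepFun_uncurry_infinitePi' (ι := Fin d) (κ := Fin r)
    (X := fun _ _ (x : ℝ) => x) (fun _ _ => gaussianReal 0 1) (fun _ _ => measurable_id)
  simpa only [Measure.infinitePi_eq_pi, gaussianMatrixLaw] using this

theorem gaussianMatrix_map (d r : ℕ) (jk : Fin d × Fin r) :
    (gaussianMatrixLaw d r).map (fun G => G jk.1 jk.2) = gaussianReal 0 1 := by
  have h1 := measurePreserving_eval
    (fun _ : Fin d => Measure.pi fun _ : Fin r => gaussianReal 0 1) jk.1
  have h2 := measurePreserving_eval (fun _ : Fin r => gaussianReal 0 1) jk.2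
  exact (h2.comp h1).map_eq

/-- The columns of `u G` for a row vector `u` and a Gaussian matrix `G` are independent Gaussian
variables of standard deviation `‖u‖`. -/
theorem gaussian_row {d r : ℕ} (u : Fin d → ℝ) :
    iIndepFun (fun (k : Fin r) (G : Fin d → Fin r → ℝ) => ∑ j, u j * G j k) (gaussianMatrixLaw d r) ∧
      ∀ k : Fin r, (gaussianMatrixLaw d r).map (fun G => ∑ j, u j * G j k)
        = (gaussianReal 0 1).map (√(u ⬝ᵥ u) * ·) := by
  have hX : ∀ jk : Fin d × Fin r, Measurable fun G : Fin d → Fin r → ℝ => G jk.1 jk.2 := by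
    intro jk; fun_prop
  let a : Fin r → Fin d × Fin r → ℝ := fun k jk => if jk.2 = k then u jk.1 else 0
  have e : ∀ (k : Fin r) (G : Fin d → Fin r → ℝ), ∑ jk, a k jk * G jk.1 jk.2 = ∑ j, u j * G j k := by
    intro k G
    rw [Fintype.sum_prod_type]
    refine Finset.sum_congr rfl fun j _ => ?_
    simp [a]
  have h1 := StableLaw.iIndepFun_linear two_pos hX (gaussianMatrix_iIndepFun d r)
    (gaussianMatrix_map d r) StableLaw.hasStableCharFun_gaussian a (by
      intro i k k' hk
      by_cases h : i.2 = k
      · right; simp only [a]; rw [if_neg (by rw [h]; exact hk)]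
      · left; simp only [a]; rw [if_neg h])
  simp only [e] at h1
  refine ⟨h1, fun k => ?_⟩
  have h2 := StableLaw.map_linear two_pos hX (gaussianMatrix_iIndepFun d r)
    (gaussianMatrix_map d r) StableLaw.hasStableCharFun_gaussian (a k)
  simp only [e] at h2
  have h3 : ∑ jk, |a k jk| ^ (2 : ℝ) = u ⬝ᵥ u := ?_
  · rw [h2, Real.sqrt_eq_rpow, h3]
  rw [Fintype.sum_prod_type]
  refine Finset.sum_congr rfl fun j _ => ?_
  simp only [a, Real.rpow_two, sq_abs]
  rw [Finset.sum_eq_single k (by intro b _ hb; simp [hb]) (by simp)]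
  simp [sq]

/-- The squared Euclidean norm of `u G`. -/
noncomputable def rowScore {d r : ℕ} (G : Fin d → Fin r → ℝ) (u : Fin d → ℝ) : ℝ :=
  ∑ k, (∑ j, u j * G j k) ^ 2

theorem rowScore_nonneg {d r : ℕ} (G : Fin d → Fin r → ℝ) (u : Fin d → ℝ) : 0 ≤ rowScore G u :=
  Finset.sum_nonneg fun _ _ => sq_nonneg _

theorem measurable_rowScore {d r : ℕ} (u : Fin d → ℝ) :
    Measurable fun G : Fin d → Fin r → ℝ => rowScore G u := by
  unfold rowScore; fun_prop

/-- The integral is `1 / √(1 + 2 * 60) = 1 / 11`, and `e² ≤ 11`. -/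
theorem integral_exp_neg_sq_gaussian :
    ∫ x, Real.exp (-60 * x ^ 2) ∂(gaussianReal 0 1) ≤ Real.exp (-2) := by
  rw [integral_gaussianReal_eq_integral_smul one_ne_zero]
  have e : ∀ x : ℝ, gaussianPDFReal 0 1 x • Real.exp (-60 * x ^ 2)
      = (√(2 * Real.pi))⁻¹ * Real.exp (-(121 / 2) * x ^ 2) := by
    intro x
    rw [gaussianPDFReal, smul_eq_mul, mul_assoc, ← Real.exp_add]
    simp only [NNReal.coe_one, mul_one]
    congr 2
    ring
  simp only [e]
  rw [integral_const_mul, integral_gaussian, ← Real.sqrt_inv, ← Real.sqrt_mul (by positivity)]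
  have h1 : (2 * Real.pi)⁻¹ * (Real.pi / (121 / 2)) = (1 / 11) ^ 2 := by
    have := Real.pi_pos
    field_simp
    norm_num
  rw [h1, Real.sqrt_sq (by norm_num), Real.exp_neg, one_div]
  have h2 : Real.exp 2 ≤ 11 := by
    have h3 : Real.exp 2 = Real.exp 1 * Real.exp 1 := by rw [← Real.exp_add]; norm_num
    have h4 := Real.exp_one_lt_d9
    have h5 := Real.exp_pos 1
    nlinarith
  gcongr

/-- Markov's inequality for `exp (-60 rowScore / ‖u‖²)`: by independence of the columns its mean is
at most `exp (-2 r)`, while it is at least `exp (-r)` on the event. -/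
theorem rowScore_lower_tail {d r : ℕ} (u : Fin d → ℝ) :
    (gaussianMatrixLaw d r).real {G | rowScore G u < 1 / 60 * (r * (u ⬝ᵥ u))} ≤ Real.exp (-r) := by
  have hu : 0 ≤ u ⬝ᵥ u := Finset.sum_nonneg fun i _ => mul_self_nonneg _
  rcases hu.eq_or_lt with h0 | h0
  · have : {G : Fin d → Fin r → ℝ | rowScore G u < 1 / 60 * (r * (u ⬝ᵥ u))} = ∅ := by
      ext G
      simp [← h0, rowScore_nonneg]
    rw [this]
    simp
    positivity
  obtain ⟨hind, hlaw⟩ := gaussian_row (r := r) u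
  set P := gaussianMatrixLaw d r with hP
  let f : ℝ → ℝ := fun y => Real.exp (-60 / (u ⬝ᵥ u) * y ^ 2)
  have hf : Measurable f := by fun_prop
  have hY : ∀ k : Fin r, Measurable fun G : Fin d → Fin r → ℝ => ∑ j, u j * G j k := by
    intro k; fun_prop
  have hind2 : iIndepFun (fun (k : Fin r) (G : Fin d → Fin r → ℝ) => f (∑ j, u j * G j k)) P :=
    hind.comp (fun _ => f) fun _ => hf
  have hone : ∀ k : Fin r, ∫ G, f (∑ j, u j * G j k) ∂P ≤ Real.exp (-2) := by
    intro k
    have h1 : ∫ G, f (∑ j, u j * G j k) ∂P = ∫ y, f y ∂(P.map fun G => ∑ j, u j * G j k) :=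
      (integral_map (hY k).aemeasurable hf.aestronglyMeasurable).symm
    rw [h1, hlaw k, integral_map (by fun_prop) hf.aestronglyMeasurable]
    refine le_trans (le_of_eq ?_) integral_exp_neg_sq_gaussian
    refine integral_congr_ae (Filter.Eventually.of_forall fun x => ?_)
    simp only [f]
    rw [mul_pow, Real.sq_sqrt hu]
    congr 1
    field_simp
  have hprod : ∫ G, ∏ k, f (∑ j, u j * G j k) ∂P ≤ Real.exp (-2) ^ r := by
    rw [hind2.integral_fun_prod_eq_prod_integral fun k => (hf.comp (hY k)).aestronglyMeasurable]
    calc _ ≤ ∏ _k : Fin r, Real.exp (-2) :=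
          Finset.prod_le_prod (fun k _ => integral_nonneg fun G => (Real.exp_pos _).le)
            fun k _ => hone k
      _ = _ := by simp
  have hbd : ∀ G : Fin d → Fin r → ℝ, ∏ k, f (∑ j, u j * G j k)
      = Real.exp (-60 / (u ⬝ᵥ u) * rowScore G u) := by
    intro G
    simp only [f]
    rw [← Real.exp_sum, rowScore, Finset.mul_sum]
  simp only [hbd] at hprod
  have hint : Integrable (fun G => Real.exp (-60 / (u ⬝ᵥ u) * rowScore G u)) P := by
    refine Integrable.mono' (g := fun _ => (1:ℝ)) (integrable_const _)
      (Measurable.aestronglyMeasurable (by have := measurable_rowScore (r := r) u; fun_prop))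
      (Filter.Eventually.of_forall fun G => ?_)
    rw [Real.norm_eq_abs, abs_of_pos (Real.exp_pos _), Real.exp_le_one_iff]
    exact mul_nonpos_of_nonpos_of_nonneg
      (div_nonpos_of_nonpos_of_nonneg (by norm_num) hu) (rowScore_nonneg _ _)
  have hm := mul_meas_ge_le_integral_of_nonneg (μ := P)
    (Filter.Eventually.of_forall fun G => (Real.exp_pos (-60 / (u ⬝ᵥ u) * rowScore G u)).le) hint
    (Real.exp (-r))
  have hsub : P.real {G | rowScore G u < 1 / 60 * (r * (u ⬝ᵥ u))}
      ≤ P.real {G | Real.exp (-r) ≤ Real.exp (-60 / (u ⬝ᵥ u) * rowScore G u)} := by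
    refine measureReal_mono ?_
    intro G hG
    have hG' : rowScore G u < 1 / 60 * (r * (u ⬝ᵥ u)) := hG
    refine Set.mem_ofPred.2 (Real.exp_le_exp.2 ?_)
    rw [neg_div, neg_mul, neg_le_neg_iff, div_mul_eq_mul_div, div_le_iff₀ h0]
    linarith
  have h1 : Real.exp (-r) * P.real {G | rowScore G u < 1 / 60 * (r * (u ⬝ᵥ u))}
      ≤ Real.exp (-r) * Real.exp (-r) := by
    calc _ ≤ _ := mul_le_mul_of_nonneg_left hsub (Real.exp_pos _).le
      _ ≤ Real.exp (-2) ^ r := hm.trans hprod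
      _ = _ := by rw [← Real.exp_nat_mul, ← Real.exp_add]; congr 1; ring
  exact le_of_mul_le_mul_left h1 (Real.exp_pos _)

theorem integral_rowScore {d r : ℕ} (u : Fin d → ℝ) :
    Integrable (fun G => rowScore G u) (gaussianMatrixLaw d r) ∧
      ∫ G, rowScore G u ∂(gaussianMatrixLaw d r) = r * (u ⬝ᵥ u) := by
  have hu : 0 ≤ u ⬝ᵥ u := Finset.sum_nonneg fun i _ => mul_self_nonneg _
  obtain ⟨-, hlaw⟩ := gaussian_row (r := r) u
  set P := gaussianMatrixLaw d r with hP
  have hY : ∀ k : Fin r, Measurable fun G : Fin d → Fin r → ℝ => ∑ j, u j * G j k := by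
    intro k; fun_prop
  have hsq : Integrable (fun x : ℝ => x ^ 2) (gaussianReal 0 1) := by
    have := memLp_id_gaussianReal (μ := 0) (v := 1) 2
    simpa using this.integrable_sq
  have hval : ∫ x, x ^ 2 ∂(gaussianReal 0 1) = 1 := by
    have h1 := variance_fun_id_gaussianReal (μ := 0) (v := 1)
    rw [variance_of_integral_eq_zero (by fun_prop) (by simp)] at h1
    simpa using h1
  have hint : ∀ k : Fin r, Integrable (fun G : Fin d → Fin r → ℝ => (∑ j, u j * G j k) ^ 2) P := by
    intro k
    have h1 : Integrable (fun y : ℝ => y ^ 2) (P.map fun G => ∑ j, u j * G j k) := by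
      rw [hlaw k, integrable_map_measure (by fun_prop) (by fun_prop)]
      refine (hsq.const_mul (u ⬝ᵥ u)).congr (Filter.Eventually.of_forall fun x => ?_)
      simp [mul_pow, Real.sq_sqrt hu]
    exact (integrable_map_measure (f := fun G : Fin d → Fin r → ℝ => ∑ j, u j * G j k)
      (g := fun y : ℝ => y ^ 2) (by fun_prop) (hY k).aemeasurable).1 h1
  refine ⟨integrable_finsetSum _ fun k _ => hint k, ?_⟩
  unfold rowScore
  rw [integral_finsetSum _ fun k _ => hint k]
  have h2 : ∀ k : Fin r, ∫ G, (∑ j, u j * G j k) ^ 2 ∂P = u ⬝ᵥ u := by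
    intro k
    have h1 : ∫ G, (∑ j, u j * G j k) ^ 2 ∂P = ∫ y, y ^ 2 ∂(P.map fun G => ∑ j, u j * G j k) :=
      (integral_map (hY k).aemeasurable (f := fun y : ℝ => y ^ 2) (by fun_prop)).symm
    rw [h1, hlaw k, integral_map (by fun_prop) (by fun_prop)]
    simp only [mul_pow, Real.sq_sqrt hu]
    rw [integral_const_mul, hval, mul_one]
  simp [h2]

/-- In place of Jensen's inequality, `z ^ (p / 2) ≤ 1 + z` is applied to the score divided by its
mean, at the cost of a factor `2`. -/
theorem integral_rowScore_rpow_le {p : ℝ} (hp₀ : 0 < p) (hp₂ : p ≤ 2) {d r : ℕ} (u : Fin d → ℝ) :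
    Integrable (fun G => rowScore G u ^ (p / 2)) (gaussianMatrixLaw d r) ∧
      ∫ G, rowScore G u ^ (p / 2) ∂(gaussianMatrixLaw d r)
        ≤ 2 * (r : ℝ) ^ (p / 2) * (u ⬝ᵥ u) ^ (p / 2) := by
  have hu : 0 ≤ u ⬝ᵥ u := Finset.sum_nonneg fun i _ => mul_self_nonneg _
  obtain ⟨hint, hval⟩ := integral_rowScore (r := r) u
  set a := (r : ℝ) * (u ⬝ᵥ u) with ha
  have ha0 : 0 ≤ a := by positivity
  have hmul : (r : ℝ) ^ (p / 2) * (u ⬝ᵥ u) ^ (p / 2) = a ^ (p / 2) := by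
    rw [ha, Real.mul_rpow (by positivity) hu]
  rw [mul_assoc, hmul]
  have hmeas : Measurable fun G : Fin d → Fin r → ℝ => rowScore G u ^ (p / 2) :=
    (measurable_rowScore u).pow_const _
  have hle1 : ∀ z : ℝ, 0 ≤ z → z ^ (p / 2) ≤ 1 + z := by
    intro z hz
    rcases le_total z 1 with h | h
    · have := Real.rpow_le_one hz h (by positivity : 0 ≤ p / 2)
      linarith
    · have := Real.rpow_le_rpow_of_exponent_le h (by linarith : p / 2 ≤ 1)
      rw [Real.rpow_one] at this
      linarith
  have hint2 : Integrable (fun G => rowScore G u ^ (p / 2)) (gaussianMatrixLaw d r) := by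
    refine Integrable.mono' ((integrable_const 1).add hint) hmeas.aestronglyMeasurable
      (Filter.Eventually.of_forall fun G => ?_)
    rw [Real.norm_eq_abs, abs_of_nonneg (Real.rpow_nonneg (rowScore_nonneg _ _) _)]
    exact hle1 _ (rowScore_nonneg _ _)
  refine ⟨hint2, ?_⟩
  rcases ha0.eq_or_lt with h0 | h0
  · have hz : ∀ᵐ G ∂(gaussianMatrixLaw d r), rowScore G u = 0 := by
      have := (integral_eq_zero_iff_of_nonneg (fun G => rowScore_nonneg G u) hint).1
        (by rw [hval, ← h0])
      exact this
    have : ∫ G, rowScore G u ^ (p / 2) ∂(gaussianMatrixLaw d r) = 0 := by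
      rw [integral_eq_zero_of_ae]
      filter_upwards [hz] with G hG
      rw [hG, Real.zero_rpow (by positivity)]; rfl
    rw [this]; positivity
  · calc ∫ G, rowScore G u ^ (p / 2) ∂(gaussianMatrixLaw d r)
        ≤ ∫ G, (a ^ (p / 2) + a ^ (p / 2) / a * rowScore G u) ∂(gaussianMatrixLaw d r) := by
          refine integral_mono hint2 ((integrable_const _).add (hint.const_mul _)) fun G => ?_
          have h1 := hle1 (rowScore G u / a) (div_nonneg (rowScore_nonneg _ _) ha0)
          rw [Real.div_rpow (rowScore_nonneg _ _) ha0, div_le_iff₀ (by positivity)] at h1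
          refine h1.trans (le_of_eq ?_)
          field_simp
      _ = 2 * a ^ (p / 2) := by
          rw [integral_add (integrable_const _) (hint.const_mul _), integral_const_mul, hval]
          simp
          field_simp
          ring

/-! ### Bases of maximal volume and heavy rows -/

/-- The `p`-th power of the Euclidean norm. -/
noncomputable def eucPow (p : ℝ) {d : ℕ} (u : Fin d → ℝ) : ℝ := (u ⬝ᵥ u) ^ (p / 2)

theorem dotProduct_self_nonneg' {d : ℕ} (u : Fin d → ℝ) : 0 ≤ u ⬝ᵥ u :=
  Finset.sum_nonneg fun _ _ => mul_self_nonneg _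

theorem eucPow_nonneg (p : ℝ) {d : ℕ} (u : Fin d → ℝ) : 0 ≤ eucPow p u :=
  Real.rpow_nonneg (dotProduct_self_nonneg' u) _

theorem sq_rpow_half {p c : ℝ} (hc : 0 ≤ c) : (c ^ 2) ^ (p / 2) = c ^ p := by
  rw [← Real.rpow_natCast, ← Real.rpow_mul hc]; congr 1; push_cast; ring

theorem abs_sq_rpow_half {p c : ℝ} : (c ^ 2) ^ (p / 2) = |c| ^ p := by
  rw [← sq_abs, sq_rpow_half (abs_nonneg c)]

theorem eucPow_smul {p c : ℝ} (hc : 0 ≤ c) {d : ℕ} (u : Fin d → ℝ) :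
    eucPow p (c • u) = c ^ p * eucPow p u := by
  unfold eucPow
  rw [smul_dotProduct, dotProduct_smul, smul_eq_mul, smul_eq_mul, ← mul_assoc, ← sq,
    Real.mul_rpow (sq_nonneg c) (dotProduct_self_nonneg' u), sq_rpow_half hc]

theorem abs_dotProduct_rpow_le {p : ℝ} (hp : 0 ≤ p) {d : ℕ} (u x : Fin d → ℝ) :
    |u ⬝ᵥ x| ^ p ≤ eucPow p u * eucPow p x := by
  unfold eucPow
  rw [← Real.mul_rpow (dotProduct_self_nonneg' u) (dotProduct_self_nonneg' x), ← abs_sq_rpow_half]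
  refine Real.rpow_le_rpow (sq_nonneg _) ?_ (by positivity)
  have := Finset.sum_mul_sq_le_sq_mul_sq Finset.univ u x
  simpa [dotProduct, sq] using this

theorem continuous_eucPow {p : ℝ} (hp : 0 ≤ p) {d : ℕ} {X : Type*} [TopologicalSpace X]
    {f : X → Fin d → ℝ} (hf : Continuous f) : Continuous fun x => eucPow p (f x) := by
  unfold eucPow dotProduct
  refine Continuous.rpow_const ?_ fun _ => Or.inr (by positivity)
  fun_prop

theorem smul_row {n d : ℕ} (A : Matrix (Fin n) (Fin d) ℝ) (B : Matrix (Fin d) (Fin d) ℝ) (c : ℝ)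
    (i : Fin n) : (A * (c • B)) i = c • (A * B) i := by
  rw [Matrix.mul_smul]; rfl

/-- A matrix `B` of maximal determinant under the constraint that the `p`-th powers of the
Euclidean norms of the rows of `A B` add up to at most `d`. -/
structure IsMaxVolume (p : ℝ) {n d : ℕ} (A : Matrix (Fin n) (Fin d) ℝ)
    (B : Matrix (Fin d) (Fin d) ℝ) : Prop where
  det_pos : 0 < B.det
  sum_le : ∑ i, eucPow p ((A * B) i) ≤ d
  max : ∀ B' : Matrix (Fin d) (Fin d) ℝ, ∑ i, eucPow p ((A * B') i) ≤ d → B'.det ≤ B.det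

theorem exists_left_inverse {n d : ℕ} {A : Matrix (Fin n) (Fin d) ℝ}
    (hA : ∀ x, A *ᵥ x = 0 → x = 0) : ∃ L : Matrix (Fin d) (Fin n) ℝ, L * A = 1 := by
  obtain ⟨g, hg⟩ := LinearMap.exists_leftInverse_of_injective A.toLin' (LinearMap.ker_eq_bot'.2 hA)
  refine ⟨LinearMap.toMatrix' g, ?_⟩
  have := congrArg LinearMap.toMatrix' hg
  rwa [LinearMap.toMatrix'_comp, LinearMap.toMatrix'_toLin', LinearMap.toMatrix'_id] at this

/-- Compactness: the feasible matrices are bounded because a left inverse of `A` recovers `B` from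
`A B`, and a small multiple of the identity is feasible, so that the maximum is positive. -/
theorem exists_isMaxVolume {p : ℝ} (hp : 0 < p) {n d : ℕ} (hd : 0 < d)
    {A : Matrix (Fin n) (Fin d) ℝ} (hA : ∀ x, A *ᵥ x = 0 → x = 0) : ∃ B, IsMaxVolume p A B := by
  have hd0 : (0 : ℝ) < d := by exact_mod_cast hd
  let K : Set (Fin d → Fin d → ℝ) := {B | ∑ i, eucPow p ((A * Matrix.of B) i) ≤ d}
  have hclosed : IsClosed K := by
    refine isClosed_le (continuous_finsetSum _ fun i _ => continuous_eucPow hp.le ?_) continuous_const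
    refine continuous_pi fun j => ?_
    simp only [Matrix.mul_apply, Matrix.of_apply]
    fun_prop
  obtain ⟨L, hL⟩ := exists_left_inverse hA
  have hbdd : ∀ B ∈ K, ∀ k j, |B k j| ≤ ∑ k, ∑ i, |L k i| * √((d : ℝ) ^ (2 / p)) := by
    intro B hB k j
    have hB' : ∑ i, eucPow p ((A * Matrix.of B) i) ≤ d := hB
    have hent : ∀ i, |(A * Matrix.of B) i j| ≤ √((d : ℝ) ^ (2 / p)) := by
      intro i
      apply Real.abs_le_sqrt
      have h1 : eucPow p ((A * Matrix.of B) i) ≤ d :=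
        (Finset.single_le_sum (f := fun i => eucPow p ((A * Matrix.of B) i))
          (fun i _ => eucPow_nonneg p _) (Finset.mem_univ i)).trans hB'
      have h2 := Real.rpow_le_rpow (eucPow_nonneg p _) h1 (by positivity : 0 ≤ 2 / p)
      rw [eucPow, ← Real.rpow_mul (dotProduct_self_nonneg' _)] at h2
      have e : p / 2 * (2 / p) = 1 := by field_simp
      rw [e, Real.rpow_one] at h2
      refine le_trans ?_ h2
      have := Finset.single_le_sum (f := fun j => (A * Matrix.of B) i j * (A * Matrix.of B) i j)
        (fun _ _ => mul_self_nonneg _) (Finset.mem_univ j)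
      rw [sq]; exact this
    have hBk : B k j = ∑ i, L k i * (A * Matrix.of B) i j := by
      rw [← Matrix.mul_apply, ← Matrix.mul_assoc, hL, Matrix.one_mul]; rfl
    rw [hBk]
    calc _ ≤ ∑ i, |L k i * (A * Matrix.of B) i j| := Finset.abs_sum_le_sum_abs _ _
      _ ≤ ∑ i, |L k i| * √((d : ℝ) ^ (2 / p)) := by
          refine Finset.sum_le_sum fun i _ => ?_
          rw [abs_mul]
          exact mul_le_mul_of_nonneg_left (hent i) (abs_nonneg _)
      _ ≤ _ := Finset.single_le_sum (f := fun k => ∑ i, |L k i| * √((d : ℝ) ^ (2 / p)))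
          (fun k _ => Finset.sum_nonneg fun i _ => by positivity) (Finset.mem_univ k)
  have hcomp : IsCompact K := by
    refine Metric.isCompact_of_isClosed_isBounded hclosed ?_
    refine (Metric.isBounded_closedBall (x := (0 : Fin d → Fin d → ℝ))
      (r := ∑ k, ∑ i, |L k i| * √((d : ℝ) ^ (2 / p)))).subset ?_
    intro B hB
    have h0 : 0 ≤ ∑ k, ∑ i, |L k i| * √((d : ℝ) ^ (2 / p)) :=
      Finset.sum_nonneg fun k _ => Finset.sum_nonneg fun i _ => by positivity
    rw [mem_closedBall_zero_iff, pi_norm_le_iff_of_nonneg h0]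
    intro k
    rw [pi_norm_le_iff_of_nonneg h0]
    intro j
    rw [Real.norm_eq_abs]
    exact hbdd B hB k j
  set S := ∑ i, eucPow p (A i) with hS
  have hS0 : 0 ≤ S := Finset.sum_nonneg fun i _ => eucPow_nonneg p _
  set c := ((d : ℝ) / (1 + S)) ^ (1 / p) with hc
  have hc0 : 0 < c := Real.rpow_pos_of_pos (by positivity) _
  have hcp : c ^ p = d / (1 + S) := by
    rw [hc, ← Real.rpow_mul (by positivity), one_div_mul_cancel hp.ne', Real.rpow_one]
  have hmem : (c • (1 : Matrix (Fin d) (Fin d) ℝ) : Fin d → Fin d → ℝ) ∈ K := by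
    change ∑ i, eucPow p ((A * (c • (1 : Matrix (Fin d) (Fin d) ℝ))) i) ≤ d
    simp only [smul_row, Matrix.mul_one, eucPow_smul hc0.le, ← Finset.mul_sum]
    rw [← hS, hcp, div_mul_eq_mul_div, div_le_iff₀ (by positivity)]
    nlinarith
  have hdetc : ContinuousOn (fun B : Fin d → Fin d → ℝ => (Matrix.of B).det) K := by
    apply Continuous.continuousOn
    apply Continuous.matrix_det
    exact continuous_id
  obtain ⟨B, hB, hmax⟩ := hcomp.exists_isMaxOn ⟨_, hmem⟩ hdetc
  refine ⟨Matrix.of B, ?_, hB, fun B' hB' => hmax (a := B') hB'⟩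
  have h1 := hmax hmem
  have h2 : (c • (1 : Matrix (Fin d) (Fin d) ℝ)).det ≤ (Matrix.of B).det := h1
  rw [Matrix.det_smul, Matrix.det_one, mul_one] at h2
  exact lt_of_lt_of_le (by positivity) h2

/-- In a basis of maximal volume the Euclidean norm of the coordinates is bounded by the `ℓ_p` norm. -/
theorem IsMaxVolume.eucPow_le {p : ℝ} (hp₁ : 1 ≤ p) (hp₂ : p ≤ 2) {n d : ℕ} (hd : 0 < d)
    {A : Matrix (Fin n) (Fin d) ℝ} {B : Matrix (Fin d) (Fin d) ℝ} (hB : IsMaxVolume p A B)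
    (x : Fin d → ℝ) : eucPow p x ≤ 8 * ∑ i, |(A * B) i ⬝ᵥ x| ^ p := by
  have hd0 : (0 : ℝ) < d := by exact_mod_cast hd
  have hp0 : 0 < p := by linarith
  have key : ∀ e : Fin d → ℝ, e ⬝ᵥ e = 1 → 1 ≤ 8 * ∑ i, |(A * B) i ⬝ᵥ e| ^ p := by
    intro e he
    set S := ∑ i, |(A * B) i ⬝ᵥ e| ^ p with hS
    have hS0 : 0 ≤ S := Finset.sum_nonneg fun i _ => by positivity
    set t := Real.exp 1 - 1 with ht
    have ht0 : 0 ≤ t := by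
      have := Real.add_one_le_exp (1 : ℝ)
      linarith
    -- Stretching the direction `e` by Euler's number multiplies the determinant by it and increases
    -- the constraint by at most `exp p * S`. If `S` were small, rescaling to feasibility would cost
    -- less than is gained, against maximality.
    set B₁ := B * (1 + t • vecMulVec e e) with hB₁
    have hrow : ∀ i, (A * B₁) i = (A * B) i + (t * ((A * B) i ⬝ᵥ e)) • e := by
      intro i
      ext j
      rw [hB₁, ← Matrix.mul_assoc, Matrix.mul_add, Matrix.mul_one, Matrix.mul_smul,
        Matrix.mul_vecMulVec]
      simp only [Matrix.add_apply, Matrix.smul_apply, vecMulVec_apply, smul_eq_mul, Pi.add_apply,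
        Pi.smul_apply, Matrix.mulVec]
      ring
    have hpow : ∀ i, eucPow p ((A * B₁) i) ≤ eucPow p ((A * B) i)
        + Real.exp p * |(A * B) i ⬝ᵥ e| ^ p := by
      intro i
      set b := (A * B) i ⬝ᵥ e with hb
      have h1 : (A * B₁) i ⬝ᵥ (A * B₁) i ≤ (A * B) i ⬝ᵥ (A * B) i + (Real.exp 1 * b) ^ 2 := by
        rw [hrow]
        simp only [dotProduct_add, add_dotProduct, dotProduct_smul, smul_dotProduct, he,
          smul_eq_mul, dotProduct_comm e, ← hb]
        have : Real.exp 1 = t + 1 := by rw [ht]; ring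
        rw [this]
        nlinarith [sq_nonneg b]
      calc eucPow p ((A * B₁) i)
          ≤ ((A * B) i ⬝ᵥ (A * B) i + (Real.exp 1 * b) ^ 2) ^ (p / 2) :=
            Real.rpow_le_rpow (dotProduct_self_nonneg' _) h1 (by positivity)
        _ ≤ ((A * B) i ⬝ᵥ (A * B) i) ^ (p / 2) + ((Real.exp 1 * b) ^ 2) ^ (p / 2) :=
            Real.rpow_add_le_add_rpow (dotProduct_self_nonneg' _) (sq_nonneg _)
              (by positivity) (by linarith)
        _ = _ := by
            rw [abs_sq_rpow_half, abs_mul, Real.mul_rpow (abs_nonneg _) (abs_nonneg _),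
              abs_of_pos (Real.exp_pos 1), ← Real.exp_mul, one_mul]
            rfl
    have hsum : ∑ i, eucPow p ((A * B₁) i) ≤ d + Real.exp p * S := by
      calc _ ≤ ∑ i, (eucPow p ((A * B) i) + Real.exp p * |(A * B) i ⬝ᵥ e| ^ p) :=
            Finset.sum_le_sum fun i _ => hpow i
        _ = ∑ i, eucPow p ((A * B) i) + Real.exp p * S := by
            rw [Finset.sum_add_distrib, ← Finset.mul_sum]
        _ ≤ _ := by
            have := hB.sum_le
            linarith
    set g := (d : ℝ) / (d + Real.exp p * S) with hg
    have hden : 0 < d + Real.exp p * S := by positivity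
    have hg0 : 0 < g := by positivity
    set c := g ^ (1 / p) with hc
    have hc0 : 0 < c := Real.rpow_pos_of_pos hg0 _
    have hcp : c ^ p = g := by
      rw [hc, ← Real.rpow_mul hg0.le, one_div_mul_cancel hp0.ne', Real.rpow_one]
    have hfeas := hB.max (c • B₁) (by
      simp only [smul_row, eucPow_smul hc0.le, ← Finset.mul_sum]
      rw [hcp, hg, div_mul_eq_mul_div, div_le_iff₀ hden]
      gcongr)
    have hdet : B₁.det = B.det * Real.exp 1 := by
      rw [hB₁, Matrix.det_mul]
      congr 1
      have : (t • vecMulVec e e) = replicateCol Unit (t • e) * replicateRow Unit e := by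
        ext i j
        simp [Matrix.mul_apply, vecMulVec_apply]
        ring
      rw [this, Matrix.det_one_add_replicateCol_mul_replicateRow, dotProduct_smul, he, ht]
      simp
    rw [Matrix.det_smul, hdet, Fintype.card_fin] at hfeas
    have h1 : c ^ d * Real.exp 1 ≤ 1 := by
      have := hB.det_pos
      nlinarith
    -- The rescaling costs `c ^ d = g ^ (d / p)` in the determinant, where `1 / g = 1 + exp p * S /
    -- d ≤ exp (exp p * S / d)`.
    have h2 : Real.exp (-(Real.exp p * S / p)) ≤ c ^ d := by
      have h3 : Real.exp (-(Real.exp p * S / d)) ≤ g := by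
        rw [Real.exp_neg, hg, inv_le_comm₀ (Real.exp_pos _) (by positivity), inv_div]
        have := Real.add_one_le_exp (Real.exp p * S / d)
        refine le_trans (le_of_eq ?_) this
        field_simp
        ring
      have h4 : Real.exp (-(Real.exp p * S / d)) ^ ((1 / p) * d) ≤ g ^ ((1 / p) * d) :=
        Real.rpow_le_rpow (Real.exp_pos _).le h3 (by positivity)
      rw [← Real.exp_mul, Real.rpow_mul hg0.le, ← hc, Real.rpow_natCast] at h4
      refine le_trans (le_of_eq ?_) h4
      congr 1
      field_simp
    have h5 : Real.exp (-(Real.exp p * S / p) + 1) ≤ 1 := by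
      rw [Real.exp_add]
      exact le_trans (by gcongr) h1
    rw [Real.exp_le_one_iff] at h5
    have h6 : p ≤ Real.exp p * S := by
      have : 1 ≤ Real.exp p * S / p := by linarith
      rwa [le_div_iff₀ hp0, one_mul] at this
    have h7 : Real.exp p ≤ 8 := by
      have h8 : Real.exp p ≤ Real.exp 2 := Real.exp_le_exp.2 hp₂
      have h3 : Real.exp 2 = Real.exp 1 * Real.exp 1 := by rw [← Real.exp_add]; norm_num
      have h4 := Real.exp_one_lt_d9
      have h5 := Real.exp_pos 1
      nlinarith
    nlinarith
  rcases (dotProduct_self_nonneg' x).eq_or_lt with h0 | h0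
  · have : eucPow p x = 0 := by
      rw [eucPow, ← h0, Real.zero_rpow (by positivity)]
    rw [this]
    exact mul_nonneg (by norm_num) (Finset.sum_nonneg fun i _ => by positivity)
  · set s := √(x ⬝ᵥ x) with hs
    have hs0 : 0 < s := Real.sqrt_pos.2 h0
    have hss : s * s = x ⬝ᵥ x := Real.mul_self_sqrt h0.le
    have hx : x = s • (s⁻¹ • x) := by rw [smul_smul, mul_inv_cancel₀ hs0.ne', one_smul]
    have h1 := key (s⁻¹ • x) (by
      rw [dotProduct_smul, smul_dotProduct, ← hss, smul_eq_mul, smul_eq_mul]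
      field_simp)
    have hex : eucPow p x = s ^ p := by
      rw [eucPow, ← hss, ← sq, sq_rpow_half hs0.le]
    have h2 : ∀ i, |(A * B) i ⬝ᵥ (s⁻¹ • x)| ^ p = (s ^ p)⁻¹ * |(A * B) i ⬝ᵥ x| ^ p := by
      intro i
      rw [dotProduct_smul, smul_eq_mul, abs_mul, Real.mul_rpow (abs_nonneg _) (abs_nonneg _),
        abs_of_pos (inv_pos.2 hs0), Real.inv_rpow hs0.le]
    simp only [h2, ← Finset.mul_sum] at h1
    have h3 : 0 < s ^ p := Real.rpow_pos_of_pos hs0 _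
    rw [hex]
    rw [mul_left_comm, le_inv_mul_iff₀ h3] at h1
    linarith

/-- The weight of row `i`: `γ` on `H`, and `1` elsewhere. -/
noncomputable def heavyWeight {n : ℕ} (γ : ℝ) (H : Finset (Fin n)) (i : Fin n) : ℝ :=
  if i ∈ H then γ else 1

/-- A basis of the column space of `A` together with a small set `H` of heavy rows: after the weight of
the heavy rows has been reduced, all other rows have small norm. -/
structure IsHeavyBasis (p γ τ : ℝ) {n d : ℕ} (A : Matrix (Fin n) (Fin d) ℝ) (H : Finset (Fin n))
    (B : Matrix (Fin d) (Fin d) ℝ) : Prop where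
  det_pos : 0 < B.det
  sum_le : ∑ i, heavyWeight γ H i ^ p * eucPow p ((A * B) i) ≤ d
  eucPow_le : ∀ x, eucPow p x ≤ 8 * ∑ i, heavyWeight γ H i ^ p * |(A * B) i ⬝ᵥ x| ^ p
  light : ∀ i, i ∉ H → eucPow p ((A * B) i) ≤ τ
  card_le : H.card * (τ / 4) ≤ d * Real.log (1 / γ)

/-- For each `H`, take a basis `B H` of maximal volume for the reweighted matrix, and choose `H` to
maximize `det (B H) * exp (-|H| τ / 4)`. Reducing the weight of a further row increases the volume,
and the exponential charges for it: only rows with norm above the threshold are worth the price, and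
the total gain in volume is limited by `γ ^ (-d)`. -/
theorem exists_isHeavyBasis {p : ℝ} (hp₁ : 1 ≤ p) (hp₂ : p ≤ 2) {n d : ℕ} (hd : 0 < d)
    {A : Matrix (Fin n) (Fin d) ℝ} (hA : ∀ x, A *ᵥ x = 0 → x = 0) {γ τ : ℝ} (hγ₀ : 0 < γ)
    (hγ₁ : γ ≤ 1 / 2) (hτ : 0 < τ) : ∃ H B, IsHeavyBasis p γ τ A H B := by
  have hd0 : (0 : ℝ) < d := by exact_mod_cast hd
  have hp0 : 0 < p := by linarith
  have hw : ∀ H (i : Fin n), 0 < heavyWeight γ H i := by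
    intro H i; unfold heavyWeight; split_ifs <;> linarith
  let W : Finset (Fin n) → Matrix (Fin n) (Fin d) ℝ := fun H =>
    Matrix.of fun i j => heavyWeight γ H i * A i j
  have hWv : ∀ H x i, (W H *ᵥ x) i = heavyWeight γ H i * (A *ᵥ x) i := by
    intro H x i
    simp only [W, Matrix.mulVec, dotProduct, Finset.mul_sum, Matrix.of_apply]
    exact Finset.sum_congr rfl fun j _ => by ring
  have hWA : ∀ H x, W H *ᵥ x = 0 → x = 0 := by
    intro H x hx
    refine hA x ?_
    ext i
    have := congrFun hx i
    rw [hWv] at this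
    exact (mul_eq_zero.1 this).resolve_left (hw H i).ne'
  have hWrow : ∀ H (B : Matrix (Fin d) (Fin d) ℝ) i,
      (W H * B) i = heavyWeight γ H i • (A * B) i := by
    intro H B i
    ext j
    simp only [W, Matrix.mul_apply, Pi.smul_apply, smul_eq_mul, Finset.mul_sum, Matrix.of_apply]
    exact Finset.sum_congr rfl fun j _ => by ring
  have hWe : ∀ H (B : Matrix (Fin d) (Fin d) ℝ) i,
      eucPow p ((W H * B) i) = heavyWeight γ H i ^ p * eucPow p ((A * B) i) := by
    intro H B i
    rw [hWrow, eucPow_smul (hw H i).le]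
  choose B hB using fun H => exists_isMaxVolume hp0 hd (hWA H)
  obtain ⟨H, -, hH⟩ := Finset.exists_max_image (Finset.univ : Finset (Finset (Fin n)))
    (fun H => (B H).det * Real.exp (-(H.card * (τ / 4)))) ⟨∅, Finset.mem_univ _⟩
  have hsum := (hB H).sum_le
  simp only [hWe] at hsum
  refine ⟨H, B H, (hB H).det_pos, hsum, ?_, ?_, ?_⟩
  · intro x
    have := (hB H).eucPow_le hp₁ hp₂ hd x
    refine this.trans (le_of_eq ?_)
    congr 1
    refine Finset.sum_congr rfl fun i _ => ?_
    rw [hWrow, smul_dotProduct, smul_eq_mul, abs_mul,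
      Real.mul_rpow (abs_nonneg _) (abs_nonneg _), abs_of_pos (hw H i)]
  · intro i hi
    by_contra hcon
    have hbig := not_le.1 hcon
    -- If the light row `i` were too big, adding it to `H` would free at least `τ / 2` of the
    -- constraint, since `γ ^ p ≤ 1 / 2`.
    set H' := insert i H with hH'
    have hsum' : ∑ k, heavyWeight γ H' k ^ p * eucPow p ((A * B H) k) ≤ d - τ / 2 := by
      have h1 : ∀ k, k ≠ i → heavyWeight γ H' k = heavyWeight γ H k := by
        intro k hk; simp [heavyWeight, hH', hk]
      rw [← Finset.add_sum_erase _ _ (Finset.mem_univ i)] at hsum ⊢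
      have h2 : ∑ k ∈ Finset.univ.erase i, heavyWeight γ H' k ^ p * eucPow p ((A * B H) k)
          = ∑ k ∈ Finset.univ.erase i, heavyWeight γ H k ^ p * eucPow p ((A * B H) k) :=
        Finset.sum_congr rfl fun k hk => by rw [h1 k (Finset.ne_of_mem_erase hk)]
      rw [h2]
      have h3 : heavyWeight γ H i = 1 := by simp [heavyWeight, hi]
      have h4 : heavyWeight γ H' i = γ := by simp [heavyWeight, hH']
      have h5 : γ ^ p ≤ 1 / 2 := by
        have := Real.rpow_le_rpow_of_exponent_ge hγ₀ (by linarith) hp₁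
        rw [Real.rpow_one] at this
        linarith
      rw [h3, Real.one_rpow, one_mul] at hsum
      rw [h4]
      nlinarith
    have hτd : τ < d := by
      refine lt_of_lt_of_le hbig (le_trans ?_ hsum)
      have := Finset.single_le_sum
        (f := fun k => heavyWeight γ H k ^ p * eucPow p ((A * B H) k))
        (fun k _ => mul_nonneg (Real.rpow_nonneg (hw H k).le _) (eucPow_nonneg p _))
        (Finset.mem_univ i)
      simpa [heavyWeight, hi] using this
    set g := (d : ℝ) / (d - τ / 2) with hg
    have hden : 0 < d - τ / 2 := by linarith
    have hg0 : 0 < g := by positivity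
    set c := g ^ (1 / p) with hc
    have hc0 : 0 < c := Real.rpow_pos_of_pos hg0 _
    have hcp : c ^ p = g := by
      rw [hc, ← Real.rpow_mul hg0.le, one_div_mul_cancel hp0.ne', Real.rpow_one]
    have hfeas := (hB H').max (c • B H) (by
      simp only [smul_row, eucPow_smul hc0.le, ← Finset.mul_sum, hWe]
      rw [hcp, hg, div_mul_eq_mul_div, div_le_iff₀ hden]
      gcongr)
    have hopt := hH H' (Finset.mem_univ _)
    rw [Matrix.det_smul, Fintype.card_fin] at hfeas
    have hcard : (H'.card : ℝ) = H.card + 1 := by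
      rw [hH', Finset.card_insert_of_notMem hi]; push_cast; ring
    have h1 : c ^ d * (B H).det * Real.exp (-((H.card + 1) * (τ / 4)))
        ≤ (B H).det * Real.exp (-(H.card * (τ / 4))) := by
      refine le_trans ?_ hopt
      rw [hcard]
      gcongr
    have h2 : c ^ d ≤ Real.exp (τ / 4) := by
      have e : Real.exp (-(H.card * (τ / 4)))
          = Real.exp (-((H.card + 1) * (τ / 4))) * Real.exp (τ / 4) := by
        rw [← Real.exp_add]; congr 1; ring
      rw [e] at h1
      have hpos : 0 < (B H).det * Real.exp (-((H.card + 1) * (τ / 4))) :=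
        mul_pos (hB H).det_pos (Real.exp_pos _)
      refine le_of_mul_le_mul_left ?_ hpos
      linarith
    -- The freed part allows scaling by `c = g ^ (1 / p)`, which gains more than `exp (τ / (2 p)) ≥
    -- exp (τ / 4)` in the determinant. This exceeds the price of one more heavy row.
    have h3 : Real.exp (τ / (2 * d)) < g := by
      have h4 : 1 - τ / (2 * d) < Real.exp (-(τ / (2 * d))) := by
        have := Real.add_one_lt_exp (x := -(τ / (2 * d)))
          (neg_ne_zero.2 (by positivity))
        linarith
      rw [Real.exp_neg, lt_inv_comm₀ (by
        rw [sub_pos, div_lt_one (by positivity)]; linarith) (Real.exp_pos _)] at h4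
      refine lt_of_lt_of_eq h4 ?_
      rw [hg]
      field_simp
    have h4 : Real.exp (τ / (2 * d)) ^ ((1 / p) * d) < g ^ ((1 / p) * d) :=
      Real.rpow_lt_rpow (Real.exp_pos _).le h3 (by positivity)
    rw [← Real.exp_mul, Real.rpow_mul hg0.le, ← hc, Real.rpow_natCast] at h4
    have h5 : Real.exp (τ / 4) ≤ Real.exp (τ / (2 * d) * (1 / p * d)) := by
      apply Real.exp_le_exp.2
      have : τ / (2 * d) * (1 / p * d) = τ / (2 * p) := by field_simp
      rw [this, div_le_div_iff₀ (by norm_num) (by positivity)]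
      nlinarith
    linarith
  -- Scaled by `γ`, the basis for `H` is feasible without any reweighting, so comparison with the
  -- empty set bounds the number of heavy rows.
  · have hfeas := (hB ∅).max (γ • B H) (by
      simp only [smul_row, eucPow_smul hγ₀.le, hWe]
      refine le_trans (Finset.sum_le_sum fun i _ => ?_) hsum
      have h1 : heavyWeight γ ∅ i = 1 := by simp [heavyWeight]
      rw [h1, Real.one_rpow, one_mul]
      have h2 : γ ^ p ≤ heavyWeight γ H i ^ p := by
        refine Real.rpow_le_rpow hγ₀.le ?_ hp0.le
        unfold heavyWeight; split_ifs <;> linarith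
      exact mul_le_mul_of_nonneg_right h2 (eucPow_nonneg p _))
    rw [Matrix.det_smul, Fintype.card_fin] at hfeas
    have hopt := hH ∅ (Finset.mem_univ _)
    simp only [Finset.card_empty, Nat.cast_zero, zero_mul, neg_zero, Real.exp_zero, mul_one] at hopt
    have h1 : γ ^ d ≤ Real.exp (-(H.card * (τ / 4))) := by
      have := (hB H).det_pos
      refine le_of_mul_le_mul_right ?_ this
      linarith
    have h2 := Real.log_le_log (by positivity) h1
    rw [Real.log_exp, Real.log_pow] at h2
    rw [one_div, Real.log_inv]
    linarith

/-! ### Nets and product measures -/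

/-- A finite net of a subset of a cube, with respect to the maximum norm. -/
theorem exists_net {d : ℕ} (Q : Set (Fin d → ℝ)) {R m : ℝ} (hm : 0 < m) (hmR : m ≤ R)
    (hQ : ∀ x ∈ Q, ∀ j, |x j| ≤ R) :
    ∃ F : Finset (Fin d → ℝ), (∀ x ∈ F, x ∈ Q) ∧ (F.card : ℝ) ≤ (5 * R / m) ^ d ∧
      ∀ x ∈ Q, ∃ x' ∈ F, ∀ j, |x j - x' j| ≤ m := by
  classical
  set K := ⌈R / m⌉ with hK
  let φ : (Fin d → ℝ) → Fin d → ℤ := fun x j => ⌊x j / m⌋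
  -- Only grid cells that meet `Q` are kept, and a point of `Q` is chosen in each, so that the net
  -- consists of points of `Q`.
  let J : Finset (Fin d → ℤ) := (Fintype.piFinset fun _ => Finset.Icc (-K) K).filter
    fun z => ∃ x ∈ Q, φ x = z
  have hmem : ∀ x ∈ Q, φ x ∈ J := by
    intro x hx
    refine Finset.mem_filter.2 ⟨Fintype.mem_piFinset.2 fun j => Finset.mem_Icc.2 ⟨?_, ?_⟩, x, hx, rfl⟩
    · rw [Int.le_floor]
      have h1 := (abs_le.1 (hQ x hx j)).1
      have h2 : R / m ≤ K := Int.le_ceil _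
      push_cast
      rw [le_div_iff₀ hm]
      rw [div_le_iff₀ hm] at h2
      linarith
    · have h1 := (abs_le.1 (hQ x hx j)).2
      have h2 : x j / m ≤ R / m := by gcongr
      have : ⌊x j / m⌋ ≤ ⌈x j / m⌉ := Int.floor_le_ceil _
      exact this.trans (Int.ceil_mono h2)
  have hrep : ∀ z ∈ J, ∃ x ∈ Q, φ x = z := fun z hz => (Finset.mem_filter.1 hz).2
  let rep : (Fin d → ℤ) → Fin d → ℝ := fun z => if hz : z ∈ J then (hrep z hz).choose else 0
  have hrep1 : ∀ z (hz : z ∈ J), rep z ∈ Q ∧ φ (rep z) = z := by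
    intro z hz
    simp only [rep, dif_pos hz]
    exact (hrep z hz).choose_spec
  refine ⟨J.image rep, ?_, ?_, ?_⟩
  · intro x hx
    obtain ⟨z, hz, rfl⟩ := Finset.mem_image.1 hx
    exact (hrep1 z hz).1
  · have h1 : (J.image rep).card ≤ (2 * K + 1).toNat ^ d := by
      refine Finset.card_image_le.trans ((Finset.card_filter_le _ _).trans ?_)
      rw [Fintype.card_piFinset]
      simp only [Int.card_Icc, Finset.prod_const, Finset.card_univ, Fintype.card_fin]
      apply le_of_eq
      congr 2
      ring
    have hK0 : 0 ≤ K := Int.ceil_nonneg (div_nonneg (by linarith) hm.le)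
    have h2 : (((2 * K + 1).toNat : ℕ) : ℝ) ≤ 5 * R / m := by
      have h3 : (((2 * K + 1).toNat : ℕ) : ℝ) = 2 * K + 1 := by
        have := Int.toNat_of_nonneg (by omega : 0 ≤ 2 * K + 1)
        exact_mod_cast this
      rw [h3]
      have h4 : (K : ℝ) < R / m + 1 := Int.ceil_lt_add_one _
      have h5 : 1 ≤ R / m := by rwa [le_div_iff₀ hm, one_mul]
      rw [mul_div_assoc]
      linarith
    calc ((J.image rep).card : ℝ) ≤ (((2 * K + 1).toNat ^ d : ℕ) : ℝ) := by exact_mod_cast h1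
      _ = (((2 * K + 1).toNat : ℕ) : ℝ) ^ d := by push_cast; ring
      _ ≤ _ := by gcongr
  · intro x hx
    refine ⟨rep (φ x), Finset.mem_image_of_mem _ (hmem x hx), fun j => ?_⟩
    have h1 := congrFun (hrep1 _ (hmem x hx)).2 j
    have h2 := Int.abs_sub_lt_one_of_floor_eq_floor h1
    rw [← sub_div, abs_div, abs_of_pos hm, div_lt_one hm, abs_sub_comm] at h2
    exact h2.le

/-- The set need not be measurable: every section is replaced by its measurable hull, and finiteness
of the first factor keeps the union measurable. -/
theorem measureReal_prod_le_of_finite {α β : Type*} [Finite α] [MeasurableSpace α]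
    [MeasurableSingletonClass α] [MeasurableSpace β] (μ : Measure α) [IsProbabilityMeasure μ]
    (ν : Measure β) [IsProbabilityMeasure ν] (S : Set (α × β)) {ε : ℝ} (hε : 0 ≤ ε)
    (h : ∀ a, ν.real {b | (a, b) ∈ S} ≤ ε) : (μ.prod ν).real S ≤ ε := by
  let T : Set (α × β) := ⋃ a, {a} ×ˢ toMeasurable ν {b | (a, b) ∈ S}
  have hT : MeasurableSet T := MeasurableSet.iUnion fun a =>
    (measurableSet_singleton a).prod (measurableSet_toMeasurable _ _)
  have hST : S ⊆ T := by
    rintro ⟨a, b⟩ hab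
    exact Set.mem_iUnion.2 ⟨a, rfl, subset_toMeasurable ν _ hab⟩
  have hsec : ∀ a, ν (Prod.mk a ⁻¹' T) ≤ ENNReal.ofReal ε := by
    intro a
    have : Prod.mk a ⁻¹' T = toMeasurable ν {b | (a, b) ∈ S} := by
      ext b
      simp [T]
    rw [this, measure_toMeasurable, ENNReal.le_ofReal_iff_toReal_le (measure_ne_top _ _) hε]
    exact h a
  refine (measureReal_mono hST).trans ?_
  rw [measureReal_def, ← ENNReal.le_ofReal_iff_toReal_le (measure_ne_top _ _) hε,
    Measure.prod_apply hT]
  calc _ ≤ ∫⁻ _a, ENNReal.ofReal ε ∂μ := lintegral_mono hsec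
    _ = _ := by simp

theorem measureReal_iUnion_finset_le {α ι : Type*} [MeasurableSpace α] {μ : Measure α}
    [IsFiniteMeasure μ] (F : Finset ι) (S : ι → Set α) {ε : ℝ} (h : ∀ i ∈ F, μ.real (S i) ≤ ε) :
    μ.real {a | ∃ i ∈ F, a ∈ S i} ≤ F.card * ε := by
  have : {a | ∃ i ∈ F, a ∈ S i} = ⋃ i ∈ F, S i := by ext; simp
  rw [this]
  calc _ ≤ ∑ i ∈ F, μ.real (S i) := measureReal_biUnion_finset_le _ _
    _ ≤ ∑ _i ∈ F, ε := Finset.sum_le_sum h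
    _ = _ := by simp

/-! ### Random hashing -/

/-- The law of a random function to `Fin s`. -/
noncomputable def hashLaw (n s : ℕ) : Measure (Fin n → Fin s) :=
  Measure.pi fun _ => uniformOn (Set.univ : Set (Fin s))

instance (n s : ℕ) [NeZero s] : IsProbabilityMeasure (hashLaw n s) := by
  have : IsProbabilityMeasure (uniformOn (Set.univ : Set (Fin s))) :=
    isProbabilityMeasure_uniformOn Set.finite_univ Set.univ_nonempty
  unfold hashLaw
  infer_instance

theorem hashLaw_collision {n s : ℕ} [NeZero s] {i j : Fin n} (hij : i ≠ j) :
    (hashLaw n s).real {h | h i = h j} = 1 / s := by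
  have : IsProbabilityMeasure (uniformOn (Set.univ : Set (Fin s))) :=
    isProbabilityMeasure_uniformOn Set.finite_univ Set.univ_nonempty
  have h1 := Measure.infinitePi_map_eval_prod
    (P := fun _ : Fin n => uniformOn (Set.univ : Set (Fin s))) hij
  rw [Measure.infinitePi_eq_pi] at h1
  have hD : MeasurableSet {z : Fin s × Fin s | z.1 = z.2} := Set.Finite.measurableSet (Set.toFinite _)
  have h2 : (hashLaw n s) {h | h i = h j} = ((hashLaw n s).map fun h => (h i, h j)) {z | z.1 = z.2} := by
    rw [Measure.map_apply (by fun_prop) hD]; rfl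
  have h3 : ∀ k : Fin s, uniformOn (Set.univ : Set (Fin s)) {k} = (s : ENNReal)⁻¹ := by
    intro k
    rw [uniformOn_univ]
    simp
  have hs : (s : ENNReal) ≠ 0 := by exact_mod_cast NeZero.ne s
  rw [measureReal_def, h2, hashLaw, h1, Measure.prod_apply hD]
  have h4 : ∀ k : Fin s, Prod.mk k ⁻¹' {z : Fin s × Fin s | z.1 = z.2} = {k} := by
    intro k; ext l; simp [eq_comm]
  simp only [h4, h3]
  simp

/-- Markov's inequality; each pair of distinct indices collides with probability `1 / s`. -/
theorem hashLaw_sum_tail {n s : ℕ} [NeZero s] (c : Fin n → Fin n → ℝ) (hc : ∀ i j, 0 ≤ c i j)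
    {a : ℝ} (ha : 0 < a) :
    (hashLaw n s).real {h | a ≤ ∑ i, ∑ j, if i ≠ j ∧ h i = h j then c i j else 0}
      ≤ (∑ i, ∑ j, c i j) / (s * a) := by
  have hs : (0 : ℝ) < s := by exact_mod_cast Nat.pos_of_ne_zero (NeZero.ne s)
  have hint : ∀ f : (Fin n → Fin s) → ℝ, Integrable f (hashLaw n s) := fun f => Integrable.of_finite
  have hm := mul_meas_ge_le_integral_of_nonneg (μ := hashLaw n s)
    (f := fun h => ∑ i, ∑ j, if i ≠ j ∧ h i = h j then c i j else 0)
    (Filter.Eventually.of_forall fun h => Finset.sum_nonneg fun i _ => Finset.sum_nonneg fun j _ => by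
      split_ifs
      · exact hc i j
      · exact le_rfl) (hint _) a
  have h1 : ∫ h, (∑ i, ∑ j, if i ≠ j ∧ h i = h j then c i j else 0) ∂(hashLaw n s)
      ≤ (∑ i, ∑ j, c i j) / s := by
    rw [integral_finsetSum _ fun i _ => hint _, Finset.sum_div]
    refine Finset.sum_le_sum fun i _ => ?_
    rw [integral_finsetSum _ fun i _ => hint _, Finset.sum_div]
    refine Finset.sum_le_sum fun j _ => ?_
    by_cases hij : i = j
    · simp [hij]
      have := hc j j
      positivity
    · have e : (fun h : Fin n → Fin s => if i ≠ j ∧ h i = h j then c i j else 0)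
          = {h : Fin n → Fin s | h i = h j}.indicator fun _ => c i j := by
        ext h
        by_cases hh : h i = h j <;> simp [hij, hh]
      rw [e, integral_indicator (Set.Finite.measurableSet (Set.toFinite _)), setIntegral_const,
        hashLaw_collision hij, smul_eq_mul]
      apply le_of_eq
      ring
  rw [le_div_iff₀ (by positivity)]
  rw [le_div_iff₀ hs] at h1
  nlinarith

/-- If no mass is large and few pairs collide, then many buckets receive a good part of the mass. -/
theorem card_big_buckets {n s : ℕ} (h : Fin n → Fin s) (v : Fin n → ℝ) (hv : ∀ i, 0 ≤ v i)
    {τ ζ : ℝ} (hτ : ∀ i, v i ≤ τ)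
    (hζ : ∑ i, ∑ j, (if i ≠ j ∧ h i = h j then v i * v j else 0) ≤ ζ) :
    (∑ i, v i) ^ 2 ≤ 4 * ((Finset.univ.filter fun k : Fin s =>
      ∑ i, v i ≤ 2 * s * ∑ i, if h i = k then v i else 0).card * (τ * ∑ i, v i + ζ)) := by
  set V := ∑ i, v i with hV
  have hV0 : 0 ≤ V := Finset.sum_nonneg fun i _ => hv i
  set m : Fin s → ℝ := fun k => ∑ i, if h i = k then v i else 0 with hm
  have hm0 : ∀ k, 0 ≤ m k := fun k => Finset.sum_nonneg fun i _ => by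
    split_ifs
    · exact hv i
    · exact le_rfl
  set F := Finset.univ.filter fun k : Fin s => V ≤ 2 * s * m k with hF
  have hsum : ∑ k, m k = V := by
    simp only [hm]
    rw [Finset.sum_comm]
    simp [hV]
  -- The sum of the squared bucket masses splits into the diagonal, bounded by the largest mass, and
  -- the colliding pairs.
  have hsq : ∑ k, m k ^ 2 ≤ τ * V + ζ := by
    have e1 : ∀ k, m k ^ 2 = ∑ i, ∑ j, if h i = k ∧ h j = k then v i * v j else 0 := by
      intro k
      rw [sq, hm]
      simp only [Finset.sum_mul_sum]
      refine Finset.sum_congr rfl fun i _ => Finset.sum_congr rfl fun j _ => ?_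
      by_cases h1 : h i = k <;> by_cases h2 : h j = k <;> simp [h1, h2]
    have e2 : ∑ k, m k ^ 2 = ∑ i, ∑ j, if h i = h j then v i * v j else 0 := by
      simp only [e1]
      rw [Finset.sum_comm]
      refine Finset.sum_congr rfl fun i _ => ?_
      rw [Finset.sum_comm]
      refine Finset.sum_congr rfl fun j _ => ?_
      rw [Finset.sum_eq_single (h i)]
      · by_cases h1 : h i = h j <;> simp [h1, eq_comm]
      · intro k _ hk; rw [if_neg]; rintro ⟨h1, -⟩; exact hk h1.symm
      · simp
    have e3 : ∑ i, ∑ j, (if h i = h j then v i * v j else 0)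
        = ∑ i, v i * v i + ∑ i, ∑ j, (if i ≠ j ∧ h i = h j then v i * v j else 0) := by
      rw [← Finset.sum_add_distrib]
      refine Finset.sum_congr rfl fun i _ => ?_
      have : v i * v i = ∑ j, if i = j then v i * v j else 0 := by simp
      rw [this, ← Finset.sum_add_distrib]
      refine Finset.sum_congr rfl fun j _ => ?_
      by_cases h1 : i = j
      · subst h1; simp
      · simp [h1]
    have e4 : ∑ i, v i * v i ≤ τ * V := by
      rw [hV, Finset.mul_sum]
      exact Finset.sum_le_sum fun i _ => mul_le_mul_of_nonneg_right (hτ i) (hv i)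
    rw [e2, e3]
    exact add_le_add e4 hζ
  -- Buckets with mass below `V / (2 s)` carry at most `V / 2` altogether; by Cauchy-Schwarz the
  -- other half cannot fit into few buckets.
  have hbig : V / 2 ≤ ∑ k ∈ F, m k := by
    have h1 := Finset.sum_filter_add_sum_filter_not Finset.univ (fun k : Fin s => V ≤ 2 * s * m k) m
    have h2 : ∑ k ∈ Finset.univ.filter (fun k : Fin s => ¬ V ≤ 2 * s * m k), m k ≤ V / 2 := by
      rcases Nat.eq_zero_or_pos s with h0 | h0
      · subst h0; simp; positivity
      have hs : (0 : ℝ) < s := by exact_mod_cast h0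
      calc _ ≤ ∑ _k ∈ Finset.univ.filter (fun k : Fin s => ¬ V ≤ 2 * s * m k), V / (2 * s) := by
            refine Finset.sum_le_sum fun k hk => ?_
            have := not_le.1 (Finset.mem_filter.1 hk).2
            rw [le_div_iff₀ (by positivity)]
            linarith
        _ ≤ ∑ _k : Fin s, V / (2 * s) :=
            Finset.sum_le_sum_of_subset_of_nonneg (Finset.filter_subset _ _)
              fun k _ _ => by positivity
        _ = V / 2 := by simp; field_simp
    rw [hsum] at h1
    linarith
  have hcs := sq_sum_le_card_mul_sum_sq (s := F) (f := m)
  have hle : ∑ k ∈ F, m k ^ 2 ≤ τ * V + ζ :=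
    le_trans (Finset.sum_le_sum_of_subset_of_nonneg (Finset.subset_univ F)
      fun k _ _ => sq_nonneg _) hsq
  have h3 : (V / 2) ^ 2 ≤ (∑ k ∈ F, m k) ^ 2 := by gcongr
  have h4 : (F.card : ℝ) * ∑ k ∈ F, m k ^ 2 ≤ F.card * (τ * V + ζ) := by gcongr
  nlinarith

/-! ### Sums of stable random variables in the buckets -/

/-- The law of independent standard stable variables. -/
noncomputable def stableVecLaw (p : ℝ) (n : ℕ) : Measure (Fin n → ℝ) :=
  Measure.pi fun _ => StableLaw.stableLaw p

instance (p : ℝ) (n : ℕ) : IsProbabilityMeasure (stableVecLaw p n) := by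
  unfold stableVecLaw; infer_instance

theorem stableVec_iIndepFun (p : ℝ) (n : ℕ) :
    iIndepFun (fun i (X : Fin n → ℝ) => X i) (stableVecLaw p n) :=
  iIndepFun_pi (X := fun _ (x : ℝ) => x) fun _ => measurable_id.aemeasurable

theorem stableVec_map (p : ℝ) (n : ℕ) (i : Fin n) :
    (stableVecLaw p n).map (fun X => X i) = StableLaw.stableLaw p :=
  (measurePreserving_eval (fun _ : Fin n => StableLaw.stableLaw p) i).map_eq

theorem stable_linear_tail {p : ℝ} (hp₁ : 1 ≤ p) (hp₂ : p < 2) {n : ℕ} (b : Fin n → ℝ) {N t : ℝ}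
    (hN : 0 < N) (hb : ∑ i, |b i| ^ p ≤ N ^ p) (ht : 2 ≤ t) :
    (stableVecLaw p n).real {X | N * t < |∑ i, b i * X i|} ≤ 4 / t := by
  have hp0 : 0 < p := by linarith
  have hD := StableLaw.hasStableCharFun_stableLaw hp0 hp₂
  have hlaw := StableLaw.map_linear hp0 (fun i => measurable_pi_apply i) (stableVec_iIndepFun p n)
    (stableVec_map p n) hD b
  set c := (∑ i, |b i| ^ p) ^ (1 / p) with hc
  have hS : 0 ≤ ∑ i, |b i| ^ p := Finset.sum_nonneg fun i _ => by positivity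
  have hc0 : 0 ≤ c := Real.rpow_nonneg hS _
  have hcN : c ≤ N := by
    have := Real.rpow_le_rpow hS hb (by positivity : 0 ≤ 1 / p)
    rwa [← Real.rpow_mul hN.le, mul_one_div_cancel hp0.ne', Real.rpow_one] at this
  have hmeas : MeasurableSet {y : ℝ | N * t < |y|} := measurableSet_lt measurable_const (by fun_prop)
  have h1 : (stableVecLaw p n).real {X | N * t < |∑ i, b i * X i|}
      = ((stableVecLaw p n).map fun X => ∑ i, b i * X i).real {y | N * t < |y|} := by
    rw [measureReal_def, measureReal_def, Measure.map_apply (by fun_prop) hmeas]; rfl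
  rw [h1, hlaw, measureReal_def, Measure.map_apply (by fun_prop) hmeas, ← measureReal_def]
  refine le_trans (measureReal_mono ?_) (StableLaw.measure_abs_gt_le hp₁ hD ht)
  intro x hx
  have hx' : N * t < |c * x| := hx
  rw [abs_mul, abs_of_nonneg hc0] at hx'
  refine Set.mem_ofPred.2 ?_
  by_contra hcon
  have := not_lt.1 hcon
  have h2 : c * |x| ≤ N * t := by gcongr
  linarith

/-- The combination is a stable variable multiplied by a scale of at least `g`, so the small-ball
bound applies at `η / g`. -/
theorem stable_linear_small {p : ℝ} (hp₁ : 1 ≤ p) (hp₂ : p < 2) {n : ℕ} (b : Fin n → ℝ) {g η : ℝ}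
    (hg : 0 < g) (hb : g ^ p ≤ ∑ i, |b i| ^ p) (hη : 0 < η) :
    (stableVecLaw p n).real {X | |∑ i, b i * X i| ≤ η} ≤ 20 * η / g := by
  have hp0 : 0 < p := by linarith
  have hD := StableLaw.hasStableCharFun_stableLaw hp0 hp₂
  have hlaw := StableLaw.map_linear hp0 (fun i => measurable_pi_apply i) (stableVec_iIndepFun p n)
    (stableVec_map p n) hD b
  set c := (∑ i, |b i| ^ p) ^ (1 / p) with hc
  have hcg : g ≤ c := by
    have := Real.rpow_le_rpow (by positivity) hb (by positivity : 0 ≤ 1 / p)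
    rwa [← Real.rpow_mul hg.le, mul_one_div_cancel hp0.ne', Real.rpow_one] at this
  have hmeas : MeasurableSet {y : ℝ | |y| ≤ η} := measurableSet_le (by fun_prop) measurable_const
  have h1 : (stableVecLaw p n).real {X | |∑ i, b i * X i| ≤ η}
      = ((stableVecLaw p n).map fun X => ∑ i, b i * X i).real {y | |y| ≤ η} := by
    rw [measureReal_def, measureReal_def, Measure.map_apply (by fun_prop) hmeas]; rfl
  rw [h1, hlaw, measureReal_def, Measure.map_apply (by fun_prop) hmeas, ← measureReal_def]
  refine le_trans (measureReal_mono ?_)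
    ((StableLaw.exists_measure_abs_le hp₁ hD (η / g) (by positivity)).trans (le_of_eq (by ring)))
  intro x hx
  have hx' : |c * x| ≤ η := hx
  rw [abs_mul, abs_of_nonneg (hg.le.trans hcg)] at hx'
  refine Set.mem_ofPred.2 ?_
  rw [le_div_iff₀ hg]
  have : |x| * g ≤ |x| * c := by gcongr
  linarith

/-- Bucket sums are all small only with a probability that is exponentially small in the number of
big buckets. -/
theorem stable_buckets_small {p : ℝ} (hp₁ : 1 ≤ p) (hp₂ : p < 2) {n s : ℕ} (h : Fin n → Fin s)
    (y : Fin n → ℝ) {g η : ℝ} (hg : 0 < g) (hη : 0 < η) (F : Finset (Fin s))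
    (hF : ∀ k ∈ F, g ^ p ≤ ∑ i, if h i = k then |y i| ^ p else 0) :
    (stableVecLaw p n).real {X | ∀ k, |∑ i, (if h i = k then y i else 0) * X i| ≤ η}
      ≤ (20 * η / g) ^ F.card := by
  have hp0 : 0 < p := by linarith
  have hD := StableLaw.hasStableCharFun_stableLaw hp0 hp₂
  have hind := StableLaw.iIndepFun_linear hp0 (fun i => measurable_pi_apply i)
    (stableVec_iIndepFun p n) (stableVec_map p n) hD
    (fun (k : Fin s) i => if h i = k then y i else 0) (by
      intro i k k' hk
      by_cases h1 : h i = k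
      · right; rw [if_neg]; rw [h1]; exact hk
      · left; rw [if_neg h1])
  have hmeas : MeasurableSet {y : ℝ | |y| ≤ η} := measurableSet_le (by fun_prop) measurable_const
  have h1 := hind.measure_inter_preimage_eq_mul F (sets := fun _ => {y : ℝ | |y| ≤ η})
    fun _ _ => hmeas
  have hsub : {X : Fin n → ℝ | ∀ k, |∑ i, (if h i = k then y i else 0) * X i| ≤ η} ⊆
      ⋂ k ∈ F, (fun X : Fin n → ℝ => ∑ i, (if h i = k then y i else 0) * X i) ⁻¹' {y | |y| ≤ η} := by
    intro X hX
    simp only [Set.mem_iInter]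
    intro k _
    exact (Set.mem_ofPred.1 hX) k
  refine (measureReal_mono hsub).trans ?_
  rw [measureReal_def, h1, ENNReal.toReal_prod]
  calc _ ≤ ∏ _k ∈ F, (20 * η / g) := by
        refine Finset.prod_le_prod (fun _ _ => ENNReal.toReal_nonneg) fun k hk => ?_
        refine stable_linear_small hp₁ hp₂ (fun i => if h i = k then y i else 0) hg ?_ hη
        refine (hF k hk).trans (le_of_eq (Finset.sum_congr rfl fun i _ => ?_))
        split_ifs <;> simp [Real.zero_rpow hp0.ne']
    _ = _ := Finset.prod_const _

/-! ### Distortion of the sparse embedding -/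

/-- The `k`-th coordinate of `S D u`. -/
noncomputable def bucketSum {n s : ℕ} (h : Fin n → Fin s) (X : Fin n → ℝ) (u : Fin n → ℝ)
    (k : Fin s) : ℝ := ∑ i, (if h i = k then u i else 0) * X i

/-- The matrix `S D A`. -/
noncomputable def sketch {n s d : ℕ} (h : Fin n → Fin s) (X : Fin n → ℝ)
    (A : Matrix (Fin n) (Fin d) ℝ) : Matrix (Fin s) (Fin d) ℝ :=
  Matrix.of fun k j => bucketSum h X (fun i => A i j) k

theorem bucketSum_sum {n s d : ℕ} (h : Fin n → Fin s) (X : Fin n → ℝ) (u : Fin n → Fin d → ℝ)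
    (x : Fin d → ℝ) (k : Fin s) :
    bucketSum h X (fun i => ∑ j, u i j * x j) k = ∑ j, x j * bucketSum h X (fun i => u i j) k := by
  simp only [bucketSum, Finset.mul_sum]
  rw [Finset.sum_comm]
  refine Finset.sum_congr rfl fun i _ => ?_
  split_ifs
  · rw [Finset.sum_mul]; exact Finset.sum_congr rfl fun j _ => by ring
  · simp

theorem sketch_mulVec {n s d : ℕ} (h : Fin n → Fin s) (X : Fin n → ℝ)
    (A : Matrix (Fin n) (Fin d) ℝ) (z : Fin d → ℝ) :
    sketch h X A *ᵥ z = bucketSum h X (A *ᵥ z) := by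
  ext k
  have := bucketSum_sum h X A z k
  rw [show (A *ᵥ z) = fun i => ∑ j, A i j * z j from rfl, this]
  simp only [Matrix.mulVec, dotProduct, sketch, Matrix.of_apply]
  exact Finset.sum_congr rfl fun j _ => mul_comm _ _

theorem abs_bucketSum_le {n s d : ℕ} (h : Fin n → Fin s) (X : Fin n → ℝ) (u : Fin n → Fin d → ℝ)
    (x : Fin d → ℝ) (k : Fin s) {m b : ℝ} (hm : ∀ j, |x j| ≤ m)
    (hb : ∀ j, |bucketSum h X (fun i => u i j) k| ≤ b) :
    |bucketSum h X (fun i => ∑ j, u i j * x j) k| ≤ d * (m * b) := by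
  rw [bucketSum_sum]
  calc _ ≤ ∑ j, |x j * bucketSum h X (fun i => u i j) k| := Finset.abs_sum_le_sum_abs _ _
    _ ≤ ∑ _j : Fin d, m * b := by
        refine Finset.sum_le_sum fun j _ => ?_
        rw [abs_mul]
        have := hm j
        have := hb j
        have h0 : 0 ≤ m := le_trans (abs_nonneg _) (hm j)
        gcongr
    _ = _ := by simp

theorem abs_le_one_of_dotProduct {d : ℕ} {x : Fin d → ℝ} (hx : x ⬝ᵥ x = 1) (j : Fin d) : |x j| ≤ 1 := by
  have h1 : x j * x j ≤ x ⬝ᵥ x :=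
    Finset.single_le_sum (f := fun i => x i * x i) (fun _ _ => mul_self_nonneg _) (Finset.mem_univ j)
  rw [hx] at h1
  rw [abs_le]
  constructor <;> nlinarith

theorem eucPow_eq_one {p : ℝ} {d : ℕ} {x : Fin d → ℝ} (hx : x ⬝ᵥ x = 1) : eucPow p x = 1 := by
  rw [eucPow, hx, Real.one_rpow]

theorem abs_entry_rpow_le {p : ℝ} (hp : 0 ≤ p) {d : ℕ} (u : Fin d → ℝ) (j : Fin d) :
    |u j| ^ p ≤ eucPow p u := by
  have h := abs_dotProduct_rpow_le hp u (Pi.single j 1)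
  rwa [dotProduct_single, mul_one, eucPow_eq_one (x := Pi.single j 1) (by simp), mul_one] at h

/-- The requirements on the hash function of a sparse embedding: no two heavy rows collide, and few pairs
of light rows do. -/
structure GoodHash (p τ : ℝ) {n s d : ℕ} (U : Matrix (Fin n) (Fin d) ℝ) (H : Finset (Fin n))
    (h : Fin n → Fin s) : Prop where
  heavy : ∀ i ∈ H, ∀ j ∈ H, h i = h j → i = j
  light : ∑ i, ∑ j, (if i ≠ j ∧ h i = h j then
    (if i ∉ H ∧ j ∉ H then eucPow p (U i) * eucPow p (U j) else 0) else 0) ≤ τ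

theorem heavyWeight_nonneg {n : ℕ} {γ : ℝ} (hγ : 0 < γ) (H : Finset (Fin n)) (i : Fin n) :
    0 ≤ heavyWeight γ H i := by
  unfold heavyWeight; split_ifs <;> linarith

/-- The sum over the light rows. -/
theorem IsHeavyBasis.light_sum_le {p γ τ : ℝ} {n d : ℕ} {A : Matrix (Fin n) (Fin d) ℝ}
    {H : Finset (Fin n)} {B : Matrix (Fin d) (Fin d) ℝ} (hb : IsHeavyBasis p γ τ A H B)
    (hγ : 0 < γ) : ∑ i, (if i ∉ H then eucPow p ((A * B) i) else 0) ≤ d := by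
  refine le_trans (Finset.sum_le_sum fun i _ => ?_) hb.sum_le
  by_cases hi : i ∈ H
  · simp only [hi, not_true_eq_false, if_false]
    exact mul_nonneg (Real.rpow_nonneg (heavyWeight_nonneg hγ H i) _) (eucPow_nonneg _ _)
  · simp [hi, heavyWeight]

theorem IsHeavyBasis.sum_eucPow_le {p γ τ : ℝ} (hp : 0 ≤ p) {n d : ℕ} {A : Matrix (Fin n) (Fin d) ℝ}
    {H : Finset (Fin n)} {B : Matrix (Fin d) (Fin d) ℝ} (hb : IsHeavyBasis p γ τ A H B)
    (hγ : 0 < γ) (hγ₁ : γ ≤ 1) : ∑ i, eucPow p ((A * B) i) ≤ d / γ ^ p := by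
  have h0 : 0 < γ ^ p := Real.rpow_pos_of_pos hγ _
  rw [le_div_iff₀ h0, Finset.sum_mul]
  refine le_trans (Finset.sum_le_sum fun i _ => ?_) hb.sum_le
  rw [mul_comm]
  refine mul_le_mul_of_nonneg_right (Real.rpow_le_rpow hγ.le ?_ hp) (eucPow_nonneg _ _)
  unfold heavyWeight; split_ifs <;> linarith

/-- Two applications of Markov's inequality: the expected number of ordered heavy collisions is at
most `|H|² / s`, and the expected mass of light collisions at most `d² / s`, as the light rows have
total mass at most `d`. -/
theorem not_goodHash_le {p γ τ : ℝ} {n s d : ℕ} [NeZero s] {A : Matrix (Fin n) (Fin d) ℝ}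
    {H : Finset (Fin n)} {B : Matrix (Fin d) (Fin d) ℝ} (hb : IsHeavyBasis p γ τ A H B)
    (hγ : 0 < γ) (hτ : 0 < τ) {δ : ℝ} (h1 : (H.card : ℝ) ^ 2 ≤ δ * s)
    (h2 : (d : ℝ) ^ 2 ≤ δ * (s * τ)) :
    (hashLaw n s).real {h | ¬ GoodHash p τ (A * B) H h} ≤ 2 * δ := by
  classical
  have hs : (0 : ℝ) < s := by exact_mod_cast Nat.pos_of_ne_zero (NeZero.ne s)
  set U := A * B with hU
  have t1 := hashLaw_sum_tail (s := s) (fun i j : Fin n => if i ∈ H ∧ j ∈ H then (1 : ℝ) else 0)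
    (fun i j => by split_ifs <;> norm_num) one_pos
  have t2 := hashLaw_sum_tail (s := s)
    (fun i j : Fin n => if i ∉ H ∧ j ∉ H then eucPow p (U i) * eucPow p (U j) else 0)
    (fun i j => by
      split_ifs
      · exact mul_nonneg (eucPow_nonneg _ _) (eucPow_nonneg _ _)
      · exact le_rfl) hτ
  have e1 : ∑ i : Fin n, ∑ j : Fin n, (if i ∈ H ∧ j ∈ H then (1 : ℝ) else 0) = (H.card : ℝ) ^ 2 := by
    have : ∀ i j : Fin n, (if i ∈ H ∧ j ∈ H then (1 : ℝ) else 0)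
        = (if i ∈ H then 1 else 0) * (if j ∈ H then 1 else 0) := by
      intro i j; by_cases h1 : i ∈ H <;> by_cases h2 : j ∈ H <;> simp [h1, h2]
    simp only [this]
    rw [← Finset.sum_mul_sum, sq]
    simp
  have e2 : ∑ i : Fin n, ∑ j : Fin n, (if i ∉ H ∧ j ∉ H then eucPow p (U i) * eucPow p (U j) else 0)
      ≤ (d : ℝ) ^ 2 := by
    have : ∀ i j : Fin n, (if i ∉ H ∧ j ∉ H then eucPow p (U i) * eucPow p (U j) else 0)
        = (if i ∉ H then eucPow p (U i) else 0) * (if j ∉ H then eucPow p (U j) else 0) := by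
      intro i j; by_cases h1 : i ∈ H <;> by_cases h2 : j ∈ H <;> simp [h1, h2]
    simp only [this]
    rw [← Finset.sum_mul_sum, ← sq]
    have h4 : 0 ≤ ∑ i : Fin n, (if i ∉ H then eucPow p (U i) else 0) :=
      Finset.sum_nonneg fun i _ => by
        split_ifs
        · exact le_rfl
        · exact eucPow_nonneg _ _
    have := hb.light_sum_le hγ
    gcongr
  have hsub : {h : Fin n → Fin s | ¬ GoodHash p τ U H h} ⊆
      {h | 1 ≤ ∑ i, ∑ j, if i ≠ j ∧ h i = h j then (if i ∈ H ∧ j ∈ H then (1 : ℝ) else 0) else 0} ∪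
      {h | τ ≤ ∑ i, ∑ j, if i ≠ j ∧ h i = h j then
        (if i ∉ H ∧ j ∉ H then eucPow p (U i) * eucPow p (U j) else 0) else 0} := by
    intro h hh
    by_contra hcon
    simp only [Set.mem_union, Set.mem_ofPred_eq, not_or, not_le] at hcon
    refine hh ⟨?_, hcon.2.le⟩
    intro i hi j hj hij
    by_contra hne
    have h1 : (1 : ℝ) ≤ ∑ j, if i ≠ j ∧ h i = h j then (if i ∈ H ∧ j ∈ H then (1 : ℝ) else 0) else 0 := by
      have := Finset.single_le_sum
        (f := fun j => if i ≠ j ∧ h i = h j then (if i ∈ H ∧ j ∈ H then (1 : ℝ) else 0) else 0)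
        (fun j _ => by split_ifs <;> norm_num) (Finset.mem_univ j)
      simpa [hne, hij, hi, hj] using this
    have h2 := Finset.single_le_sum
        (f := fun i => ∑ j, if i ≠ j ∧ h i = h j then (if i ∈ H ∧ j ∈ H then (1 : ℝ) else 0) else 0)
        (fun i _ => Finset.sum_nonneg fun j _ => by split_ifs <;> norm_num) (Finset.mem_univ i)
    linarith [hcon.1]
  calc _ ≤ _ := measureReal_mono hsub
    _ ≤ _ := measureReal_union_le _ _
    _ ≤ (H.card : ℝ) ^ 2 / (s * 1) + (d : ℝ) ^ 2 / (s * τ) := by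
        refine add_le_add (t1.trans (le_of_eq (by rw [e1]))) (t2.trans ?_)
        gcongr
    _ ≤ δ + δ := by
        refine add_le_add ?_ ?_
        · rw [div_le_iff₀ (by positivity)]; linarith
        · rw [div_le_iff₀ (by positivity)]; linarith
    _ = _ := by ring

/-- For a good hash function, the bucket sums of a vector with light rows are all small with very small
probability. -/
theorem light_vector_small {p γ τ : ℝ} (hp₁ : 1 ≤ p) (hp₂ : p < 2) {n s d : ℕ} (hs : 0 < s)
    (hd : 0 < d) {A : Matrix (Fin n) (Fin d) ℝ} {H : Finset (Fin n)} {B : Matrix (Fin d) (Fin d) ℝ}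
    (hb : IsHeavyBasis p γ τ A H B) (hτ : τ = 1 / (2200 * d)) {h : Fin n → Fin s}
    (hh : GoodHash p τ (A * B) H h) {x : Fin d → ℝ} (hx : x ⬝ᵥ x = 1)
    (hlight : 1 / 16 ≤ ∑ i, if i ∉ H then |(A * B) i ⬝ᵥ x| ^ p else 0) {η : ℝ} (hη : 0 < η)
    (hη₁ : 1280 * s * η ≤ 1) :
    (stableVecLaw p n).real {X | ∀ k, |bucketSum h X (fun i => (A * B) i ⬝ᵥ x) k| ≤ 2 * η}
      ≤ (1280 * s * η) ^ (2 * d) := by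
  have hp0 : 0 < p := by linarith
  have hd0 : (1 : ℝ) ≤ d := by exact_mod_cast hd
  have hs0 : (1 : ℝ) ≤ s := by exact_mod_cast hs
  have hτ0 : 0 < τ := by rw [hτ]; positivity
  set U := A * B with hU
  set v : Fin n → ℝ := fun i => if i ∉ H then |U i ⬝ᵥ x| ^ p else 0 with hv
  set V := ∑ i, v i with hV
  have hv0 : ∀ i, 0 ≤ v i := by
    intro i; simp only [hv]; split_ifs
    · exact le_rfl
    · positivity
  have hvle : ∀ i, v i ≤ if i ∉ H then eucPow p (U i) else 0 := by
    intro i; simp only [hv]; split_ifs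
    · exact le_rfl
    · have := abs_dotProduct_rpow_le hp0.le (U i) x
      rwa [eucPow_eq_one hx, mul_one] at this
  -- The light masses are at most `τ`, and the mass of their collisions is at most `τ` because the
  -- hash function is good.
  have hcard := card_big_buckets h v hv0 (τ := τ) (ζ := τ) (fun i => (hvle i).trans (by
      split_ifs with hi
      · exact hτ0.le
      · exact hb.light i hi))
    (le_trans (Finset.sum_le_sum fun i _ => Finset.sum_le_sum fun j _ => (by
      by_cases hij : i ≠ j ∧ h i = h j
      · rw [if_pos hij, if_pos hij]
        refine (mul_le_mul (hvle i) (hvle j) (hv0 j) (le_trans (hv0 i) (hvle i))).trans ?_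
        by_cases hi : i ∈ H <;> by_cases hj : j ∈ H <;> simp [hi, hj]
      · rw [if_neg hij, if_neg hij])) hh.light)
  rw [← hV] at hcard
  set F := Finset.univ.filter fun k : Fin s => V ≤ 2 * s * ∑ i, if h i = k then v i else 0 with hF
  -- From `V ≥ 1 / 16` follows `V ≤ 68 τ |F|`; the constant `2200` in `τ` is a little more than `2 *
  -- 16 * 68`, so that `|F| ≥ 2 d`.
  have hF2 : 2 * d ≤ F.card := by
    have h1 : V + 1 ≤ 17 * V := by linarith
    have h2 : V ^ 2 ≤ 4 * (F.card * (τ * (17 * V))) := by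
      refine hcard.trans ?_
      have : τ * V + τ ≤ τ * (17 * V) := by nlinarith
      gcongr
    have hVpos : 0 < V := by linarith
    have h3 : V ≤ F.card * (68 * τ) := by
      have : V * V ≤ (F.card * (68 * τ)) * V := by nlinarith
      exact le_of_mul_le_mul_right this hVpos
    have h4 : (2 * d : ℝ) ≤ F.card := by
      have h5 : (1 : ℝ) / 16 ≤ F.card * (68 * τ) := hlight.trans h3
      rw [hτ] at h5
      field_simp at h5
      linarith
    exact_mod_cast h4
  have hg : (0 : ℝ) < 1 / (32 * s) := by positivity
  have hsm := stable_buckets_small hp₁ hp₂ h (fun i => U i ⬝ᵥ x) hg (by linarith : 0 < 2 * η) F (by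
    intro k hk
    have h1 : V ≤ 2 * s * ∑ i, if h i = k then v i else 0 := (Finset.mem_filter.1 hk).2
    have h2 : (1 / (32 * s) : ℝ) ^ p ≤ 1 / (32 * s) := by
      have := Real.rpow_le_rpow_of_exponent_ge hg (by
        rw [div_le_one (by positivity)]; linarith) hp₁
      rwa [Real.rpow_one] at this
    have h3 : (1 / (32 * s) : ℝ) ≤ ∑ i, if h i = k then v i else 0 := by
      rw [div_le_iff₀ (by positivity)]
      linarith
    refine h2.trans (h3.trans (Finset.sum_le_sum fun i _ => ?_))
    by_cases hi : h i = k
    · rw [if_pos hi, if_pos hi]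
      simp only [hv]
      split_ifs
      · positivity
      · exact le_rfl
    · rw [if_neg hi, if_neg hi])
  refine hsm.trans ?_
  have e : 20 * (2 * η) / (1 / (32 * s)) = 1280 * s * η := by field_simp; ring
  rw [e]
  exact pow_le_pow_of_le_one (by positivity) hη₁ hF2

/-- The multipliers of a sparse embedding are good with high probability, for a good hash function. -/
theorem bucketSum_bounds {p γ τ δ t θ η : ℝ} (hp₁ : 1 ≤ p) (hp₂ : p < 2) {n s d : ℕ} (hd : 0 < d)
    (hds : d ≤ s) {A : Matrix (Fin n) (Fin d) ℝ} {H : Finset (Fin n)}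
    {B : Matrix (Fin d) (Fin d) ℝ} (hb : IsHeavyBasis p γ τ A H B) (hδ : 0 < δ) (hδ₁ : δ ≤ 1)
    (hτ : τ = 1 / (2200 * d)) (ht : t = 4 * s ^ 2 / δ) (hθ : θ = δ / (20 * s))
    (hγ : γ = θ / (32 * s ^ 3 * t)) (hη : η = δ * γ / (5 * 1280 ^ 2 * s ^ 4 * t))
    (hH : H.card ≤ s) {h : Fin n → Fin s} (hh : GoodHash p τ (A * B) H h) :
    (stableVecLaw p n).real {X | ¬ ∀ x : Fin d → ℝ, x ⬝ᵥ x = 1 →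
      (∃ k, η ≤ |bucketSum h X (fun i => (A * B) i ⬝ᵥ x) k|) ∧
        ∀ k, |bucketSum h X (fun i => (A * B) i ⬝ᵥ x) k| ≤ s ^ 2 * t / γ} ≤ 4 * δ := by
  classical
  have hp0 : 0 < p := by linarith
  have hd0 : (1 : ℝ) ≤ d := by exact_mod_cast hd
  have hds' : (d : ℝ) ≤ s := by exact_mod_cast hds
  have hs : 0 < s := lt_of_lt_of_le hd hds
  have hs0 : (1 : ℝ) ≤ s := hd0.trans hds'
  have ht0 : 0 < t := by rw [ht]; positivity
  have hθ0 : 0 < θ := by rw [hθ]; positivity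
  have hγ0 : 0 < γ := by rw [hγ]; positivity
  have hη0 : 0 < η := by rw [hη]; positivity
  have hs2 : (1 : ℝ) ≤ s ^ 2 := one_le_pow₀ hs0
  have hs3 : (1 : ℝ) ≤ s ^ 3 := one_le_pow₀ hs0
  have hs4 : (1 : ℝ) ≤ s ^ 4 := one_le_pow₀ hs0
  have ht2 : 4 ≤ t := by
    rw [ht, le_div_iff₀ hδ]; nlinarith
  have hθ1 : θ ≤ 1 := by
    rw [hθ, div_le_one (by positivity)]; linarith
  have hst : (1 : ℝ) ≤ s ^ 3 * t := by nlinarith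
  have hγ1 : γ ≤ 1 := by
    rw [hγ, div_le_one (by positivity)]; nlinarith
  have hηs : 1280 * s * η ≤ 1 := by
    rw [hη]
    have h1 : δ * γ ≤ 1 := by nlinarith
    rw [← mul_div_assoc, div_le_one (by positivity)]
    have h2 : (s : ℝ) ≤ s ^ 4 * t := by nlinarith [pow_le_pow_right₀ hs0 (by norm_num : 1 ≤ 4)]
    nlinarith
  have hη1 : η ≤ s ^ 2 * t := by nlinarith
  set U := A * B with hU
  -- The basis with the heavy rows set to zero. Its bucket sums are the noise that a heavy row has
  -- to beat, and their bound does not involve `γ`.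
  set UL : Fin n → Fin d → ℝ := fun i j => if i ∉ H then U i j else 0 with hUL
  set Q : Set (Fin d → ℝ) := {x | x ⬝ᵥ x = 1 ∧
    1 / 16 ≤ ∑ i, if i ∉ H then |U i ⬝ᵥ x| ^ p else 0} with hQ
  -- The mesh is such that moving to the nearest net point changes every bucket sum by at most `η`,
  -- given the bound `d t / γ` on the bucket sums of the columns.
  set m := η * γ / (s ^ 2 * t) with hm
  have hm0 : 0 < m := by positivity
  have hm1 : m ≤ 1 := by
    rw [hm, div_le_one (by positivity)]
    have : η * γ ≤ η := by nlinarith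
    linarith
  obtain ⟨F, hFQ, hFcard, hFnet⟩ := exists_net Q hm0 hm1
    fun x hx j => abs_le_one_of_dotProduct hx.1 j
  -- the four bad events
  have b1 : (stableVecLaw p n).real {X | ∃ i ∈ H, X ∈ {X : Fin n → ℝ | |X i| ≤ θ}} ≤ δ := by
    refine (measureReal_iUnion_finset_le (ε := 20 * θ) H _ fun i _ => ?_).trans ?_
    · have h1 := stable_linear_small hp₁ hp₂ (Pi.single i 1 : Fin n → ℝ) one_pos (by
        rw [Real.one_rpow]
        have := Finset.single_le_sum (f := fun k => |(Pi.single i 1 : Fin n → ℝ) k| ^ p)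
          (fun _ _ => by positivity) (Finset.mem_univ i)
        simpa using this) hθ0
      simpa [Pi.single_apply] using h1
    · have : (H.card : ℝ) ≤ s := by exact_mod_cast hH
      calc (H.card : ℝ) * (20 * θ) ≤ s * (20 * θ) := by gcongr
        _ = δ := by rw [hθ]; field_simp
  have hcount : ((Finset.univ : Finset (Fin s × Fin d)).card : ℝ) * (4 / t) ≤ δ := by
    rw [Finset.card_univ, Fintype.card_prod, Fintype.card_fin, Fintype.card_fin]
    push_cast
    calc (s * d : ℝ) * (4 / t) ≤ (s * s) * (4 / t) := by gcongr
      _ = δ := by rw [ht]; field_simp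
  have b2 : (stableVecLaw p n).real {X | ∃ kj ∈ (Finset.univ : Finset (Fin s × Fin d)),
      X ∈ {X | d * t < |bucketSum h X (fun i => UL i kj.2) kj.1|}} ≤ δ := by
    refine (measureReal_iUnion_finset_le (ε := 4 / t) _ _ fun kj _ => ?_).trans hcount
    refine stable_linear_tail hp₁ hp₂ (fun i => if h i = kj.1 then UL i kj.2 else 0)
      (by linarith) ?_ (by linarith)
    calc ∑ i, |if h i = kj.1 then UL i kj.2 else 0| ^ p
        ≤ ∑ i, (if i ∉ H then eucPow p (U i) else 0) := by
          refine Finset.sum_le_sum fun i _ => ?_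
          by_cases hi : i ∈ H
          · simp [hUL, hi, Real.zero_rpow hp0.ne']
          · simp only [hUL, hi, not_false_eq_true, if_true]
            split_ifs
            · exact abs_entry_rpow_le hp0.le _ _
            · simp [Real.zero_rpow hp0.ne', eucPow_nonneg]
      _ ≤ d := hb.light_sum_le hγ0
      _ ≤ (d : ℝ) ^ p := by
          have := Real.rpow_le_rpow_of_exponent_le hd0 hp₁
          rwa [Real.rpow_one] at this
  have b3 : (stableVecLaw p n).real {X | ∃ kj ∈ (Finset.univ : Finset (Fin s × Fin d)),
      X ∈ {X | d / γ * t < |bucketSum h X (fun i => U i kj.2) kj.1|}} ≤ δ := by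
    refine (measureReal_iUnion_finset_le (ε := 4 / t) _ _ fun kj _ => ?_).trans hcount
    refine stable_linear_tail hp₁ hp₂ (fun i => if h i = kj.1 then U i kj.2 else 0)
      (by positivity) ?_ (by linarith)
    calc ∑ i, |if h i = kj.1 then U i kj.2 else 0| ^ p
        ≤ ∑ i, eucPow p (U i) := by
          refine Finset.sum_le_sum fun i _ => ?_
          split_ifs
          · exact abs_entry_rpow_le hp0.le _ _
          · simp [Real.zero_rpow hp0.ne', eucPow_nonneg]
      _ ≤ d / γ ^ p := hb.sum_eucPow_le hp0.le hγ0 hγ1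
      _ ≤ (d / γ) ^ p := by
          rw [Real.div_rpow (by linarith) hγ0.le]
          have := Real.rpow_le_rpow_of_exponent_le hd0 hp₁
          rw [Real.rpow_one] at this
          gcongr
  have b4 : (stableVecLaw p n).real {X | ∃ x ∈ F,
      X ∈ {X | ∀ k, |bucketSum h X (fun i => U i ⬝ᵥ x) k| ≤ 2 * η}} ≤ δ := by
    refine (measureReal_iUnion_finset_le (ε := (1280 * s * η) ^ (2 * d)) F _ fun x hx => ?_).trans ?_
    · exact light_vector_small hp₁ hp₂ hs hd hb hτ hh (hFQ x hx).1 (hFQ x hx).2 hη0 hηs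
    -- The net has about `η ^ (-d)` points and each fails with probability about `η ^ (2 d)`. Having
    -- `2 d` independent big buckets is what makes the product small as `η` decreases; `η` is chosen
    -- so that it equals `δ ^ d`.
    · calc (F.card : ℝ) * (1280 * s * η) ^ (2 * d)
          ≤ (5 * 1 / m) ^ d * (1280 * s * η) ^ (2 * d) := by gcongr
        _ = δ ^ d := by
            rw [pow_mul, ← mul_pow]
            congr 1
            rw [hm]
            have h1 : η * (5 * 1280 ^ 2 * s ^ 4 * t) = δ * γ := by rw [hη]; field_simp
            field_simp
            linarith
        _ ≤ δ := pow_le_of_le_one hδ.le hδ₁ hd.ne'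
  refine le_trans (measureReal_mono (s₂ :=
    ({X | ∃ i ∈ H, X ∈ {X : Fin n → ℝ | |X i| ≤ θ}} ∪
      {X | ∃ kj ∈ (Finset.univ : Finset (Fin s × Fin d)),
        X ∈ {X | d * t < |bucketSum h X (fun i => UL i kj.2) kj.1|}}) ∪
    ({X | ∃ kj ∈ (Finset.univ : Finset (Fin s × Fin d)),
      X ∈ {X | d / γ * t < |bucketSum h X (fun i => U i kj.2) kj.1|}} ∪
      {X | ∃ x ∈ F, X ∈ {X | ∀ k, |bucketSum h X (fun i => U i ⬝ᵥ x) k| ≤ 2 * η}})) ?_) ?_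
  swap
  · refine (measureReal_union_le _ _).trans ?_
    have h1 := measureReal_union_le (μ := stableVecLaw p n)
      {X | ∃ i ∈ H, X ∈ {X : Fin n → ℝ | |X i| ≤ θ}}
      {X | ∃ kj ∈ (Finset.univ : Finset (Fin s × Fin d)),
        X ∈ {X | d * t < |bucketSum h X (fun i => UL i kj.2) kj.1|}}
    have h2 := measureReal_union_le (μ := stableVecLaw p n)
      {X | ∃ kj ∈ (Finset.univ : Finset (Fin s × Fin d)),
        X ∈ {X | d / γ * t < |bucketSum h X (fun i => U i kj.2) kj.1|}}
      {X | ∃ x ∈ F, X ∈ {X | ∀ k, |bucketSum h X (fun i => U i ⬝ᵥ x) k| ≤ 2 * η}}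
    linarith
  intro X hX
  by_contra hcon
  simp only [Set.mem_union, not_or] at hcon
  obtain ⟨⟨c1, c2⟩, c3, c4⟩ := hcon
  have g1 : ∀ i ∈ H, θ < |X i| := fun i hi => by
    by_contra hc; exact c1 ⟨i, hi, not_lt.1 hc⟩
  have g2 : ∀ k j, |bucketSum h X (fun i => UL i j) k| ≤ d * t := fun k j => by
    by_contra hc; exact c2 ⟨(k, j), Finset.mem_univ _, not_le.1 hc⟩
  have g3 : ∀ k j, |bucketSum h X (fun i => U i j) k| ≤ d / γ * t := fun k j => by
    by_contra hc; exact c3 ⟨(k, j), Finset.mem_univ _, not_le.1 hc⟩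
  have g4 : ∀ x ∈ F, ∃ k, 2 * η < |bucketSum h X (fun i => U i ⬝ᵥ x) k| := fun x hx => by
    by_contra hc
    push Not at hc
    exact c4 ⟨x, hx, hc⟩
  refine hX fun x hx => ⟨?_, fun k => ?_⟩
  swap
  · have := abs_bucketSum_le h X U x k (abs_le_one_of_dotProduct hx) (g3 k)
    refine this.trans ?_
    rw [one_mul]
    calc (d : ℝ) * (d / γ * t) ≤ s * (s / γ * t) := by gcongr
      _ = _ := by field_simp
  -- Light case: a nearby net point has a bucket sum above `2 η`, and at most `η` is lost in passing
  -- from it to `x`.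
  by_cases hl : 1 / 16 ≤ ∑ i, if i ∉ H then |U i ⬝ᵥ x| ^ p else 0
  · obtain ⟨x', hx', hxx⟩ := hFnet x ⟨hx, hl⟩
    obtain ⟨k, hk⟩ := g4 x' hx'
    refine ⟨k, ?_⟩
    have hdiff := abs_bucketSum_le h X U (x - x') k hxx (g3 k)
    have hsplit : bucketSum h X (fun i => ∑ j, U i j * (x - x') j) k
        = bucketSum h X (fun i => U i ⬝ᵥ x) k - bucketSum h X (fun i => U i ⬝ᵥ x') k := by
      refine (bucketSum_sum h X U (x - x') k).trans (Eq.trans ?_ (congrArg₂ (· - ·)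
        (bucketSum_sum h X U x k) (bucketSum_sum h X U x' k)).symm)
      rw [← Finset.sum_sub_distrib]
      exact Finset.sum_congr rfl fun j _ => by rw [Pi.sub_apply]; ring
    rw [hsplit] at hdiff
    have hsmall : (d : ℝ) * (m * (d / γ * t)) ≤ η := by
      calc (d : ℝ) * (m * (d / γ * t)) ≤ s * (m * (s / γ * t)) := by gcongr
        _ = η := by rw [hm]; field_simp
    have h1 := abs_sub_abs_le_abs_sub (bucketSum h X (fun i => U i ⬝ᵥ x') k)
      (bucketSum h X (fun i => U i ⬝ᵥ x) k)
    rw [abs_sub_comm] at h1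
    linarith
  · have hl' := not_le.1 hl
    have htot := hb.eucPow_le x
    rw [eucPow_eq_one hx] at htot
    have hsplit : ∑ i, heavyWeight γ H i ^ p * |U i ⬝ᵥ x| ^ p
        = ∑ i, (if i ∉ H then |U i ⬝ᵥ x| ^ p else 0) + ∑ i ∈ H, γ ^ p * |U i ⬝ᵥ x| ^ p := by
      have : ∑ i ∈ H, γ ^ p * |U i ⬝ᵥ x| ^ p = ∑ i, if i ∈ H then γ ^ p * |U i ⬝ᵥ x| ^ p else 0 := by
        simp
      rw [this, ← Finset.sum_add_distrib]
      refine Finset.sum_congr rfl fun i _ => ?_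
      by_cases hi : i ∈ H <;> simp [hi, heavyWeight]
    rw [hsplit] at htot
    have hheavy : 1 / 16 ≤ ∑ i ∈ H, γ ^ p * |U i ⬝ᵥ x| ^ p := by linarith
    -- Heavy case: by the basis inequality the reweighted heavy rows carry mass at least `1 / 16`,
    -- hence one of the at most `s` heavy rows carries at least `1 / (16 s)`. Before reweighting,
    -- its entry is larger by the factor `1 / γ`.
    obtain ⟨i, hi, hix⟩ : ∃ i ∈ H, 1 / (16 * s) ≤ γ ^ p * |U i ⬝ᵥ x| ^ p := by
      by_contra hc
      push Not at hc
      have hne : H.Nonempty := by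
        by_contra hemp
        rw [Finset.not_nonempty_iff_eq_empty] at hemp
        rw [hemp] at hheavy
        norm_num at hheavy
      have h1 := Finset.sum_lt_sum_of_nonempty hne hc
      rw [Finset.sum_const, nsmul_eq_mul] at h1
      have h2 : (H.card : ℝ) ≤ s := by exact_mod_cast hH
      have h3 : (H.card : ℝ) * (1 / (16 * s)) ≤ s * (1 / (16 * s)) := by gcongr
      have h4 : (s : ℝ) * (1 / (16 * s)) = 1 / 16 := by field_simp
      linarith
    have hval : 1 / (16 * s) ≤ γ * |U i ⬝ᵥ x| := by
      rw [← Real.mul_rpow hγ0.le (abs_nonneg _)] at hix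
      by_contra hc
      have h1 := not_le.1 hc
      have h0 : 0 ≤ γ * |U i ⬝ᵥ x| := by positivity
      have h2 : (γ * |U i ⬝ᵥ x|) ^ p < (1 / (16 * s)) ^ p := Real.rpow_lt_rpow h0 h1 hp0
      have h3 : (1 / (16 * s) : ℝ) ^ p ≤ 1 / (16 * s) := by
        have := Real.rpow_le_rpow_of_exponent_ge (x := 1 / (16 * (s : ℝ))) (by positivity) (by
          rw [div_le_one (by positivity)]; linarith) hp₁
        rwa [Real.rpow_one] at this
      linarith
    refine ⟨h i, ?_⟩
    -- No other heavy row is in the bucket of `i`, so everything else in it comes from light rows.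
    have hdec : bucketSum h X (fun i => U i ⬝ᵥ x) (h i)
        = (U i ⬝ᵥ x) * X i + bucketSum h X (fun i => ∑ j, UL i j * x j) (h i) := by
      have hULx : ∀ i', ∑ j, UL i' j * x j = if i' ∉ H then U i' ⬝ᵥ x else 0 := by
        intro i'
        by_cases hi' : i' ∈ H <;> simp [hUL, hi', dotProduct]
      simp only [bucketSum, hULx]
      have h1 : (U i ⬝ᵥ x) * X i = ∑ i', if i' = i then (U i' ⬝ᵥ x) * X i' else 0 := by simp
      rw [h1, ← Finset.sum_add_distrib]
      refine Finset.sum_congr rfl fun i' _ => ?_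
      by_cases h2 : i' = i
      · subst h2; simp [hi]
      · by_cases h3 : h i' = h i
        · have h4 : i' ∉ H := fun h4 => h2 (hh.heavy i' h4 i hi h3)
          simp [h2, h3, h4]
        · simp [h2, h3]
    have hnoise := abs_bucketSum_le h X UL x (h i) (abs_le_one_of_dotProduct hx) (g2 (h i))
    have hnoise' : (d : ℝ) * (1 * (d * t)) ≤ s ^ 2 * t := by
      calc (d : ℝ) * (1 * (d * t)) ≤ s * (1 * (s * t)) := by gcongr
        _ = _ := by ring
    -- This determines `γ`: the heavy entry times its multiplier is at least twice the noise bound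
    -- `s² t`.
    have hsig : 2 * (s ^ 2 * t) ≤ |(U i ⬝ᵥ x) * X i| := by
      rw [abs_mul]
      have h1 : 1 / (16 * s * γ) ≤ |U i ⬝ᵥ x| := by
        rw [div_le_iff₀ (by positivity)]
        rw [div_le_iff₀ (by positivity)] at hval
        linarith
      calc 2 * (s ^ 2 * t) = 1 / (16 * s * γ) * θ := by
            rw [hγ]; field_simp; norm_num
        _ ≤ _ := mul_le_mul h1 (g1 i hi).le hθ0.le (abs_nonneg _)
    rw [hdec]
    have h5 := abs_sub_abs_le_abs_sub ((U i ⬝ᵥ x) * X i)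
      (-bucketSum h X (fun i => ∑ j, UL i j * x j) (h i))
    rw [sub_neg_eq_add, abs_neg] at h5
    linarith

/-- Every nonzero vector is a positive multiple of a unit vector. -/
theorem exists_unit_smul {d : ℕ} (x : Fin d → ℝ) (hx : x ≠ 0) :
    ∃ (r : ℝ) (y : Fin d → ℝ), 0 < r ∧ y ⬝ᵥ y = 1 ∧ x = r • y := by
  have h0 : 0 < x ⬝ᵥ x := lt_of_le_of_ne (dotProduct_self_nonneg' x)
    (Ne.symm (by rwa [Ne, dotProduct_self_eq_zero]))
  have hs0 : 0 < √(x ⬝ᵥ x) := Real.sqrt_pos.2 h0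
  have hss : √(x ⬝ᵥ x) * √(x ⬝ᵥ x) = x ⬝ᵥ x := Real.mul_self_sqrt h0.le
  refine ⟨√(x ⬝ᵥ x), (√(x ⬝ᵥ x))⁻¹ • x, hs0, ?_, ?_⟩
  · rw [dotProduct_smul, smul_dotProduct, smul_eq_mul, smul_eq_mul]
    nth_rewrite 3 [← hss]
    field_simp
  · rw [smul_smul, mul_inv_cancel₀ hs0.ne', one_smul]

theorem eucPow_zero {p : ℝ} (hp : 0 < p) {d : ℕ} : eucPow p (0 : Fin d → ℝ) = 0 := by
  rw [eucPow, dotProduct_zero, Real.zero_rpow (by positivity)]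

/-- Homogeneity passes from unit vectors in the coordinates of `B` to all vectors. Since `γ, η ≤ 1`
and `s E² ≥ 1`, powers with exponent `p` or `p / 2` are replaced by squares or first powers, and the
constants do not involve `p`. -/
theorem IsHeavyBasis.distortion {p γ τ η E : ℝ} (hp₁ : 1 ≤ p) (hp₂ : p < 2) {n s d : ℕ}
    {A : Matrix (Fin n) (Fin d) ℝ} {H : Finset (Fin n)} {B : Matrix (Fin d) (Fin d) ℝ}
    (hb : IsHeavyBasis p γ τ A H B) (hγ : 0 < γ) (hγ₁ : γ ≤ 1) (hη : 0 < η) (hη₁ : η ≤ 1)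
    (hE : 1 ≤ s * E ^ 2) {h : Fin n → Fin s} {X : Fin n → ℝ}
    (hbd : ∀ x : Fin d → ℝ, x ⬝ᵥ x = 1 →
      (∃ k, η ≤ |bucketSum h X (fun i => (A * B) i ⬝ᵥ x) k|) ∧
        ∀ k, |bucketSum h X (fun i => (A * B) i ⬝ᵥ x) k| ≤ E) (z : Fin d → ℝ) :
    ∑ i, |(A *ᵥ z) i| ^ p ≤ d / (γ * η) ^ 2 * eucPow p (sketch h X A *ᵥ z) ∧
      eucPow p (sketch h X A *ᵥ z) ≤ 8 * (s * E ^ 2) * ∑ i, |(A *ᵥ z) i| ^ p := by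
  have hp0 : 0 < p := by linarith
  have hdet : IsUnit B.det := isUnit_iff_ne_zero.2 hb.det_pos.ne'
  set x := B⁻¹ *ᵥ z with hx
  have hz : z = B *ᵥ x := by
    rw [hx, Matrix.mulVec_mulVec, Matrix.mul_nonsing_inv _ hdet, Matrix.one_mulVec]
  have hAz : A *ᵥ z = fun i => (A * B) i ⬝ᵥ x := by
    rw [hz, Matrix.mulVec_mulVec]; rfl
  rw [sketch_mulVec, hAz]
  rcases eq_or_ne x 0 with h0 | h0
  · have e1 : (fun i => (A * B) i ⬝ᵥ x) = 0 := by rw [h0]; ext i; simp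
    have e2 : bucketSum h X 0 = 0 := by ext k; simp [bucketSum]
    have e3 : ∀ i, (A * B) i ⬝ᵥ x = 0 := fun i => congrFun e1 i
    rw [e1, e2, eucPow_zero hp0]
    simp [Real.zero_rpow hp0.ne']
  obtain ⟨r, y, hr, hy, hxy⟩ := exists_unit_smul x h0
  have hr' : 0 < r ^ p := Real.rpow_pos_of_pos hr _
  have ex : eucPow p x = r ^ p := by rw [hxy, eucPow_smul hr.le, eucPow_eq_one hy, mul_one]
  have eb : ∀ k, bucketSum h X (fun i => (A * B) i ⬝ᵥ x) k
      = r * bucketSum h X (fun i => (A * B) i ⬝ᵥ y) k := by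
    intro k
    simp only [bucketSum, Finset.mul_sum]
    refine Finset.sum_congr rfl fun i _ => ?_
    rw [hxy, dotProduct_smul, smul_eq_mul]
    split_ifs
    · ring
    · ring
  obtain ⟨⟨k, hk⟩, hup⟩ := hbd y hy
  have hsq : ∀ a : ℝ, 0 < a → a ≤ 1 → a ^ 2 ≤ a ^ p := by
    intro a ha ha1
    rw [← Real.rpow_natCast]
    exact Real.rpow_le_rpow_of_exponent_ge ha ha1 (by simpa using hp₂.le)
  constructor
  · have l1 : ∑ i, |(A * B) i ⬝ᵥ x| ^ p ≤ d / γ ^ p * r ^ p := by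
      calc _ ≤ ∑ i, eucPow p ((A * B) i) * eucPow p x :=
            Finset.sum_le_sum fun i _ => abs_dotProduct_rpow_le hp0.le _ _
        _ = (∑ i, eucPow p ((A * B) i)) * r ^ p := by rw [← Finset.sum_mul, ex]
        _ ≤ _ := by
            have := hb.sum_eucPow_le hp0.le hγ hγ₁
            gcongr
    have l2 : η ^ p * r ^ p ≤ eucPow p (bucketSum h X (fun i => (A * B) i ⬝ᵥ x)) := by
      refine le_trans ?_ (abs_entry_rpow_le hp0.le _ k)
      rw [eb k, abs_mul, abs_of_pos hr, mul_comm r, Real.mul_rpow (abs_nonneg _) hr.le]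
      gcongr
    have hγp : 0 < γ ^ p := Real.rpow_pos_of_pos hγ _
    have hηp : 0 < η ^ p := Real.rpow_pos_of_pos hη _
    calc _ ≤ d / γ ^ p * r ^ p := l1
      _ = d / (γ ^ p * η ^ p) * (η ^ p * r ^ p) := by field_simp
      _ ≤ d / (γ ^ 2 * η ^ 2) * (η ^ p * r ^ p) := by
          have h1 := hsq γ hγ hγ₁
          have h2 := hsq η hη hη₁
          gcongr
      _ = d / (γ * η) ^ 2 * (η ^ p * r ^ p) := by rw [mul_pow]
      _ ≤ _ := by gcongr
  · have u1 : r ^ p ≤ 8 * ∑ i, |(A * B) i ⬝ᵥ x| ^ p := by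
      rw [← ex]
      refine (hb.eucPow_le x).trans ?_
      gcongr with i
      have h1 : heavyWeight γ H i ≤ 1 := by unfold heavyWeight; split_ifs <;> linarith
      have h2 := Real.rpow_le_one (heavyWeight_nonneg hγ H i) h1 hp0.le
      have : 0 ≤ |(A * B) i ⬝ᵥ x| ^ p := by positivity
      nlinarith
    have u2 : eucPow p (bucketSum h X (fun i => (A * B) i ⬝ᵥ x)) ≤ s * E ^ 2 * r ^ p := by
      have : bucketSum h X (fun i => (A * B) i ⬝ᵥ x)
          = r • bucketSum h X (fun i => (A * B) i ⬝ᵥ y) := by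
        ext k; rw [eb k]; rfl
      rw [this, eucPow_smul hr.le, mul_comm]
      refine mul_le_mul_of_nonneg_right ?_ hr'.le
      have h3 : bucketSum h X (fun i => (A * B) i ⬝ᵥ y) ⬝ᵥ bucketSum h X (fun i => (A * B) i ⬝ᵥ y)
          ≤ s * E ^ 2 := by
        calc _ ≤ ∑ _k : Fin s, E ^ 2 := by
              refine Finset.sum_le_sum fun k _ => ?_
              rw [← sq, ← sq_abs]
              exact pow_le_pow_left₀ (abs_nonneg _) (hup k) 2
          _ = _ := by simp
      calc _ ≤ (s * E ^ 2) ^ (p / 2) := Real.rpow_le_rpow (dotProduct_self_nonneg' _) h3 (by positivity)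
        _ ≤ (s * E ^ 2) ^ (1 : ℝ) := Real.rpow_le_rpow_of_exponent_le hE (by linarith)
        _ = _ := Real.rpow_one _
    have : 0 ≤ s * E ^ 2 := by linarith
    calc _ ≤ s * E ^ 2 * r ^ p := u2
      _ ≤ s * E ^ 2 * (8 * ∑ i, |(A * B) i ⬝ᵥ x| ^ p) := by gcongr
      _ = _ := by ring

/-- The sparse embedding has polynomial distortion with high probability. -/
theorem sketch_distortion {p δ : ℝ} (hp₁ : 1 ≤ p) (hp₂ : p < 2) {n s d : ℕ} [NeZero s] (hd : 0 < d)
    {A : Matrix (Fin n) (Fin d) ℝ} (hA : ∀ x, A *ᵥ x = 0 → x = 0) (hδ : 0 < δ) (hδ₁ : δ ≤ 1)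
    (h1 : (8800 * d ^ 2 * Real.log (2560 * s ^ 6 / δ ^ 2)) ^ 2 ≤ δ * s)
    (h2 : 2200 * (d : ℝ) ^ 3 ≤ δ * s) :
    ((hashLaw n s).prod (stableVecLaw p n)).real
      {hX | ¬ ∀ z, ∑ i, |(A *ᵥ z) i| ^ p
            ≤ 10 ^ 30 * s ^ 37 / δ ^ 12 * eucPow p (sketch hX.1 hX.2 A *ᵥ z) ∧
          eucPow p (sketch hX.1 hX.2 A *ᵥ z)
            ≤ 10 ^ 30 * s ^ 37 / δ ^ 12 * ∑ i, |(A *ᵥ z) i| ^ p} ≤ 6 * δ := by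
  have hd0 : (1 : ℝ) ≤ d := by exact_mod_cast hd
  have hd3 : (d : ℝ) ≤ d ^ 3 := le_self_pow₀ hd0 (by norm_num)
  have hs0' : (0 : ℝ) ≤ s := by positivity
  have hds' : (d : ℝ) ≤ s := by nlinarith
  have hds : d ≤ s := by exact_mod_cast hds'
  have hs0 : (1 : ℝ) ≤ s := hd0.trans hds'
  have hs6 : (1 : ℝ) ≤ s ^ 6 := one_le_pow₀ hs0
  have hs12 : (1 : ℝ) ≤ s ^ 12 := one_le_pow₀ hs0
  have hδ2 : δ ^ 2 ≤ 1 := pow_le_one₀ hδ.le hδ₁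
  have hδ4 : δ ^ 4 ≤ 1 := pow_le_one₀ hδ.le hδ₁
  -- These are the values that the equations in `bucketSum_bounds` impose for `t = 4 s² / δ` and `θ
  -- = δ / (20 s)`.
  set γ : ℝ := δ ^ 2 / (2560 * s ^ 6) with hγ
  set η : ℝ := δ ^ 4 / (2560 * 20 * 1280 ^ 2 * s ^ 12) with hη
  set τ : ℝ := 1 / (2200 * d) with hτ
  have hγ0 : 0 < γ := by positivity
  have hη0 : 0 < η := by positivity
  have hτ0 : 0 < τ := by positivity
  have hγ1 : γ ≤ 1 / 2 := by
    rw [hγ, div_le_iff₀ (by positivity)]; linarith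
  have hη1 : η ≤ 1 := by
    rw [hη, div_le_one (by positivity)]; linarith
  obtain ⟨H, B, hb⟩ := exists_isHeavyBasis hp₁ hp₂.le hd hA hγ0 hγ1 hτ0
  have hHc : (H.card : ℝ) ≤ 8800 * d ^ 2 * Real.log (2560 * s ^ 6 / δ ^ 2) := by
    have := hb.card_le
    rw [hτ, hγ, one_div_div] at this
    field_simp at this
    linarith
  have hH2 : (H.card : ℝ) ^ 2 ≤ δ * s := le_trans (by gcongr) h1
  have hHs : H.card ≤ s := by
    have h3 : (H.card : ℝ) ^ 2 ≤ s := by nlinarith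
    have h4 : H.card ^ 2 ≤ s := by exact_mod_cast h3
    nlinarith
  have hgood := not_goodHash_le (s := s) hb hγ0 hτ0 hH2 (by
    rw [hτ]; field_simp; linarith)
  set t : ℝ := 4 * s ^ 2 / δ with ht
  have hbb : ∀ h : Fin n → Fin s, GoodHash p τ (A * B) H h → _ := fun h hh =>
    bucketSum_bounds (t := t) (θ := δ / (20 * s)) (η := η) hp₁ hp₂ hd hds hb hδ hδ₁ hτ ht rfl
      (by rw [hγ, ht]; field_simp; norm_num) (by rw [hη, ht, hγ]; field_simp; norm_num) hHs hh
  have hE1 : 1 ≤ s * (s ^ 2 * t / γ) ^ 2 := by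
    have : 1 ≤ s ^ 2 * t / γ := by
      rw [ht, hγ, le_div_iff₀ (by positivity), one_mul, div_le_iff₀ (by positivity), mul_div_assoc',
        div_mul_eq_mul_div, le_div_iff₀ hδ]
      have : δ ^ 2 * δ ≤ 1 := by nlinarith
      have : (1 : ℝ) ≤ s ^ 2 * (4 * s ^ 2) * (2560 * s ^ 6) := by
        have : (1 : ℝ) ≤ s ^ 10 := one_le_pow₀ hs0
        nlinarith
      linarith
    nlinarith
  set Bad : Set ((Fin n → Fin s) × (Fin n → ℝ)) := {hX | ¬ ∀ z, ∑ i, |(A *ᵥ z) i| ^ p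
            ≤ 10 ^ 30 * s ^ 37 / δ ^ 12 * eucPow p (sketch hX.1 hX.2 A *ᵥ z) ∧
          eucPow p (sketch hX.1 hX.2 A *ᵥ z)
            ≤ 10 ^ 30 * s ^ 37 / δ ^ 12 * ∑ i, |(A *ᵥ z) i| ^ p} with hBad
  -- The hash function is fixed first; for each good one the multipliers are bad with probability at
  -- most `4 δ`.
  have hsub : Bad ⊆ {h | ¬ GoodHash p τ (A * B) H h} ×ˢ Set.univ ∪
      {hX | GoodHash p τ (A * B) H hX.1 ∧ hX ∈ Bad} := by
    intro hX h
    by_cases hg : GoodHash p τ (A * B) H hX.1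
    · exact Or.inr ⟨hg, h⟩
    · exact Or.inl ⟨hg, trivial⟩
  have e1 : 8 * (s * (s ^ 2 * t / γ) ^ 2) ≤ 10 ^ 30 * s ^ 37 / δ ^ 12 := by
    rw [ht, hγ, le_div_iff₀ (by positivity)]
    have : 8 * (s * (s ^ 2 * (4 * s ^ 2 / δ) / (δ ^ 2 / (2560 * s ^ 6))) ^ 2) * δ ^ 12
        = 8 * 10240 ^ 2 * (δ ^ 6 * (s : ℝ) ^ 21) := by field_simp; norm_num
    rw [this]
    have h3 : δ ^ 6 ≤ 1 := pow_le_one₀ hδ.le hδ₁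
    have h4 : (s : ℝ) ^ 21 ≤ s ^ 37 := pow_le_pow_right₀ hs0 (by norm_num)
    have h5 : δ ^ 6 * (s : ℝ) ^ 21 ≤ 1 * s ^ 37 := by gcongr
    have h6 : (0 : ℝ) ≤ s ^ 37 := by positivity
    linarith
  -- This is the larger of the two distortions: `γ η` is of order `δ ^ 6 / s ^ 18`, which gives the
  -- powers `s ^ 37` and `δ ^ 12`, using `d ≤ s`.
  have e2 : d / (γ * η) ^ 2 ≤ 10 ^ 30 * s ^ 37 / δ ^ 12 := by
    have h3 : d / (γ * η) ^ 2 = (2560 ^ 2 * 20 * 1280 ^ 2) ^ 2 * (d * s ^ 36) / δ ^ 12 := by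
      rw [hγ, hη]; field_simp
    rw [h3]
    have h4 : (d : ℝ) * s ^ 36 ≤ s * s ^ 36 := by gcongr
    have h5 : ((2560 : ℝ) ^ 2 * 20 * 1280 ^ 2) ^ 2 * (d * s ^ 36) ≤ 10 ^ 30 * s ^ 37 := by
      calc _ ≤ (10 : ℝ) ^ 30 * (s * s ^ 36) := by gcongr; norm_num
        _ = _ := by ring
    exact div_le_div_of_nonneg_right h5 (by positivity)
  have hsec : ((hashLaw n s).prod (stableVecLaw p n)).real
      {hX | GoodHash p τ (A * B) H hX.1 ∧ hX ∈ Bad} ≤ 4 * δ := by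
    refine measureReal_prod_le_of_finite _ _ _ (by linarith) fun h => ?_
    by_cases hg : GoodHash p τ (A * B) H h
    · refine le_trans (measureReal_mono ?_) (hbb h hg)
      rintro X ⟨-, hX⟩ hcon
      refine hX fun z => ?_
      obtain ⟨g1, g2⟩ := hb.distortion hp₁ hp₂ hγ0 (by linarith) hη0 hη1 hE1 hcon z
      refine ⟨g1.trans ?_, g2.trans ?_⟩
      · exact mul_le_mul_of_nonneg_right e2 (eucPow_nonneg _ _)
      · exact mul_le_mul_of_nonneg_right e1 (Finset.sum_nonneg fun i _ => by positivity)
    · have : {X | (h, X) ∈ {hX | GoodHash p τ (A * B) H hX.1 ∧ hX ∈ Bad}} = ∅ := by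
        ext X; simp [hg]
      rw [this, measureReal_empty]; linarith
  calc _ ≤ _ := measureReal_mono hsub
    _ ≤ _ := measureReal_union_le _ _
    _ ≤ 2 * δ + 4 * δ := by
        refine add_le_add ?_ hsec
        rw [measureReal_prod_prod]
        simpa using hgood
    _ = _ := by ring

/-- The condition is implicit, as the logarithm contains the dimension `s` itself. With `w = s ^ (1
/ 5)`, the logarithm is at most `(a + 60) √w`, and `b d ≤ w`. So the left side is at most a constant
times `d ^ 4 w`, and `b d ^ 4 ≤ w ^ 4` gives `w ^ 5 = s` with a factor that a large `b` makes as
small as needed. -/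
theorem sq_log_le_of_pow_le {δ a b d s : ℝ} (hδ : 0 < δ) (ha : a = |Real.log (2560 / δ ^ 2)|)
    (hb1 : 1 ≤ b) (hbδ : 8800 ^ 2 * (a + 60) ^ 2 ≤ δ * b) (hd0 : 1 ≤ d) (hlow : b ^ 5 * d ^ 5 ≤ s) :
    (8800 * d ^ 2 * Real.log (2560 * s ^ 6 / δ ^ 2)) ^ 2 ≤ δ * s := by
  have ha0 : 0 ≤ a := ha ▸ abs_nonneg _
  have hb5 : b ≤ b ^ 5 := le_self_pow₀ hb1 (by norm_num)
  have hb4 : b ≤ b ^ 4 := le_self_pow₀ hb1 (by norm_num)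
  have hd5 : (1 : ℝ) ≤ d ^ 5 := one_le_pow₀ hd0
  have hs1 : (1 : ℝ) ≤ s := by nlinarith
  set w : ℝ := s ^ (1 / 5 : ℝ) with hw
  have hw5 : w ^ 5 = s := by
    rw [hw, ← Real.rpow_natCast, ← Real.rpow_mul (by linarith)]; norm_num
  have hw1 : 1 ≤ w := Real.one_le_rpow hs1 (by norm_num)
  have hbd : b * d ≤ w := by
    refine le_of_pow_le_pow_left₀ (n := 5) (by norm_num) (by linarith) ?_
    rw [mul_pow, hw5]; exact hlow
  have hsq1 : 1 ≤ √w := Real.one_le_sqrt.2 hw1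
  have hsq2 : √w * √w = w := Real.mul_self_sqrt (by linarith)
  have hl1 : Real.log s ≤ 10 * √w := by
    have h1 : s = √w ^ 10 := by
      rw [← hw5]; nth_rewrite 1 [← hsq2]; ring
    rw [h1, Real.log_pow]
    have := Real.log_le_sub_one_of_pos (show 0 < √w by linarith)
    push_cast; linarith
  have hL : Real.log (2560 * s ^ 6 / δ ^ 2) = Real.log (2560 / δ ^ 2) + 6 * Real.log s := by
    rw [mul_div_right_comm, Real.log_mul (by positivity) (by positivity), Real.log_pow]
    push_cast; ring
  have habs : |Real.log (2560 * s ^ 6 / δ ^ 2)| ≤ (a + 60) * √w := by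
    rw [hL]
    refine (abs_add_le _ _).trans ?_
    rw [← ha, abs_of_nonneg (by have := Real.log_nonneg hs1; linarith)]
    nlinarith
  have hL2 : Real.log (2560 * s ^ 6 / δ ^ 2) ^ 2 ≤ (a + 60) ^ 2 * w := by
    rw [← sq_abs]
    calc _ ≤ ((a + 60) * √w) ^ 2 := by gcongr
      _ = (a + 60) ^ 2 * (√w * √w) := by ring
      _ = _ := by rw [hsq2]
  have hd4 : b * d ^ 4 ≤ w ^ 4 := by
    calc b * d ^ 4 ≤ b ^ 4 * d ^ 4 := by gcongr
      _ = (b * d) ^ 4 := by ring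
      _ ≤ _ := by gcongr
  calc (8800 * d ^ 2 * Real.log (2560 * s ^ 6 / δ ^ 2)) ^ 2
      = 8800 ^ 2 * d ^ 4 * Real.log (2560 * s ^ 6 / δ ^ 2) ^ 2 := by ring
    _ ≤ 8800 ^ 2 * d ^ 4 * ((a + 60) ^ 2 * w) := by gcongr
    _ = (8800 ^ 2 * (a + 60) ^ 2) * (d ^ 4 * w) := by ring
    _ ≤ (δ * b) * (d ^ 4 * w) := by gcongr
    _ = δ * ((b * d ^ 4) * w) := by ring
    _ ≤ δ * (w ^ 4 * w) := by gcongr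
    _ = δ * s := by rw [← hw5]; ring

theorem exists_embedDim_bounds {δ : ℝ} (hδ : 0 < δ) : ∃ b : ℝ, 0 < b ∧ ∀ c : Constants, c.embed = b →
    ∀ d : ℕ, 0 < d →
      (8800 * d ^ 2 * Real.log (2560 * (embedDim c d : ℝ) ^ 6 / δ ^ 2)) ^ 2 ≤ δ * embedDim c d ∧
      2200 * (d : ℝ) ^ 3 ≤ δ * embedDim c d ∧ (embedDim c d : ℝ) ≤ (b + 2) * d ^ 10 := by
  set a := |Real.log (2560 / δ ^ 2)| with ha
  have ha0 : 0 ≤ a := abs_nonneg _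
  set b : ℝ := 1 + 8800 ^ 2 * (a + 60) ^ 2 / δ + 2200 / δ with hb
  have hx1 : 0 < 8800 ^ 2 * (a + 60) ^ 2 / δ := by positivity
  have hx2 : 0 < 2200 / δ := by positivity
  have hb1 : 1 ≤ b := by rw [hb]; linarith
  have hb5 : b ≤ b ^ 5 := le_self_pow₀ hb1 (by norm_num)
  clear_value b a
  -- A fifth power, so that the dimension is at least `(b d) ^ 5`. For the upper bound, `1 + log d ≤
  -- d` leads to the crude degree `10`.
  refine ⟨b ^ 5, by positivity, fun c hc d hd => ?_⟩
  have hd0 : (1 : ℝ) ≤ d := by exact_mod_cast hd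
  have hlog : 0 ≤ Real.log d := Real.log_nonneg hd0
  set s := embedDim c d with hs
  have hlow : b ^ 5 * (d : ℝ) ^ 5 ≤ s := by
    rw [hs, embedDim, hc]
    push_cast
    have h1 := Nat.le_ceil (b ^ 5 * (d : ℝ) ^ 5 * (1 + Real.log d) ^ 5)
    have h2 : (1 : ℝ) ≤ (1 + Real.log d) ^ 5 := one_le_pow₀ (by linarith)
    have h3 : 0 ≤ b ^ 5 * (d : ℝ) ^ 5 := by positivity
    nlinarith
  have hup : (s : ℝ) ≤ (b ^ 5 + 2) * d ^ 10 := by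
    rw [hs, embedDim, hc]
    push_cast
    have h1 := Nat.ceil_lt_add_one (a := b ^ 5 * (d : ℝ) ^ 5 * (1 + Real.log d) ^ 5) (by positivity)
    have h2 : (1 + Real.log d) ^ 5 ≤ (d : ℝ) ^ 5 := by
      have := Real.log_le_sub_one_of_pos (show (0 : ℝ) < d by linarith)
      gcongr; linarith
    have h3 : b ^ 5 * (d : ℝ) ^ 5 * (1 + Real.log d) ^ 5 ≤ b ^ 5 * (d : ℝ) ^ 5 * d ^ 5 := by gcongr
    have h4 : (1 : ℝ) ≤ d ^ 10 := one_le_pow₀ hd0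
    nlinarith
  refine ⟨?_, ?_, hup⟩
  · refine sq_log_le_of_pow_le hδ ha hb1 ?_ hd0 hlow
    have : δ * (8800 ^ 2 * (a + 60) ^ 2 / δ) = 8800 ^ 2 * (a + 60) ^ 2 := by field_simp
    rw [hb]; nlinarith
  · have h1 : 2200 ≤ δ * b := by
      have : δ * (2200 / δ) = 2200 := by field_simp
      rw [hb]; nlinarith
    calc 2200 * (d : ℝ) ^ 3 ≤ (δ * b) * d ^ 3 := by gcongr
      _ ≤ (δ * b ^ 5) * d ^ 5 := by
          gcongr
          norm_num
      _ = δ * (b ^ 5 * d ^ 5) := by ring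
      _ ≤ _ := by gcongr

/-- For a suitable constant in the dimension of the sparse embedding, its distortion is polynomial in `d`
with probability at least `1 - δ`. -/
theorem exists_embed_const {p δ : ℝ} (hp₁ : 1 ≤ p) (hp₂ : p < 2) (hδ : 0 < δ) (hδ₁ : δ ≤ 1) :
    ∃ b E : ℝ, 0 < b ∧ 1 ≤ E ∧ ∀ c : Constants, c.embed = b → ∀ n d : ℕ, 0 < d →
      (embedDim c d : ℝ) ≤ E * d ^ 370 ∧
      ∀ A : Matrix (Fin n) (Fin d) ℝ, (∀ x, A *ᵥ x = 0 → x = 0) →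
      ((hashLaw n (embedDim c d)).prod (stableVecLaw p n)).real
        {hX | ¬ ∀ z, ∑ i, |(A *ᵥ z) i| ^ p ≤ E * d ^ 370 * eucPow p (sketch hX.1 hX.2 A *ᵥ z) ∧
          eucPow p (sketch hX.1 hX.2 A *ᵥ z) ≤ E * d ^ 370 * ∑ i, |(A *ᵥ z) i| ^ p} ≤ δ := by
  -- The six terms of failure probability in `sketch_distortion` require `δ / 6`; the degree `370`
  -- is `37 * 10`.
  obtain ⟨b, hb, hbd⟩ := exists_embedDim_bounds (δ := δ / 6) (by positivity)
  have hb2 : (1 : ℝ) ≤ (b + 2) ^ 37 := one_le_pow₀ (by linarith)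
  have hb3 : b + 2 ≤ (b + 2) ^ 37 := le_self_pow₀ (by linarith) (by norm_num)
  have hδ6 : (δ / 6) ^ 12 ≤ 1 := pow_le_one₀ (by positivity) (by linarith)
  have hδ0 : (0 : ℝ) < (δ / 6) ^ 12 := by positivity
  have hE : (b + 2) ^ 37 ≤ 10 ^ 30 * (b + 2) ^ 37 / (δ / 6) ^ 12 := by
    rw [le_div_iff₀ hδ0]; nlinarith
  refine ⟨b, 10 ^ 30 * (b + 2) ^ 37 / (δ / 6) ^ 12, hb, hb2.trans hE, fun c hc n d hd => ?_⟩
  obtain ⟨h1, h2, h3⟩ := hbd c hc d hd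
  have hd0 : (1 : ℝ) ≤ d := by exact_mod_cast hd
  refine ⟨h3.trans ?_, fun A hA => ?_⟩
  · have : (d : ℝ) ^ 10 ≤ d ^ 370 := pow_le_pow_right₀ hd0 (by norm_num)
    gcongr
    exact hb3.trans hE
  · refine le_trans (measureReal_mono ?_) ((sketch_distortion hp₁ hp₂ hd hA (by positivity)
      (by linarith) h1 h2).trans (by linarith))
    intro hX hbad hgood
    have hs : (embedDim c d : ℝ) ^ 37 ≤ (b + 2) ^ 37 * d ^ 370 := by
      calc _ ≤ ((b + 2) * (d : ℝ) ^ 10) ^ 37 := by gcongr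
        _ = _ := by rw [mul_pow, ← pow_mul]
    have hle : 10 ^ 30 * (embedDim c d : ℝ) ^ 37 / (δ / 6) ^ 12
        ≤ 10 ^ 30 * (b + 2) ^ 37 / (δ / 6) ^ 12 * d ^ 370 := by
      rw [div_mul_eq_mul_div]
      refine div_le_div_of_nonneg_right ?_ hδ0.le
      linarith
    refine hbad fun z => ⟨(hgood z).1.trans ?_, (hgood z).2.trans ?_⟩
    · exact mul_le_mul_of_nonneg_right hle (eucPow_nonneg _ _)
    · exact mul_le_mul_of_nonneg_right hle (Finset.sum_nonneg fun i _ => by positivity)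

/-- A set whose sections over the values of a measurable function all have small measure. -/
theorem measureReal_section_le {α β γ : Type*} [MeasurableSpace α] [MeasurableSpace β]
    [MeasurableSpace γ] (μ : Measure α) [IsProbabilityMeasure μ] (ν : Measure β)
    [IsProbabilityMeasure ν] {f : α → γ} (hf : Measurable f) {S : Set (γ × β)}
    (hS : MeasurableSet S) {ε : ℝ} (hε : 0 ≤ ε) (h : ∀ c, ν.real {b | (c, b) ∈ S} ≤ ε) :
    (μ.prod ν).real {ab | (f ab.1, ab.2) ∈ S} ≤ ε := by
  have hm : MeasurableSet {ab : α × β | (f ab.1, ab.2) ∈ S} :=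
    ((hf.comp measurable_fst).prodMk measurable_snd) hS
  refine ENNReal.toReal_le_of_le_ofReal hε ?_
  rw [Measure.prod_apply hm]
  calc _ ≤ ∫⁻ _a, ENNReal.ofReal ε ∂μ := by
        refine lintegral_mono fun a => ?_
        rw [← ENNReal.ofReal_toReal (measure_ne_top ν _)]
        exact ENNReal.ofReal_le_ofReal (h (f a))
    _ = _ := by simp

/-! ### Comparison of seminorms on a net -/

/-- The seminorm `y ↦ (∑ i, c i * |U i ⬝ᵥ y| ^ p) ^ (1 / p)`. -/
noncomputable def weightedSeminorm {p : ℝ} (hp : 1 ≤ p) {n d : ℕ} (c : Fin n → ℝ) (hc : ∀ i, 0 ≤ c i)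
    (U : Fin n → Fin d → ℝ) : Seminorm ℝ (Fin d → ℝ) :=
  Seminorm.of (fun y => (∑ i, c i * |U i ⬝ᵥ y| ^ p) ^ (1 / p))
    (by
      have hp0 : 0 < p := by linarith
      have e : ∀ i (a : ℝ), c i * |a| ^ p = |c i ^ (1 / p) * a| ^ p := by
        intro i a
        rw [abs_mul, Real.mul_rpow (abs_nonneg _) (abs_nonneg _),
          abs_of_nonneg (Real.rpow_nonneg (hc i) _), ← Real.rpow_mul (hc i),
          one_div_mul_cancel hp0.ne', Real.rpow_one]
      intro x y
      simp only [e, dotProduct_add, mul_add]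
      exact Real.Lp_add_le Finset.univ _ _ hp)
    (by
      have hp0 : 0 < p := by linarith
      intro a y
      have e : ∑ i, c i * |U i ⬝ᵥ (a • y)| ^ p = |a| ^ p * ∑ i, c i * |U i ⬝ᵥ y| ^ p := by
        rw [Finset.mul_sum]
        refine Finset.sum_congr rfl fun i _ => ?_
        rw [dotProduct_smul, smul_eq_mul, abs_mul, Real.mul_rpow (abs_nonneg _) (abs_nonneg _)]
        ring
      rw [e, Real.mul_rpow (by positivity)
        (Finset.sum_nonneg fun i _ => mul_nonneg (hc i) (by positivity)),
        ← Real.rpow_mul (abs_nonneg a), mul_one_div_cancel hp0.ne', Real.rpow_one, Real.norm_eq_abs])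

theorem weightedSeminorm_apply {p : ℝ} (hp : 1 ≤ p) {n d : ℕ} (c : Fin n → ℝ) (hc : ∀ i, 0 ≤ c i)
    (U : Fin n → Fin d → ℝ) (y : Fin d → ℝ) :
    weightedSeminorm hp c hc U y = (∑ i, c i * |U i ⬝ᵥ y| ^ p) ^ (1 / p) := rfl

theorem seminorm_le_of_basis {d : ℕ} (N : Seminorm ℝ (Fin d → ℝ)) {D m : ℝ}
    (hD : ∀ j, N (Pi.single j 1) ≤ D) {y : Fin d → ℝ} (hy : ∀ j, |y j| ≤ m) : N y ≤ d * (m * D) := by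
  have e : y = ∑ j, y j • (Pi.single j 1 : Fin d → ℝ) := by
    ext k
    simp [Finset.sum_apply, Pi.single_apply]
  rw [e]
  calc _ ≤ ∑ j, N (y j • (Pi.single j 1 : Fin d → ℝ)) := by
        refine Finset.le_sum_of_subadditive _ (map_zero N).le (map_add_le_add N) _ _
    _ ≤ ∑ _j : Fin d, m * D := by
        refine Finset.sum_le_sum fun j _ => ?_
        rw [map_smul_eq_mul, Real.norm_eq_abs]
        exact mul_le_mul (hy j) (hD j) (apply_nonneg N _) ((abs_nonneg _).trans (hy j))
    _ = _ := by simp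

/-- Two seminorms that are close to each other on a net and on the standard basis are close everywhere. -/
theorem seminorm_close {d : ℕ} (N S : Seminorm ℝ (Fin d → ℝ)) {R D m ε : ℝ} (hε₀ : 0 < ε)
    (hε₁ : ε ≤ 1) (hR : ∀ y j, |y j| ≤ R * N y) (hD : ∀ j, N (Pi.single j 1) ≤ D)
    (hm : d * (m * D) ≤ ε / 8) (F : Finset (Fin d → ℝ))
    (hF : ∀ x : Fin d → ℝ, (∀ j, |x j| ≤ R) → ∃ x' ∈ F, ∀ j, |x j - x' j| ≤ m)
    (hFS : ∀ y ∈ F, |S y - N y| ≤ ε / 4 * N y)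
    (hbS : ∀ j, |S (Pi.single j 1) - N (Pi.single j 1)| ≤ ε / 4 * N (Pi.single j 1))
    (y : Fin d → ℝ) : |S y - N y| ≤ ε * N y := by
  rcases (apply_nonneg N y).eq_or_lt with h0 | h0
  · have : y = 0 := by
      ext j
      have := hR y j
      rw [← h0, mul_zero] at this
      exact abs_eq_zero.1 (le_antisymm this (abs_nonneg _))
    rw [this, map_zero, map_zero]; simp
  -- On the unit sphere of `N` the nearest net point is within `ε / 8` for `N`, and within `ε / 4`
  -- for `S`, because `S` is at most `2 D` on the standard basis.
  have key : ∀ y, N y = 1 → |S y - N y| ≤ ε := by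
    intro y hy
    obtain ⟨x, hx, hxy⟩ := hF y fun j => by simpa [hy] using hR y j
    have n1 : N (y - x) ≤ d * (m * D) := seminorm_le_of_basis N hD hxy
    have hSD : ∀ j, S (Pi.single j 1) ≤ 2 * D := fun j => by
      have h1 := (abs_le.1 (hbS j)).2
      have h2 := hD j
      have h3 := apply_nonneg N (Pi.single j 1 : Fin d → ℝ)
      nlinarith
    have s1 : S (y - x) ≤ d * (m * (2 * D)) := seminorm_le_of_basis S hSD hxy
    have n2 := abs_sub_map_le_sub N y x
    have s2 := abs_sub_map_le_sub S y x
    have hx1 := hFS x hx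
    have hNx : N x ≤ 2 := by linarith [(abs_le.1 n2).1]
    rw [abs_le] at *
    constructor <;> nlinarith
  have h1 := key ((N y)⁻¹ • y) (by
    rw [map_smul_eq_mul, Real.norm_eq_abs, abs_of_pos (inv_pos.2 h0), inv_mul_cancel₀ h0.ne'])
  rw [map_smul_eq_mul, map_smul_eq_mul, Real.norm_eq_abs, abs_of_pos (inv_pos.2 h0), ← mul_sub,
    abs_mul, abs_of_pos (inv_pos.2 h0), inv_mul_le_iff₀ h0] at h1
  linarith

/-- As `1 / p ≤ 1`, taking the root brings `1 ± ε` closer to `1`. -/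
theorem abs_rpow_inv_sub_le {p a b ε : ℝ} (hp : 1 ≤ p) (ha : 0 ≤ a) (hb : 0 ≤ b) (hε₀ : 0 ≤ ε)
    (hε₁ : ε ≤ 1) (h : |a - b| ≤ ε * b) : |a ^ (1 / p) - b ^ (1 / p)| ≤ ε * b ^ (1 / p) := by
  have hp0 : 0 < p := by linarith
  have hq : 1 / p ≤ 1 := by rw [div_le_one hp0]; exact hp
  have hq0 : 0 ≤ 1 / p := by positivity
  have hbp : 0 ≤ b ^ (1 / p) := Real.rpow_nonneg hb _
  rw [abs_le] at h ⊢
  have h1 : a ≤ (1 + ε) * b := by linarith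
  have h2 : (1 - ε) * b ≤ a := by linarith
  have g1 := Real.rpow_le_rpow ha h1 hq0
  have g2 := Real.rpow_le_rpow (by nlinarith) h2 hq0
  rw [Real.mul_rpow (by linarith) hb] at g1 g2
  have k1 : (1 + ε) ^ (1 / p) ≤ 1 + ε := by
    have := Real.rpow_le_rpow_of_exponent_le (show 1 ≤ 1 + ε by linarith) hq
    rwa [Real.rpow_one] at this
  have k2 : 1 - ε ≤ (1 - ε) ^ (1 / p) := by
    rcases (show 0 ≤ 1 - ε by linarith).eq_or_lt with h0 | h0
    · rw [← h0, Real.zero_rpow (by positivity)]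
    · have := Real.rpow_le_rpow_of_exponent_ge h0 (show 1 - ε ≤ 1 by linarith) hq
      rwa [Real.rpow_one] at this
  constructor <;> nlinarith

/-! ### Sampling probabilities -/

/-- `U` is a well-conditioned basis: `‖y‖₂ ^ p ≤ κ₁ ‖U y‖_p ^ p`, and the `p`-th powers of the Euclidean
norms of the rows of `U` add up to at most `κ₂`. -/
structure IsConditioned (p κ₁ κ₂ : ℝ) {n d : ℕ} (U : Fin n → Fin d → ℝ) : Prop where
  eucPow_le : ∀ y, eucPow p y ≤ κ₁ * ∑ i, |U i ⬝ᵥ y| ^ p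
  sum_le : ∑ i, eucPow p (U i) ≤ κ₂

/-- The estimate of the `p`-th power of the Euclidean norm of row `i` of `U`. -/
noncomputable def rowWeight (p : ℝ) {n d r : ℕ} (U : Fin n → Fin d → ℝ) (G : Fin d → Fin r → ℝ)
    (i : Fin n) : ℝ := rowScore G (U i) ^ (p / 2)

/-- The probability that row `i` is kept. -/
noncomputable def sampleProb (p σ : ℝ) {n d r : ℕ} (U : Fin n → Fin d → ℝ) (G : Fin d → Fin r → ℝ)
    (i : Fin n) : ℝ := min 1 (σ * rowWeight p U G i / ∑ j, rowWeight p U G j)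

theorem rowWeight_nonneg (p : ℝ) {n d r : ℕ} (U : Fin n → Fin d → ℝ) (G : Fin d → Fin r → ℝ)
    (i : Fin n) : 0 ≤ rowWeight p U G i := Real.rpow_nonneg (rowScore_nonneg _ _) _

theorem sum_rowWeight_nonneg (p : ℝ) {n d r : ℕ} (U : Fin n → Fin d → ℝ) (G : Fin d → Fin r → ℝ) :
    0 ≤ ∑ i, rowWeight p U G i := Finset.sum_nonneg fun i _ => rowWeight_nonneg p U G i

theorem sampleProb_nonneg {p σ : ℝ} (hσ : 0 ≤ σ) {n d r : ℕ} (U : Fin n → Fin d → ℝ)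
    (G : Fin d → Fin r → ℝ) (i : Fin n) : 0 ≤ sampleProb p σ U G i :=
  le_min zero_le_one (div_nonneg (mul_nonneg hσ (rowWeight_nonneg _ _ _ _)) (sum_rowWeight_nonneg _ _ _))

theorem sampleProb_le_one (p σ : ℝ) {n d r : ℕ} (U : Fin n → Fin d → ℝ)
    (G : Fin d → Fin r → ℝ) (i : Fin n) : sampleProb p σ U G i ≤ 1 := min_le_left _ _

theorem sum_sampleProb_le {p σ : ℝ} (hσ : 0 ≤ σ) {n d r : ℕ} (U : Fin n → Fin d → ℝ)
    (G : Fin d → Fin r → ℝ) : ∑ i, sampleProb p σ U G i ≤ σ := by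
  calc _ ≤ ∑ i, σ * rowWeight p U G i / ∑ j, rowWeight p U G j :=
        Finset.sum_le_sum fun i _ => min_le_right _ _
    _ = σ * ((∑ i, rowWeight p U G i) / ∑ j, rowWeight p U G j) := by
        rw [← Finset.sum_div, ← Finset.mul_sum, mul_div_assoc]
    _ ≤ σ * 1 := by gcongr; exact div_self_le_one _
    _ = σ := mul_one σ

/-- The Gaussian matrix gives good estimates of the row norms. -/
structure GoodScores (p a κ : ℝ) {n d r : ℕ} (U : Fin n → Fin d → ℝ) (G : Fin d → Fin r → ℝ) : Prop where
  le_rowScore : ∀ i, 1 / 60 * (r * (U i ⬝ᵥ U i)) ≤ rowScore G (U i)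
  sum_le : ∑ i, rowWeight p U G i ≤ a * (r : ℝ) ^ (p / 2) * κ

/-- A union bound over the `n` rows for the lower tail, which is why the number of columns grows
like `log n`, and Markov's inequality for the sum. -/
theorem not_goodScores_le {p δ κ : ℝ} (hp₀ : 0 < p) (hp₂ : p ≤ 2) {n d r : ℕ} (hr : 0 < r)
    (hκ : 0 < κ) (hδ : 0 < δ) (hrδ : n * Real.exp (-r) ≤ δ) {U : Fin n → Fin d → ℝ}
    (hU : ∑ i, eucPow p (U i) ≤ κ) :
    (gaussianMatrixLaw d r).real {G | ¬ GoodScores p (2 / δ) κ U G} ≤ 2 * δ := by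
  have hr0 : (0 : ℝ) < (r : ℝ) ^ (p / 2) := Real.rpow_pos_of_pos (by exact_mod_cast hr) _
  have h1 := measureReal_iUnion_finset_le (μ := gaussianMatrixLaw d r) (ε := Real.exp (-r)) Finset.univ
    (fun i : Fin n => {G : Fin d → Fin r → ℝ | rowScore G (U i) < 1 / 60 * (r * (U i ⬝ᵥ U i))})
    (fun i _ => rowScore_lower_tail _)
  rw [Finset.card_univ, Fintype.card_fin] at h1
  have hint : Integrable (fun G => ∑ i, rowWeight p U G i) (gaussianMatrixLaw d r) :=
    integrable_finsetSum _ fun i _ => (integral_rowScore_rpow_le hp₀ hp₂ (U i)).1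
  have hexp : ∫ G, ∑ i, rowWeight p U G i ∂(gaussianMatrixLaw d r) ≤ 2 * (r : ℝ) ^ (p / 2) * κ := by
    have e := integral_finsetSum (μ := gaussianMatrixLaw d r) Finset.univ
      fun (i : Fin n) _ => (integral_rowScore_rpow_le hp₀ hp₂ (U i)).1
    refine (le_of_eq e).trans ?_
    calc _ ≤ ∑ i, 2 * (r : ℝ) ^ (p / 2) * eucPow p (U i) :=
          Finset.sum_le_sum fun i _ => (integral_rowScore_rpow_le hp₀ hp₂ (U i)).2
      _ = 2 * (r : ℝ) ^ (p / 2) * ∑ i, eucPow p (U i) := by rw [Finset.mul_sum]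
      _ ≤ _ := by gcongr
  set b := 2 / δ * (r : ℝ) ^ (p / 2) * κ with hb
  have hb0 : 0 < b := by positivity
  have h2 : (gaussianMatrixLaw d r).real {G | b ≤ ∑ i, rowWeight p U G i} ≤ δ := by
    have := mul_meas_ge_le_integral_of_nonneg
      (Filter.Eventually.of_forall fun G => sum_rowWeight_nonneg p U G) hint b
    have h3 : b * (gaussianMatrixLaw d r).real {G | b ≤ ∑ i, rowWeight p U G i} ≤ b * δ := by
      refine this.trans (hexp.trans (le_of_eq ?_))
      rw [hb]; field_simp
    exact le_of_mul_le_mul_left h3 hb0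
  refine le_trans (measureReal_mono (s₂ := {G | ∃ i ∈ Finset.univ, G ∈
    {G : Fin d → Fin r → ℝ | rowScore G (U i) < 1 / 60 * (r * (U i ⬝ᵥ U i))}} ∪
    {G | b ≤ ∑ i, rowWeight p U G i}) ?_) ?_
  · intro G hG
    by_contra hcon
    simp only [Set.mem_union, not_or, Set.mem_ofPred_eq, not_exists, not_and, not_lt, not_le] at hcon
    exact hG ⟨fun i => hcon.1 i (Finset.mem_univ _), hcon.2.le⟩
  · refine (measureReal_union_le _ _).trans ?_
    linarith

/-- Only a lower bound for the score of row `i` and an upper bound for the sum of all scores enter.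
The factor `r ^ (p / 2)` is in both and cancels. -/
theorem le_sampleProb {p σ a κ : ℝ} (hp₁ : 1 ≤ p) (hp₂ : p ≤ 2) {n d r : ℕ} (hr : 0 < r)
    (hσ : 0 < σ) (ha : 0 < a) (hκ : 0 < κ) {U : Fin n → Fin d → ℝ} {G : Fin d → Fin r → ℝ}
    (hG : GoodScores p a κ U G) {i : Fin n} (hi : U i ≠ 0) :
    0 < sampleProb p σ U G i ∧ (sampleProb p σ U G i < 1 →
      σ * eucPow p (U i) / (60 * a * κ) ≤ sampleProb p σ U G i) := by
  have hr0 : (0 : ℝ) < r := by exact_mod_cast hr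
  have hrp : (0 : ℝ) < (r : ℝ) ^ (p / 2) := Real.rpow_pos_of_pos hr0 _
  have hu : 0 < U i ⬝ᵥ U i := lt_of_le_of_ne (dotProduct_self_nonneg' _)
    (Ne.symm (by rwa [Ne, dotProduct_self_eq_zero]))
  have hlow : 1 / 60 * ((r : ℝ) ^ (p / 2) * eucPow p (U i)) ≤ rowWeight p U G i := by
    have h1 : (1 / 60 * (r * (U i ⬝ᵥ U i))) ^ (p / 2) ≤ rowWeight p U G i :=
      Real.rpow_le_rpow (by positivity) (hG.le_rowScore i) (by linarith)
    refine le_trans ?_ h1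
    rw [Real.mul_rpow (by norm_num) (by positivity), Real.mul_rpow hr0.le hu.le]
    have h2 : (1 / 60 : ℝ) ≤ (1 / 60) ^ (p / 2) := by
      have := Real.rpow_le_rpow_of_exponent_ge (x := 1 / 60) (by norm_num) (by norm_num)
        (show p / 2 ≤ 1 by linarith)
      rwa [Real.rpow_one] at this
    have h3 : 0 ≤ (r : ℝ) ^ (p / 2) * eucPow p (U i) := mul_nonneg hrp.le (eucPow_nonneg _ _)
    exact mul_le_mul_of_nonneg_right h2 h3
  have he : 0 < eucPow p (U i) := Real.rpow_pos_of_pos hu _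
  have hpos : 0 < rowWeight p U G i := lt_of_lt_of_le (by positivity) hlow
  have hsum : 0 < ∑ j, rowWeight p U G j := lt_of_lt_of_le hpos
    (Finset.single_le_sum (f := rowWeight p U G) (fun j _ => rowWeight_nonneg p U G j)
      (Finset.mem_univ i))
  constructor
  · exact lt_min one_pos (div_pos (mul_pos hσ hpos) hsum)
  · intro hlt
    have : sampleProb p σ U G i = σ * rowWeight p U G i / ∑ j, rowWeight p U G j := by
      unfold sampleProb at hlt ⊢
      rcases min_lt_iff.1 hlt with h | h
      · exact absurd h (lt_irrefl _)
      · exact min_eq_right h.le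
    have h60 : 0 < 60 * a * κ := by positivity
    rw [this, div_le_div_iff₀ h60 hsum]
    have h1 := mul_le_mul_of_nonneg_left hG.sum_le (mul_pos hσ he).le
    have h2 := mul_le_mul_of_nonneg_right (mul_le_mul_of_nonneg_left hlow hσ.le) h60.le
    refine h1.trans (le_trans (le_of_eq ?_) h2)
    ring

/-- The outcome of sampling with probabilities `q`: the `p`-th powers of the norms of the vectors in `F`
are preserved up to the factor `1 ± ε`, and less than `b` rows are kept. -/
structure GoodSample (p ε b : ℝ) {n d : ℕ} (F : Finset (Fin d → ℝ)) (U : Fin n → Fin d → ℝ)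
    (q x : Fin n → ℝ) : Prop where
  close : ∀ y ∈ F, |sampleSum q (fun i => |U i ⬝ᵥ y| ^ p) x - ∑ i, |U i ⬝ᵥ y| ^ p|
    ≤ ε * ∑ i, |U i ⬝ᵥ y| ^ p
  card_lt : ∑ i, (if x i < q i then (1 : ℝ) else 0) < b

theorem sampleSum_congr {n : ℕ} {q q' v x : Fin n → ℝ} (h : ∀ i, v i ≠ 0 → q i = q' i) :
    sampleSum q v x = sampleSum q' v x := by
  refine Finset.sum_congr rfl fun i _ => ?_
  rcases eq_or_ne (v i) 0 with h0 | h0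
  · rw [h0, mul_zero, mul_zero]
  · rw [h i h0]

theorem not_goodSample_le {p σ δ ε κ₁ κ₂ : ℝ} (hp₁ : 1 ≤ p) (hp₂ : p ≤ 2) (hκ₁ : 0 < κ₁) (hκ₂ : 0 < κ₂)
    (hσ : 0 < σ) (hδ : 0 < δ) (hε₀ : 0 < ε) (hε₁ : ε ≤ 1) {n d r : ℕ} (hr : 0 < r)
    {F : Finset (Fin d → ℝ)}
    (hF : F.card * (2 * Real.exp (-(ε ^ 2 * (δ * σ) / (480 * (κ₁ * κ₂))))) ≤ δ)
    {U : Fin n → Fin d → ℝ} (hU : IsConditioned p κ₁ κ₂ U) {G : Fin d → Fin r → ℝ}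
    (hG : GoodScores p (2 / δ) κ₂ U G) :
    (uniformLaw n).real {x | ¬ GoodSample p ε (σ / δ) F U (sampleProb p σ U G) x} ≤ 2 * δ := by
  classical
  have hp0 : 0 < p := by linarith
  set q := sampleProb p σ U G with hq
  -- A zero row of `U` may have probability zero, whereas the Chernoff bound needs positive ones.
  -- Such rows contribute nothing, so their probabilities can be changed to `1`.
  set q' : Fin n → ℝ := fun i => if U i = 0 then 1 else q i with hq'
  have ha : 0 < 2 / δ := by positivity
  have key := fun i (hi : U i ≠ 0) => le_sampleProb hp₁ hp₂ hr hσ ha hκ₂ hG hi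
  have hq'0 : ∀ i, 0 < q' i := by
    intro i; simp only [hq']; split_ifs with hi
    · exact one_pos
    · exact (key i hi).1
  have hq'1 : ∀ i, q' i ≤ 1 := by
    intro i; simp only [hq']; split_ifs with hi
    · exact le_rfl
    · exact sampleProb_le_one _ _ _ _ _
  -- The relative contribution of a row is at most `κ₁ ‖U i‖₂ ^ p`, and its probability, if below
  -- `1`, is at least `σ ‖U i‖₂ ^ p / (60 (2 / δ) κ₂)`; `ρ` bounds the quotient.
  set ρ := 120 * (κ₁ * κ₂) / (δ * σ) with hρ
  have hρ0 : 0 < ρ := by positivity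
  have h1 := measureReal_iUnion_finset_le (μ := uniformLaw n)
    (ε := 2 * Real.exp (-(ε ^ 2 / (4 * ρ)))) F
    (fun y => {x | ε * ∑ i, |U i ⬝ᵥ y| ^ p < |sampleSum q' (fun i => |U i ⬝ᵥ y| ^ p) x -
      ∑ i, |U i ⬝ᵥ y| ^ p|}) (fun y _ => by
      refine sampleSum_tail hq'0 hq'1 (fun i => by positivity) hρ0 hε₀ hε₁ fun i hi => ?_
      simp only [hq'] at hi ⊢
      split_ifs at hi ⊢ with hi0
      · exact absurd hi (lt_irrefl _)
      have k1 := (key i hi0).2 hi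
      have hV : 0 ≤ ∑ j, |U j ⬝ᵥ y| ^ p := Finset.sum_nonneg fun j _ => by positivity
      calc |U i ⬝ᵥ y| ^ p ≤ eucPow p (U i) * eucPow p y := abs_dotProduct_rpow_le hp0.le _ _
        _ ≤ eucPow p (U i) * (κ₁ * ∑ j, |U j ⬝ᵥ y| ^ p) :=
            mul_le_mul_of_nonneg_left (hU.eucPow_le y) (eucPow_nonneg _ _)
        _ = ρ * (∑ j, |U j ⬝ᵥ y| ^ p) * (σ * eucPow p (U i) / (60 * (2 / δ) * κ₂)) := by
            rw [hρ]; field_simp; ring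
        _ ≤ _ := mul_le_mul_of_nonneg_left k1 (mul_nonneg hρ0.le hV))
  have h2 := sample_card_tail (q := q) (fun i => sampleProb_nonneg hσ.le U G i)
    (fun i => sampleProb_le_one _ _ _ _ _) (show 0 < σ / δ by positivity)
  have h3 : (∑ i, q i) / (σ / δ) ≤ δ := by
    rw [div_le_iff₀ (by positivity), mul_div_cancel₀ _ hδ.ne']
    exact sum_sampleProb_le hσ.le U G
  have h4 : ε ^ 2 / (4 * ρ) = ε ^ 2 * (δ * σ) / (480 * (κ₁ * κ₂)) := by
    rw [hρ]; field_simp; norm_num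
  rw [h4] at h1
  refine le_trans (measureReal_mono (s₂ := {x | ∃ y ∈ F, x ∈
    {x | ε * ∑ i, |U i ⬝ᵥ y| ^ p < |sampleSum q' (fun i => |U i ⬝ᵥ y| ^ p) x -
      ∑ i, |U i ⬝ᵥ y| ^ p|}} ∪ {x | σ / δ ≤ ∑ i, if x i < q i then (1 : ℝ) else 0}) ?_)
    ((measureReal_union_le _ _).trans (by linarith))
  intro x hx
  by_contra hcon
  simp only [Set.mem_union, not_or, Set.mem_ofPred_eq, not_exists, not_and, not_lt, not_le] at hcon
  refine hx ⟨fun y hy => ?_, hcon.2⟩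
  have := hcon.1 y hy
  rwa [sampleSum_congr (q' := q)] at this
  intro i hi
  have : U i ≠ 0 := by
    intro h0
    rw [h0] at hi
    simp [Real.zero_rpow hp0.ne'] at hi
  simp [hq', this]

/-- Closedness provides measurability although the condition is an intersection over uncountably
many `y`. -/
theorem isClosed_isConditioned {p κ₁ κ₂ : ℝ} (hp : 0 < p) {n d : ℕ} :
    IsClosed {U : Fin n → Fin d → ℝ | IsConditioned p κ₁ κ₂ U} := by
  have e : {U : Fin n → Fin d → ℝ | IsConditioned p κ₁ κ₂ U}
      = (⋂ y, {U | eucPow p y ≤ κ₁ * ∑ i, |U i ⬝ᵥ y| ^ p}) ∩ {U | ∑ i, eucPow p (U i) ≤ κ₂} := by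
    ext U
    simp only [Set.mem_ofPred_eq, Set.mem_inter_iff, Set.mem_iInter]
    exact ⟨fun h => ⟨h.1, h.2⟩, fun h => ⟨h.1, h.2⟩⟩
  rw [e]
  have hdot : ∀ (i : Fin n) (y : Fin d → ℝ), Continuous fun U : Fin n → Fin d → ℝ => U i ⬝ᵥ y := by
    intro i y; simp only [dotProduct]; fun_prop
  refine (isClosed_iInter fun y => isClosed_le continuous_const ?_).inter (isClosed_le ?_ continuous_const)
  · refine continuous_const.mul (continuous_finsetSum _ fun i _ => ?_)
    exact (hdot i y).abs.rpow_const fun _ => Or.inr hp.le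
  · refine continuous_finsetSum _ fun i _ => ?_
    exact continuous_eucPow hp.le (continuous_apply i)

theorem measurable_rowWeight {α : Type*} [MeasurableSpace α] {p : ℝ} {n d r : ℕ}
    {U : α → Fin n → Fin d → ℝ} {G : α → Fin d → Fin r → ℝ} (hU : Measurable U) (hG : Measurable G)
    (i : Fin n) : Measurable fun a => rowWeight p (U a) (G a) i := by
  have hU' : ∀ j, Measurable fun a => U a i j := fun j =>
    (measurable_pi_apply j).comp ((measurable_pi_apply i).comp hU)
  have hG' : ∀ j k, Measurable fun a => G a j k := fun j k =>
    (measurable_pi_apply k).comp ((measurable_pi_apply j).comp hG)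
  unfold rowWeight rowScore
  exact Measurable.pow_const (Finset.measurable_sum _ fun k _ => Measurable.pow_const
    (Finset.measurable_sum _ fun j _ => (hU' j).mul (hG' j k)) _) _

theorem measurable_sampleProb {α : Type*} [MeasurableSpace α] {p σ : ℝ} {n d r : ℕ}
    {U : α → Fin n → Fin d → ℝ} {G : α → Fin d → Fin r → ℝ} (hU : Measurable U) (hG : Measurable G)
    (i : Fin n) : Measurable fun a => sampleProb p σ (U a) (G a) i := by
  unfold sampleProb
  exact measurable_const.min (((measurable_rowWeight hU hG i).const_mul σ).div
    (Finset.measurable_sum _ fun j _ => measurable_rowWeight hU hG j))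

theorem measurableSet_goodSample {p σ ε b : ℝ} {n d r : ℕ} (F : Finset (Fin d → ℝ)) :
    MeasurableSet {z : (Fin n → Fin d → ℝ) × ((Fin d → Fin r → ℝ) × (Fin n → ℝ)) |
      GoodSample p ε b F z.1 (sampleProb p σ z.1 z.2.1) z.2.2} := by
  have hq : ∀ i, Measurable fun z : (Fin n → Fin d → ℝ) × ((Fin d → Fin r → ℝ) × (Fin n → ℝ)) =>
      sampleProb p σ z.1 z.2.1 i := fun i =>
    measurable_sampleProb measurable_fst (measurable_fst.comp measurable_snd) i
  have hx : ∀ i, Measurable fun z : (Fin n → Fin d → ℝ) × ((Fin d → Fin r → ℝ) × (Fin n → ℝ)) =>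
      z.2.2 i := fun i => by fun_prop
  have hlt : ∀ i, MeasurableSet {z : (Fin n → Fin d → ℝ) × ((Fin d → Fin r → ℝ) × (Fin n → ℝ)) |
      z.2.2 i < sampleProb p σ z.1 z.2.1 i} := fun i => measurableSet_lt (hx i) (hq i)
  have hv : ∀ (i : Fin n) (y : Fin d → ℝ), Measurable fun z : (Fin n → Fin d → ℝ) ×
      ((Fin d → Fin r → ℝ) × (Fin n → ℝ)) => |z.1 i ⬝ᵥ y| ^ p := by
    intro i y; simp only [dotProduct]; fun_prop
  have hV : ∀ (y : Fin d → ℝ), Measurable fun z : (Fin n → Fin d → ℝ) ×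
      ((Fin d → Fin r → ℝ) × (Fin n → ℝ)) => ∑ i, |z.1 i ⬝ᵥ y| ^ p :=
    fun y => Finset.measurable_sum _ fun i _ => hv i y
  have e : {z : (Fin n → Fin d → ℝ) × ((Fin d → Fin r → ℝ) × (Fin n → ℝ)) |
      GoodSample p ε b F z.1 (sampleProb p σ z.1 z.2.1) z.2.2} =
      (⋂ y ∈ F, {z | |sampleSum (sampleProb p σ z.1 z.2.1) (fun i => |z.1 i ⬝ᵥ y| ^ p) z.2.2
        - ∑ i, |z.1 i ⬝ᵥ y| ^ p| ≤ ε * ∑ i, |z.1 i ⬝ᵥ y| ^ p}) ∩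
      {z | ∑ i, (if z.2.2 i < sampleProb p σ z.1 z.2.1 i then (1 : ℝ) else 0) < b} := by
    ext z
    simp only [Set.mem_ofPred_eq, Set.mem_inter_iff, Set.mem_iInter]
    exact ⟨fun h => ⟨h.1, h.2⟩, fun h => ⟨h.1, h.2⟩⟩
  rw [e]
  refine (Finset.measurableSet_biInter F fun y _ => measurableSet_le (Measurable.abs (Measurable.sub
    ?_ (hV y))) ((hV y).const_mul ε)).inter (measurableSet_lt ?_ measurable_const)
  · unfold sampleSum
    exact Finset.measurable_sum _ fun i _ =>
      (Measurable.ite (hlt i) (hq i).inv measurable_const).mul (hv i y)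
  · exact Finset.measurable_sum _ fun i _ => Measurable.ite (hlt i) measurable_const measurable_const

theorem measurableSet_goodScores {p a κ : ℝ} {n d r : ℕ} (U : Fin n → Fin d → ℝ) :
    MeasurableSet {G : Fin d → Fin r → ℝ | GoodScores p a κ U G} := by
  have e : {G : Fin d → Fin r → ℝ | GoodScores p a κ U G} =
      (⋂ i, {G | 1 / 60 * (r * (U i ⬝ᵥ U i)) ≤ rowScore G (U i)}) ∩
      {G | ∑ i, rowWeight p U G i ≤ a * (r : ℝ) ^ (p / 2) * κ} := by
    ext z
    simp only [Set.mem_ofPred_eq, Set.mem_inter_iff, Set.mem_iInter]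
    exact ⟨fun h => ⟨h.1, h.2⟩, fun h => ⟨h.1, h.2⟩⟩
  rw [e]
  refine (MeasurableSet.iInter fun i => measurableSet_le measurable_const
    (measurable_rowScore _)).inter (measurableSet_le ?_ measurable_const)
  exact Finset.measurable_sum _ fun i _ => (measurable_rowScore (U i)).pow_const _

theorem sample_section_le {p σ δ ε κ₁ κ₂ : ℝ} (hp₁ : 1 ≤ p) (hp₂ : p ≤ 2) (hκ₁ : 0 < κ₁)
    (hκ₂ : 0 < κ₂) (hσ : 0 < σ) (hδ : 0 < δ) (hε₀ : 0 < ε) (hε₁ : ε ≤ 1) {n d r : ℕ} (hr : 0 < r)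
    (hrδ : n * Real.exp (-r) ≤ δ) {F : Finset (Fin d → ℝ)}
    (hF : F.card * (2 * Real.exp (-(ε ^ 2 * (δ * σ) / (480 * (κ₁ * κ₂))))) ≤ δ)
    {U : Fin n → Fin d → ℝ} (hU : IsConditioned p κ₁ κ₂ U) :
    ((gaussianMatrixLaw d r).prod (uniformLaw n)).real
      {Gx | ¬ GoodSample p ε (σ / δ) F U (sampleProb p σ U Gx.1) Gx.2} ≤ 4 * δ := by
  have hgood := not_goodScores_le (n := n) (by linarith) hp₂ hr hκ₂ hδ hrδ hU.sum_le
  have hm : MeasurableSet {Gx : (Fin d → Fin r → ℝ) × (Fin n → ℝ) | GoodScores p (2 / δ) κ₂ U Gx.1 ∧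
      ¬ GoodSample p ε (σ / δ) F U (sampleProb p σ U Gx.1) Gx.2} :=
    (measurable_fst (measurableSet_goodScores U)).inter
      ((measurable_const.prodMk measurable_id) (measurableSet_goodSample F)).compl
  have hsec := measureReal_section_le (gaussianMatrixLaw d r) (uniformLaw n) measurable_id hm
    (show 0 ≤ 2 * δ by linarith) fun G => by
      by_cases hG : GoodScores p (2 / δ) κ₂ U G
      · refine le_trans (measureReal_mono fun x hx => ?_)
          (not_goodSample_le hp₁ hp₂ hκ₁ hκ₂ hσ hδ hε₀ hε₁ hr hF hU hG)
        exact hx.2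
      · have : {x : Fin n → ℝ | (G, x) ∈ {Gx : (Fin d → Fin r → ℝ) × (Fin n → ℝ) |
            GoodScores p (2 / δ) κ₂ U Gx.1 ∧
              ¬ GoodSample p ε (σ / δ) F U (sampleProb p σ U Gx.1) Gx.2}} = ∅ := by
          ext x; simp [hG]
        rw [this, measureReal_empty]; linarith
  refine le_trans (measureReal_mono (s₂ := {G | ¬ GoodScores p (2 / δ) κ₂ U G} ×ˢ Set.univ ∪
    {Gx : (Fin d → Fin r → ℝ) × (Fin n → ℝ) | GoodScores p (2 / δ) κ₂ U Gx.1 ∧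
      ¬ GoodSample p ε (σ / δ) F U (sampleProb p σ U Gx.1) Gx.2}) ?_)
    ((measureReal_union_le _ _).trans ?_)
  · intro Gx h
    by_cases hG : GoodScores p (2 / δ) κ₂ U Gx.1
    · exact Or.inr ⟨hG, h⟩
    · exact Or.inl ⟨hG, trivial⟩
  · rw [measureReal_prod_prod]
    simp only [probReal_univ, mul_one]
    have h5 : ((gaussianMatrixLaw d r).prod (uniformLaw n)).real
      {Gx : (Fin d → Fin r → ℝ) × (Fin n → ℝ) | GoodScores p (2 / δ) κ₂ U Gx.1 ∧
      ¬ GoodSample p ε (σ / δ) F U (sampleProb p σ U Gx.1) Gx.2} ≤ 2 * δ := hsec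
    linarith

/-- A good sample of a well-conditioned basis, for a fine net, is an embedding. -/
theorem GoodSample.embedding {p ε b κ₁ κ₂ m : ℝ} (hp₁ : 1 ≤ p) (hκ₁ : 1 ≤ κ₁)
    (hκ₂ : 1 ≤ κ₂) (hε₀ : 0 < ε) (hε₁ : ε ≤ 1) {n d : ℕ} (hm : d * (m * κ₂) ≤ ε / 8)
    {F : Finset (Fin d → ℝ)} (hb : ∀ j, Pi.single j 1 ∈ F)
    (hF : ∀ x : Fin d → ℝ, (∀ j, |x j| ≤ κ₁) → ∃ x' ∈ F, ∀ j, |x j - x' j| ≤ m)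
    {U : Fin n → Fin d → ℝ} (hU : IsConditioned p κ₁ κ₂ U) {q x : Fin n → ℝ} (hq : ∀ i, 0 ≤ q i)
    (hg : GoodSample p (ε / 4) b F U q x) (y : Fin d → ℝ) :
    |sampleSum q (fun i => |U i ⬝ᵥ y| ^ p) x ^ (1 / p) - (∑ i, |U i ⬝ᵥ y| ^ p) ^ (1 / p)|
      ≤ ε * (∑ i, |U i ⬝ᵥ y| ^ p) ^ (1 / p) := by
  have hp0 : 0 < p := by linarith
  have hq1 : 1 / p ≤ 1 := by rw [div_le_one hp0]; exact hp₁
  have hq0 : 0 ≤ 1 / p := by positivity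
  have hc : ∀ i, 0 ≤ if x i < q i then (q i)⁻¹ else 0 := fun i => by
    split_ifs
    · exact inv_nonneg.2 (hq i)
    · exact le_rfl
  set N := weightedSeminorm hp₁ (fun _ : Fin n => (1 : ℝ)) (fun _ => zero_le_one) U with hN
  set S := weightedSeminorm hp₁ (fun i => if x i < q i then (q i)⁻¹ else 0) hc U with hS
  have eN : ∀ y, N y = (∑ i, |U i ⬝ᵥ y| ^ p) ^ (1 / p) := fun y => by
    rw [hN, weightedSeminorm_apply]; simp only [one_mul]
  have eS : ∀ y, S y = sampleSum q (fun i => |U i ⬝ᵥ y| ^ p) x ^ (1 / p) := fun y => rfl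
  have hclose : ∀ y ∈ F, |S y - N y| ≤ ε / 4 * N y := by
    intro y hy
    rw [eN, eS]
    refine abs_rpow_inv_sub_le hp₁ (Finset.sum_nonneg fun i _ => mul_nonneg (hc i) (by positivity))
      (Finset.sum_nonneg fun i _ => by positivity) (by linarith) (by linarith) (hg.close y hy)
  rw [← eN, ← eS]
  -- Conditioning supplies both inputs: `κ₁` bounds the coordinates of the unit ball of `N`, and
  -- `κ₂` bounds `N` on the standard basis.
  refine seminorm_close N S hε₀ hε₁ (R := κ₁) (D := κ₂) (fun y j => ?_) (fun j => ?_) hm F hF hclose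
    (fun j => hclose _ (hb j)) y
  · rw [eN]
    have h1 : |y j| ^ p ≤ κ₁ * ∑ i, |U i ⬝ᵥ y| ^ p :=
      (abs_entry_rpow_le hp0.le y j).trans (hU.eucPow_le y)
    have h2 := Real.rpow_le_rpow (by positivity) h1 hq0
    rw [← Real.rpow_mul (abs_nonneg _), mul_one_div_cancel hp0.ne', Real.rpow_one,
      Real.mul_rpow (by linarith) (Finset.sum_nonneg fun i _ => by positivity)] at h2
    refine h2.trans (mul_le_mul_of_nonneg_right ?_
      (Real.rpow_nonneg (Finset.sum_nonneg fun i _ => by positivity) _))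
    have := Real.rpow_le_rpow_of_exponent_le hκ₁ hq1
    rwa [Real.rpow_one] at this
  · rw [eN]
    have h1 : ∑ i, |U i ⬝ᵥ Pi.single j 1| ^ p ≤ κ₂ := by
      refine le_trans (Finset.sum_le_sum fun i _ => ?_) hU.sum_le
      rw [dotProduct_single, mul_one]
      exact abs_entry_rpow_le hp0.le _ _
    have h2 := Real.rpow_le_rpow (Finset.sum_nonneg fun i _ => by positivity) h1 hq0
    have := Real.rpow_le_rpow_of_exponent_le hκ₂ hq1
    rw [Real.rpow_one] at this
    exact h2.trans this

/-- Sampling with respect to a well-conditioned basis `U` gives an embedding of the column space of `U`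
with high probability; the bad event is measurable as a function of `U` as well. -/
theorem exists_sampling_event {p σ δ ε κ₁ κ₂ : ℝ} (hp₁ : 1 ≤ p) (hp₂ : p ≤ 2) (hκ₁ : 1 ≤ κ₁)
    (hκ₂ : 1 ≤ κ₂) (hσ : 0 < σ) (hδ : 0 < δ) (hε₀ : 0 < ε) (hε₁ : ε ≤ 1) {n d r : ℕ} (hr : 0 < r)
    (hd : 0 < d) (hrδ : n * Real.exp (-r) ≤ δ)
    (hsize : Real.log (4 / δ) + d * Real.log (40 * d * (κ₁ * κ₂) / ε)
      ≤ ε ^ 2 * (δ * σ) / (7680 * (κ₁ * κ₂))) :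
    ∃ Bad : Set ((Fin n → Fin d → ℝ) × ((Fin d → Fin r → ℝ) × (Fin n → ℝ))), MeasurableSet Bad ∧
      (∀ U, ((gaussianMatrixLaw d r).prod (uniformLaw n)).real {Gx | (U, Gx) ∈ Bad} ≤ 4 * δ) ∧
      ∀ U G x, IsConditioned p κ₁ κ₂ U → (U, (G, x)) ∉ Bad →
        (∀ y, |sampleSum (sampleProb p σ U G) (fun i => |U i ⬝ᵥ y| ^ p) x ^ (1 / p)
            - (∑ i, |U i ⬝ᵥ y| ^ p) ^ (1 / p)| ≤ ε * (∑ i, |U i ⬝ᵥ y| ^ p) ^ (1 / p)) ∧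
          ∑ i, (if x i < sampleProb p σ U G i then (1 : ℝ) else 0) < σ / δ := by
  classical
  have hp0 : 0 < p := by linarith
  have hd0 : (1 : ℝ) ≤ d := by exact_mod_cast hd
  set m := ε / (8 * d * κ₂) with hm
  have hm0 : 0 < m := by positivity
  have hm1 : m ≤ κ₁ := by
    refine le_trans ?_ hκ₁
    rw [hm, div_le_one (by positivity)]
    nlinarith
  obtain ⟨F₀, -, hcard, hnet⟩ := exists_net {x : Fin d → ℝ | ∀ j, |x j| ≤ κ₁} hm0 hm1 fun x hx => hx
  -- The standard basis is added to the net because `S` has to be controlled on it as well.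
  set F := F₀ ∪ Finset.univ.image fun j : Fin d => (Pi.single j 1 : Fin d → ℝ) with hF
  set B := 40 * d * (κ₁ * κ₂) / ε with hB
  have hκ : 1 ≤ κ₁ * κ₂ := one_le_mul_of_one_le_of_one_le hκ₁ hκ₂
  have hdB : d ≤ B := by
    rw [hB, le_div_iff₀ hε₀]; nlinarith
  have hB1 : 1 ≤ B := hd0.trans hdB
  have hFc : (F.card : ℝ) ≤ 2 * B ^ d := by
    have h1 : F.card ≤ F₀.card + d := by
      refine (Finset.card_union_le _ _).trans (Nat.add_le_add_left ?_ _)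
      exact Finset.card_image_le.trans (by simp)
    have h2 : (F.card : ℝ) ≤ F₀.card + d := by exact_mod_cast h1
    have h3 : 5 * κ₁ / m = B := by rw [hm, hB]; field_simp; norm_num
    rw [h3] at hcard
    have h4 : B ≤ B ^ d := le_self_pow₀ hB1 hd.ne'
    linarith
  have hFδ : F.card * (2 * Real.exp (-((ε / 4) ^ 2 * (δ * σ) / (480 * (κ₁ * κ₂))))) ≤ δ := by
    have e1 : (ε / 4) ^ 2 * (δ * σ) / (480 * (κ₁ * κ₂)) = ε ^ 2 * (δ * σ) / (7680 * (κ₁ * κ₂)) := by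
      field_simp; norm_num
    rw [e1]
    have h1 : Real.exp (-(ε ^ 2 * (δ * σ) / (7680 * (κ₁ * κ₂)))) ≤ δ / 4 * (B ^ d)⁻¹ := by
      calc _ ≤ Real.exp (-(Real.log (4 / δ) + d * Real.log B)) := by
            exact Real.exp_le_exp.2 (neg_le_neg hsize)
        _ = _ := by
            rw [neg_add, Real.exp_add, Real.exp_neg, Real.exp_log (by positivity), Real.exp_neg,
              mul_comm (d : ℝ), Real.exp_mul, Real.exp_log (by linarith), Real.rpow_natCast, inv_div]
    have hBd : 0 < B ^ d := by positivity
    calc _ ≤ 2 * B ^ d * (2 * (δ / 4 * (B ^ d)⁻¹)) := by gcongr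
      _ = δ := by field_simp; norm_num
  -- Conditioning is part of the event, so that the bound on the sections holds for every `U`, also
  -- for those that a failed earlier stage may produce.
  refine ⟨{z | IsConditioned p κ₁ κ₂ z.1 ∧
    ¬ GoodSample p (ε / 4) (σ / δ) F z.1 (sampleProb p σ z.1 z.2.1) z.2.2}, ?_, ?_, ?_⟩
  · exact (measurable_fst (isClosed_isConditioned hp0).measurableSet).inter
      (measurableSet_goodSample F).compl
  · intro U
    by_cases hU : IsConditioned p κ₁ κ₂ U
    · refine le_trans (measureReal_mono fun x hx => ?_) (sample_section_le hp₁ hp₂ (by linarith)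
        (by linarith) hσ hδ (by linarith) (by linarith) hr hrδ hFδ hU)
      exact hx.2
    · have : {Gx : (Fin d → Fin r → ℝ) × (Fin n → ℝ) | (U, Gx) ∈ {z : (Fin n → Fin d → ℝ) ×
          ((Fin d → Fin r → ℝ) × (Fin n → ℝ)) | IsConditioned p κ₁ κ₂ z.1 ∧
          ¬ GoodSample p (ε / 4) (σ / δ) F z.1 (sampleProb p σ z.1 z.2.1) z.2.2}} = ∅ := by
        ext x; simp [hU]
      rw [this, measureReal_empty]; linarith
  · intro U G x hU hnot
    have hg : GoodSample p (ε / 4) (σ / δ) F U (sampleProb p σ U G) x := by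
      by_contra hc; exact hnot ⟨hU, hc⟩
    refine ⟨hg.embedding hp₁ hκ₁ hκ₂ hε₀ hε₁ (m := m) ?_ (fun j => ?_) (fun x hx => ?_) hU
      (fun i => sampleProb_nonneg hσ.le U G i), hg.card_lt⟩
    · rw [hm]; apply le_of_eq; field_simp
    · exact Finset.mem_union_right _ (Finset.mem_image_of_mem _ (Finset.mem_univ _))
    · obtain ⟨x', h1, h2⟩ := hnet x hx
      exact ⟨x', Finset.mem_union_left _ h1, h2⟩

/-! ### The sparse format -/

theorem sum_map_filter {α M : Type*} [AddCommMonoid M] (l : List α) (P : α → Bool) (f : α → M) :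
    ((l.filter P).map f).sum = (l.map fun a => if P a then f a else 0).sum := by
  induction l with
  | nil => rfl
  | cons a l ih => cases h : P a <;> simp [h, ih]

/-- The list of the nonzero entries of row `i`. -/
noncomputable def rowEntries {n d : ℕ} (A : Matrix (Fin n) (Fin d) ℝ) (i : Fin n) : List (Fin d × ℝ) :=
  ((List.finRange d).filter fun j => decide (A i j ≠ 0)).map fun j => (j, A i j)

theorem rowEntries_sum {M : Type*} [AddCommMonoid M] {n d : ℕ} (A : Matrix (Fin n) (Fin d) ℝ)
    (i : Fin n) (g : Fin d × ℝ → M) (hg : ∀ j, g (j, 0) = 0) :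
    ((rowEntries A i).map g).sum = ∑ j, g (j, A i j) := by
  rw [rowEntries, List.map_map, sum_map_filter, Fin.sum_univ_def]
  congr 1
  refine List.map_congr_left fun j _ => ?_
  by_cases h : A i j = 0 <;> simp [h, hg]

theorem rowEntries_eq_nil {n d : ℕ} {A : Matrix (Fin n) (Fin d) ℝ} {i : Fin n} :
    rowEntries A i = [] ↔ A i = 0 := by
  simp only [rowEntries, List.map_eq_nil_iff, List.filter_eq_nil_iff, List.mem_finRange,
    forall_const, decide_eq_true_eq, not_not]
  exact ⟨fun h => funext h, fun h j => congrFun h j⟩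

theorem sparseRows_sum {M : Type*} [AddCommMonoid M] {n d : ℕ} (A : Matrix (Fin n) (Fin d) ℝ)
    (f : SparseRow n d → M) (hf : ∀ i, f (i, []) = 0) :
    ((sparseRows A).map f).sum = ∑ i, f (i, rowEntries A i) := by
  rw [sparseRows, sum_map_filter, List.map_map, Fin.sum_univ_def]
  congr 1
  refine List.map_congr_left fun i _ => ?_
  change (if (!(rowEntries A i).isEmpty) = true then f (i, rowEntries A i) else 0) = _
  by_cases h : rowEntries A i = []
  · simp [h, hf]
  · simp [h]

theorem mem_sparseRows {n d : ℕ} {A : Matrix (Fin n) (Fin d) ℝ} {row : SparseRow n d}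
    (h : row ∈ sparseRows A) : row.2 = rowEntries A row.1 := by
  simp only [sparseRows, List.mem_filter, List.mem_map, List.mem_finRange, true_and] at h
  obtain ⟨⟨i, rfl⟩, -⟩ := h
  rfl

theorem rowEntries_dot {n d : ℕ} (A : Matrix (Fin n) (Fin d) ℝ) (i : Fin n) (u : Fin d → ℝ) :
    ((rowEntries A i).map fun e => e.2 * u e.1).sum = ∑ j, A i j * u j :=
  rowEntries_sum A i _ fun _ => zero_mul _

/-! ### The sparse embedding -/

theorem foldl_store₂ {s d : ℕ} (k : Fin s) (x : ℝ) (l : List (Fin d × ℝ)) (M : Fin s → Fin d → ℝ)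
    (k' : Fin s) (j : Fin d) :
    l.foldl (fun M e => (store₂ M k e.1 (M k e.1 + x * e.2)).val) M k' j
      = M k' j + if k = k' then x * (l.map fun e => if e.1 = j then e.2 else 0).sum else 0 := by
  induction l generalizing M with
  | nil => simp
  | cons e l ih =>
    rw [List.foldl_cons, ih]
    simp only [store₂, op, List.map_cons, List.sum_cons]
    by_cases hk : k = k'
    · subst hk
      by_cases hj : e.1 = j
      · subst hj; simp; ring
      · simp [hj, Function.update_of_ne (Ne.symm hj)]
    · simp [hk, Function.update_of_ne (Ne.symm hk)]

theorem sparseEmbed_val {n d s : ℕ} (A : Matrix (Fin n) (Fin d) ℝ) (h : Fin n → Fin s)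
    (X : Fin n → ℝ) : Matrix.of (sparseEmbed (sparseRows A) h X).val = sketch h X A := by
  have e1 : (sparseEmbed (sparseRows A) h X).val = (sparseRows A).foldl (fun M row =>
      row.2.foldl (fun M e => (store₂ M (h row.1) e.1 (M (h row.1) e.1 + X row.1 * e.2)).val) M)
      (fun _ _ => 0) := by
    simp only [sparseEmbed, bind_val, forList_val]
    rfl
  have e2 : ∀ (l : List (SparseRow n d)) (M : Fin s → Fin d → ℝ) (k : Fin s) (j : Fin d),
      l.foldl (fun M row => row.2.foldl
        (fun M e => (store₂ M (h row.1) e.1 (M (h row.1) e.1 + X row.1 * e.2)).val) M) M k j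
      = M k j + (l.map fun row => if h row.1 = k then
          X row.1 * (row.2.map fun e => if e.1 = j then e.2 else 0).sum else 0).sum := by
    intro l
    induction l with
    | nil => intro M k j; simp
    | cons row l ih =>
      intro M k j
      rw [List.foldl_cons, ih, foldl_store₂, List.map_cons, List.sum_cons, add_assoc]
  ext k j
  rw [Matrix.of_apply, e1, e2, zero_add, sparseRows_sum _ _ (by simp)]
  simp only [sketch, Matrix.of_apply, bucketSum]
  refine Finset.sum_congr rfl fun i _ => ?_
  rw [rowEntries_sum _ _ (fun e : Fin d × ℝ => if e.1 = j then e.2 else 0) (by simp)]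
  by_cases hk : h i = k <;> simp [hk, mul_comm]

/-! ### Sampling -/

theorem foldl_push {α β : Type*} (l : List α) (P : α → Prop) [DecidablePred P] (f : α → β)
    (acc : List β) : l.foldl (fun acc a => if P a then f a :: acc else acc) acc
      = ((l.filter fun a => decide (P a)).map f).reverse ++ acc := by
  induction l generalizing acc with
  | nil => rfl
  | cons a l ih => by_cases h : P a <;> simp [h, ih]

/-- The list of kept rows with their weights, for given probabilities. -/
noncomputable def keptRows {n d : ℕ} (p : ℝ) (A : Matrix (Fin n) (Fin d) ℝ) (q x : Fin n → ℝ) :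
    List (SparseRow n d × ℝ) :=
  (((sparseRows A).filter fun row => decide (x row.1 < q row.1)).map
    fun row => (row, q row.1 ^ (-1 / p))).reverse

/-- The rows of `A T`. -/
def rowsMul {n d : ℕ} (A : Matrix (Fin n) (Fin d) ℝ) (T : Fin d → Fin d → ℝ) : Fin n → Fin d → ℝ :=
  fun i => (A * Matrix.of T) i

theorem rowsMul_dotProduct {n d : ℕ} (A : Matrix (Fin n) (Fin d) ℝ) (T : Fin d → Fin d → ℝ)
    (y : Fin d → ℝ) (i : Fin n) : rowsMul A T i ⬝ᵥ y = (A *ᵥ (Matrix.of T *ᵥ y)) i := by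
  rw [Matrix.mulVec_mulVec]; rfl

theorem sampleRows_val {n d r : ℕ} {p s : ℝ} (hp : 0 < p) (A : Matrix (Fin n) (Fin d) ℝ)
    (T : Fin d → Fin d → ℝ) (G : Fin d → Fin r → ℝ) (x : Fin n → ℝ) :
    (sampleRows p s (sparseRows A) T G x).val = keptRows p A (sampleProb p s (rowsMul A T) G) x := by
  set score : SparseRow n d → ℝ := fun row =>
    (∑ k, (row.2.map fun e => e.2 * ∑ j, T e.1 j * G j k).sum *
      (row.2.map fun e => e.2 * ∑ j, T e.1 j * G j k).sum) ^ (p / 2) with hscore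
  have hs : ∀ i, score (i, rowEntries A i) = rowWeight p (rowsMul A T) G i := by
    intro i
    simp only [hscore, rowWeight, rowScore]
    congr 1
    refine Finset.sum_congr rfl fun k _ => ?_
    rw [rowEntries_dot A i fun l => ∑ j, T l j * G j k, ← sq]
    congr 1
    simp only [Finset.mul_sum, rowsMul, Matrix.mul_apply', dotProduct, Finset.sum_mul, Matrix.of_apply]
    rw [Finset.sum_comm]
    exact Finset.sum_congr rfl fun j _ => Finset.sum_congr rfl fun l _ => by ring
  -- The zero rows are missing in the list; their scores are `0` because `p / 2 ≠ 0`.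
  have htot : ((sparseRows A).map score).sum = ∑ i, rowWeight p (rowsMul A T) G i := by
    rw [sparseRows_sum]
    · exact Finset.sum_congr rfl fun i _ => hs i
    · intro i
      simp [hscore, Real.zero_rpow (show p / 2 ≠ 0 by positivity)]
  have e1 : (sampleRows p s (sparseRows A) T G x).val =
      ((sparseRows A).map fun row => (row, score row)).foldl (fun acc (y : SparseRow n d × ℝ) =>
        if x y.1.1 < (1 : ℝ) ⊓ (s * y.2 / ((sparseRows A).map score).sum) then
          (y.1, ((1 : ℝ) ⊓ (s * y.2 / ((sparseRows A).map score).sum)) ^ (-1 / p)) :: acc else acc) [] := by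
    simp only [sampleRows, bind_val, forList_val]
    have e2 : ((sumList ((sparseRows A).map fun row => (row, score row)) fun y => pure y.2)).val
        = ((sparseRows A).map score).sum := by
      simp only [sumList, List.map_map, pure_val]; rfl
    rw [← e2]
    congr 1
    funext acc y
    rw [apply_ite Timed.val]
    exact if_congr decide_eq_true_iff rfl rfl
  rw [e1, foldl_push, List.append_nil, keptRows, List.filter_map, List.map_map]
  congr 1
  have hq : ∀ row ∈ sparseRows A, (1 : ℝ) ⊓ (s * score row / ((sparseRows A).map score).sum)
      = sampleProb p s (rowsMul A T) G row.1 := by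
    intro row hrow
    have : row = (row.1, rowEntries A row.1) := Prod.ext rfl (mem_sparseRows hrow)
    rw [htot, sampleProb, ← hs, ← this]
  have hfil : (sparseRows A).filter ((fun y : SparseRow n d × ℝ => decide (x y.1.1 <
      (1 : ℝ) ⊓ (s * y.2 / ((sparseRows A).map score).sum))) ∘ fun row => (row, score row))
      = (sparseRows A).filter fun row => decide (x row.1 < sampleProb p s (rowsMul A T) G row.1) := by
    refine List.filter_congr fun row hrow => ?_
    simp only [Function.comp, hq row hrow]
  rw [hfil]
  refine List.map_congr_left fun row hrow => ?_
  simp only [Function.comp, hq row (List.mem_of_mem_filter hrow)]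

/-- The `p`-th power turns the weight `q ^ (-1 / p)` into `q⁻¹`, as in `sampleSum`. Zero rows of `A`
never appear in the list, hence the condition on `v`. -/
theorem keptRows_sum {n d : ℕ} {p : ℝ} (hp : 0 < p) (A : Matrix (Fin n) (Fin d) ℝ) {q : Fin n → ℝ}
    (hq : ∀ i, 0 ≤ q i) (x : Fin n → ℝ) (v : Fin n → ℝ) (hv : ∀ i, A i = 0 → v i = 0) :
    ((keptRows p A q x).map fun y => |y.2 * v y.1.1| ^ p).sum = sampleSum q (fun i => |v i| ^ p) x := by
  rw [keptRows, List.map_reverse, List.sum_reverse, List.map_map, sum_map_filter]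
  have e : ∀ row : SparseRow n d, (if decide (x row.1 < q row.1) = true then
      ((fun y : SparseRow n d × ℝ => |y.2 * v y.1.1| ^ p) ∘ fun row => (row, q row.1 ^ (-1 / p))) row
      else 0) = (if x row.1 < q row.1 then (q row.1)⁻¹ else 0) * |v row.1| ^ p := by
    intro row
    by_cases h : x row.1 < q row.1
    · simp only [h, decide_true, if_true, Function.comp]
      rw [abs_mul, Real.mul_rpow (abs_nonneg _) (abs_nonneg _),
        abs_of_nonneg (Real.rpow_nonneg (hq _) _), ← Real.rpow_mul (hq _),
        div_mul_cancel₀ _ hp.ne', Real.rpow_neg_one]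
    · simp [h]
  simp only [e]
  have e2 : ∀ row ∈ sparseRows A, (if x row.1 < q row.1 then (q row.1)⁻¹ else 0) * |v row.1| ^ p
      = if row.2 = [] then 0 else (if x row.1 < q row.1 then (q row.1)⁻¹ else 0) * |v row.1| ^ p := by
    intro row hrow
    by_cases h : row.2 = []
    · rw [if_pos h]
      rw [mem_sparseRows hrow, rowEntries_eq_nil] at h
      rw [hv _ h, abs_zero, Real.zero_rpow hp.ne', mul_zero]
    · rw [if_neg h]
  rw [List.map_congr_left e2, sparseRows_sum _ _ (by simp), sampleSum]
  refine Finset.sum_congr rfl fun i _ => ?_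
  by_cases h : rowEntries A i = []
  · rw [if_pos h, hv _ (rowEntries_eq_nil.1 h), abs_zero, Real.zero_rpow hp.ne', mul_zero]
  · rw [if_neg h]

theorem keptRows_length_le {n d : ℕ} (p : ℝ) (A : Matrix (Fin n) (Fin d) ℝ) (q x : Fin n → ℝ) :
    ((keptRows p A q x).length : ℝ) ≤ ∑ i, if x i < q i then (1 : ℝ) else 0 := by
  have e1 : (keptRows p A q x).length = ∑ i : Fin n, if rowEntries A i = [] then 0 else
      if x i < q i then 1 else 0 := by
    rw [keptRows, List.length_reverse, List.length_map]
    have := sum_map_filter (sparseRows A) (fun row => decide (x row.1 < q row.1)) (fun _ => 1)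
    rw [List.map_const', List.sum_replicate, smul_eq_mul, mul_one] at this
    rw [this]
    have e2 : ∀ row ∈ sparseRows A, (if decide (x row.1 < q row.1) = true then 1 else 0)
        = if row.2 = [] then 0 else if x row.1 < q row.1 then 1 else 0 := by
      intro row hrow
      have hne : row.2 ≠ [] := by
        simp only [sparseRows, List.mem_filter] at hrow
        simpa using hrow.2
      simp [hne]
    rw [List.map_congr_left e2, sparseRows_sum _ _ (by simp)]
  rw [e1]
  push_cast
  refine Finset.sum_le_sum fun i _ => ?_
  split_ifs <;> norm_num

/-! ### The matrix of the kept rows -/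

/-- Since `store` overwrites, each column must occur only once for the sum on the right to be the
stored entry. -/
theorem foldl_store {d : ℕ} (w : ℝ) (l : List (Fin d × ℝ)) (hl : (l.map Prod.fst).Nodup)
    (z : Fin d → ℝ) (j : Fin d) :
    l.foldl (fun z e => (store z e.1 (w * e.2)).val) z j
      = if j ∈ l.map Prod.fst then w * (l.map fun e => if e.1 = j then e.2 else 0).sum else z j := by
  induction l generalizing z with
  | nil => simp
  | cons e l ih =>
    rw [List.map_cons, List.nodup_cons] at hl
    rw [List.foldl_cons, ih hl.2]
    simp only [store, op, List.map_cons, List.sum_cons, List.mem_cons]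
    by_cases hj : j = e.1
    · subst hj
      have h0 : (l.map fun e' => if e'.1 = e.1 then e'.2 else 0).sum = 0 := by
        refine List.sum_eq_zero fun a ha => ?_
        obtain ⟨e', he', rfl⟩ := List.mem_map.1 ha
        have : e'.1 ≠ e.1 := fun h => hl.1 (h ▸ List.mem_map_of_mem he')
        simp [this]
      simp [hl.1, h0]
    · rw [if_neg (Ne.symm hj), zero_add, Function.update_of_ne hj]
      by_cases hm : j ∈ l.map Prod.fst
      · rw [if_pos hm, if_pos (Or.inr hm)]
      · rw [if_neg hm, if_neg (not_or.2 ⟨hj, hm⟩)]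

theorem denseRows_val {n d : ℕ} (L : List (SparseRow n d × ℝ)) (A : Matrix (Fin n) (Fin d) ℝ)
    (hL : ∀ y ∈ L, y.1.2 = rowEntries A y.1.1) (k : Fin L.length) (j : Fin d) :
    (denseRows L).val k j = (L.get k).2 * A (L.get k).1.1 j := by
  have e1 : (denseRows L).val k = (L.get k).1.2.foldl
      (fun z e => (store z e.1 ((L.get k).2 * e.2)).val) (fun _ => 0) := by
    simp only [denseRows, tabulate, bind_val, forList_val]
    rfl
  have hr := hL _ (L.get_mem k)
  have hfst : (rowEntries A (L.get k).1.1).map Prod.fst =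
      (List.finRange d).filter fun j => decide (A (L.get k).1.1 j ≠ 0) := by
    rw [rowEntries, List.map_map]; exact List.map_id _
  have hmem : j ∈ (List.finRange d).filter (fun j => decide (A (L.get k).1.1 j ≠ 0)) ↔
      A (L.get k).1.1 j ≠ 0 := by simp
  rw [e1, hr, foldl_store, hfst]
  · rw [rowEntries_sum _ _ (fun e : Fin d × ℝ => if e.1 = j then e.2 else 0) (by simp)]
    by_cases h : A (L.get k).1.1 j = 0
    · rw [if_neg fun hc => hmem.1 hc h, h, mul_zero]
    · rw [if_pos (hmem.2 h)]; simp
  · rw [hfst]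
    exact (List.nodup_finRange d).filter _

theorem keptRows_entries {n d : ℕ} (p : ℝ) (A : Matrix (Fin n) (Fin d) ℝ) (q x : Fin n → ℝ) :
    ∀ y ∈ keptRows p A q x, y.1.2 = rowEntries A y.1.1 := by
  intro y hy
  rw [keptRows, List.mem_reverse, List.mem_map] at hy
  obtain ⟨row, hrow, rfl⟩ := hy
  exact mem_sparseRows (List.mem_of_mem_filter hrow)

theorem denseRows_mulVec {n d : ℕ} {p : ℝ} (hp : 0 < p) (A : Matrix (Fin n) (Fin d) ℝ) {q : Fin n → ℝ}
    (hq : ∀ i, 0 ≤ q i) (x : Fin n → ℝ) (z : Fin d → ℝ) :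
    ∑ k, |(Matrix.of (denseRows (keptRows p A q x)).val *ᵥ z) k| ^ p
      = sampleSum q (fun i => |(A *ᵥ z) i| ^ p) x := by
  rw [← keptRows_sum hp A hq x (A *ᵥ z)]
  · set L := keptRows p A q x with hL
    have e : ∀ k, (Matrix.of (denseRows L).val *ᵥ z) k = (L.get k).2 * (A *ᵥ z) (L.get k).1.1 := by
      intro k
      simp only [Matrix.mulVec, dotProduct, Matrix.of_apply, Finset.mul_sum]
      refine Finset.sum_congr rfl fun j _ => ?_
      rw [denseRows_val L A (keptRows_entries p A q x) k j, mul_assoc]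
    simp only [e]
    have := Fin.sum_univ_fun_getElem L fun y => |y.2 * (A *ᵥ z) y.1.1| ^ p
    simpa using this
  · intro i hi
    simp [Matrix.mulVec, hi]

theorem lpNorm_samplingMatrix {n d : ℕ} {p : ℝ} (hp : 0 < p) (A : Matrix (Fin n) (Fin d) ℝ)
    {q : Fin n → ℝ} (hq : ∀ i, 0 ≤ q i) (x : Fin n → ℝ) (z : Fin d → ℝ) :
    lpNorm p (samplingMatrix ((keptRows p A q x).map fun y => (y.1.1, y.2)) *ᵥ (A *ᵥ z))
      = sampleSum q (fun i => |(A *ᵥ z) i| ^ p) x ^ (1 / p) := by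
  rw [← keptRows_sum hp A hq x (A *ᵥ z)]
  · set L := (keptRows p A q x).map fun y => (y.1.1, y.2) with hL
    have e : ∀ k, (samplingMatrix L *ᵥ (A *ᵥ z)) k = (L.get k).2 * (A *ᵥ z) (L.get k).1 := by
      intro k
      simp [samplingMatrix, Matrix.mulVec, dotProduct]
    unfold lpNorm
    simp only [e]
    have := Fin.sum_univ_fun_getElem L fun y => |y.2 * (A *ᵥ z) y.1| ^ p
    have h2 : (∑ k, |(L.get k).2 * (A *ᵥ z) (L.get k).1| ^ p)
        = (L.map fun y => |y.2 * (A *ᵥ z) y.1| ^ p).sum := by simpa using this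
    rw [h2, hL, List.map_map]
    rfl
  · intro i hi
    simp [Matrix.mulVec, hi]

/-! ### Measurability of the results of computations -/

theorem measurable_foldl {Ω α σ : Type*} [MeasurableSpace Ω] [MeasurableSpace σ] (l : List α)
    (f : Ω → σ → α → σ) (hf : ∀ a (t : Ω → σ), Measurable t → Measurable fun ω => f ω (t ω) a)
    (s : Ω → σ) (hs : Measurable s) : Measurable fun ω => l.foldl (f ω) (s ω) := by
  induction l generalizing s with
  | nil => exact hs
  | cons a l ih => exact ih (fun ω => f ω (s ω) a) (hf a s hs)

theorem measurable_iterate {Ω σ : Type*} [MeasurableSpace Ω] [MeasurableSpace σ]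
    (f : Ω → σ → σ) (hf : ∀ t : Ω → σ, Measurable t → Measurable fun ω => f ω (t ω)) (k : ℕ)
    (s : Ω → σ) (hs : Measurable s) : Measurable fun ω => (f ω)^[k] (s ω) := by
  induction k generalizing s with
  | zero => exact hs
  | succ k ih => exact ih (fun ω => f ω (s ω)) (hf s hs)

theorem measurable_update_apply {Ω σ : Type*} [MeasurableSpace Ω] [MeasurableSpace σ] {m : ℕ}
    {v : Ω → Fin m → σ} (hv : Measurable v) (i : Fin m) {x : Ω → σ} (hx : Measurable x) :
    Measurable fun ω => Function.update (v ω) i (x ω) := by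
  refine measurable_pi_iff.2 fun j => ?_
  by_cases h : j = i
  · subst h; simpa using hx
  · simp only [Function.update_of_ne h]
    exact (measurable_pi_apply j).comp hv

theorem measurable_qrInverse {Ω : Type*} [MeasurableSpace Ω] {m d : ℕ} {M : Ω → Fin m → Fin d → ℝ}
    (hM : Measurable M) : Measurable fun ω => (qrInverse (M ω)).val := by
  have hMkj : ∀ k j, Measurable fun ω => M ω k j := fun k j =>
    (measurable_pi_apply j).comp ((measurable_pi_apply k).comp hM)
  have hdot : ∀ {a : ℕ} {u v : Ω → Fin a → ℝ}, Measurable u → Measurable v →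
      Measurable fun ω => u ω ⬝ᵥ v ω := by
    intro a u v hu hv
    exact Finset.measurable_sum _ fun i _ =>
      ((measurable_pi_apply i).comp hu).mul ((measurable_pi_apply i).comp hv)
  -- orthogonalization of a column against a column
  have step : ∀ (i j : Fin d) (QT : Ω → (Fin d → Fin m → ℝ) × (Fin d → Fin d → ℝ)), Measurable QT →
      ∀ vt : Ω → (Fin m → ℝ) × (Fin d → ℝ), Measurable vt → Measurable fun ω =>
        if i < j then ((vt ω).1 - ((QT ω).1 i ⬝ᵥ (vt ω).1) • (QT ω).1 i,
          (vt ω).2 - ((QT ω).1 i ⬝ᵥ (vt ω).1) • (QT ω).2 i) else vt ω := by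
    intro i j QT hQT vt hvt
    split_ifs
    · have h1 : Measurable fun ω => (QT ω).1 i := (measurable_pi_apply i).comp hQT.fst
      have h2 : Measurable fun ω => (QT ω).2 i := (measurable_pi_apply i).comp hQT.snd
      have h3 := hdot h1 hvt.fst
      exact (hvt.fst.sub (h3.smul h1)).prodMk (hvt.snd.sub (h3.smul h2))
    · exact hvt
  -- The loops written as plain folds of measurable operations on the state.
  let F : Ω → (Fin d → Fin m → ℝ) × (Fin d → Fin d → ℝ) := fun ω => (List.finRange d).foldl
      (fun QT j =>
        let vt := (List.finRange d).foldl (fun vt i => if i < j then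
          (vt.1 - (QT.1 i ⬝ᵥ vt.1) • QT.1 i, vt.2 - (QT.1 i ⬝ᵥ vt.1) • QT.2 i) else vt)
          ((fun k => M ω k j), (fun l => if l = j then 1 else 0))
        (Function.update QT.1 j (fun k => vt.1 k / √(vt.1 ⬝ᵥ vt.1)),
          Function.update QT.2 j (fun l => vt.2 l / √(vt.1 ⬝ᵥ vt.1))))
      ((fun _ _ => 0), (fun _ _ => 0))
  have e : ∀ ω, (qrInverse (M ω)).val = fun k j => (F ω).2 j k := by
    intro ω
    have hin : ∀ (j : Fin d) (QT : (Fin d → Fin m → ℝ) × (Fin d → Fin d → ℝ)) (i : Fin d)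
        (vt : (Fin m → ℝ) × (Fin d → ℝ)),
        (if i < j then do
          let r ← dot (QT.1 i) vt.1
          let v ← tabulate fun k => do
            let y ← mul r (QT.1 i k)
            sub (vt.1 k) y
          let t ← tabulate fun l => do
            let y ← mul r (QT.2 i l)
            sub (vt.2 l) y
          pure (v, t)
        else pure vt : Timed ((Fin m → ℝ) × (Fin d → ℝ))).val = if i < j then
          (vt.1 - (QT.1 i ⬝ᵥ vt.1) • QT.1 i, vt.2 - (QT.1 i ⬝ᵥ vt.1) • QT.2 i) else vt := by
      intro j QT i vt
      rw [apply_ite Timed.val]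
      rfl
    simp only [qrInverse, bind_val, forFin_val, hin]
    rfl
  have hF : Measurable F := by
    refine measurable_foldl _ _ (fun j QT hQT => ?_) _ measurable_const
    have hvt : Measurable fun ω => (List.finRange d).foldl (fun vt i => if i < j then
        (vt.1 - ((QT ω).1 i ⬝ᵥ vt.1) • (QT ω).1 i, vt.2 - ((QT ω).1 i ⬝ᵥ vt.1) • (QT ω).2 i) else vt)
        (((fun k => M ω k j), (fun l => if l = j then 1 else 0)) : (Fin m → ℝ) × (Fin d → ℝ)) := by
      refine measurable_foldl _ _ (fun i vt hvt => step i j QT hQT vt hvt) _ ?_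
      exact (measurable_pi_iff.2 fun k => hMkj k j).prodMk measurable_const
    have hc := (hdot hvt.fst hvt.fst).sqrt
    refine (measurable_update_apply hQT.fst j ?_).prodMk (measurable_update_apply hQT.snd j ?_)
    · exact measurable_pi_iff.2 fun k => ((measurable_pi_apply k).comp hvt.fst).div hc
    · exact measurable_pi_iff.2 fun k => ((measurable_pi_apply k).comp hvt.snd).div hc
  simp only [e]
  exact measurable_pi_iff.2 fun k => measurable_pi_iff.2 fun j =>
    (measurable_pi_apply k).comp ((measurable_pi_apply j).comp hF.snd)

theorem measurable_signedPow {Ω : Type*} [MeasurableSpace Ω] (p : ℝ) {f : Ω → ℝ} (hf : Measurable f) :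
    Measurable fun ω => signedPow p (f ω) := by
  unfold signedPow Real.sign
  refine Measurable.mul ?_ (hf.abs.pow_const _)
  exact Measurable.ite (measurableSet_lt hf measurable_const) measurable_const
    (Measurable.ite (measurableSet_lt measurable_const hf) measurable_const measurable_const)

/-- The fold returns the last hit, so induction from the right decides by one measurable condition
at a time; no measurable structure on `Option τ` is required. -/
theorem measurable_match_foldl {Ω α τ β : Type*} [MeasurableSpace Ω] [MeasurableSpace β] (l : List α)
    (P : Ω → α → Prop) [∀ ω a, Decidable (P ω a)] (hP : ∀ a, MeasurableSet {ω | P ω a})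
    (z : Ω → α → τ) (f : Ω → Option τ → β) (h0 : Measurable fun ω => f ω none)
    (h1 : ∀ a, Measurable fun ω => f ω (some (z ω a))) :
    Measurable fun ω => f ω (l.foldl (fun acc a => if P ω a then some (z ω a) else acc) none) := by
  induction l using List.reverseRecOn with
  | nil => exact h0
  | append_singleton l a ih =>
    simp only [List.foldl_append, List.foldl_cons, List.foldl_nil]
    simp only [apply_ite (f _)]
    exact Measurable.ite (hP a) (h1 a) ih

theorem measurable_roundingStep {Ω : Type*} [MeasurableSpace Ω] (p : ℝ) {m d : ℕ}
    {M : Ω → Fin m → Fin d → ℝ} (hM : Measurable M) {B : Ω → Fin d → Fin d → ℝ} (hB : Measurable B) :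
    Measurable fun ω => (roundingStep p (M ω) (B ω)).val := by
  have hM' : ∀ k j, Measurable fun ω => M ω k j := fun k j =>
    (measurable_pi_apply j).comp ((measurable_pi_apply k).comp hM)
  have hB' : ∀ k j, Measurable fun ω => B ω k j := fun k j =>
    (measurable_pi_apply j).comp ((measurable_pi_apply k).comp hB)
  have hz : ∀ l k, Measurable fun ω => (Matrix.of (M ω) *ᵥ axisPoint (B ω) l) k := by
    intro l k
    change Measurable fun ω => ∑ j, M ω k j * (B ω j l / (2 * √(d : ℝ)))
    exact Finset.measurable_sum _ fun j _ => (hM' k j).mul ((hB' j l).div_const _)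
  have e : ∀ ω, (roundingStep p (M ω) (B ω)).val =
      (fun o : Option (Fin m → ℝ) => match o with
        | none => B ω
        | some z => cut p (M ω) (B ω) z) (findOutside p (M ω) (B ω)) := fun ω =>
    roundingStep_val p (M ω) (B ω)
  simp only [e, findOutside]
  refine measurable_match_foldl _ (fun ω l => 1 < ∑ k, |(Matrix.of (M ω) *ᵥ axisPoint (B ω) l) k| ^ p)
    (fun l => ?_) (fun ω l => Matrix.of (M ω) *ᵥ axisPoint (B ω) l)
    (fun ω o => match o with
        | none => B ω
        | some z => cut p (M ω) (B ω) z) hB (fun l => ?_)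
  · exact measurableSet_lt measurable_const
      (Finset.measurable_sum _ fun k _ => (hz l k).abs.pow_const _)
  · have hn : ∀ j, Measurable fun ω =>
        slabNormal p (M ω) (B ω) (Matrix.of (M ω) *ᵥ axisPoint (B ω) l) j := by
      intro j
      change Measurable fun ω => ∑ i, (∑ k, signedPow p ((Matrix.of (M ω) *ᵥ axisPoint (B ω) l) k) *
        M ω k i) * B ω i j
      exact Finset.measurable_sum _ fun i _ => (Finset.measurable_sum _ fun k _ =>
        (measurable_signedPow p (hz l k)).mul (hM' k i)).mul (hB' i j)
    have hs : Measurable fun ω => √(slabNormal p (M ω) (B ω) (Matrix.of (M ω) *ᵥ axisPoint (B ω) l) ⬝ᵥ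
        slabNormal p (M ω) (B ω) (Matrix.of (M ω) *ᵥ axisPoint (B ω) l)) :=
      (Finset.measurable_sum _ fun j _ => (hn j).mul (hn j)).sqrt
    refine measurable_pi_iff.2 fun i => measurable_pi_iff.2 fun j => ?_
    change Measurable fun ω => ∑ k, B ω i k * squeeze (stretch d) (fun l' =>
      slabNormal p (M ω) (B ω) (Matrix.of (M ω) *ᵥ axisPoint (B ω) l) l' /
        √(slabNormal p (M ω) (B ω) (Matrix.of (M ω) *ᵥ axisPoint (B ω) l) ⬝ᵥ
          slabNormal p (M ω) (B ω) (Matrix.of (M ω) *ᵥ axisPoint (B ω) l))) k j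
    refine Finset.measurable_sum _ fun k _ => (hB' i k).mul ?_
    simp only [squeeze, Matrix.add_apply, Matrix.smul_apply, vecMulVec_apply, smul_eq_mul]
    exact measurable_const.add (measurable_const.mul (((hn k).div hs).mul ((hn j).div hs)))

theorem measurable_rounding {Ω : Type*} [MeasurableSpace Ω] (p : ℝ) {m d : ℕ}
    {M : Ω → Fin m → Fin d → ℝ} (hM : Measurable M) :
    Measurable fun ω => (rounding p (M ω)).val := by
  have e : ∀ ω, (rounding p (M ω)).val =
      (fun B => (roundingStep p (M ω) B).val)^[⌈4 * (d : ℝ) * Real.log m⌉₊ + 1] (qrInverse (M ω)).val := by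
    intro ω
    simp only [rounding, bind_val, repeatTimes_val]
    rfl
  simp only [e]
  exact measurable_iterate _ (fun B hB => measurable_roundingStep p hM hB) _ _ (measurable_qrInverse hM)

/-- The rounding does not depend on the way in which the number of rows is written. -/
theorem rounding_congr {m m' d : ℕ} (p : ℝ) (h : m = m') {M : Fin m → Fin d → ℝ}
    {M' : Fin m' → Fin d → ℝ} (hM : ∀ k, M k = M' (Fin.cast h k)) :
    (rounding p M).val = (rounding p M').val := by
  subst h
  have : M = M' := funext hM
  rw [this]

theorem measurable_of_finite_cases {Ω ι β : Type*} [MeasurableSpace Ω] [MeasurableSpace β] [Finite ι]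
    (W : Ω → ι) (hW : ∀ w, MeasurableSet {ω | W ω = w}) (f : Ω → β) (g : ι → Ω → β)
    (hg : ∀ w, Measurable (g w)) (hf : ∀ ω, f ω = g (W ω) ω) : Measurable f := by
  intro S hS
  have : f ⁻¹' S = ⋃ w, {ω | W ω = w} ∩ g w ⁻¹' S := by
    ext ω
    simp only [Set.mem_preimage, Set.mem_iUnion, Set.mem_inter_iff, Set.mem_ofPred_eq]
    rw [hf]
    constructor
    · exact fun h => ⟨_, rfl, h⟩
    · rintro ⟨w, rfl, h⟩; exact h
  rw [this]
  exact MeasurableSet.iUnion fun w => (hW w).inter (hg w hS)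

/-- The number of rows of the sampled matrix is random, and with it the type of the matrix. On each
of the finitely many events that fix the set of kept rows, the size is constant and
`measurable_rounding` applies. -/
theorem measurable_rounding_keptRows {Ω : Type*} [MeasurableSpace Ω] (p : ℝ) {n d : ℕ}
    (A : Matrix (Fin n) (Fin d) ℝ) {q x : Ω → Fin n → ℝ} (hq : ∀ i, Measurable fun ω => q ω i)
    (hx : ∀ i, Measurable fun ω => x ω i) :
    Measurable fun ω => (rounding p (denseRows (keptRows p A (q ω) (x ω))).val).val := by
  classical
  let W : Ω → Finset (Fin n) := fun ω => Finset.univ.filter fun i => x ω i < q ω i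
  let R : Finset (Fin n) → List (SparseRow n d) := fun w =>
    ((sparseRows A).filter fun row => decide (row.1 ∈ w)).reverse
  refine measurable_of_finite_cases W (fun w => ?_) _ (fun w ω => (rounding p
    fun (k : Fin (R w).length) j => q ω ((R w).get k).1 ^ (-1 / p) * A ((R w).get k).1 j).val)
    (fun w => ?_) (fun ω => ?_)
  · have : {ω | W ω = w} = ⋂ i, {ω | x ω i < q ω i ↔ i ∈ w} := by
      ext ω
      simp [W, Finset.ext_iff]
    rw [this]
    refine MeasurableSet.iInter fun i => ?_
    by_cases h : i ∈ w
    · simpa [h] using measurableSet_lt (hx i) (hq i)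
    · simpa [h] using measurableSet_le (hq i) (hx i)
  · refine measurable_rounding p (measurable_pi_iff.2 fun k => measurable_pi_iff.2 fun j => ?_)
    exact ((hq _).pow_const _).mul_const _
  · have hL : keptRows p A (q ω) (x ω) = (R (W ω)).map fun row => (row, q ω row.1 ^ (-1 / p)) := by
      simp only [keptRows, R, W, List.map_reverse, Finset.mem_filter, Finset.mem_univ, true_and]
    have hlen : (keptRows p A (q ω) (x ω)).length = (R (W ω)).length := by rw [hL, List.length_map]
    refine rounding_congr p hlen fun k => ?_
    ext j
    rw [denseRows_val _ A (keptRows_entries p A (q ω) (x ω))]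
    have : (keptRows p A (q ω) (x ω)).get k = ((R (W ω)).get (Fin.cast hlen k),
        q ω ((R (W ω)).get (Fin.cast hlen k)).1 ^ (-1 / p)) := by
      simp [hL]
    rw [this]

theorem measurable_sketch {n s d : ℕ} (A : Matrix (Fin n) (Fin d) ℝ) :
    Measurable fun hX : (Fin n → Fin s) × (Fin n → ℝ) => fun k j => sketch hX.1 hX.2 A k j := by
  refine measurable_pi_iff.2 fun k => measurable_pi_iff.2 fun j => ?_
  simp only [sketch, Matrix.of_apply, bucketSum]
  refine Finset.measurable_sum _ fun i _ => Measurable.mul (Measurable.ite ?_ measurable_const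
    measurable_const) ((measurable_pi_apply i).comp measurable_snd)
  have hk : Measurable fun hX : (Fin n → Fin s) × (Fin n → ℝ) => hX.1 i :=
    (measurable_pi_apply i).comp measurable_fst
  exact hk (measurableSet_singleton k)

theorem measurable_rowsMul {Ω : Type*} [MeasurableSpace Ω] {n d : ℕ} (A : Matrix (Fin n) (Fin d) ℝ)
    {T : Ω → Fin d → Fin d → ℝ} (hT : Measurable T) : Measurable fun ω => rowsMul A (T ω) := by
  refine measurable_pi_iff.2 fun i => measurable_pi_iff.2 fun j => ?_
  change Measurable fun ω => ∑ k, A i k * T ω k j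
  exact Finset.measurable_sum _ fun k _ => measurable_const.mul
    ((measurable_pi_apply j).comp ((measurable_pi_apply k).comp hT))

/-! ### Conditioned bases from comparable norms -/

theorem eucPow_le_sum {p : ℝ} (hp₁ : 1 ≤ p) (hp₂ : p ≤ 2) {d : ℕ} (u : Fin d → ℝ) :
    eucPow p u ≤ ∑ j, |u j| ^ p := by
  have h : ∀ s : Finset (Fin d), (∑ j ∈ s, u j * u j) ^ (p / 2) ≤ ∑ j ∈ s, |u j| ^ p := by
    intro s
    induction s using Finset.cons_induction with
    | empty => simp [Real.zero_rpow (show p / 2 ≠ 0 by positivity)]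
    | cons a s ha ih =>
      rw [Finset.sum_cons, Finset.sum_cons]
      -- Subadditivity of `t ↦ t ^ (p / 2)`, by `p / 2 ≤ 1`.
      refine (Real.rpow_add_le_add_rpow (mul_self_nonneg _)
        (Finset.sum_nonneg fun _ _ => mul_self_nonneg _) (by linarith) (by linarith)).trans ?_
      rw [← sq, abs_sq_rpow_half]
      linarith
  exact h Finset.univ

/-- A basis that is well-conditioned with respect to `f`, where `f` is comparable to `z ↦ ‖A z‖_p ^ p`. -/
theorem isConditioned_of_comparison {p Γ D : ℝ} (hp₁ : 1 ≤ p) (hp₂ : p ≤ 2) (hΓ : 0 ≤ Γ) {n d : ℕ}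
    {A : Matrix (Fin n) (Fin d) ℝ} {T : Fin d → Fin d → ℝ} {f : (Fin d → ℝ) → ℝ}
    (h1 : ∀ z, ∑ i, |(A *ᵥ z) i| ^ p ≤ Γ * f z) (h2 : ∀ z, f z ≤ Γ * ∑ i, |(A *ᵥ z) i| ^ p)
    (h3 : ∀ y, eucPow p y ≤ f (Matrix.of T *ᵥ y))
    (h4 : ∀ l, f (Matrix.of T *ᵥ Pi.single l 1) ≤ D) :
    IsConditioned p Γ (d * (Γ * D)) (rowsMul A T) where
  eucPow_le y := by
    simp only [rowsMul_dotProduct]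
    exact (h3 y).trans (h2 _)
  sum_le := by
    calc ∑ i, eucPow p (rowsMul A T i) ≤ ∑ i, ∑ l, |rowsMul A T i l| ^ p :=
          Finset.sum_le_sum fun i _ => eucPow_le_sum hp₁ hp₂ _
      _ = ∑ l, ∑ i, |(A *ᵥ (Matrix.of T *ᵥ Pi.single l 1)) i| ^ p := by
          rw [Finset.sum_comm]
          refine Finset.sum_congr rfl fun l _ => Finset.sum_congr rfl fun i _ => ?_
          rw [← rowsMul_dotProduct, dotProduct_single, mul_one]
      _ ≤ ∑ _l : Fin d, Γ * D := Finset.sum_le_sum fun l _ =>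
          (h1 _).trans (mul_le_mul_of_nonneg_left (h4 l) hΓ)
      _ = _ := by simp

theorem eq_zero_of_sum_abs_rpow {p : ℝ} (hp : 0 < p) {m : ℕ} {v : Fin m → ℝ}
    (h : ∑ i, |v i| ^ p ≤ 0) : v = 0 := by
  have h0 := (Finset.sum_eq_zero_iff_of_nonneg fun i _ => by positivity).1
    (le_antisymm h (Finset.sum_nonneg fun i (_ : i ∈ Finset.univ) =>
      (by positivity : 0 ≤ |v i| ^ p)))
  ext i
  have := h0 i (Finset.mem_univ i)
  rw [Real.rpow_eq_zero (abs_nonneg _) hp.ne'] at this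
  simpa using this

/-- A lower comparison with the injective `A` makes the smaller matrix injective, as the QR
decomposition and the rounding require. -/
theorem of_mulVec_zero {p : ℝ} (hp : 0 < p) {n m d : ℕ} {A : Matrix (Fin n) (Fin d) ℝ}
    (hA : ∀ x, A *ᵥ x = 0 → x = 0) {M : Fin m → Fin d → ℝ} {Γ : ℝ} {f : (Fin m → ℝ) → ℝ} (hf : f 0 = 0)
    (h1 : ∀ z, ∑ i, |(A *ᵥ z) i| ^ p ≤ Γ * f (Matrix.of M *ᵥ z)) (z : Fin d → ℝ)
    (hz : Matrix.of M *ᵥ z = 0) : z = 0 := by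
  refine hA z (eq_zero_of_sum_abs_rpow hp ?_)
  have := h1 z
  rwa [hz, hf, mul_zero] at this

/-- The QR decomposition of a matrix with small distortion gives a well-conditioned basis. -/
theorem isConditioned_qrInverse {p Γ : ℝ} (hp₁ : 1 ≤ p) (hp₂ : p ≤ 2) (hΓ : 0 ≤ Γ) {n m d : ℕ}
    {A : Matrix (Fin n) (Fin d) ℝ} (hA : ∀ x, A *ᵥ x = 0 → x = 0) {M : Fin m → Fin d → ℝ}
    (hM : ∀ z, ∑ i, |(A *ᵥ z) i| ^ p ≤ Γ * eucPow p (Matrix.of M *ᵥ z) ∧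
      eucPow p (Matrix.of M *ᵥ z) ≤ Γ * ∑ i, |(A *ᵥ z) i| ^ p) :
    (Matrix.of (qrInverse M).val).det ≠ 0 ∧
      IsConditioned p Γ (d * Γ) (rowsMul A (qrInverse M).val) := by
  have hp0 : 0 < p := by linarith
  have hinj := of_mulVec_zero hp0 hA (eucPow_zero hp0) fun z => (hM z).1
  have horth := qrInverse_orthonormal M hinj
  refine ⟨det_ne_zero_of_orthonormal horth, ?_⟩
  have he : ∀ y, eucPow p (Matrix.of M *ᵥ (Matrix.of (qrInverse M).val *ᵥ y)) = eucPow p y := by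
    intro y
    rw [eucPow, eucPow, Matrix.mulVec_mulVec, dotProduct_mulVec_self_of_orthonormal horth]
  have := isConditioned_of_comparison (D := 1) hp₁ hp₂ hΓ (fun z => (hM z).1) (fun z => (hM z).2)
    (T := (qrInverse M).val) (fun y => (he y).ge) fun l => by
      rw [he]; exact (eucPow_eq_one (by simp)).le
  rwa [mul_one] at this

/-- The rounding of a matrix with constant distortion gives a well-conditioned basis. -/
theorem isConditioned_rounding {p Γ : ℝ} (hp₁ : 1 ≤ p) (hp₂ : p ≤ 2) (hΓ : 0 ≤ Γ) {n m d : ℕ}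
    (hd : 0 < d) {A : Matrix (Fin n) (Fin d) ℝ} (hA : ∀ x, A *ᵥ x = 0 → x = 0)
    {M : Fin m → Fin d → ℝ}
    (hM : ∀ z, ∑ i, |(A *ᵥ z) i| ^ p ≤ Γ * ∑ k, |(Matrix.of M *ᵥ z) k| ^ p ∧
      ∑ k, |(Matrix.of M *ᵥ z) k| ^ p ≤ Γ * ∑ i, |(A *ᵥ z) i| ^ p) :
    (Matrix.of (rounding p M).val).det ≠ 0 ∧
      IsConditioned p Γ (4 * Γ * (d : ℝ) ^ (1 + p / 2)) (rowsMul A (rounding p M).val) := by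
  have hp0 : 0 < p := by linarith
  have hd0 : (0 : ℝ) < d := by exact_mod_cast hd
  have hinj := of_mulVec_zero hp0 hA (f := fun v => ∑ k, |v k| ^ p)
    (by simp [Real.zero_rpow hp0.ne']) fun z => (hM z).1
  refine ⟨(rounding_contains hp₁ hp₂ hd M hinj).2.1, ?_⟩
  have hD : (2 * √(d : ℝ)) ^ p ≤ 4 * (d : ℝ) ^ (p / 2) := by
    rw [Real.mul_rpow (by norm_num) (Real.sqrt_nonneg _), Real.sqrt_eq_rpow, ← Real.rpow_mul hd0.le]
    have h1 : (2 : ℝ) ^ p ≤ 4 := by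
      have := Real.rpow_le_rpow_of_exponent_le (show (1 : ℝ) ≤ 2 by norm_num) hp₂
      norm_num at this
      exact this
    have h2 : 1 / 2 * p = p / 2 := by ring
    rw [h2]
    gcongr
  have := isConditioned_of_comparison (D := 4 * (d : ℝ) ^ (p / 2)) hp₁ hp₂ hΓ (fun z => (hM z).1)
    (fun z => (hM z).2) (T := (rounding p M).val) (fun y => rounding_lower hp₁ hp₂ hd M hinj y)
    fun l => by
      refine le_trans (le_of_eq ?_) ((rounding_upper hp₁ hp₂ hd M hinj l).trans hD)
      refine Finset.sum_congr rfl fun k _ => ?_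
      rw [Matrix.mulVec_mulVec, Matrix.mulVec_single_one]
      rfl
  have e : (d : ℝ) * (Γ * (4 * (d : ℝ) ^ (p / 2))) = 4 * Γ * (d : ℝ) ^ (1 + p / 2) := by
    rw [Real.rpow_add hd0, Real.rpow_one]; ring
  rwa [e] at this

/-- An estimate for all vectors in the range of an invertible matrix. -/
theorem forall_of_forall_mulVec {d : ℕ} {T : Matrix (Fin d) (Fin d) ℝ} (hT : T.det ≠ 0)
    {P : (Fin d → ℝ) → Prop} (h : ∀ y, P (T *ᵥ y)) (z : Fin d → ℝ) : P z := by
  have : z = T *ᵥ (T⁻¹ *ᵥ z) := by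
    rw [Matrix.mulVec_mulVec, Matrix.mul_nonsing_inv _ (isUnit_iff_ne_zero.2 hT), Matrix.one_mulVec]
  rw [this]; exact h _

/-- A relative error of `1 / 2` in the norm is a factor of at most `2`, hence at most `2 ^ p ≤ 4`
for the `p`-th powers. -/
theorem le_four_mul_of_abs_rpow_sub_le {p a b : ℝ} (hp₁ : 1 ≤ p) (hp₂ : p ≤ 2) (ha : 0 ≤ a)
    (hb : 0 ≤ b) (h : |a ^ (1 / p) - b ^ (1 / p)| ≤ 1 / 2 * b ^ (1 / p)) :
    b ≤ 4 * a ∧ a ≤ 4 * b := by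
  have hp0 : 0 < p := by linarith
  have h2p : (2 : ℝ) ^ p ≤ 4 := by
    have := Real.rpow_le_rpow_of_exponent_le (show (1 : ℝ) ≤ 2 by norm_num) hp₂
    norm_num at this
    exact this
  have e : ∀ c : ℝ, 0 ≤ c → (c ^ (1 / p)) ^ p = c := fun c hc => by
    rw [← Real.rpow_mul hc, one_div_mul_cancel hp0.ne', Real.rpow_one]
  have ha' : 0 ≤ a ^ (1 / p) := Real.rpow_nonneg ha _
  have hb' : 0 ≤ b ^ (1 / p) := Real.rpow_nonneg hb _
  rw [abs_le] at h
  have h1 := Real.rpow_le_rpow hb' (show b ^ (1 / p) ≤ 2 * a ^ (1 / p) by linarith) hp0.le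
  have h2 := Real.rpow_le_rpow ha' (show a ^ (1 / p) ≤ 2 * b ^ (1 / p) by linarith) hp0.le
  rw [Real.mul_rpow (by norm_num) ha', e a ha, e b hb] at h1
  rw [Real.mul_rpow (by norm_num) hb', e a ha, e b hb] at h2
  constructor <;> nlinarith

/-! ### The algorithm -/

/-- `R̃⁻¹`. -/
noncomputable def coarseBasis {n d s : ℕ} (A : Matrix (Fin n) (Fin d) ℝ)
    (hX : (Fin n → Fin s) × (Fin n → ℝ)) : Fin d → Fin d → ℝ :=
  (qrInverse fun k j => sketch hX.1 hX.2 A k j).val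

/-- The probabilities of the coarse sampling. -/
noncomputable def coarseProb {n d s r : ℕ} (p σ : ℝ) (A : Matrix (Fin n) (Fin d) ℝ)
    (hX : (Fin n → Fin s) × (Fin n → ℝ)) (G : Fin d → Fin r → ℝ) : Fin n → ℝ :=
  sampleProb p σ (rowsMul A (coarseBasis A hX)) G

/-- `R⁻¹`. -/
noncomputable def fineBasis {n d s r : ℕ} (p σ : ℝ) (A : Matrix (Fin n) (Fin d) ℝ)
    (z : ((Fin n → Fin s) × (Fin n → ℝ)) × ((Fin d → Fin r → ℝ) × (Fin n → ℝ))) :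
    Fin d → Fin d → ℝ :=
  (rounding p (denseRows (keptRows p A (coarseProb p σ A z.1 z.2.1) z.2.2)).val).val

theorem measurable_coarseBasis {n d s : ℕ} (A : Matrix (Fin n) (Fin d) ℝ) :
    Measurable (coarseBasis (s := s) A) := measurable_qrInverse (measurable_sketch A)

theorem measurable_fineBasis {n d s r : ℕ} (p σ : ℝ) (A : Matrix (Fin n) (Fin d) ℝ) :
    Measurable (fineBasis (s := s) (r := r) p σ A) := by
  unfold fineBasis coarseProb
  refine measurable_rounding_keptRows p A (fun i => ?_) fun i => ?_
  · exact measurable_sampleProb (measurable_rowsMul A ((measurable_coarseBasis A).comp measurable_fst))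
      (measurable_fst.comp measurable_snd) i
  · exact (measurable_pi_apply i).comp (measurable_snd.comp measurable_snd)

/-- The random numbers are regrouped by stages (embedding, coarse sampling, final sampling), each
independent of the earlier ones. -/
theorem measurePreserving_assoc (p : ℝ) (n d s r : ℕ) [NeZero s] :
    MeasurePreserving (fun ω : Randomness n d s r =>
      (((ω.1, ω.2.1), (ω.2.2.1, ω.2.2.2.1)), (ω.2.2.2.2.1, ω.2.2.2.2.2)))
      (randomnessLaw p n d s r)
      ((((hashLaw n s).prod (stableVecLaw p n)).prod
        ((gaussianMatrixLaw d r).prod (uniformLaw n))).prod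
        ((gaussianMatrixLaw d r).prod (uniformLaw n))) := by
  have h1 := (measurePreserving_prodAssoc (hashLaw n s) (stableVecLaw p n)
    ((gaussianMatrixLaw d r).prod ((uniformLaw n).prod
        ((gaussianMatrixLaw d r).prod (uniformLaw n))))).symm
  have h2 := (MeasurePreserving.id ((hashLaw n s).prod (stableVecLaw p n))).prod
    (measurePreserving_prodAssoc (gaussianMatrixLaw d r) (uniformLaw n)
      ((gaussianMatrixLaw d r).prod (uniformLaw n))).symm
  have h3 := (measurePreserving_prodAssoc ((hashLaw n s).prod (stableVecLaw p n))
    ((gaussianMatrixLaw d r).prod (uniformLaw n)) ((gaussianMatrixLaw d r).prod (uniformLaw n))).symm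
  exact h3.comp (h2.comp h1)

theorem measure_preimage_le {α β : Type*} [MeasurableSpace α] [MeasurableSpace β] {μ : Measure α}
    {ν : Measure β} [IsFiniteMeasure ν] {f : α → β} (hf : MeasurePreserving f μ ν) (S : Set β) {ε : ℝ}
    (h : ν.real S ≤ ε) : μ (f ⁻¹' S) ≤ ENNReal.ofReal ε := by
  calc μ (f ⁻¹' S) ≤ μ.map f S := Measure.le_map_apply hf.measurable.aemeasurable S
    _ = ENNReal.ofReal (ν.real S) := by
        rw [hf.map_eq, measureReal_def, ENNReal.ofReal_toReal (measure_ne_top ν S)]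
    _ ≤ _ := ENNReal.ofReal_le_ofReal h

/-- The success event is not shown to be measurable, so its measure is bounded from below by
subadditivity and not by passing to the complement. -/
theorem ofReal_le_measure_of_bad {α : Type*} [MeasurableSpace α] {μ : Measure α}
    [IsProbabilityMeasure μ] {δ : ℝ} (hδ : 0 ≤ δ) {S B₁ B₂ B₃ : Set α}
    (h1 : μ B₁ ≤ ENNReal.ofReal (δ / 3)) (h2 : μ B₂ ≤ ENNReal.ofReal (δ / 3))
    (h3 : μ B₃ ≤ ENNReal.ofReal (δ / 3)) (h : ∀ ω, ω ∉ B₁ → ω ∉ B₂ → ω ∉ B₃ → ω ∈ S) :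
    ENNReal.ofReal (1 - δ) ≤ μ S := by
  have hcov : (Set.univ : Set α) ⊆ S ∪ (B₁ ∪ (B₂ ∪ B₃)) := by
    intro ω _
    by_contra hc
    simp only [Set.mem_union, not_or] at hc
    exact hc.1 (h ω hc.2.1 hc.2.2.1 hc.2.2.2)
  have hle : (1 : ENNReal) ≤ μ S + ENNReal.ofReal δ := by
    calc (1 : ENNReal) = μ Set.univ := measure_univ.symm
      _ ≤ μ (S ∪ (B₁ ∪ (B₂ ∪ B₃))) := measure_mono hcov
      _ ≤ μ S + (μ B₁ + (μ B₂ + μ B₃)) := (measure_union_le _ _).trans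
          (add_le_add le_rfl ((measure_union_le _ _).trans (add_le_add le_rfl (measure_union_le _ _))))
      _ ≤ μ S + (ENNReal.ofReal (δ / 3) + (ENNReal.ofReal (δ / 3) + ENNReal.ofReal (δ / 3))) := by
          gcongr
      _ = _ := by
          rw [← ENNReal.ofReal_add (by positivity) (by positivity),
            ← ENNReal.ofReal_add (by positivity) (by positivity)]
          congr 2; ring
  rw [ENNReal.ofReal_sub _ hδ, ENNReal.ofReal_one]
  exact tsub_le_iff_right.2 hle

theorem log_le_cast {d : ℕ} (hd : 0 < d) : Real.log d ≤ d := by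
  have := Real.log_le_sub_one_of_pos (show (0 : ℝ) < d by exact_mod_cast hd)
  linarith

theorem gaussDim_pos {c : Constants} (hc : 0 < c.gauss) (n : ℕ) : 0 < gaussDim c n := by
  unfold gaussDim
  rw [Nat.ceil_pos]
  have := Real.log_natCast_nonneg n
  positivity

/-- With `1 + log (1 / δ)` as factor, the number of columns is at least `log n + log (1 / δ)`, which
is what the union bound over the rows needs. -/
theorem mul_exp_gaussDim_le {c : Constants} {δ : ℝ} (hδ : 0 < δ) (hδ₁ : δ ≤ 1)
    (hc : c.gauss = 1 + Real.log (1 / δ)) (n : ℕ) : n * Real.exp (-(gaussDim c n : ℝ)) ≤ δ := by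
  rcases Nat.eq_zero_or_pos n with rfl | hn
  · simpa using hδ.le
  have hn0 : (0 : ℝ) < n := by exact_mod_cast hn
  have hl : 0 ≤ Real.log (1 / δ) := Real.log_nonneg (by rw [le_div_iff₀ hδ]; linarith)
  have hln := Real.log_natCast_nonneg n
  have h1 : Real.log n + Real.log (1 / δ) ≤ gaussDim c n := by
    refine le_trans ?_ (Nat.le_ceil _)
    rw [hc]; nlinarith
  calc (n : ℝ) * Real.exp (-(gaussDim c n : ℝ))
      ≤ n * Real.exp (-(Real.log n + Real.log (1 / δ))) := by gcongr
    _ = δ := by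
        rw [neg_add, Real.exp_add, Real.exp_neg, Real.exp_log hn0, Real.exp_neg,
          Real.exp_log (by positivity)]
        field_simp

/-- The factor in the size of the coarse sample. -/
noncomputable def coarseFactor (δ E : ℝ) : ℝ :=
  (Real.log (4 / δ) + Real.log (80 * E ^ 2) + 742) * 30720 * E ^ 2 / δ

/-- The factor in the size of the final sample. -/
noncomputable def finalFactor (δ : ℝ) : ℝ :=
  (Real.log (4 / δ) + Real.log 2560 + 4) * 491520 / δ

/-- Here `κ₁ κ₂ = E² d ^ 741`, so the net has logarithmic size about `d * 742 log d ≤ 742 d²`. The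
exponent `743` leaves exactly a factor `d²` after division by `κ₁ κ₂`. -/
theorem coarseSize_bound {c : Constants} {δ E : ℝ} (hδ : 0 < δ) (hδ₁ : δ ≤ 1) (hE : 1 ≤ E)
    (hc : c.coarse = coarseFactor δ E) (hk : c.coarseExp = 743) {d : ℕ} (hd : 0 < d) :
    Real.log (4 / δ) + d * Real.log (40 * d * ((E * d ^ 370) * (d * (E * d ^ 370))) / (1 / 2))
      ≤ (1 / 2) ^ 2 * (δ * coarseSize c d) / (7680 * ((E * d ^ 370) * (d * (E * d ^ 370)))) := by
  have hd0 : (1 : ℝ) ≤ d := by exact_mod_cast hd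
  have hl4 : 0 ≤ Real.log (4 / δ) := Real.log_nonneg (by rw [le_div_iff₀ hδ]; linarith)
  have hl80 : 0 ≤ Real.log (80 * E ^ 2) := Real.log_nonneg (by nlinarith)
  have e1 : 40 * d * ((E * d ^ 370) * (d * (E * d ^ 370))) / (1 / 2) = 80 * E ^ 2 * (d : ℝ) ^ 742 := by
    ring
  have e2 : (1 / 2) ^ 2 * (δ * coarseSize c d) / (7680 * ((E * d ^ 370) * (d * (E * d ^ 370))))
      = (Real.log (4 / δ) + Real.log (80 * E ^ 2) + 742) * (d : ℝ) ^ 2 := by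
    rw [coarseSize, hc, hk, coarseFactor, div_eq_iff (by positivity)]
    field_simp
    ring
  rw [e1, e2, Real.log_mul (by positivity) (by positivity), Real.log_pow]
  have h1 := log_le_cast hd
  push_cast
  have h2 : (d : ℝ) ≤ d ^ 2 := by nlinarith
  have h3 : d * Real.log (80 * E ^ 2) ≤ (d : ℝ) ^ 2 * Real.log (80 * E ^ 2) := by gcongr
  have h4 : Real.log (4 / δ) ≤ (d : ℝ) ^ 2 * Real.log (4 / δ) := by nlinarith
  have h5 : (d : ℝ) * (742 * Real.log d) ≤ 742 * d ^ 2 := by nlinarith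
  linarith

/-- Here `κ₁ κ₂ = 64 d ^ (1 + p / 2)`. The size of the net contributes `d log (d κ₁ κ₂ / ε)`, which
is absorbed in `d² (1 + log (1 / ε))`; together these give the exponent `3 + p / 2`. -/
theorem finalSize_bound {c : Constants} {p δ ε : ℝ} (hp₁ : 1 ≤ p) (hp₂ : p ≤ 2) (hδ : 0 < δ)
    (hδ₁ : δ ≤ 1) (hε : 0 < ε) (hε₁ : ε ≤ 1) (hc : c.final = finalFactor δ) {d : ℕ} (hd : 0 < d) :
    Real.log (4 / δ) + d * Real.log (40 * d * (4 * (4 * 4 * (d : ℝ) ^ (1 + p / 2))) / ε)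
      ≤ ε ^ 2 * (δ * finalSize c p ε d) / (7680 * (4 * (4 * 4 * (d : ℝ) ^ (1 + p / 2)))) := by
  have hd0 : (1 : ℝ) ≤ d := by exact_mod_cast hd
  have hd1 : (0 : ℝ) < d := by linarith
  have hl4 : 0 ≤ Real.log (4 / δ) := Real.log_nonneg (by rw [le_div_iff₀ hδ]; linarith)
  have hl : 0 ≤ Real.log 2560 := Real.log_nonneg (by norm_num)
  have hle : 0 ≤ Real.log (1 / ε) := Real.log_nonneg (by rw [le_div_iff₀ hε]; linarith)
  have hdp : (0 : ℝ) < (d : ℝ) ^ (1 + p / 2) := Real.rpow_pos_of_pos hd1 _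
  have e0 : (d : ℝ) ^ (3 + p / 2) = d ^ 2 * (d : ℝ) ^ (1 + p / 2) := by
    rw [show 3 + p / 2 = 2 + (1 + p / 2) by ring, Real.rpow_add hd1]
    norm_num
  have e1 : 40 * d * (4 * (4 * 4 * (d : ℝ) ^ (1 + p / 2))) / ε
      = 2560 * (d * (d : ℝ) ^ (1 + p / 2)) * (1 / ε) := by
    field_simp; norm_num
  have e2 : ε ^ 2 * (δ * finalSize c p ε d) / (7680 * (4 * (4 * 4 * (d : ℝ) ^ (1 + p / 2))))
      = (Real.log (4 / δ) + Real.log 2560 + 4) * ((d : ℝ) ^ 2 * (1 + Real.log (1 / ε))) := by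
    rw [finalSize, hc, finalFactor, e0, div_eq_iff (by positivity)]
    field_simp
    ring
  rw [e1, e2, Real.log_mul (by positivity) (by positivity), Real.log_mul (by norm_num) (by positivity),
    Real.log_mul (by positivity) hdp.ne', Real.log_rpow hd1]
  have h1 := log_le_cast hd
  have h0 : 0 ≤ Real.log d := Real.log_natCast_nonneg d
  have h2 : Real.log d + (1 + p / 2) * Real.log d ≤ 3 * d := by nlinarith
  set ℓ := Real.log (1 / ε) with hℓ
  have hX : (d : ℝ) ≤ d ^ 2 * (1 + ℓ) := by nlinarith
  have hX1 : 1 ≤ (d : ℝ) ^ 2 * (1 + ℓ) := by linarith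
  have h4 : Real.log (4 / δ) ≤ Real.log (4 / δ) * (d ^ 2 * (1 + ℓ)) := by nlinarith
  have h5 : (d : ℝ) * Real.log 2560 ≤ Real.log 2560 * (d ^ 2 * (1 + ℓ)) := by nlinarith
  have h6 : (d : ℝ) * (Real.log d + (1 + p / 2) * Real.log d) ≤ 3 * (d ^ 2 * (1 + ℓ)) := by nlinarith
  have h7 : (d : ℝ) * ℓ ≤ d ^ 2 * (1 + ℓ) := by nlinarith
  linarith

/-- The three bad events of the algorithm, and what holds outside of them. -/
theorem exists_bad_events {c : Constants} {p δ E ε : ℝ} (hp₁ : 1 ≤ p) (hp₂ : p < 2) (hδ : 0 < δ)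
    (hδ₁ : δ ≤ 1) (hE : 1 ≤ E) (hgauss : c.gauss = 1 + Real.log (1 / δ))
    (hcoarse : c.coarse = coarseFactor δ E) (hk : c.coarseExp = 743)
    (hfinal : c.final = finalFactor δ) (hε : 0 < ε) (hε₁ : ε ≤ 1) {n d : ℕ} (hd : 0 < d)
    {A : Matrix (Fin n) (Fin d) ℝ} (hA : ∀ x, A *ᵥ x = 0 → x = 0)
    (hembed : ((hashLaw n (embedDim c d)).prod (stableVecLaw p n)).real
        {hX | ¬ ∀ z, ∑ i, |(A *ᵥ z) i| ^ p ≤ E * d ^ 370 * eucPow p (sketch hX.1 hX.2 A *ᵥ z) ∧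
          eucPow p (sketch hX.1 hX.2 A *ᵥ z) ≤ E * d ^ 370 * ∑ i, |(A *ᵥ z) i| ^ p} ≤ 4 * δ) :
    ∃ B₁ B₂ B₃ : Set (Randomness n d (embedDim c d) (gaussDim c n)),
      randomnessLaw p n d (embedDim c d) (gaussDim c n) B₁ ≤ ENNReal.ofReal (4 * δ) ∧
      randomnessLaw p n d (embedDim c d) (gaussDim c n) B₂ ≤ ENNReal.ofReal (4 * δ) ∧
      randomnessLaw p n d (embedDim c d) (gaussDim c n) B₃ ≤ ENNReal.ofReal (4 * δ) ∧
      ∀ ω, ω ∉ B₁ → ω ∉ B₂ → ω ∉ B₃ →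
        (∑ i, (if ω.2.2.2.1 i < coarseProb p (coarseSize c d) A (ω.1, ω.2.1) ω.2.2.1 i then (1 : ℝ)
          else 0) < coarseSize c d / δ) ∧
        (∀ z, |sampleSum (sampleProb p (finalSize c p ε d) (rowsMul A (fineBasis p (coarseSize c d) A
            ((ω.1, ω.2.1), (ω.2.2.1, ω.2.2.2.1)))) ω.2.2.2.2.1) (fun i => |(A *ᵥ z) i| ^ p)
              ω.2.2.2.2.2 ^ (1 / p) - (∑ i, |(A *ᵥ z) i| ^ p) ^ (1 / p)|
            ≤ ε * (∑ i, |(A *ᵥ z) i| ^ p) ^ (1 / p)) ∧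
        ∑ i, (if ω.2.2.2.2.2 i < sampleProb p (finalSize c p ε d) (rowsMul A (fineBasis p
          (coarseSize c d) A ((ω.1, ω.2.1), (ω.2.2.1, ω.2.2.2.1)))) ω.2.2.2.2.1 i then (1 : ℝ) else 0)
          < finalSize c p ε d / δ := by
  have hd0 : (1 : ℝ) ≤ d := by exact_mod_cast hd
  have hl : 0 ≤ Real.log (1 / δ) := Real.log_nonneg (by rw [le_div_iff₀ hδ]; linarith)
  have hl4 : 0 ≤ Real.log (4 / δ) := Real.log_nonneg (by rw [le_div_iff₀ hδ]; linarith)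
  have hl80 : 0 ≤ Real.log (80 * E ^ 2) := Real.log_nonneg (by nlinarith)
  have hl25 : 0 ≤ Real.log 2560 := Real.log_nonneg (by norm_num)
  have hle : 0 ≤ Real.log (1 / ε) := Real.log_nonneg (by rw [le_div_iff₀ hε]; linarith)
  set Γ := E * (d : ℝ) ^ 370 with hΓ
  have hΓ1 : 1 ≤ Γ := one_le_mul_of_one_le_of_one_le hE (one_le_pow₀ hd0)
  have hdΓ1 : 1 ≤ d * Γ := one_le_mul_of_one_le_of_one_le hd0 hΓ1
  have hdp1 : 1 ≤ 4 * 4 * (d : ℝ) ^ (1 + p / 2) := by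
    have := Real.one_le_rpow hd0 (show 0 ≤ 1 + p / 2 by linarith)
    linarith
  have hr := gaussDim_pos (c := c) (by rw [hgauss]; linarith) n
  have hrδ := mul_exp_gaussDim_le hδ hδ₁ hgauss n
  have hσ₁ : 0 < coarseSize c d := by
    rw [coarseSize, hcoarse, coarseFactor]; positivity
  have hσ₂ : 0 < finalSize c p ε d := by
    rw [finalSize, hfinal, finalFactor]; positivity
  obtain ⟨S₂, hm₂, hsec₂, hS₂⟩ := exists_sampling_event hp₁ hp₂.le hΓ1 hdΓ1 hσ₁ hδ
    (show (0 : ℝ) < 1 / 2 by norm_num) (by norm_num) hr hd hrδ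
    (coarseSize_bound hδ hδ₁ hE hcoarse hk hd)
  obtain ⟨S₃, hm₃, hsec₃, hS₃⟩ := exists_sampling_event hp₁ hp₂.le (show (1 : ℝ) ≤ 4 by norm_num) hdp1
    hσ₂ hδ hε hε₁ hr hd hrδ (finalSize_bound hp₁ hp₂.le hδ hδ₁ hε hε₁ hfinal hd)
  have hφ := measurePreserving_assoc p n d (embedDim c d) (gaussDim c n)
  set φ := fun ω : Randomness n d (embedDim c d) (gaussDim c n) =>
      (((ω.1, ω.2.1), (ω.2.2.1, ω.2.2.2.1)), (ω.2.2.2.2.1, ω.2.2.2.2.2)) with hφdef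
  set S₁ := {hX : (Fin n → Fin (embedDim c d)) × (Fin n → ℝ) |
    ¬ ∀ z, ∑ i, |(A *ᵥ z) i| ^ p ≤ Γ * eucPow p (sketch hX.1 hX.2 A *ᵥ z) ∧
          eucPow p (sketch hX.1 hX.2 A *ᵥ z) ≤ Γ * ∑ i, |(A *ᵥ z) i| ^ p} with hS₁
  have h4δ : 0 ≤ 4 * δ := by linarith
  refine ⟨φ ⁻¹' ((S₁ ×ˢ Set.univ) ×ˢ Set.univ),
    φ ⁻¹' ({ab | (rowsMul A (coarseBasis A ab.1), ab.2) ∈ S₂} ×ˢ Set.univ),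
    φ ⁻¹' {abc | (rowsMul A (fineBasis p (coarseSize c d) A abc.1), abc.2) ∈ S₃},
    measure_preimage_le hφ _ ?_, measure_preimage_le hφ _ ?_, measure_preimage_le hφ _ ?_, ?_⟩
  · rw [measureReal_prod_prod, measureReal_prod_prod]
    simpa using hembed
  · rw [measureReal_prod_prod, probReal_univ, mul_one]
    exact measureReal_section_le _ _ (measurable_rowsMul A (measurable_coarseBasis A)) hm₂ h4δ hsec₂
  · exact measureReal_section_le _ _ (measurable_rowsMul A (measurable_fineBasis p _ A)) hm₃ h4δ hsec₃
  · intro ω h1 h2 h3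
    have g1 : ∀ z, ∑ i, |(A *ᵥ z) i| ^ p ≤ Γ * eucPow p (sketch ω.1 ω.2.1 A *ᵥ z) ∧
          eucPow p (sketch ω.1 ω.2.1 A *ᵥ z) ≤ Γ * ∑ i, |(A *ᵥ z) i| ^ p := by
      by_contra hc
      exact h1 ⟨⟨hc, trivial⟩, trivial⟩
    have g2 : (rowsMul A (coarseBasis A (ω.1, ω.2.1)), (ω.2.2.1, ω.2.2.2.1)) ∉ S₂ := fun hc =>
      h2 ⟨hc, trivial⟩
    have g3 : (rowsMul A (fineBasis p (coarseSize c d) A ((ω.1, ω.2.1), (ω.2.2.1, ω.2.2.2.1))),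
      (ω.2.2.2.2.1, ω.2.2.2.2.2)) ∉ S₃ := h3
    -- Outside of the three events the stages can be chained: the distortion of the sketch
    -- conditions the first basis, the coarse sample preserves norms up to a constant, its rounding
    -- conditions the second basis, and the final sample is accurate.
    obtain ⟨hdet₁, hcond₁⟩ := isConditioned_qrInverse hp₁ hp₂.le (by linarith) hA
      (M := fun k j => sketch ω.1 ω.2.1 A k j) g1
    obtain ⟨hemb₁, hcard₁⟩ := hS₂ _ _ _ hcond₁ g2
    -- Invertibility of the basis change turns an estimate in coordinates into one for all of the
    -- column space.
    have hz₁ := forall_of_forall_mulVec hdet₁ (P := fun z =>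
      |sampleSum (coarseProb p (coarseSize c d) A (ω.1, ω.2.1) ω.2.2.1) (fun i => |(A *ᵥ z) i| ^ p)
        ω.2.2.2.1 ^ (1 / p) - (∑ i, |(A *ᵥ z) i| ^ p) ^ (1 / p)|
          ≤ 1 / 2 * (∑ i, |(A *ᵥ z) i| ^ p) ^ (1 / p)) fun y => by
      have := hemb₁ y
      simp only [rowsMul_dotProduct] at this
      exact this
    have hp0 : 0 < p := by linarith
    have hq₁ : ∀ i, 0 ≤ coarseProb p (coarseSize c d) A (ω.1, ω.2.1) ω.2.2.1 i := fun i =>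
      sampleProb_nonneg hσ₁.le _ _ i
    obtain ⟨hdet₂, hcond₂⟩ := isConditioned_rounding hp₁ hp₂.le (show (0 : ℝ) ≤ 4 by norm_num) hd hA
      (M := (denseRows (keptRows p A (coarseProb p (coarseSize c d) A (ω.1, ω.2.1) ω.2.2.1)
        ω.2.2.2.1)).val) fun z => by
      rw [denseRows_mulVec hp0 A hq₁]
      refine le_four_mul_of_abs_rpow_sub_le hp₁ hp₂.le ?_
        (Finset.sum_nonneg fun i _ => by positivity) (hz₁ z)
      refine Finset.sum_nonneg fun i _ => mul_nonneg ?_ (by positivity)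
      split_ifs
      · exact inv_nonneg.2 (hq₁ i)
      · exact le_rfl
    obtain ⟨hemb₂, hcard₂⟩ := hS₃ _ _ _ hcond₂ g3
    refine ⟨hcard₁, forall_of_forall_mulVec hdet₂ fun y => ?_, hcard₂⟩
    have := hemb₂ y
    simp only [rowsMul_dotProduct] at this
    exact this

/-! ### Running times -/

/-- Applied along a program, it produces a cost expression of the same shape; the sums in the bounds
below mirror the programs line by line. -/
theorem bind_cost_le {α β : Type} {x : Timed α} {f : α → Timed β} {a b : ℕ} (hx : x.cost ≤ a)
    (hf : (f x.val).cost ≤ b) : (x >>= f).cost ≤ a + b := Nat.add_le_add hx hf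

theorem zeros_cost_le (a b : ℕ) : (zeros a b).cost ≤ a * (b * (0 + 1) + 1) :=
  tabulate_cost_le _ _ fun _ => tabulate_cost_le _ _ fun _ => le_rfl

theorem dot_cost_le {a : ℕ} (u v : Fin a → ℝ) : (dot u v).cost ≤ a * (1 + 1) :=
  sum_cost_le _ _ fun _ => le_rfl

theorem matVec_cost_le {a b : ℕ} (P : Fin a → Fin b → ℝ) (u : Fin b → ℝ) :
    (matVec P u).cost ≤ a * (b * (1 + 1) + 1) :=
  tabulate_cost_le _ _ fun _ => sum_cost_le _ _ fun _ => le_rfl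

theorem vecMat_cost_le {a b : ℕ} (u : Fin a → ℝ) (P : Fin a → Fin b → ℝ) :
    (vecMat u P).cost ≤ b * (a * (1 + 1) + 1) :=
  tabulate_cost_le _ _ fun _ => sum_cost_le _ _ fun _ => le_rfl

theorem matMul_cost_le {a b c : ℕ} (P : Fin a → Fin b → ℝ) (Q : Fin b → Fin c → ℝ) :
    (matMul P Q).cost ≤ a * (c * (b * (1 + 1) + 1) + 1) :=
  tabulate_cost_le _ _ fun _ => tabulate_cost_le _ _ fun _ => sum_cost_le _ _ fun _ => le_rfl

theorem sum_rowEntries_length {n d : ℕ} (A : Matrix (Fin n) (Fin d) ℝ) :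
    ((sparseRows A).map fun row => row.2.length).sum = nnz A := by
  classical
  rw [sparseRows_sum _ (fun row : SparseRow n d => row.2.length) (by simp)]
  have h1 : ∀ i, (rowEntries A i).length = ∑ j, if A i j ≠ 0 then 1 else 0 := by
    intro i
    have h := rowEntries_sum A i (fun e => if e.2 ≠ 0 then 1 else 0) (by simp)
    rw [← h]
    have h2 : ∀ e ∈ rowEntries A i, (if e.2 ≠ 0 then 1 else 0) = 1 := by
      intro e he
      simp only [rowEntries, List.mem_map, List.mem_filter] at he
      obtain ⟨j, ⟨-, hj⟩, rfl⟩ := he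
      rw [if_pos (by simpa using hj)]
    rw [List.map_congr_left h2, List.map_const', List.sum_replicate, smul_eq_mul, mul_one]
  have h2 : nnz A = (Finset.univ.filter fun ij : Fin n × Fin d => A ij.1 ij.2 ≠ 0).card := by
    rw [nnz, ← Set.ncard_coe_finset]
    congr 1
    ext ij; simp
  rw [h2, Finset.card_filter, Fintype.sum_prod_type]
  exact Finset.sum_congr rfl fun i _ => h1 i

/-- As the list has no empty rows, a constant cost per row can be charged to the entries of that
row. -/
theorem one_le_length_of_mem_sparseRows {n d : ℕ} {A : Matrix (Fin n) (Fin d) ℝ} {row : SparseRow n d}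
    (h : row ∈ sparseRows A) : 1 ≤ row.2.length := by
  simp only [sparseRows, List.mem_filter] at h
  have : row.2 ≠ [] := by simpa using h.2
  exact List.length_pos_iff.2 this

theorem sum_map_le_nnz {n d : ℕ} (A : Matrix (Fin n) (Fin d) ℝ) (f : SparseRow n d → ℕ) (a : ℕ)
    (hf : ∀ row ∈ sparseRows A, f row ≤ a * row.2.length) : ((sparseRows A).map f).sum ≤ a * nnz A := by
  calc _ ≤ ((sparseRows A).map fun row => a * row.2.length).sum := List.sum_le_sum hf
    _ = _ := by rw [List.sum_map_mul_left, sum_rowEntries_length]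

theorem length_sparseRows_le {n d : ℕ} (A : Matrix (Fin n) (Fin d) ℝ) :
    (sparseRows A).length ≤ nnz A := by
  have := sum_map_le_nnz A (fun _ => 1) 1 fun row hrow => by
    simpa using one_le_length_of_mem_sparseRows hrow
  simpa using this

theorem rowEntries_length_le {n d : ℕ} (A : Matrix (Fin n) (Fin d) ℝ) (i : Fin n) :
    (rowEntries A i).length ≤ d := by
  rw [rowEntries, List.length_map]
  exact (List.length_filter_le _ _).trans (by simp)

theorem nnz_le {n d : ℕ} (A : Matrix (Fin n) (Fin d) ℝ) : nnz A ≤ n * d := by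
  refine (Set.ncard_le_ncard (Set.subset_univ _)).trans ?_
  rw [Set.ncard_univ, Nat.card_eq_fintype_card, Fintype.card_prod, Fintype.card_fin, Fintype.card_fin]

theorem sparseEmbed_cost_le {n d s : ℕ} (A : Matrix (Fin n) (Fin d) ℝ) (h : Fin n → Fin s)
    (X : Fin n → ℝ) :
    (sparseEmbed (sparseRows A) h X).cost ≤ s * (d * (0 + 1) + 1) + 7 * nnz A := by
  refine bind_cost_le (zeros_cost_le _ _) ?_
  refine (forList_cost_le _ _ _ (fun row => 1 + (1 + (row.2.map fun _ => 3 + 1).sum))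
    fun row _ M => ?_).trans (sum_map_le_nnz A _ 7 fun row hrow => ?_)
  · exact bind_cost_le le_rfl (bind_cost_le le_rfl (forList_cost_le _ _ _ (fun _ => 3)
      fun e _ t => le_rfl))
  · have := one_le_length_of_mem_sparseRows hrow
    simp
    omega

theorem qrInverse_cost_le {m d : ℕ} (hd : 0 < d) (M : Fin m → Fin d → ℝ) :
    (qrInverse M).cost ≤ 20 * (d ^ 2 * (m + d)) := by
  have h : (qrInverse M).cost ≤ d * (m * (0 + 1) + 1) + (d * (d * (0 + 1) + 1) +
      (d * ((m * (0 + 1) + (d * (0 + 1) + (d * ((m * (1 + 1) + (m * (1 + 1 + 1) +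
        (d * (1 + 1 + 1) + 0))) + 1) + (m * (1 + 1) + (1 + (m * (1 + 1) + (d * (1 + 1) +
          (1 + (1 + 0))))))))) + 1) + d * (d * (0 + 1) + 1))) := by
    refine bind_cost_le (zeros_cost_le _ _) (bind_cost_le (zeros_cost_le _ _)
      (bind_cost_le (forFin_cost_le _ _ _ fun j QT => ?_)
        (tabulate_cost_le _ _ fun _ => tabulate_cost_le _ _ fun _ => le_rfl)))
    refine bind_cost_le (tabulate_cost_le _ _ fun _ => le_rfl) (bind_cost_le
      (tabulate_cost_le _ _ fun _ => le_rfl) (bind_cost_le (forFin_cost_le _ _ _ fun i vt => ?_)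
      (bind_cost_le (dot_cost_le _ _) (bind_cost_le le_rfl (bind_cost_le
        (tabulate_cost_le _ _ fun _ => le_rfl) (bind_cost_le (tabulate_cost_le _ _ fun _ => le_rfl)
          (bind_cost_le le_rfl (bind_cost_le le_rfl le_rfl))))))))
    split_ifs
    · exact bind_cost_le (dot_cost_le _ _) (bind_cost_le (tabulate_cost_le _ _ fun _ => le_rfl)
        (bind_cost_le (tabulate_cost_le _ _ fun _ => le_rfl) le_rfl))
    · exact Nat.zero_le _
  refine h.trans ?_
  have h1 : 1 ≤ d := hd
  have h2 : d ≤ d * d := Nat.le_mul_self d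
  have h3 : d * m ≤ d * (d * m) := Nat.mul_le_mul_left _ (Nat.le_mul_of_pos_left _ hd)
  have h4 : d * d ≤ d * (d * d) := Nat.mul_le_mul_left _ h2
  ring_nf at h2 h3 h4 ⊢
  omega

theorem sampleRows_cost_le {n d r : ℕ} (p σ : ℝ) (A : Matrix (Fin n) (Fin d) ℝ)
    (T : Fin d → Fin d → ℝ) (G : Fin d → Fin r → ℝ) (x : Fin n → ℝ) (hd : 0 < d) :
    (sampleRows p σ (sparseRows A) T G x).cost ≤ 20 * ((r + 1) * (nnz A + d ^ 2)) := by
  have h : (sampleRows p σ (sparseRows A) T G x).cost ≤ d * (r * (1 + 1) + 1) +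
      (d * (r * (d * (1 + 1) + 1) + 1) + (1 + ((5 * r + 2) * nnz A + (nnz A + (1 + 8 * nnz A))))) := by
    refine bind_cost_le (tabulate_cost_le _ _ fun _ => tabulate_cost_le _ _ fun _ => le_rfl)
      (bind_cost_le (matMul_cost_le _ _) (bind_cost_le le_rfl (bind_cost_le ?_
        (bind_cost_le ?_ (bind_cost_le le_rfl ?_)))))
    · refine sum_map_le_nnz A _ _ fun row hrow => ?_
      have h1 := one_le_length_of_mem_sparseRows hrow
      have h2 : r ≤ r * row.2.length := Nat.le_mul_of_pos_right _ h1
      have h3 : ∀ x : Timed (Fin r → ℝ), x.cost ≤ r * (2 * row.2.length + 1) →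
          (x >>= fun v => dot v v >>= fun a => Timed.pow a (p / 2) >>= fun score =>
            (pure (row, score) : Timed (SparseRow n d × ℝ))).cost + 1 ≤
              (5 * r + 2) * row.2.length := by
        intro x hx
        have h4 := bind_cost_le (f := fun v => dot v v >>= fun a => Timed.pow a (p / 2) >>=
          fun score => (pure (row, score) : Timed (SparseRow n d × ℝ))) (b := r * (1 + 1) + (1 + 0))
          hx (bind_cost_le (dot_cost_le _ _) (bind_cost_le le_rfl le_rfl))
        refine (Nat.add_le_add_right h4 1).trans ?_
        ring_nf
        ring_nf at h2
        omega
      refine h3 _ (tabulate_cost_le _ _ fun k => le_of_eq ?_)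
      change (row.2.map fun _ => 1 + 1).sum = _
      simp [mul_comm]
    · refine le_trans (le_of_eq ?_) (length_sparseRows_le A)
      change (((sparseRows A).map _).map fun _ => 0 + 1).sum = _
      rw [List.map_const', List.sum_replicate, List.length_map, smul_eq_mul, zero_add, mul_one]
    · refine (forList_cost_le _ _ _ (fun _ => 7) fun y _ acc => ?_).trans ?_
      · show _ ≤ 1 + (1 + (1 + (1 + (1 + 2))))
        refine bind_cost_le le_rfl (bind_cost_le le_rfl (bind_cost_le le_rfl (bind_cost_le le_rfl
          (bind_cost_le le_rfl ?_))))
        split_ifs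
        · exact le_rfl
        · exact Nat.zero_le _
      · have h1 := length_sparseRows_le A
        change (((sparseRows A).map _).map fun _ => 7 + 1).sum ≤ _
        rw [List.map_const', List.sum_replicate, List.length_map, smul_eq_mul]
        omega
  refine h.trans ?_
  have h2 : d ≤ d ^ 2 := Nat.le_self_pow (by norm_num) d
  have h3 : r * d ≤ r * d ^ 2 := Nat.mul_le_mul_left _ h2
  have h4 : 1 ≤ d ^ 2 := Nat.one_le_pow _ _ hd
  ring_nf at h2 h3 h4 ⊢
  omega

theorem denseRows_cost_le {n d : ℕ} (hd : 0 < d) {L : List (SparseRow n d × ℝ)}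
    {A : Matrix (Fin n) (Fin d) ℝ} (hL : ∀ y ∈ L, y.1.2 = rowEntries A y.1.1) :
    (denseRows L).cost ≤ 5 * (d * L.length) := by
  have h : (denseRows L).cost ≤ L.length * ((d * (0 + 1) + 3 * d) + 1) := by
    refine tabulate_cost_le _ _ fun k => bind_cost_le (tabulate_cost_le _ _ fun _ => le_rfl) ?_
    refine (forList_cost_le _ _ _ (fun _ => 2) fun e _ t => le_rfl).trans ?_
    have h1 : (L.get k).1.2.length ≤ d := by
      rw [hL _ (L.get_mem k)]; exact rowEntries_length_le A _
    simp only [List.map_const', List.sum_replicate, smul_eq_mul]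
    omega
  refine h.trans ?_
  have : L.length ≤ L.length * d := Nat.le_mul_of_pos_right _ hd
  ring_nf at this ⊢
  omega

theorem roundingStep_cost_le {m d : ℕ} (hd : 0 < d) (p : ℝ) (M : Fin m → Fin d → ℝ)
    (B : Fin d → Fin d → ℝ) : (roundingStep p M B).cost ≤ 60 * (d ^ 2 * (m + 1)) := by
  have h : (roundingStep p M B).cost ≤ 1 + (1 + (d * ((d * (1 + 1) + (m * (d * (1 + 1) + 1) +
      (m * (2 + 1) + (1 + 0)))) + 1) + (1 + (m * (4 + 1) + (d * (m * (1 + 1) + 1) +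
      (d * (d * (1 + 1) + 1) + (d * (1 + 1) + (1 + (d * (1 + 1) + (1 + (1 + (1 + (1 + (1 +
      (d * (d * (1 + 1) + 1) + d * (d * (4 + 1) + 1)))))))))))))))) := by
    refine bind_cost_le le_rfl (bind_cost_le le_rfl (bind_cost_le
      (forFin_cost_le _ _ _ fun l acc => ?_) ?_))
    · exact bind_cost_le (tabulate_cost_le _ _ fun _ => le_rfl) (bind_cost_le (matVec_cost_le _ _)
        (bind_cost_le (sum_cost_le _ _ fun _ => le_rfl) (bind_cost_le le_rfl le_rfl)))
    · split
      · exact Nat.zero_le _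
      · exact bind_cost_le le_rfl (bind_cost_le (tabulate_cost_le _ _ fun _ => le_rfl)
          (bind_cost_le (vecMat_cost_le _ _) (bind_cost_le (vecMat_cost_le _ _)
          (bind_cost_le (dot_cost_le _ _) (bind_cost_le le_rfl (bind_cost_le
          (tabulate_cost_le _ _ fun _ => le_rfl) (bind_cost_le le_rfl (bind_cost_le le_rfl
          (bind_cost_le le_rfl (bind_cost_le le_rfl (bind_cost_le le_rfl (bind_cost_le
          (matVec_cost_le _ _) (tabulate_cost_le _ _ fun _ => tabulate_cost_le _ _ fun _ =>
            le_rfl)))))))))))))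
  refine h.trans ?_
  have h2 : d ≤ d ^ 2 := Nat.le_self_pow (by norm_num) d
  have h3 : m * d ≤ m * d ^ 2 := Nat.mul_le_mul_left _ h2
  have h4 : 1 ≤ d ^ 2 := Nat.one_le_pow _ _ hd
  have h5 : m ≤ m * d ^ 2 := Nat.le_mul_of_pos_right _ h4
  ring_nf at h2 h3 h4 h5 ⊢
  omega

theorem rounding_cost_le {m d : ℕ} (hd : 0 < d) (p : ℝ) (M : Fin m → Fin d → ℝ) :
    (rounding p M).cost ≤ 300 * (d ^ 3 * (m + 1) ^ 2) := by
  -- Replacing `log m` by `m` is harmless: only a polynomial bound is needed, as `m` will be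
  -- polynomial in `d`.
  have hN : ⌈4 * (d : ℝ) * Real.log m⌉₊ ≤ 4 * d * m := by
    refine Nat.ceil_le.2 ?_
    push_cast
    have h1 : Real.log m ≤ m := (Real.log_le_self (Nat.cast_nonneg m))
    gcongr
  have h : (rounding p M).cost ≤ 20 * (d ^ 2 * (m + d)) + (1 + (1 + (1 + (1 +
      (4 * d * m + 1) * (60 * (d ^ 2 * (m + 1)) + 1))))) := by
    refine bind_cost_le (qrInverse_cost_le hd M) (bind_cost_le le_rfl (bind_cost_le le_rfl
      (bind_cost_le le_rfl (bind_cost_le le_rfl ?_))))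
    refine (repeatTimes_cost_le _ _ _ _ fun B => roundingStep_cost_le hd p M B).trans ?_
    exact Nat.mul_le_mul_right _ (Nat.succ_le_succ hN)
  refine h.trans ?_
  have h4 : 1 ≤ d ^ 2 := Nat.one_le_pow _ _ hd
  have h5 : d ^ 2 * (m + d) ≤ d ^ 3 * (m + 1) ^ 2 := by
    calc d ^ 2 * (m + d) ≤ d ^ 2 * (d * (m + 1)) := by
          refine Nat.mul_le_mul_left _ ?_
          have : m ≤ d * m := Nat.le_mul_of_pos_left _ hd
          rw [mul_add, mul_one]; omega
      _ = d ^ 3 * (m + 1) := by ring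
      _ ≤ _ := Nat.mul_le_mul_left _ (Nat.le_self_pow (by norm_num) _)
  have h6 : 1 ≤ d ^ 3 * (m + 1) ^ 2 :=
    Nat.mul_pos (Nat.pow_pos hd) (Nat.pow_pos (Nat.succ_pos m))
  have h7 : (4 * d * m + 1) * (60 * (d ^ 2 * (m + 1)) + 1) ≤ 244 * (d ^ 3 * (m + 1) ^ 2) := by
    calc _ ≤ (4 * d * (m + 1)) * (61 * (d ^ 2 * (m + 1))) := by
          refine Nat.mul_le_mul ?_ ?_
          · rw [mul_add]; omega
          · have : 1 ≤ d ^ 2 * (m + 1) := Nat.mul_pos h4 (Nat.succ_pos m)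
            omega
      _ = _ := by ring
  omega

/-- The outcome of the coarse sampling. -/
theorem coarseSample_val {p σ : ℝ} (hp : 0 < p) {n d s r : ℕ} (A : Matrix (Fin n) (Fin d) ℝ)
    (h : Fin n → Fin s) (X : Fin n → ℝ) (G : Fin d → Fin r → ℝ) (x : Fin n → ℝ) :
    (sampleRows p σ (sparseRows A) (qrInverse (sparseEmbed (sparseRows A) h X).val).val G x).val
      = keptRows p A (coarseProb p σ A (h, X) G) x := by
  have hT : (qrInverse (sparseEmbed (sparseRows A) h X).val).val = coarseBasis A (h, X) := by
    rw [coarseBasis]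
    congr 2
    exact sparseEmbed_val A h X
  rw [hT, sampleRows_val hp]
  rfl

/-- The running time of the algorithm, in terms of the sizes of its intermediate results. -/
theorem improvedEmbedding_cost_le {c : Constants} {p ε : ℝ} (hp : 0 < p) {n d : ℕ} (hd : 0 < d)
    (A : Matrix (Fin n) (Fin d) ℝ) (ω : Randomness n d (embedDim c d) (gaussDim c n)) {m : ℕ}
    (hm : (keptRows p A (coarseProb p (coarseSize c d) A (ω.1, ω.2.1) ω.2.2.1) ω.2.2.2.1).length ≤ m) :
    (improvedEmbedding c p ε (sparseRows A) ω).cost ≤ 30 + 22 * (d ^ 2 * (embedDim c d + d)) +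
      8 * nnz A + 40 * ((gaussDim c n + 1) * (nnz A + d ^ 2)) + 305 * (d ^ 3 * (m + 1) ^ 2) := by
  set L := keptRows p A (coarseProb p (coarseSize c d) A (ω.1, ω.2.1) ω.2.2.1) ω.2.2.2.1 with hLdef
  have h : (improvedEmbedding c p ε (sparseRows A) ω).cost ≤ 30 +
      ((embedDim c d * (d * (0 + 1) + 1) + 7 * nnz A) + (20 * (d ^ 2 * (embedDim c d + d)) +
      (20 * ((gaussDim c n + 1) * (nnz A + d ^ 2)) + (5 * (d * L.length) +
      (300 * (d ^ 3 * (L.length + 1) ^ 2) +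
      (20 * ((gaussDim c n + 1) * (nnz A + d ^ 2)) + nnz A)))))) := by
    refine bind_cost_le le_rfl (bind_cost_le (sparseEmbed_cost_le _ _ _) (bind_cost_le
      (qrInverse_cost_le hd _) (bind_cost_le (sampleRows_cost_le _ _ _ _ _ _ hd) ?_)))
    rw [coarseSample_val hp, ← hLdef]
    refine bind_cost_le (denseRows_cost_le hd (keptRows_entries p A _ _)) (bind_cost_le
      (rounding_cost_le hd _ _) (bind_cost_le (sampleRows_cost_le _ _ _ _ _ _ hd) ?_))
    rw [sampleRows_val hp]
    change ((keptRows p A _ _).map fun _ => 0 + 1).sum ≤ _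
    rw [List.map_const', List.sum_replicate, smul_eq_mul, zero_add, mul_one, keptRows, List.length_reverse,
      List.length_map]
    exact (List.length_filter_le _ _).trans (length_sparseRows_le A)
  refine h.trans ?_
  have h1 : L.length + 1 ≤ m + 1 := Nat.succ_le_succ hm
  have h2 : d ^ 3 * (L.length + 1) ^ 2 ≤ d ^ 3 * (m + 1) ^ 2 :=
    Nat.mul_le_mul_left _ (Nat.pow_le_pow_left h1 2)
  have h3 : d * L.length ≤ d ^ 3 * (m + 1) ^ 2 := by
    refine Nat.mul_le_mul (Nat.le_self_pow (by norm_num) d) ?_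
    exact (Nat.le_succ_of_le hm).trans (Nat.le_self_pow (by norm_num) _)
  have h4 : embedDim c d * (d * (0 + 1) + 1) ≤ 2 * (d ^ 2 * (embedDim c d + d)) := by
    have h5 : d + 1 ≤ 2 * d ^ 2 := by
      have := Nat.le_self_pow (n := 2) (by norm_num) d
      omega
    calc embedDim c d * (d * (0 + 1) + 1) = (d + 1) * embedDim c d := by ring
      _ ≤ (2 * d ^ 2) * (embedDim c d + d) := Nat.mul_le_mul h5 (Nat.le_add_right _ _)
      _ = _ := by ring
  omega

/-! ### The guarantees of the algorithm -/

theorem improvedEmbedding_val {c : Constants} {p ε : ℝ} (hp : 0 < p) {n d : ℕ}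
    (A : Matrix (Fin n) (Fin d) ℝ) (ω : Randomness n d (embedDim c d) (gaussDim c n)) :
    (improvedEmbedding c p ε (sparseRows A) ω).val = (keptRows p A (sampleProb p (finalSize c p ε d)
      (rowsMul A (fineBasis p (coarseSize c d) A ((ω.1, ω.2.1), (ω.2.2.1, ω.2.2.2.1)))) ω.2.2.2.2.1)
        ω.2.2.2.2.2).map fun y => (y.1.1, y.2) := by
  change (sampleRows p (finalSize c p ε d) (sparseRows A) (rounding p (denseRows (sampleRows p
    (coarseSize c d) (sparseRows A) (qrInverse (sparseEmbed (sparseRows A) ω.1 ω.2.1).val).val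
      ω.2.2.1 ω.2.2.2.1).val).val).val ω.2.2.2.2.1 ω.2.2.2.2.2).val.map _ = _
  rw [coarseSample_val hp, sampleRows_val hp]
  rfl

theorem mulVec_eq_zero_of_rank_eq {n d : ℕ} {A : Matrix (Fin n) (Fin d) ℝ} (hA : A.rank = d)
    (x : Fin d → ℝ) (hx : A *ᵥ x = 0) : x = 0 := by
  have h1 := LinearMap.finrank_range_add_finrank_ker A.mulVecLin
  rw [← Matrix.rank, hA, Module.finrank_fintype_fun_eq_card, Fintype.card_fin] at h1
  have h2 : LinearMap.ker A.mulVecLin = ⊥ := Submodule.finrank_eq_zero.1 (by omega)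
  have h3 : x ∈ LinearMap.ker A.mulVecLin := by simpa using hx
  rwa [h2, Submodule.mem_bot] at h3

theorem isLpEmbedding_of_abs_le {p ε : ℝ} {s n d : ℕ} {S : Matrix (Fin s) (Fin n) ℝ}
    {A : Matrix (Fin n) (Fin d) ℝ}
    (h : ∀ z, |lpNorm p (S *ᵥ (A *ᵥ z)) - lpNorm p (A *ᵥ z)| ≤ ε * lpNorm p (A *ᵥ z)) :
    IsLpEmbedding p ε S A := by
  intro z
  have := abs_le.1 (h z)
  constructor <;> linarith [this.1, this.2]

theorem gaussDim_succ_le {c : Constants} (hc : 0 < c.gauss) {n : ℕ} (hn : 1 ≤ Real.log n) :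
    (gaussDim c n : ℝ) + 1 ≤ (2 * c.gauss + 2) * Real.log n := by
  have h : (gaussDim c n : ℝ) < c.gauss * (1 + Real.log n) + 1 :=
    Nat.ceil_lt_add_one (by positivity)
  nlinarith

/-- From `3 d ≤ nnz A ≤ n d` follows `n ≥ 3 > e`. Without `log n ≥ 1` the constant term in the
number of Gaussian columns could not be absorbed. -/
theorem one_le_log_of_three_mul_le {n d N k : ℕ} (hd : 0 < d) (hk : 1 ≤ k) (hN : N ≤ n * d)
    (h : 3 * (d : ℝ) ^ k ≤ N) : 1 ≤ Real.log n := by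
  have h1 : 3 * d ^ k ≤ n * d := le_trans (by exact_mod_cast h) hN
  have h2 : d ≤ d ^ k := Nat.le_self_pow (by omega) d
  have h3 : 3 ≤ n := Nat.le_of_mul_le_mul_right ((Nat.mul_le_mul_left 3 h2).trans h1) hd
  rw [Real.le_log_iff_exp_le (by exact_mod_cast (by omega : 0 < n))]
  have : (3 : ℝ) ≤ n := by exact_mod_cast h3
  linarith [Real.exp_one_lt_d9]

/-- If `A` has sufficiently many nonzero entries, then the terms of the running time that do not depend
on `n` are dominated by `nnz A`. -/
theorem cost_bound_le {d s r m N : ℕ} {E M γ ℓ : ℝ} (hd : 0 < d) (hE : 0 ≤ E) (hM : 0 ≤ M)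
    (hs : (s : ℝ) ≤ E * d ^ 370) (hm : (m : ℝ) ≤ M * d ^ 743) (hr : (r : ℝ) + 1 ≤ γ * ℓ)
    (hℓ : 1 ≤ ℓ) (hN : 3 * (d : ℝ) ^ 1489 ≤ N) :
    ((30 + 22 * (d ^ 2 * (s + d)) + 8 * N + 40 * ((r + 1) * (N + d ^ 2)) +
      305 * (d ^ 3 * (m + 1) ^ 2) : ℕ) : ℝ) ≤
        (30 + 22 * (E + 1) + 305 * (M + 1) ^ 2 + 8 + 80 * γ) * (N * ℓ) := by
  have hd1 : (1 : ℝ) ≤ d := by exact_mod_cast hd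
  have hX : (1 : ℝ) ≤ (d : ℝ) ^ 1489 := one_le_pow₀ hd1
  have h2 : (d : ℝ) ^ 2 ≤ (d : ℝ) ^ 1489 := pow_le_pow_right₀ hd1 (by norm_num)
  have h3 : (d : ℝ) ^ 3 ≤ (d : ℝ) ^ 1489 := pow_le_pow_right₀ hd1 (by norm_num)
  have h4 : (d : ℝ) ^ 372 ≤ (d : ℝ) ^ 1489 := pow_le_pow_right₀ hd1 (by norm_num)
  have h5 : (d : ℝ) ^ 2 * (s + d) ≤ (E + 1) * (d : ℝ) ^ 1489 := by
    calc (d : ℝ) ^ 2 * (s + d) ≤ (d : ℝ) ^ 2 * (E * d ^ 370 + d) := by gcongr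
      _ = E * (d : ℝ) ^ 372 + (d : ℝ) ^ 3 := by ring
      _ ≤ E * (d : ℝ) ^ 1489 + (d : ℝ) ^ 1489 := by gcongr
      _ = _ := by ring
  have h6 : (d : ℝ) ^ 3 * (m + 1) ^ 2 ≤ (M + 1) ^ 2 * (d : ℝ) ^ 1489 := by
    -- The rounding is the most expensive part: cubic in `d` and quadratic in the size of the coarse
    -- sample, so the exponent is `3 + 2 * 743 = 1489`.
    have : (1 : ℝ) ≤ (d : ℝ) ^ 743 := one_le_pow₀ hd1
    calc (d : ℝ) ^ 3 * (m + 1) ^ 2 ≤ (d : ℝ) ^ 3 * ((M + 1) * (d : ℝ) ^ 743) ^ 2 := by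
          gcongr; linarith
      _ = (M + 1) ^ 2 * ((d : ℝ) ^ 3 * ((d : ℝ) ^ 743) ^ 2) := by ring
      _ = _ := by rw [← pow_mul, ← pow_add]
  set X := (d : ℝ) ^ 1489
  have hN0 : (0 : ℝ) ≤ N := Nat.cast_nonneg N
  have h7 : ((r : ℝ) + 1) * (N + (d : ℝ) ^ 2) ≤ (γ * ℓ) * (2 * N) := by
    have : (N : ℝ) + (d : ℝ) ^ 2 ≤ 2 * N := by linarith
    have h0 : (0 : ℝ) ≤ r + 1 := by positivity
    exact mul_le_mul hr this (by positivity) (h0.trans hr)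
  have h8 : (N : ℝ) ≤ N * ℓ := le_mul_of_one_le_right hN0 hℓ
  have h9 : X ≤ N * ℓ := by linarith
  have h10 : (30 + 22 * (E + 1) + 305 * (M + 1) ^ 2) * X ≤
      (30 + 22 * (E + 1) + 305 * (M + 1) ^ 2) * (N * ℓ) := by gcongr
  push_cast
  nlinarith

end LpEmbedding


/-! ### Choice of the constants and conclusion -/

theorem theorem6 (p : ℝ) (hp₁ : 1 ≤ p) (hp₂ : p < 2) (δ : ℝ) (hδ₀ : 0 < δ) (hδ₁ : δ < 1) :
    ∃ (c : LpEmbedding.Constants) (C K : ℝ) (k : ℕ),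
      (0 < c.embed ∧ 0 < c.gauss ∧ 0 < c.coarse ∧ 0 < c.final ∧ 0 < C ∧ 0 < K) ∧
      ∀ (n d : ℕ), 0 < d → ∀ A : Matrix (Fin n) (Fin d) ℝ, A.rank = d →
        ∀ ε : ℝ, 0 < ε → ε < 1 →
          ENNReal.ofReal (1 - δ) ≤
            LpEmbedding.randomnessLaw p n d (LpEmbedding.embedDim c d) (LpEmbedding.gaussDim c n)
              {ω | let out := LpEmbedding.improvedEmbedding c p ε (LpEmbedding.sparseRows A) ω
                LpEmbedding.IsLpEmbedding p ε (LpEmbedding.samplingMatrix out.val) A ∧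
                (out.val.length : ℝ) ≤
                  C * (d : ℝ) ^ (3 + p / 2) * (1 + Real.log (1 / ε)) / ε ^ 2 ∧
                (K * (d : ℝ) ^ k ≤ LpEmbedding.nnz A →
                  (out.cost : ℝ) ≤ C * (LpEmbedding.nnz A * Real.log n))} := by
  open LpEmbedding in
  have hp₀ : 0 < p := by linarith
  obtain ⟨b, E, hb, hE, hbE⟩ := exists_embed_const hp₁ hp₂ (δ := δ / 3) (by linarith) (by linarith)
  -- Each sampling fails with probability at most `4 δ'`, so that the three stages fail with
  -- probability at most `δ / 3` each.
  set δ' := δ / 12 with hδ'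
  have hδ'₀ : 0 < δ' := by positivity
  have hδ'₁ : δ' ≤ 1 := by linarith
  have hδ'₃ : 4 * δ' = δ / 3 := by rw [hδ']; ring
  have hlog₁ : 0 ≤ Real.log (1 / δ') := Real.log_nonneg (by rw [le_div_iff₀ hδ'₀]; linarith)
  have hlog₄ : 0 ≤ Real.log (4 / δ') := Real.log_nonneg (by rw [le_div_iff₀ hδ'₀]; linarith)
  have hlog₈₀ : 0 ≤ Real.log (80 * E ^ 2) := Real.log_nonneg (by nlinarith)
  have hlog₂₅ : 0 ≤ Real.log 2560 := Real.log_nonneg (by norm_num)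
  set c : Constants := ⟨b, 1 + Real.log (1 / δ'), coarseFactor δ' E, 743, finalFactor δ'⟩ with hc
  have hgauss : 0 < c.gauss := by change 0 < 1 + Real.log (1 / δ'); linarith
  have hcoarse : 0 < c.coarse := by change 0 < coarseFactor δ' E; rw [coarseFactor]; positivity
  have hfinal : 0 < c.final := by change 0 < finalFactor δ'; rw [finalFactor]; positivity
  set M := c.coarse / δ' with hM
  have hM₀ : 0 < M := by positivity
  set C₁ := 30 + 22 * (E + 1) + 305 * (M + 1) ^ 2 + 8 + 80 * (2 * c.gauss + 2) with hC₁
  have hC₁₀ : 0 < C₁ := by positivity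
  set C₂ := c.final / δ' with hC₂
  have hC₂₀ : 0 < C₂ := by positivity
  -- `C₁` serves the running time and `C₂` the number of rows; `3` and `1489` are what
  -- `one_le_log_of_three_mul_le` and `cost_bound_le` ask for.
  refine ⟨c, C₁ + C₂, 3, 1489, ⟨hb, hgauss, hcoarse, hfinal, by positivity, by norm_num⟩,
    fun n d hd A hA ε hε₀ hε₁ => ?_⟩
  obtain ⟨hs, hembed⟩ := hbE c rfl n d hd
  have hA' := mulVec_eq_zero_of_rank_eq hA
  have hembed' := hembed A hA'
  rw [← hδ'₃] at hembed'
  obtain ⟨B₁, B₂, B₃, h₁, h₂, h₃, h⟩ := exists_bad_events hp₁ hp₂ hδ'₀ hδ'₁ hE rfl rfl rfl rfl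
    hε₀ hε₁.le hd hA' hembed'
  rw [hδ'₃] at h₁ h₂ h₃
  refine ofReal_le_measure_of_bad hδ₀.le h₁ h₂ h₃ fun ω hω₁ hω₂ hω₃ => ?_
  obtain ⟨hcount, hnorm, hrows⟩ := h ω hω₁ hω₂ hω₃
  have hlogε : 0 ≤ Real.log (1 / ε) := Real.log_nonneg (by rw [le_div_iff₀ hε₀]; linarith)
  have hsize : 0 ≤ finalSize c p ε d := by rw [finalSize]; positivity
  refine ⟨?_, ?_, fun hN => ?_⟩
  · refine isLpEmbedding_of_abs_le fun z => ?_
    rw [improvedEmbedding_val hp₀, lpNorm_samplingMatrix hp₀ A (sampleProb_nonneg hsize _ _)]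
    exact hnorm z
  · rw [improvedEmbedding_val hp₀, List.length_map]
    refine (keptRows_length_le _ _ _ _).trans (hrows.le.trans ?_)
    calc finalSize c p ε d / δ' = C₂ * (d : ℝ) ^ (3 + p / 2) * (1 + Real.log (1 / ε)) / ε ^ 2 := by
          rw [finalSize, hC₂]; field_simp
      _ ≤ _ := by gcongr; linarith
  · have hn := one_le_log_of_three_mul_le hd (by norm_num) (nnz_le A) hN
    have hm := (keptRows_length_le p A _ _).trans hcount.le
    have hm' : coarseSize c d / δ' = M * (d : ℝ) ^ 743 := by
      rw [coarseSize, hM]; change c.coarse * (d : ℝ) ^ 743 / δ' = _; ring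
    rw [hm'] at hm
    refine (Nat.cast_le.2 (improvedEmbedding_cost_le hp₀ hd A ω le_rfl)).trans ?_
    refine (cost_bound_le hd (by linarith) hM₀.le hs hm (gaussDim_succ_le hgauss hn) hn hN).trans ?_
    exact mul_le_mul_of_nonneg_right (by linarith) (by positivity)
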